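/- Let $\mathfrak g$ be a simple Lie algebra of type $A_n$ ($n\ge1$), $B_n,C_n$ ($n\ge2$), $D_n$ ($n\ge3$, $D_3=A_3$) or $G_2$, with set $I$ of Dynkin nodes, Cartan matrix $a_{ij}=2(\alpha_i,\alpha_j)/(\alpha_i,\alpha_i)$ and multipliers $d_i=(\alpha_i,\alpha_i)/2$ normalized to be $1$ on long roots. A quiver means a finite vertex set with a frozen subset, multipliers $d_v>0$ and skew-symmetric rational weights $w_{uv}=d_ub_{uv}$ (an arrow $u\to v$ of weight $w_{uv}$ if $w_{uv}>0$). Mutation at a non-frozen vertex $k$ replaces $w_{uv}$ by $-w_{uv}$ if $k\in\{u,v\}$, and by $w_{uv}+\frac{w_{uk}|w_{kv}|+|w_{uk}|w_{kv}}{2d_k}$ otherwise. Two quivers are mutation equivalent if a finite sequence of such mutations turns one into a quiver isomorphic to the other (respecting frozen vertices, multipliers and weights). Let $\mathbf i=(i_1,\dots,i_N)$ be a reduced word of the longest element $w_0$ of the Weyl group, $n_i$ the number of letters $i$, $u_i^k$ a variable for the $k$-th letter $i$ (also called $v_t$ if this is the $t$-th letter of $\mathbf i$; put $v(i,k)=t$)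 and $p_i^k$ its conjugate momentum. The $\mathcal D_{\mathfrak g}$-quiver has vertices $f_i^{-n_i},\dots,f_i^{n_i},e_i^0$ with multiplier $d_i$, of which $f_i^{\pm n_i}$ are frozen; its weights are given by the commutation relations $X_uX_v=q^{-2w_{uv}}X_vX_u$ of the following exponential monomials. Let $F_i^{k,\pm}$ have exponent $\pm\big(\sum_{t\le v(i,k)}a_{i_t,i}v_t-u_i^k\big)+2p_i^k$, and let $K_i^{-1}$ have exponent $\sum_ta_{i_t,i}v_t$ (up to central parameters). Then $X_{f_i^{-n_i}}=F_i^{n_i,-}$, the other $X_{f_i^k}$ are, in order, the successive ratios (each term divided by the preceding one) of $F_i^{n_i,-},\dots,F_i^{1,-},F_i^{1,+},\dots,F_i^{n_i,+},K_i^{-1}$, and $X_{e_i^0}$ has exponent $-2v_t$, where $t$ is the position with $s_{i_N}\cdots s_{i_{t+1}}(\alpha_{i_t})=\alpha_i$. Here, writing $e(\cdot)$ for the monomial with the given exponent, $e(v_t)\,e(2p_t)=q^{d_{i_t}}e(2p_t)\,e(v_t)$, the $v_t$ commute with each other, so do the $p_t$, and $v_s,p_t$ commute for $s\ne t$. Changes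 of words act on quivers with vertices labelled by $f_i^k,e_i^0$ as follows. Write $f_i^k$, $f_j^l$ for the vertices between the first two letters $i$, resp. $j$, of the changed block (for $s_is_js_i$, with only one letter $j$, $f_j^l$ is the vertex after it). A swap of commuting reflections changes nothing; $s_is_js_i\to s_js_is_j$ acts by mutation at $f_i^k$, followed by the renaming $f_i^k\mapsto f_j^l$, $f_i^t\mapsto f_i^{t-1}$ ($t>k$), $f_j^t\mapsto f_j^{t+1}$ ($t\ge l$); $s_is_js_is_j\leftrightarrow s_js_is_js_i$ with $i$ long and $j$ short acts by mutations at $f_j^l,f_i^k,f_j^l$; in type $G_2$ with $1$ long and $2$ short, $(2,1,2,1,2,1)\to(1,2,1,2,1,2)$ acts by mutations at $f_1^2,f_1^1,f_2^2,f_1^2,f_2^2,f_2^1,f_2^2,f_1^2,f_1^1,f_2^2,f_1^2$ in this order, followed by exchanging the names $f_2^1,f_2^2$, and the reverse move by the inverse. Let $\eta$ be the Dynkin involution, $w_0\alpha_i=-\alpha_{\eta(i)}$. A basic quiver for $\mathbf i$ is a quiver $Q$ with vertices $f_i^0,\dots,f_i^{n_i},e_i^0$ ($i\in I$) and frozen vertices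 $f_i^0,f_i^{n_i},e_i^0$ such that, with $\widetilde Q$ obtained from $Q$ by renaming $f_i^k\mapsto f_i^{-k}$ and flipping all arrows: (1) gluing $Q$ and $\widetilde Q$ along all $f_i^0,e_i^0$ (adding weights and unfreezing the glued vertices) gives the $\mathcal D_{\mathfrak g}$-quiver; (2) changing the word to $(i_N,\dots,i_1)$ transforms $Q$ into $\widetilde Q$, where $f_i^k,e_i^0$ are identified with $f_i^{k-n_i},e_{\eta(i)}^0$; (3) changing the word to $(\eta(i_1),\dots,\eta(i_N))$ transforms $Q$ into $Q$, where $f_i^k,e_i^0$ of $Q$ are identified with $f_{\eta(i)}^k,e_{\eta(i)}^0$ of the result. The $\mathrm{Conf}_3\,\mathcal A_G$ quiver is the following. Type $A_n$: the vertices are the $(a,b,c)\in\mathbb Z_{\ge0}^3$ with $a+b+c=n+1$ other than the three corners, those with $abc=0$ are frozen, all multipliers are $1$, and there are arrows $(a,b,c)\to(a-1,b+1,c),\ (a,b-1,c+1),\ (a+1,b,c-1)$ of weight $1$, or $\frac12$ if they lie on a side of the triangle. Types $B_n,C_n,D_n,G_2$: let $m=h/2$ be half the Coxeter number ($n,n,n-1,3$,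 respectively), and label the Dynkin nodes $0,\dots,r-1$ ($r$ the rank): in $B_n,C_n$ a chain $0-1-\cdots-(n-1)$ with the double bond between $0$ and $1$, where node $0$ is short in $B_n$ and long in $C_n$ and all other nodes have the other length; in $D_n$ a chain $1-\cdots-(n-1)$ with $0$ joined to $2$; in $G_2$, $0$ long and $1$ short. The vertices are $x_{i,k}$ ($0\le k\le m$) and $y_i$, with multiplier $d_i$; $x_{i,0},x_{i,m},y_i$ are frozen. For each $i$ there are arrows $x_{i,k-1}\to x_{i,k}$ of weight $d_i$. For adjacent nodes $i>i'$ put $g=|d_ia_{ii'}|$; there are arrows $x_{i,k}\to x_{i',k-1}$ of weight $g$ ($1\le k\le m$), $x_{i',k}\to x_{i,k}$ of weight $g$ for $0<k<m$ and $g/2$ for $k=0,m$, and $y_i\to y_{i'}$ of weight $g/2$. Finally there are arrows $y_i\to x_{r_i,c_i-1}$ and $x_{r_i,c_i}\to y_i$ of weight $d_i$, with $(r_i,c_i)$ as follows. In types $B_n,C_n$: $(r_0,c_0)=(0,n)$ and $(r_i,c_i)=(n-1,n-i)$ for $i\ge1$. In type $D_n$: $(r_i,c_i)=(i,n-1)$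 for $i=0,1$ and $(n-1,n-i)$ for $i\ge2$. In type $G_2$: $(r_0,c_0)=(0,3)$ and $(r_1,c_1)=(1,1)$. Then for every reduced word $\mathbf i$ of $w_0$ there is exactly one basic quiver, and it is mutation equivalent to the $\mathrm{Conf}_3\,\mathcal A_G$ quiver for $G$ of the type of $\mathfrak g$. -/

import Mathlib

/-! ## Weighted quivers (seeds), mutation, amalgamation -/

/-- A seed `(I, I₀, B, D)`, recorded as its weighted quiver. The vertex set `verts` is a finite set
of labels, `frozen` is the set of frozen vertices, `d` gives the multipliers, and
`w u v = d u * b u v` is the weight of the arrow from `u` to `v`. Off the vertex set all data are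
`0`, so that two seeds are equal exactly when all their data on their vertices agree. -/
@[ext]
structure WQuiver (V : Type) where
  verts : Set V
  frozen : Set V
  d : V → ℚ
  w : V → V → ℚ
  finite_verts : verts.Finite
  frozen_subset : frozen ⊆ verts
  d_pos : ∀ v ∈ verts, 0 < d v
  d_off : ∀ v, v ∉ verts → d v = 0
  skew : ∀ u v, w u v = - w v u
  support : ∀ u v, w u v ≠ 0 → u ∈ verts ∧ v ∈ verts

namespace WQuiver

variable {V V' : Type}

open Classical in
/-- The quiver on the given vertices with multipliers `d` and weights `w`, both of which are cut off
outside of the vertex set. -/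
noncomputable def restrict (verts frozen : Set V) (d : V → ℚ) (w : V → V → ℚ)
    (hfin : verts.Finite) (hfr : frozen ⊆ verts) (hd : ∀ v, 0 < d v)
    (hw : ∀ u v, w u v = - w v u) : WQuiver V where
  verts := verts
  frozen := frozen
  d := fun v => if v ∈ verts then d v else 0
  w := fun u v => if u ∈ verts ∧ v ∈ verts then w u v else 0
  finite_verts := hfin
  frozen_subset := hfr
  d_pos := by
    intro v hv
    simp [hv, hd v]
  d_off := by
    intro v hv
    simp [hv]
  skew := by
    intro u v
    by_cases hu : u ∈ verts <;> by_cases hv : v ∈ verts <;> simp [hu, hv]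
    exact hw u v
  support := by
    intro u v h
    by_contra hc
    simp [hc] at h

open Classical in
/-- Mutation in direction `k`. In terms of `b u v = w u v / d u` this is
`b' u v = - b u v` if `u = k` or `v = k`, and
`b' u v = b u v + (b u k * |b k v| + |b u k| * b k v) / 2` otherwise. -/
noncomputable def mutate (Q : WQuiver V) (k : V) : WQuiver V where
  verts := Q.verts
  frozen := Q.frozen
  d := Q.d
  w := fun u v =>
    if u = k ∨ v = k then - Q.w u v
    else Q.w u v + (Q.w u k * |Q.w k v| + |Q.w u k| * Q.w k v) / (2 * Q.d k)
  finite_verts := Q.finite_verts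
  frozen_subset := Q.frozen_subset
  d_pos := Q.d_pos
  d_off := Q.d_off
  skew := by
    intro u v
    by_cases h : u = k ∨ v = k
    · have h' : v = k ∨ u = k := h.symm
      rw [if_pos h, if_pos h', Q.skew u v]
    · have h' : ¬ (v = k ∨ u = k) := fun x => h x.symm
      rw [if_neg h, if_neg h', Q.skew u v, Q.skew u k, Q.skew k v, abs_neg, abs_neg]
      ring
  support := by
    intro u v hne
    by_cases h : u = k ∨ v = k
    · rw [if_pos h] at hne
      exact Q.support u v (neg_ne_zero.mp hne)
    · rw [if_neg h] at hne
      by_cases h1 : Q.w u v = 0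
      · have h2 : Q.w u k ≠ 0 := fun hz => hne (by simp [h1, hz])
        have h3 : Q.w k v ≠ 0 := fun hz => hne (by simp [h1, hz])
        exact ⟨(Q.support u k h2).1, (Q.support k v h3).2⟩
      · exact Q.support u v h1

/-- Renaming of the vertices: the vertex `v` gets the new name `σ v`. -/
def relabel (Q : WQuiver V) (σ : V ≃ V') : WQuiver V' where
  verts := σ.symm ⁻¹' Q.verts
  frozen := σ.symm ⁻¹' Q.frozen
  d := fun v => Q.d (σ.symm v)
  w := fun u v => Q.w (σ.symm u) (σ.symm v)
  finite_verts := Q.finite_verts.preimage σ.symm.injective.injOn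
  frozen_subset := Set.preimage_mono Q.frozen_subset
  d_pos := fun _ hv => Q.d_pos _ hv
  d_off := fun _ hv => Q.d_off _ hv
  skew := fun _ _ => Q.skew _ _
  support := fun _ _ h => Q.support _ _ h

/-- All arrows are flipped. -/
def opposite (Q : WQuiver V) : WQuiver V where
  verts := Q.verts
  frozen := Q.frozen
  d := Q.d
  w := fun u v => - Q.w u v
  finite_verts := Q.finite_verts
  frozen_subset := Q.frozen_subset
  d_pos := Q.d_pos
  d_off := Q.d_off
  skew := fun u v => by rw [Q.skew u v]
  support := fun u v h => Q.support u v (neg_ne_zero.mp h)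

/-- `Q` is the amalgamation of `Q₁` and `Q₂` along their common vertices, which have to be frozen
with equal multipliers in both. The glued vertices are not frozen any more, and the weights are
added (a weight being `0` outside of the vertices of a quiver). -/
structure IsAmalgamation (Q₁ Q₂ Q : WQuiver V) : Prop where
  frozen_left : Q₁.verts ∩ Q₂.verts ⊆ Q₁.frozen
  frozen_right : Q₁.verts ∩ Q₂.verts ⊆ Q₂.frozen
  verts_eq : Q.verts = Q₁.verts ∪ Q₂.verts
  frozen_eq : Q.frozen = (Q₁.frozen ∪ Q₂.frozen) \ (Q₁.verts ∩ Q₂.verts)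
  d_left : ∀ v ∈ Q₁.verts, Q.d v = Q₁.d v
  d_right : ∀ v ∈ Q₂.verts, Q.d v = Q₂.d v
  w_eq : ∀ u v, Q.w u v = Q₁.w u v + Q₂.w u v

/-- `Q'` is obtained from `Q` by mutation at one vertex that is not frozen. -/
def MutationStep (Q Q' : WQuiver V) : Prop :=
  ∃ k ∈ Q.verts, k ∉ Q.frozen ∧ Q' = Q.mutate k

/-- A bijection of the vertices that respects frozen vertices, multipliers and weights. -/
def Isomorphic (Q : WQuiver V) (Q' : WQuiver V') : Prop :=
  ∃ σ : Q.verts ≃ Q'.verts,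
    (∀ v : Q.verts, (v : V) ∈ Q.frozen ↔ (σ v : V') ∈ Q'.frozen) ∧
    (∀ v : Q.verts, Q'.d (σ v) = Q.d v) ∧
    (∀ u v : Q.verts, Q'.w (σ u) (σ v) = Q.w u v)

/-- A finite sequence of mutations transforms `Q` into a quiver isomorphic to `Q'`. -/
def MutationEquivalent (Q : WQuiver V) (Q' : WQuiver V') : Prop :=
  ∃ Q'' : WQuiver V, Relation.ReflTransGen MutationStep Q Q'' ∧ Q''.Isomorphic Q'

end WQuiver

/-! ## Cartan data and Weyl groups of types A, B, C, D, G₂ -/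

/-- The Lie types under consideration. -/
inductive LieType where
  | A (n : ℕ)
  | B (n : ℕ)
  | C (n : ℕ)
  | D (n : ℕ)
  | G2

namespace LieType

/-- The range of the rank in each family; `D 3` is `A 3`, with another labelling. -/
def Admissible : LieType → Prop
  | A n => 1 ≤ n
  | B n => 2 ≤ n
  | C n => 2 ≤ n
  | D n => 3 ≤ n
  | G2 => True

def rank : LieType → ℕ
  | A n => n
  | B n => n
  | C n => n
  | D n => n
  | G2 => 2

/-- The nodes of the Dynkin diagram.
* `A n`, `B n`, `C n`: a chain `0 - 1 - ... - (n-1)`; the double bond of `B n` and `C n` joins `0`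
  and `1`. In `B n` the root `0` is short and all others are long, in `C n` the root `0` is long
  and all others are short.
* `D n`: a chain `1 - 2 - ... - (n-1)`, and `0` is joined to `2`.
* `G2`: `0` is long and `1` is short. -/
abbrev Node (X : LieType) : Type := Fin X.rank

/-- The multipliers `d i = (α i, α i) / 2`, normalized to be `1` for long roots. -/
def mult (X : LieType) (i : X.Node) : ℚ :=
  match X with
  | A _ => 1
  | B _ => if i.val = 0 then 1 / 2 else 1
  | C _ => if i.val = 0 then 1 else 1 / 2
  | D _ => 1
  | G2 => if i.val = 0 then 1 else 1 / 3

/-- Adjacency in the Dynkin diagram. -/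
def Adj (X : LieType) (i j : X.Node) : Prop :=
  match X with
  | D _ => (1 ≤ i.val ∧ i.val + 1 = j.val) ∨ (1 ≤ j.val ∧ j.val + 1 = i.val) ∨
      (i.val = 0 ∧ j.val = 2) ∨ (i.val = 2 ∧ j.val = 0)
  | _ => i.val + 1 = j.val ∨ j.val + 1 = i.val

open Classical in
/-- The Cartan matrix `a i j = 2 (α i, α j) / (α i, α i)`. -/
noncomputable def cartan (X : LieType) (i j : X.Node) : ℤ :=
  if i = j then 2
  else if X.Adj i j then
    match X with
    | B _ => if i.val = 0 then -2 else -1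
    | C _ => if j.val = 0 then -2 else -1
    | G2 => if i.val = 1 then -3 else -1
    | _ => -1
  else 0

theorem mult_pos (X : LieType) (i : X.Node) : 0 < X.mult i := by
  cases X <;> simp only [mult] <;> (try split_ifs) <;> norm_num

theorem adj_comm (X : LieType) (i j : X.Node) : X.Adj i j ↔ X.Adj j i := by
  cases X <;> simp only [Adj] <;> omega

/-- The multipliers symmetrize the Cartan matrix. -/
theorem mult_mul_cartan (X : LieType) (i j : X.Node) :
    X.mult i * X.cartan i j = X.mult j * X.cartan j i := by
  by_cases hij : i = j
  · subst hij; rfl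
  · have hji : ¬ j = i := fun h => hij h.symm
    have hv : i.val ≠ j.val := fun h => hij (Fin.ext h)
    by_cases ha : X.Adj i j
    · have hb := (X.adj_comm i j).1 ha
      have hi := i.isLt
      have hj := j.isLt
      cases X <;> simp only [cartan, hij, hji, ha, hb, if_true, if_false, mult] <;>
        simp only [Adj] at ha <;> simp only [rank] at hi hj <;>
        split_ifs <;> norm_num <;> omega
    · have hb : ¬ X.Adj j i := fun h => ha ((X.adj_comm i j).2 h)
      simp [cartan, hij, hji, ha, hb]

/-- The order of `s i * s j` for `i ≠ j`, as a function of `a i j * a j i`. -/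
def braidOrder : ℤ → ℕ
  | 0 => 2
  | 1 => 3
  | 2 => 4
  | 3 => 6
  | _ => 0

/-- The Coxeter matrix that belongs to the Cartan matrix. -/
noncomputable def coxeterMatrix (X : LieType) : CoxeterMatrix X.Node where
  M := Matrix.of fun i j =>
    if i = j then 1 else braidOrder (X.cartan i j * X.cartan j i)
  isSymm := by
    ext i j
    simp only [Matrix.transpose_apply, Matrix.of_apply, eq_comm (a := i) (b := j),
      mul_comm (X.cartan i j)]
  diagonal := by simp
  off_diagonal := by
    intro i j h
    simp only [Matrix.of_apply, h, if_false]
    unfold braidOrder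
    split <;> norm_num

/-- The Weyl group with its simple reflections. -/
noncomputable def weyl (X : LieType) : CoxeterSystem X.coxeterMatrix X.coxeterMatrix.Group :=
  X.coxeterMatrix.toCoxeterSystem

/-- `l` is a reduced word of the longest element `w₀` of the Weyl group. -/
def IsLongestWord (X : LieType) (l : List X.Node) : Prop :=
  X.weyl.IsReduced l ∧ ∀ g : X.coxeterMatrix.Group, X.weyl.length g ≤ l.length

/-- `η` is the Dynkin involution, `w₀ s i = s (η i) w₀`, where `l` is a word of `w₀`. -/
def IsDynkinInvolution (X : LieType) (l : List X.Node) (η : Equiv.Perm X.Node) : Prop :=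
  ∀ i, X.weyl.wordProd l * X.weyl.simple i = X.weyl.simple (η i) * X.weyl.wordProd l

end LieType

/-! ## The quiver of the quantum torus algebra that contains the quantum group -/

/-- Labels of vertices: `f i k` is `f_i^k`, and `e i` is `e_i^0`. -/
inductive QLabel (I : Type) where
  | f (i : I) (k : ℤ)
  | e (i : I)

namespace QLabel

variable {I : Type}

def node : QLabel I → I
  | f i _ => i
  | e i => i

/-- The mirror image `f_i^k ↦ f_i^{-k}`, `e_i^0 ↦ e_i^0`. -/
def mirror : QLabel I ≃ QLabel I where
  toFun
    | f i k => f i (-k)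
    | e i => e i
  invFun
    | f i k => f i (-k)
    | e i => e i
  left_inv := by rintro (⟨i, k⟩ | i) <;> simp
  right_inv := by rintro (⟨i, k⟩ | i) <;> simp

/-- `f_i^k ↦ f_i^{k - n i}`, `e_i^0 ↦ e_{η i}^0`. -/
def shift (n : I → ℕ) (η : Equiv.Perm I) : QLabel I ≃ QLabel I where
  toFun
    | f i k => f i (k - n i)
    | e i => e (η i)
  invFun
    | f i k => f i (k + n i)
    | e i => e (η.symm i)
  left_inv := by rintro (⟨i, k⟩ | i) <;> simp
  right_inv := by rintro (⟨i, k⟩ | i) <;> simp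

/-- `f_i^k ↦ f_{η i}^k`, `e_i^0 ↦ e_{η i}^0`. -/
def permute (η : Equiv.Perm I) : QLabel I ≃ QLabel I where
  toFun
    | f i k => f (η i) k
    | e i => e (η i)
  invFun
    | f i k => f (η.symm i) k
    | e i => e (η.symm i)
  left_inv := by rintro (⟨i, k⟩ | i) <;> simp
  right_inv := by rintro (⟨i, k⟩ | i) <;> simp

open Classical in
/-- The renaming after a move `i j i → j i j`: the old `f_i^k` is the new `f_j^m`, the old `f_i^t`
with `t > k` is the new `f_i^{t-1}`, and the old `f_j^t` with `t ≥ m` is the new `f_j^{t+1}`. -/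
noncomputable def braidRename (i j : I) (hij : i ≠ j) (k m : ℤ) : QLabel I ≃ QLabel I where
  toFun
    | f a t =>
      if a = i then (if t = k then f j m else if k < t then f i (t - 1) else f i t)
      else if a = j then (if m ≤ t then f j (t + 1) else f j t)
      else f a t
    | e a => e a
  invFun
    | f a t =>
      if a = i then (if k ≤ t then f i (t + 1) else f i t)
      else if a = j then (if t = m then f i k else if m < t then f j (t - 1) else f j t)
      else f a t
    | e a => e a
  left_inv := by
    rintro (⟨a, t⟩ | a)
    · by_cases hi : a = i
      · subst hi
        rcases lt_trichotomy t k with h | h | h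
        · simp [h.ne, h.not_gt, h.not_ge]
        · subst h; simp [hij.symm]
        · have h1 : ¬ t = k := h.ne'
          have h2 : k ≤ t - 1 := by omega
          simp [h1, h, h2]
      · by_cases hj : a = j
        · subst hj
          by_cases h : m ≤ t
          · have h1 : ¬ t + 1 = m := by omega
            have h2 : m < t + 1 := by omega
            simp [hi, h, h1, h2]
          · have h1 : ¬ t = m := by omega
            have h2 : ¬ m < t := by omega
            simp [hi, h, h1, h2]
        · simp [hi, hj]
    · rfl
  right_inv := by
    rintro (⟨a, t⟩ | a)
    · by_cases hi : a = i
      · subst hi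
        by_cases h : k ≤ t
        · have h1 : ¬ t + 1 = k := by omega
          have h2 : k < t + 1 := by omega
          simp [h, h1, h2]
        · have h1 : ¬ t = k := by omega
          have h2 : ¬ k < t := by omega
          simp [h, h1, h2]
      · by_cases hj : a = j
        · subst hj
          rcases lt_trichotomy t m with h | h | h
          · simp [hi, h.ne, h.not_gt, h.not_ge]
          · subst h; simp [hi]
          · have h1 : ¬ t = m := h.ne'
            have h2 : m ≤ t - 1 := by omega
            simp [hi, h1, h, h2]
        · simp [hi, hj]
    · rfl

open Classical in
/-- Exchange of the labels `f_j^1` and `f_j^2`. -/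
noncomputable def swapOneTwo (j : I) : QLabel I ≃ QLabel I := Equiv.swap (f j 1) (f j 2)

end QLabel

namespace LieType

variable (X : LieType)

section Embedding

variable (l : List X.Node)

/-- An exponential monomial `e(∑ t, (x t) v_t + (p t) p_t)` in the variables `v_t` and their momenta
`p_t`, with one `t` for each letter of the word, is recorded as the pair `(x, p)`. The scalar
parameters `λ` of the representation commute with everything and are left out. -/
abbrev Mono : Type := (Fin l.length → ℚ) × (Fin l.length → ℚ)

/-- The letter at position `t` is the `k`-th occurrence of `i`, i.e. its variable is `u_i^k`. -/
def IsOcc (i : X.Node) (k : ℕ) (t : Fin l.length) : Prop :=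
  l.get t = i ∧ (l.take t).count i + 1 = k

open Classical in
/-- The exponent of
`F_i^{k,s} = e(s (∑_{t ≤ v(i,k)} a_{i_t,i} v_t - u_i^k) + 2 p_i^k)`, for a sign `s = ±1`,
where `v(i,k)` is the position of the `k`-th occurrence of `i`. The condition `t ≤ v(i,k)` says that
fewer than `k` letters before position `t` are equal to `i`. -/
noncomputable def fMono (i : X.Node) (k : ℕ) (s : ℚ) : X.Mono l :=
  (fun t => s * ((if (l.take t).count i < k then (X.cartan (l.get t) i : ℚ) else 0)
      - (if X.IsOcc l i k t then 1 else 0)),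
    fun t => if X.IsOcc l i k t then 2 else 0)

/-- The exponent of `K_i⁻¹ = e(∑_t a_{i_t,i} v_t)`. -/
noncomputable def kInvMono (i : X.Node) : X.Mono l :=
  (fun t => (X.cartan (l.get t) i : ℚ), 0)

open Classical in
/-- The exponents of the cluster variables: consecutive ratios of the terms
`F_i^{n,-}, ..., F_i^{1,-}, F_i^{1,+}, ..., F_i^{n,+}, K_i⁻¹` of the generators `f_i`,
preceded by `F_i^{n,-}` itself, and `X_{e_i^0} = e(-2 v_t)` for the initial term `[v_t]` of the
generator `e_i`. Here `t` is the position whose root `s_{i_N} ... s_{i_{t+1}} (α_{i_t})` is `α_i`,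
i.e. the entry of the right inversion sequence at `t` is the simple reflection `s_i`. (For the last
letter `i = i_N` this is `t = N`, and a braid move on a block of consecutive letters interchanges
the two ends of the block.) -/
noncomputable def clusterMono : QLabel X.Node → X.Mono l
  | .f i k =>
    if k = (l.count i : ℤ) then X.kInvMono l i - X.fMono l i (l.count i) 1
    else if 0 < k then X.fMono l i (k.toNat + 1) 1 - X.fMono l i k.toNat 1
    else if k = 0 then X.fMono l i 1 1 - X.fMono l i 1 (-1)
    else if k = -(l.count i : ℤ) then X.fMono l i (l.count i) (-1)
    else X.fMono l i (-k).toNat (-1) - X.fMono l i ((-k).toNat + 1) (-1)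
  | .e i =>
    (fun t => if (X.weyl.rightInvSeq l)[(t : ℕ)]? = some (X.weyl.simple i) then -2 else 0, 0)

/-- The number `c` in the commutation relation `X Y = q^{-2 c} Y X` of two exponential monomials;
`[p_t, v_t] = (2 π √-1)⁻¹`, the exponents of `v_t` and `p_t` carry the factor `b` with
`exp (π √-1 b²) = q^{d_{i_t}}`, and the different positions commute. -/
def commutator (A B : X.Mono l) : ℚ :=
  (∑ t : Fin l.length, X.mult (l.get t) * (A.2 t * B.1 t - A.1 t * B.2 t)) / 4

/-- The vertices `f_i^{-n_i}, ..., f_i^{n_i}, e_i^0`. -/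
def doubleVerts : Set (QLabel X.Node) :=
  fun v => match v with
    | .f i k => -(l.count i : ℤ) ≤ k ∧ k ≤ l.count i
    | .e _ => True

/-- The vertices `f_i^{-n_i}` and `f_i^{n_i}`. -/
def doubleFrozen : Set (QLabel X.Node) :=
  fun v => match v with
    | .f i k => k = -(l.count i : ℤ) ∨ k = l.count i
    | .e _ => False

theorem doubleVerts_finite : (X.doubleVerts l).Finite := by
  refine Set.Finite.subset ((Set.finite_iUnion fun i : X.Node =>
    (Set.finite_Icc (-(l.count i : ℤ)) (l.count i)).image (QLabel.f i)).union
      (Set.finite_range QLabel.e)) ?_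
  rintro (⟨i, k⟩ | i) h
  · exact Or.inl (Set.mem_iUnion.2 ⟨i, k, h, rfl⟩)
  · exact Or.inr ⟨i, rfl⟩

theorem doubleFrozen_subset : X.doubleFrozen l ⊆ X.doubleVerts l := by
  rintro (⟨i, k⟩ | i) h
  · change k = -(l.count i : ℤ) ∨ k = l.count i at h
    change -(l.count i : ℤ) ≤ k ∧ k ≤ l.count i
    omega
  · exact trivial

/-- The `𝒟_𝔤`-quiver of the word `l`, whose arrows record the commutation relations
`X_u X_v = q^{-2 w u v} X_v X_u` of the cluster variables. -/
noncomputable def doubleQuiver : WQuiver (QLabel X.Node) :=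
  WQuiver.restrict (X.doubleVerts l) (X.doubleFrozen l) (fun v => X.mult v.node)
    (fun u v => X.commutator l (X.clusterMono l u) (X.clusterMono l v))
    (X.doubleVerts_finite l) (X.doubleFrozen_subset l) (fun v => X.mult_pos v.node)
    (fun u v => by
      unfold commutator
      rw [← neg_div, ← Finset.sum_neg_distrib]
      congr 1
      refine Finset.sum_congr rfl fun t _ => ?_
      ring)

end Embedding

/-! ## Basic quivers -/

/-- One change of words, together with the corresponding sequence of quiver mutations and the
renaming of the vertices. -/
inductive WordMove : List X.Node × WQuiver (QLabel X.Node) →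
    List X.Node × WQuiver (QLabel X.Node) → Prop
  /-- `s_i s_j = s_j s_i`: the quiver does not change. -/
  | swap (l₁ l₂ : List X.Node) (i j : X.Node) (Q : WQuiver (QLabel X.Node))
      (hij : X.cartan i j = 0) :
      WordMove (l₁ ++ [i, j] ++ l₂, Q) (l₁ ++ [j, i] ++ l₂, Q)
  /-- `s_i s_j s_i = s_j s_i s_j`: mutation at the vertex `f_i^k` between the two letters `i`. -/
  | simplyLaced (l₁ l₂ : List X.Node) (i j : X.Node) (Q : WQuiver (QLabel X.Node)) (hij : i ≠ j)
      (h₁ : X.cartan i j = -1) (h₂ : X.cartan j i = -1) (k m : ℤ)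
      (hk : k = l₁.count i + 1) (hm : m = l₁.count j + 1) :
      WordMove (l₁ ++ [i, j, i] ++ l₂, Q)
        (l₁ ++ [j, i, j] ++ l₂, (Q.mutate (.f i k)).relabel (QLabel.braidRename i j hij k m))
  /-- `s_i s_j s_i s_j = s_j s_i s_j s_i` with `i` long and `j` short: mutations at
  `f_j^m, f_i^k, f_j^m`, where `f_i^k` is the vertex between the two letters `i`, and `f_j^m` is the
  one between the two letters `j`. -/
  | doublyLaced (l₁ l₂ : List X.Node) (i j : X.Node) (Q : WQuiver (QLabel X.Node))
      (h₁ : X.cartan i j = -1) (h₂ : X.cartan j i = -2) (k m : ℤ)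
      (hk : k = l₁.count i + 1) (hm : m = l₁.count j + 1) :
      WordMove (l₁ ++ [i, j, i, j] ++ l₂, Q)
        (l₁ ++ [j, i, j, i] ++ l₂, ((Q.mutate (.f j m)).mutate (.f i k)).mutate (.f j m))
  /-- The inverse of the previous move. -/
  | doublyLacedInv (l₁ l₂ : List X.Node) (i j : X.Node) (Q : WQuiver (QLabel X.Node))
      (h₁ : X.cartan i j = -1) (h₂ : X.cartan j i = -2) (k m : ℤ)
      (hk : k = l₁.count i + 1) (hm : m = l₁.count j + 1) :
      WordMove (l₁ ++ [j, i, j, i] ++ l₂, Q)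
        (l₁ ++ [i, j, i, j] ++ l₂, ((Q.mutate (.f j m)).mutate (.f i k)).mutate (.f j m))
  /-- Type `G2`, with `i` long and `j` short: eleven mutations. -/
  | triplyLaced (i j : X.Node) (Q : WQuiver (QLabel X.Node))
      (h₁ : X.cartan i j = -1) (h₂ : X.cartan j i = -3) :
      WordMove ([j, i, j, i, j, i], Q)
        ([i, j, i, j, i, j],
          ([QLabel.f i 2, .f i 1, .f j 2, .f i 2, .f j 2, .f j 1, .f j 2, .f i 2, .f i 1, .f j 2,
            .f i 2].foldl WQuiver.mutate Q).relabel (QLabel.swapOneTwo j))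
  /-- The inverse of the previous move. -/
  | triplyLacedInv (i j : X.Node) (Q : WQuiver (QLabel X.Node))
      (h₁ : X.cartan i j = -1) (h₂ : X.cartan j i = -3) :
      WordMove ([i, j, i, j, i, j], Q)
        ([j, i, j, i, j, i],
          [QLabel.f i 2, .f j 2, .f i 1, .f i 2, .f j 2, .f j 1, .f j 2, .f i 2, .f j 2, .f i 1,
            .f i 2].foldl WQuiver.mutate (Q.relabel (QLabel.swapOneTwo j)))

/-- The quiver of the second word results from the one of the first word by a sequence of changes
of words. -/
def WordMoves : List X.Node × WQuiver (QLabel X.Node) →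
    List X.Node × WQuiver (QLabel X.Node) → Prop :=
  Relation.ReflTransGen X.WordMove

/-- The mirror image `Q̃` of `Q` with all arrows flipped. -/
def mirrorQuiver (Q : WQuiver (QLabel X.Node)) : WQuiver (QLabel X.Node) :=
  Q.opposite.relabel QLabel.mirror

/-- `Q` is a basic quiver for the reduced word `l` of `w₀`:
* its vertices are `f_i^0, ..., f_i^{n_i}, e_i^0`, of which `f_i^0`, `f_i^{n_i}`, `e_i^0` (the
  vertices on the three sides of the triangle) are frozen;
* the amalgamation of `Q` and `Q̃` along the `f_i^0` and `e_i^0` is the `𝒟_𝔤`-quiver;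
* the mutation sequence of `(i_1, ..., i_N) → (i_N, ..., i_1)` transforms `Q` into `Q̃`, where the
  vertices `f_i^k`, `e_i^0` are identified with `f_i^{k-n_i}`, `e_{η i}^0`;
* the mutation sequence of `(i_1, ..., i_N) → (η i_1, ..., η i_N)` transforms `Q` into itself, where
  the vertices `f_i^k`, `e_i^0` of `Q` are identified with `f_{η i}^k`, `e_{η i}^0`. -/
structure IsBasicQuiver (l : List X.Node) (Q : WQuiver (QLabel X.Node)) : Prop where
  verts_eq : Q.verts = {v | (∃ i, v = .e i) ∨ ∃ i k, 0 ≤ k ∧ k ≤ (l.count i : ℤ) ∧ v = .f i k}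
  frozen_eq : Q.frozen = {v | ∃ i, v = .e i ∨ v = .f i 0 ∨ v = .f i (l.count i)}
  amalgamation : WQuiver.IsAmalgamation (X.mirrorQuiver Q) Q (X.doubleQuiver l)
  symmetric : ∃ η : Equiv.Perm X.Node, X.IsDynkinInvolution l η ∧
    (∃ Q', X.WordMoves (l, Q) (l.reverse, Q') ∧
      Q'.relabel (QLabel.shift (fun i => l.count i) η) = X.mirrorQuiver Q) ∧
    (∃ Q', X.WordMoves (l, Q) (l.map η, Q') ∧ Q.relabel (QLabel.permute η) = Q')

end LieType

/-! ## The quivers of the cluster structures on `Conf₃ 𝒜_G` -/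

/-- Labels of vertices: `x i k` and `y i` for a node `i` of the Dynkin diagram are used in types
B, C, D, G₂, and `t a b c` in type A. -/
inductive ConfLabel (I : Type) where
  | x (i : I) (k : ℕ)
  | y (i : I)
  | t (a b c : ℕ)

namespace LieType

variable (X : LieType)

/-- Half of the Coxeter number, in types B, C, D, G₂. -/
def halfCoxeter : LieType → ℕ
  | A _ => 0
  | B n => n
  | C n => n
  | D n => n - 1
  | G2 => 3

/-- The vertex `y i` is attached to `x r (c - 1)` and `x r c` with `r = yRow i`, `c = yCol i`. -/
def yRow (X : LieType) (i : X.Node) : ℕ :=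
  match X with
  | A _ => 0
  | B n => if i.val = 0 then 0 else n - 1
  | C n => if i.val = 0 then 0 else n - 1
  | D n => if i.val ≤ 1 then i.val else n - 1
  | G2 => i.val

/-- See `yRow`. -/
def yCol (X : LieType) (i : X.Node) : ℕ :=
  match X with
  | A _ => 0
  | B n => n - i.val
  | C n => n - i.val
  | D n => if i.val ≤ 1 then n - 1 else n - i.val
  | G2 => if i.val = 0 then 3 else 1

/-- The multiplier of a vertex. -/
def confMult : ConfLabel X.Node → ℚ
  | .x i _ => X.mult i
  | .y i => X.mult i
  | .t _ _ _ => 1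

/-- In type `A n` the vertices are the points of the `(n+1)`-triangulation of the triangle except for
the corners. In the other types there are a row `x i 0, ..., x i m` for each node `i`, with `m` half
the Coxeter number, and one more vertex `y i` for each `i`. -/
def confVerts (X : LieType) : Set (ConfLabel X.Node) :=
  fun v => match X, v with
    | A n, .t a b c => a + b + c = n + 1 ∧ a ≤ n ∧ b ≤ n ∧ c ≤ n
    | A _, _ => False
    | _, .t _ _ _ => False
    | X, .x _ k => k ≤ X.halfCoxeter
    | _, .y _ => True

/-- The frozen vertices: the points on the sides of the triangle in type `A n`; the two ends of each
row and the vertices `y i` in the other types. -/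
def confFrozen (X : LieType) : Set (ConfLabel X.Node) :=
  fun v => v ∈ X.confVerts ∧
    match v with
    | .t a b c => a = 0 ∨ b = 0 ∨ c = 0
    | .x _ k => k = 0 ∨ k = X.halfCoxeter
    | .y _ => True

open Classical in
/-- The weight of the arrow from the first vertex to the second one.
Type `A n`: the small upward triangles of the triangulation are oriented cyclically, with half
weights on the sides of the big triangle.
Other types: `m` copies of the Coxeter word `w_c = s_{n-1} ... s_1 s_0` (nodes in decreasing order)
give the arrows between the `x i k`; half weights occur only between frozen vertices on the same
side. Each `y i` forms an oriented triangle with an arrow of one row, and the `y i` are joined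
among each other by half weights. -/
noncomputable def confArrow : ConfLabel X.Node → ConfLabel X.Node → ℚ
  | .t a b c, .t a' b' c' =>
    if a' + 1 = a ∧ b' = b + 1 ∧ c' = c then (if c = 0 then 1 / 2 else 1)
    else if a' = a ∧ b' + 1 = b ∧ c' = c + 1 then (if a = 0 then 1 / 2 else 1)
    else if a' = a + 1 ∧ b' = b ∧ c' + 1 = c then (if b = 0 then 1 / 2 else 1)
    else 0
  | .x i k, .x i' k' =>
    if i = i' then (if k' = k + 1 then X.mult i else 0)
    else if i' < i then (if k = k' + 1 then |X.mult i * X.cartan i i'| else 0)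
    else if k = k' then
      (if k = 0 ∨ k = X.halfCoxeter then |X.mult i * X.cartan i i'| / 2
        else |X.mult i * X.cartan i i'|)
    else 0
  | .y i, .x r k => if r.val = X.yRow i ∧ k + 1 = X.yCol i then X.mult i else 0
  | .x r k, .y i => if r.val = X.yRow i ∧ k = X.yCol i then X.mult i else 0
  | .y i, .y i' => if i' < i then |X.mult i * X.cartan i i'| / 2 else 0
  | _, _ => 0

theorem confMult_pos (v : ConfLabel X.Node) : 0 < X.confMult v := by
  cases v
  · exact X.mult_pos _
  · exact X.mult_pos _
  · exact one_pos

theorem confVerts_finite : X.confVerts.Finite := by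
  refine Set.Finite.subset (((Set.finite_iUnion fun i : X.Node =>
    (Set.finite_Iic X.halfCoxeter).image (ConfLabel.x i)).union
      (Set.finite_range ConfLabel.y)).union
        (((Set.finite_Iic X.rank).prod ((Set.finite_Iic X.rank).prod
          (Set.finite_Iic X.rank))).image
            (fun p : ℕ × ℕ × ℕ => ConfLabel.t p.1 p.2.1 p.2.2))) ?_
  rintro (⟨i, k⟩ | i | ⟨a, b, c⟩) h
  · refine Or.inl (Or.inl (Set.mem_iUnion.2 ⟨i, k, ?_, rfl⟩))
    cases X
    · exact h.elim
    all_goals exact h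
  · exact Or.inl (Or.inr ⟨i, rfl⟩)
  · refine Or.inr ⟨(a, b, c), ?_, rfl⟩
    cases X
    · exact ⟨h.2.1, h.2.2.1, h.2.2.2⟩
    all_goals exact h.elim

/-- The quiver of the cluster structure on `Conf₃ 𝒜_G` for `G` of type `X`. -/
noncomputable def confQuiver : WQuiver (ConfLabel X.Node) :=
  WQuiver.restrict X.confVerts X.confFrozen X.confMult
    (fun u v => X.confArrow u v - X.confArrow v u)
    X.confVerts_finite (fun _ h => h.1) X.confMult_pos (fun u v => by ring)

end LieType

/-!
The basic quiver of a reduced word `l` of `w₀` is written down explicitly (`triQuiver l`), and every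
claim is checked for this quiver. Its weights are a sum of two parts. Reading the word from left to
right, let `f_j^{c j}` be the current vertex of the row `j`, where `c j` counts the letters `j` read
so far; a letter `i` contributes the arrow from `L = f_i^{c i}` to `R = f_i^{c i + 1}`, half arrows
from `R` to the current vertices of the other rows and from these to `L`, and, if the entry of the
right inversion sequence at this letter is a simple reflection `s_a`, arrows `R → e_a^0 → L`
(`letterForm`, `wordForm`). To this are added half arrows between the vertices `e_a^0`, in the order
of the letters that carry them (`labelForm`).

Changes of words. The sum over the letters splits along a factorization of the word, so that a move
only has to be examined on the block that it changes (`triForm_block`). A mutation is computed by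
`mutForm_eq`: if the arrows at `k` are `k → P` and `N → k`, it reverses them and adds `N ∧ P / d_k`.
Call `a` the label of a letter that carries `e_a^0`. Inside a braid block only the two end letters
can have labels, as otherwise the word would not be reduced (`label_conj_eq_none`), and the move
interchanges these labels.
For two and three letters this gives general identities (`triForm_swap`, `mutForm_triForm_iji`), and
likewise for four (`mutForm_triForm_ijij`); in type G₂ the block is the whole word, and the eleven
mutations are carried out on `10 × 10` integer matrices (`triQuiver_jijiji`). Hence every change of
words transforms explicit quivers into explicit quivers (`WordMove.eq_triQuiver`), and by
Matsumoto's theorem (`reflTransGen_braidStep`) any two words of `w₀` are connected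
(`wordMoves_triQuiver`).

Existence. The exponents of the cluster variables are differences and sums of the indicators of the
current vertices before and after each letter, so that the commutators in the `𝒟_𝔤`-quiver become
the same sums over letters, up to boundary terms that telescope (`commutator_clusterMono_eq`,
`isAmalgamation_triQuiver`). Reading a word backwards, or applying the Dynkin involution to its
letters, changes the sums in the way the two symmetry conditions require (`triQuiver_reverse`,
`triQuiver_map`).

Uniqueness. Because of the gluing condition, a basic quiver can differ from the explicit one only in
the weights between the glued vertices `f_i^0`, `e_a^0`. These vertices are frozen, so no change of
words affects the difference `δ` (`DiffersBy.wordMoves`). Reversal moves the vertices `f_i^0` to the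
other ends of their rows, so `δ` vanishes there; on the vertices `e_a^0` it gives
`δ (η a) (η b) = - δ a b`, whereas the condition for the Dynkin involution gives
`δ (η a) (η b) = δ a b` (`IsBasicQuiver.eq_triQuiver`).

Mutation equivalence. It remains to find one word whose explicit quiver is isomorphic to the
`Conf₃ 𝒜_G` quiver. In types B, C, D and G₂ this is a power of the Coxeter word `n-1, ..., 1, 0`,
and in type A the word made of the blocks `n-1, ..., r` for `r = 0, ..., n-1` (`staircase`). That it
is a reduced word of `w₀` is shown by the numbers game, in which the blocks permute coordinates and
change their signs (`isReduced_of_isPositivePlay`, `play_descend`). The weights between rows are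
computed in `triForm_staircase_self` and `triForm_staircase_pair`, and the positions of the labels
follow from `c s_{j+1} c⁻¹ = s_j` for a block `c` (`wordProd_descend_mul_simple`).

The facts on Weyl groups that are needed (positivity of roots, Matsumoto's theorem, the longest
element and its involution) are derived from the action on the root lattice (`act_root_nonneg`).
-/

namespace LieType

variable (X : LieType)

/-! ### The action of the Weyl group on the root lattice -/

theorem cartan_self (i : X.Node) : X.cartan i i = 2 := by simp [cartan]

theorem cartan_cases {i j : X.Node} (h : i ≠ j) :
    (X.cartan i j = 0 ∧ X.cartan j i = 0) ∨ (X.cartan i j = -1 ∧ X.cartan j i = -1) ∨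
    (X.cartan i j = -1 ∧ X.cartan j i = -2) ∨ (X.cartan i j = -2 ∧ X.cartan j i = -1) ∨
    (X.cartan i j = -1 ∧ X.cartan j i = -3) ∨ (X.cartan i j = -3 ∧ X.cartan j i = -1) := by
  by_cases ha : X.Adj i j
  · have hb := (X.adj_comm i j).1 ha
    have hi := i.isLt
    have hj := j.isLt
    cases X <;> simp only [cartan, h, h.symm, ha, hb, if_true, if_false] <;>
      simp only [Adj] at ha <;> simp only [rank] at hi hj <;>
      (try split_ifs) <;> norm_num <;> omega
  · have hb : ¬ X.Adj j i := fun h => ha ((X.adj_comm i j).2 h)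
    simp [cartan, h, h.symm, ha, hb]

theorem coxeterMatrix_apply {i j : X.Node} (h : i ≠ j) :
    X.coxeterMatrix i j = braidOrder (X.cartan i j * X.cartan j i) := by
  change (if i = j then 1 else _) = _
  simp [h]

/-- The simple root `α i` in the root lattice. -/
def root (i : X.Node) : X.Node → ℤ := Pi.single i 1

/-- The pairing `v ↦ ⟨α i ^∨, v⟩` with a simple coroot. -/
noncomputable def coroot (i : X.Node) : (X.Node → ℤ) →ₗ[ℤ] ℤ :=
  ∑ j, X.cartan i j • LinearMap.proj j

theorem coroot_apply (i : X.Node) (v : X.Node → ℤ) :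
    X.coroot i v = ∑ j, X.cartan i j * v j := by
  simp [coroot]

theorem coroot_root (i j : X.Node) : X.coroot i (X.root j) = X.cartan i j := by
  simp [coroot_apply, root, Pi.single_apply]

/-- The simple reflection `s i` acting on the root lattice. -/
noncomputable def refl (i : X.Node) : Module.End ℤ (X.Node → ℤ) :=
  Module.preReflection (X.root i) (X.coroot i)

theorem refl_apply (i : X.Node) (v : X.Node → ℤ) :
    X.refl i v = v - X.coroot i v • X.root i := by
  simp [refl, Module.preReflection_apply]

theorem refl_root (i j : X.Node) :
    X.refl i (X.root j) = X.root j - X.cartan i j • X.root i := by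
  rw [refl_apply, coroot_root]

theorem refl_root_self (i : X.Node) : X.refl i (X.root i) = - X.root i := by
  rw [refl_root, cartan_self]; module

/-- Reflections change only the coefficients of the two simple roots involved. -/
theorem refl_add_left (i j : X.Node) (v : X.Node → ℤ) (p q : ℤ) :
    X.refl i (v + p • X.root i + q • X.root j) =
      v + (-p - X.cartan i j * q - X.coroot i v) • X.root i + q • X.root j := by
  rw [refl_apply, map_add, map_add, map_smul, map_smul, coroot_root, coroot_root, cartan_self]
  simp only [smul_eq_mul]
  module

theorem refl_add_right (i j : X.Node) (v : X.Node → ℤ) (p q : ℤ) :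
    X.refl j (v + p • X.root i + q • X.root j) =
      v + p • X.root i + (-q - X.cartan j i * p - X.coroot j v) • X.root j := by
  rw [refl_apply, map_add, map_add, map_smul, map_smul, coroot_root, coroot_root, cartan_self]
  simp only [smul_eq_mul]
  module

theorem refl_refl (i : X.Node) : X.refl i * X.refl i = 1 := by
  refine LinearMap.ext fun v => ?_
  have := refl_add_left X i i v 0 0
  simp only [zero_smul, add_zero] at this
  simp only [Module.End.mul_apply, Module.End.one_apply]
  rw [this]
  have := refl_add_left X i i v (-X.coroot i v) 0
  simp only [zero_smul, add_zero, mul_zero, neg_zero, zero_sub, sub_zero] at this ⊢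
  rw [this]; module

theorem isLiftable_refl : X.coxeterMatrix.IsLiftable X.refl := by
  intro i j
  by_cases h : i = j
  · subst h
    simp [refl_refl]
  rw [coxeterMatrix_apply X h]
  refine LinearMap.ext fun v => ?_
  have h0 : v = v + (0 : ℤ) • X.root i + (0 : ℤ) • X.root j := by simp
  rw [h0]
  rcases X.cartan_cases h with ⟨h1, h2⟩ | ⟨h1, h2⟩ | ⟨h1, h2⟩ | ⟨h1, h2⟩ | ⟨h1, h2⟩ | ⟨h1, h2⟩ <;>
  · simp only [h1, h2, braidOrder, pow_succ, pow_zero, one_mul, Module.End.mul_apply,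
      refl_add_left, refl_add_right, Module.End.one_apply, neg_mul, mul_zero,
      show ((-1 : ℤ) * (-1)) = 1 by norm_num, show ((-1 : ℤ) * (-2)) = 2 by norm_num,
      show ((-2 : ℤ) * (-1)) = 2 by norm_num, show ((-1 : ℤ) * (-3)) = 3 by norm_num,
      show ((-3 : ℤ) * (-1)) = 3 by norm_num]
    congr 2
    · congr 1
      ring
    · ring

/-- The action of the Weyl group on the root lattice. -/
noncomputable def act : X.coxeterMatrix.Group →* Module.End ℤ (X.Node → ℤ) :=
  X.weyl.lift ⟨X.refl, X.isLiftable_refl⟩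

theorem act_simple (i : X.Node) : X.act (X.weyl.simple i) = X.refl i :=
  X.weyl.lift_apply_simple X.isLiftable_refl i

theorem act_mul_apply (g h : X.coxeterMatrix.Group) (v : X.Node → ℤ) :
    X.act (g * h) v = X.act g (X.act h v) := by
  rw [map_mul]; rfl

theorem act_inv_apply (g : X.coxeterMatrix.Group) (v : X.Node → ℤ) :
    X.act g⁻¹ (X.act g v) = v := by
  rw [← act_mul_apply, inv_mul_cancel, map_one]; rfl

/-- The invariant bilinear form, with `(α i, α j) = d i * a i j`. -/
noncomputable def form (v w : X.Node → ℤ) : ℚ :=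
  ∑ i, X.mult i * v i * X.coroot i w

theorem form_root_left (i : X.Node) (w : X.Node → ℤ) :
    X.form (X.root i) w = X.mult i * X.coroot i w := by
  simp [form, root, Pi.single_apply]

theorem form_comm (v w : X.Node → ℤ) : X.form v w = X.form w v := by
  simp only [form, coroot_apply, Int.cast_sum, Finset.mul_sum]
  rw [Finset.sum_comm]
  refine Finset.sum_congr rfl fun i _ => Finset.sum_congr rfl fun j _ => ?_
  have := X.mult_mul_cartan i j
  push_cast
  linear_combination (-(v j : ℚ) * w i) * this

theorem form_sub_smul_right (v w u : X.Node → ℤ) (c : ℤ) :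
    X.form v (w - c • u) = X.form v w - c * X.form v u := by
  simp only [form, map_sub, map_smul, Finset.mul_sum, ← Finset.sum_sub_distrib]
  refine Finset.sum_congr rfl fun i _ => ?_
  push_cast [smul_eq_mul]
  ring

theorem form_refl (i : X.Node) (v w : X.Node → ℤ) :
    X.form (X.refl i v) (X.refl i w) = X.form v w := by
  rw [refl_apply X i w, form_sub_smul_right, form_comm X _ w, form_comm X _ (X.root i),
    refl_apply, form_sub_smul_right, form_sub_smul_right, form_comm X w, form_comm X w,
    form_root_left, form_root_left, form_root_left, coroot_root, cartan_self]
  push_cast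
  ring

theorem form_act (g : X.coxeterMatrix.Group) (v w : X.Node → ℤ) :
    X.form (X.act g v) (X.act g w) = X.form v w := by
  induction g using X.weyl.simple_induction_left with
  | one => simp
  | mul_simple_left g i ih =>
    rw [act_mul_apply, act_mul_apply, act_simple, form_refl, ih]

theorem form_root_root (i j : X.Node) :
    X.form (X.root i) (X.root j) = X.mult i * X.cartan i j := by
  rw [form_root_left, coroot_root]

/-! ### Positivity of roots -/

theorem root_nonneg (i : X.Node) : 0 ≤ X.root i := by
  intro j; by_cases h : j = i <;> simp [root, h]

theorem root_ne_nonpos (i : X.Node) : ¬ X.root i ≤ 0 := fun h => by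
  have := h i; simp [root] at this

/-- In the dihedral subgroup generated by `s_i` and `s_j`, alternating words that are shorter than
the longest one, and to which `s_i` can be appended, map `α_i` to a positive root. -/
theorem alternatingWord_root_nonneg {i j : X.Node} (h : i ≠ j) {k : ℕ}
    (hk : k < X.coxeterMatrix i j) :
    ∃ p q : ℤ, 0 ≤ p ∧ 0 ≤ q ∧
      X.act (X.weyl.wordProd (CoxeterSystem.alternatingWord i j k)) (X.root i) =
        p • X.root i + q • X.root j := by
  rw [coxeterMatrix_apply X h] at hk
  have e0 : X.root i = 0 + (1 : ℤ) • X.root i + (0 : ℤ) • X.root j := by simp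
  suffices h : ∃ p q : ℤ, 0 ≤ p ∧ 0 ≤ q ∧
      X.act (X.weyl.wordProd (CoxeterSystem.alternatingWord i j k))
        (0 + (1 : ℤ) • X.root i + (0 : ℤ) • X.root j) = 0 + p • X.root i + q • X.root j by
    rw [← e0] at h; simpa only [zero_add] using h
  rcases X.cartan_cases h with ⟨h1, h2⟩ | ⟨h1, h2⟩ | ⟨h1, h2⟩ | ⟨h1, h2⟩ | ⟨h1, h2⟩ | ⟨h1, h2⟩ <;>
  simp only [h1, h2, mul_zero, mul_one, neg_mul, mul_neg, one_mul, neg_neg, braidOrder] at hk <;>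
  interval_cases k <;>
  simp only [CoxeterSystem.alternatingWord, List.concat_eq_append, List.nil_append,
    List.cons_append, X.weyl.wordProd_cons, X.weyl.wordProd_nil, act_mul_apply, act_simple, map_one,
    Module.End.one_apply, refl_add_left, refl_add_right, h1, h2, map_zero] <;>
  refine ⟨_, _, ?_, ?_, rfl⟩ <;> norm_num

theorem two_le_coxeterMatrix {i j : X.Node} (h : i ≠ j) : 2 ≤ X.coxeterMatrix i j := by
  rw [coxeterMatrix_apply X h]
  rcases X.cartan_cases h with ⟨h1, h2⟩ | ⟨h1, h2⟩ | ⟨h1, h2⟩ | ⟨h1, h2⟩ | ⟨h1, h2⟩ | ⟨h1, h2⟩ <;>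
  simp [h1, h2, braidOrder]

open CoxeterSystem in
/-- A maximal factorization `w = v * (⋯ s_j s_i s_j)` with additive lengths. Unless the alternating
factor is the longest element of the dihedral subgroup, neither `i` nor `j` is a descent of `v`. -/
theorem exists_alternating_factor (w : X.coxeterMatrix.Group) {i j : X.Node} (h : i ≠ j)
    (hj : X.weyl.IsRightDescent w j) :
    ∃ k v, 1 ≤ k ∧ k ≤ X.coxeterMatrix i j ∧ w = v * X.weyl.wordProd (alternatingWord i j k) ∧
      X.weyl.length v + k = X.weyl.length w ∧
      (k < X.coxeterMatrix i j → ¬ X.weyl.IsRightDescent v i ∧ ¬ X.weyl.IsRightDescent v j) := by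
  classical
  let P : ℕ → Prop := fun k => ∃ v, w = v * X.weyl.wordProd (alternatingWord i j k) ∧
    X.weyl.length v + k = X.weyl.length w
  have hM := X.two_le_coxeterMatrix h
  have h1 : P 1 := ⟨w * X.weyl.simple j, by simp [alternatingWord],
    X.weyl.isRightDescent_iff.1 hj⟩
  have hk1 : 1 ≤ Nat.findGreatest P (X.coxeterMatrix i j) :=
    Nat.le_findGreatest (by omega) h1
  obtain ⟨v, hv, hl⟩ : P (Nat.findGreatest P (X.coxeterMatrix i j)) :=
    Nat.findGreatest_spec (m := 1) (by omega) h1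
  have hmax : ∀ k, Nat.findGreatest P (X.coxeterMatrix i j) < k → k ≤ X.coxeterMatrix i j → ¬ P k :=
    fun k h h' => Nat.findGreatest_is_greatest h h'
  have hle := Nat.findGreatest_le (P := P) (X.coxeterMatrix i j)
  generalize Nat.findGreatest P (X.coxeterMatrix i j) = k at *
  refine ⟨k, v, hk1, hle, hv, hl, fun hlt => ?_⟩
  have next : ¬ X.weyl.IsRightDescent v (if Even k then j else i) := by
    intro hd
    refine hmax (k + 1) (by omega) hlt ⟨v * X.weyl.simple (if Even k then j else i), ?_, ?_⟩
    · rw [alternatingWord_succ', X.weyl.wordProd_cons, ← mul_assoc,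
        X.weyl.simple_mul_simple_cancel_right, hv]
    · have := X.weyl.isRightDescent_iff.1 hd
      omega
  have first : ¬ X.weyl.IsRightDescent v (if Even k then i else j) := by
    intro hd
    obtain ⟨m, rfl⟩ : ∃ m, k = m + 1 := ⟨k - 1, by omega⟩
    have hf : (if Even (m + 1) then i else j) = if Even m then j else i := by
      by_cases hm : Even m <;> simp [hm, Nat.even_add_one]
    rw [hf] at hd
    rw [alternatingWord_succ', X.weyl.wordProd_cons, ← mul_assoc] at hv
    have h2 := X.weyl.length_mul_le (v * X.weyl.simple (if Even m then j else i))
      (X.weyl.wordProd (alternatingWord i j m))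
    have h3 := X.weyl.length_wordProd_le (alternatingWord i j m)
    rw [length_alternatingWord] at h3
    rw [← hv] at h2
    have := X.weyl.isRightDescent_iff.1 hd
    omega
  by_cases hk : Even k
  · rw [if_pos hk] at next first
    exact ⟨first, next⟩
  · rw [if_neg hk] at next first
    exact ⟨next, first⟩

open CoxeterSystem in
/-- An element with a longest dihedral right factor has both generators as descents, because the
longest dihedral element has two reduced words. -/
theorem isRightDescent_of_alternating_factor {v : X.coxeterMatrix.Group} {i j : X.Node} (h : i ≠ j)
    (hl : X.weyl.length v + X.coxeterMatrix i j =
      X.weyl.length (v * X.weyl.wordProd (alternatingWord i j (X.coxeterMatrix i j)))) :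
    X.weyl.IsRightDescent
      (v * X.weyl.wordProd (alternatingWord i j (X.coxeterMatrix i j))) i := by
  have hM := X.two_le_coxeterMatrix h
  obtain ⟨m, hm⟩ : ∃ m, X.coxeterMatrix i j = m + 1 := ⟨X.coxeterMatrix i j - 1, by omega⟩
  have hb : X.weyl.wordProd (alternatingWord i j (X.coxeterMatrix i j)) =
      X.weyl.wordProd (alternatingWord i j m) * X.weyl.simple i := by
    have := X.weyl.wordProd_braidWord_eq i j
    unfold CoxeterSystem.braidWord at this
    rw [this, X.coxeterMatrix.symmetric j i, hm, alternatingWord_succ, X.weyl.wordProd_concat]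
  unfold CoxeterSystem.IsRightDescent
  rw [← hl, hb, ← mul_assoc, X.weyl.simple_mul_simple_cancel_right]
  have h2 := X.weyl.length_mul_le v (X.weyl.wordProd (alternatingWord i j m))
  have h3 := X.weyl.length_wordProd_le (alternatingWord i j m)
  rw [length_alternatingWord] at h3
  omega

/-- If `w s_i` is longer than `w`, then `w α_i` is a positive root. -/
theorem act_root_nonneg (w : X.coxeterMatrix.Group) (i : X.Node)
    (hi : ¬ X.weyl.IsRightDescent w i) : 0 ≤ X.act w (X.root i) := by
  induction hn : X.weyl.length w using Nat.strong_induction_on generalizing w i with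
  | _ n ih =>
    by_cases hw : w = 1
    · subst hw
      rw [map_one]
      exact X.root_nonneg i
    obtain ⟨j, hj⟩ := X.weyl.exists_rightDescent_of_ne_one hw
    have hij : i ≠ j := fun h => hi (h ▸ hj)
    obtain ⟨k, v, hk1, hkM, hv, hl, hd⟩ := X.exists_alternating_factor w hij hj
    rcases hkM.lt_or_eq with hlt | heq
    · obtain ⟨p, q, hp, hq, he⟩ := X.alternatingWord_root_nonneg hij hlt
      have hvi := ih _ (by omega) v i (hd hlt).1 rfl
      have hvj := ih _ (by omega) v j (hd hlt).2 rfl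
      rw [hv, act_mul_apply, he, map_add, map_smul, map_smul]
      exact add_nonneg (smul_nonneg hp hvi) (smul_nonneg hq hvj)
    · subst heq
      rw [hv] at hi hl
      exact (hi (X.isRightDescent_of_alternating_factor hij hl)).elim

theorem act_root_nonpos (w : X.coxeterMatrix.Group) (i : X.Node)
    (hi : X.weyl.IsRightDescent w i) : X.act w (X.root i) ≤ 0 := by
  have h := X.act_root_nonneg _ i (X.weyl.isRightDescent_iff_not_isRightDescent_mul.1 hi)
  rw [act_mul_apply, act_simple, refl_root_self, map_neg] at h
  exact neg_nonneg.1 h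

theorem act_injective (w : X.coxeterMatrix.Group) : Function.Injective (X.act w) :=
  Function.LeftInverse.injective (X.act_inv_apply w)

theorem root_ne_zero (i : X.Node) : X.root i ≠ 0 := fun h => by
  have := congrFun h i; simp [root] at this

theorem act_root_ne_zero (w : X.coxeterMatrix.Group) (i : X.Node) : X.act w (X.root i) ≠ 0 :=
  fun h => X.root_ne_zero i (X.act_injective w (by rw [h, map_zero]))

theorem isRightDescent_iff_act_nonpos (w : X.coxeterMatrix.Group) (i : X.Node) :
    X.weyl.IsRightDescent w i ↔ X.act w (X.root i) ≤ 0 := by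
  refine ⟨X.act_root_nonpos w i, fun h => ?_⟩
  by_contra hc
  exact X.act_root_ne_zero w i (le_antisymm h (X.act_root_nonneg w i hc))

/-- Roots in the same orbit have the same length. -/
theorem mult_eq_of_act_root {w : X.coxeterMatrix.Group} {i j : X.Node}
    (h : X.act w (X.root i) = X.root j ∨ X.act w (X.root i) = - X.root j) :
    X.mult i = X.mult j := by
  have h1 := X.form_act w (X.root i) (X.root i)
  have h2 : X.form (X.root j) (X.root j) = X.form (X.root i) (X.root i) := by
    rcases h with h | h
    · rwa [h] at h1
    · rw [h, ← zero_sub, ← one_smul ℤ (X.root j), form_sub_smul_right, form_comm,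
        form_sub_smul_right] at h1
      simp only [form_comm X _ 0, one_smul] at h1
      rw [← h1]
      simp [form]
  rw [form_root_root, form_root_root, cartan_self, cartan_self] at h2
  push_cast at h2
  linarith

/-- A root proportional to a simple root is that root up to sign. -/
theorem eq_or_eq_neg_of_act_root_eq_smul {w : X.coxeterMatrix.Group} {i j : X.Node} {c : ℤ}
    (h : X.act w (X.root i) = c • X.root j) :
    X.act w (X.root i) = X.root j ∨ X.act w (X.root i) = - X.root j := by
  have h1 : X.root i = c • X.act w⁻¹ (X.root j) := by rw [← map_smul, ← h, act_inv_apply]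
  have h2 : c * (X.act w⁻¹ (X.root j)) i = 1 := by
    have := congrFun h1 i
    simpa [root] using this.symm
  rcases Int.eq_one_or_neg_one_of_mul_eq_one h2 with h3 | h3
  · left; rw [h, h3, one_smul]
  · right; rw [h, h3, neg_one_smul]

theorem act_root_of_conj {w : X.coxeterMatrix.Group} {i j : X.Node}
    (h : w * X.weyl.simple i = X.weyl.simple j * w) :
    X.act w (X.root i) = X.root j ∨ X.act w (X.root i) = - X.root j := by
  have h1 : X.act (w * X.weyl.simple i) (X.root i) = X.act (X.weyl.simple j * w) (X.root i) := by
    rw [h]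
  rw [act_mul_apply, act_mul_apply, act_simple, act_simple, refl_root_self, map_neg,
    refl_apply] at h1
  set u := X.act w (X.root i) with hu
  have h2 : (2 : ℤ) • u = X.coroot j u • X.root j := by
    rw [two_smul]
    linear_combination (exp := 1) -h1
  have h3 : 2 * u j = X.coroot j u := by
    have := congrFun h2 j
    simpa [root] using this
  have h4 : u = u j • X.root j := by
    rw [← h3, mul_smul] at h2
    exact smul_right_injective _ (two_ne_zero' ℤ) h2
  rw [hu] at h4 ⊢
  exact X.eq_or_eq_neg_of_act_root_eq_smul h4

theorem simple_injective : Function.Injective X.weyl.simple := by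
  intro i j h
  by_contra hij
  have h1 : (1 : X.coxeterMatrix.Group) * X.weyl.simple i = X.weyl.simple j * 1 := by simp [h]
  rcases X.act_root_of_conj h1 with h2 | h2 <;>
  · rw [map_one] at h2
    have := congrFun h2 i
    simp [root, hij] at this

/-! ### Matsumoto's theorem -/

/-- One braid relation, applied to a factor of a word. -/
def BraidStep (l l' : List X.Node) : Prop :=
  ∃ l₁ l₂ i j, i ≠ j ∧
    l = l₁ ++ CoxeterSystem.alternatingWord i j (X.coxeterMatrix i j) ++ l₂ ∧
    l' = l₁ ++ CoxeterSystem.alternatingWord j i (X.coxeterMatrix i j) ++ l₂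

theorem BraidStep.append_right {l l' : List X.Node} (h : X.BraidStep l l') (m : List X.Node) :
    X.BraidStep (l ++ m) (l' ++ m) := by
  obtain ⟨l₁, l₂, i, j, hij, rfl, rfl⟩ := h
  exact ⟨l₁, l₂ ++ m, i, j, hij, by simp, by simp⟩

theorem isReduced_of_concat {u : List X.Node} {i : X.Node}
    (h : X.weyl.IsReduced (u.concat i)) : X.weyl.IsReduced u := by
  have h1 := h.eq
  rw [X.weyl.wordProd_concat, List.length_concat] at h1
  have h2 := X.weyl.length_mul_simple (X.weyl.wordProd u) i
  have h3 := X.weyl.length_wordProd_le u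
  unfold CoxeterSystem.IsReduced
  omega

theorem isRightDescent_of_concat {u : List X.Node} {i : X.Node}
    (h : X.weyl.IsReduced (u.concat i)) :
    X.weyl.IsRightDescent (X.weyl.wordProd (u.concat i)) i := by
  unfold CoxeterSystem.IsRightDescent
  rw [h.eq, X.weyl.wordProd_concat, X.weyl.simple_mul_simple_cancel_right, List.length_concat]
  have h3 := X.weyl.length_wordProd_le u
  omega

open CoxeterSystem in
/-- Matsumoto's theorem: braid relations connect any two reduced words of the same element. -/
theorem reflTransGen_braidStep {l l' : List X.Node} (hl : X.weyl.IsReduced l)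
    (hl' : X.weyl.IsReduced l') (h : X.weyl.wordProd l = X.weyl.wordProd l') :
    Relation.ReflTransGen X.BraidStep l l' := by
  induction hn : l.length using Nat.strong_induction_on generalizing l l' with
  | _ n ih =>
    have hlen : l.length = l'.length := by rw [← hl.eq, ← hl'.eq, h]
    -- two words with the same last letter
    have key : ∀ (u u' : List X.Node) (i : X.Node), X.weyl.IsReduced (u.concat i) →
        X.weyl.IsReduced (u'.concat i) → (u.concat i).length = n →
        X.weyl.wordProd (u.concat i) = X.weyl.wordProd (u'.concat i) →
        Relation.ReflTransGen X.BraidStep (u.concat i) (u'.concat i) := by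
      intro u u' i hu hu' hn' he
      rw [X.weyl.wordProd_concat, X.weyl.wordProd_concat] at he
      rw [List.length_concat] at hn'
      have := ih u.length (by omega) (X.isReduced_of_concat hu) (X.isReduced_of_concat hu')
        (mul_right_cancel he) rfl
      rw [List.concat_eq_append, List.concat_eq_append]
      exact this.lift (· ++ [i]) fun _ _ hs => BraidStep.append_right X hs [i]
    rcases List.eq_nil_or_concat' l with rfl | ⟨u, i, rfl⟩
    · have : l' = [] := List.length_eq_zero_iff.1 hlen.symm
      rw [this]
    rcases List.eq_nil_or_concat' l' with rfl | ⟨u', j, rfl⟩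
    · simp at hlen
    rw [← List.concat_eq_append] at *
    rw [← List.concat_eq_append] at *
    by_cases hij : i = j
    · subst hij
      exact key u u' i hl hl' hn h
    have hi := X.isRightDescent_of_concat hl
    have hj := X.isRightDescent_of_concat hl'
    rw [← h] at hj
    set w := X.weyl.wordProd (u.concat i) with hw
    obtain ⟨k, v, hk1, hkM, hv, hlv, hd⟩ := X.exists_alternating_factor w hij hj
    -- otherwise `w α_i` would be a positive root, although `i` is a descent
    have hkM' : k = X.coxeterMatrix i j := by
      refine hkM.lt_or_eq.resolve_left fun hlt => ?_
      obtain ⟨p, q, hp, hq, he⟩ := X.alternatingWord_root_nonneg hij hlt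
      have h0 := X.act_root_nonpos w i hi
      have hvi := X.act_root_nonneg v i (hd hlt).1
      have hvj := X.act_root_nonneg v j (hd hlt).2
      refine X.act_root_ne_zero w i (le_antisymm h0 ?_)
      rw [hv, act_mul_apply, he, map_add, map_smul, map_smul]
      exact add_nonneg (smul_nonneg hp hvi) (smul_nonneg hq hvj)
    subst hkM'
    obtain ⟨z, hz, rfl⟩ := X.weyl.exists_isReduced v
    have hb : X.weyl.wordProd (alternatingWord i j (X.coxeterMatrix i j)) =
        X.weyl.wordProd (alternatingWord j i (X.coxeterMatrix i j)) := by
      have := X.weyl.wordProd_braidWord_eq i j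
      unfold CoxeterSystem.braidWord at this
      rwa [X.coxeterMatrix.symmetric j i] at this
    -- both words of the longest dihedral element can be put at the end of a word of `w`
    have hstep : X.BraidStep (z ++ alternatingWord i j (X.coxeterMatrix i j))
        (z ++ alternatingWord j i (X.coxeterMatrix i j)) :=
      ⟨z, [], i, j, hij, by simp, by simp⟩
    have hstep' : X.BraidStep (z ++ alternatingWord j i (X.coxeterMatrix i j))
        (z ++ alternatingWord i j (X.coxeterMatrix i j)) :=
      ⟨z, [], j, i, Ne.symm hij, by simp [X.coxeterMatrix.symmetric j i],
        by simp [X.coxeterMatrix.symmetric j i]⟩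
    have e1 : X.weyl.wordProd (z ++ alternatingWord i j (X.coxeterMatrix i j)) = w := by
      rw [X.weyl.wordProd_append, hv]
    have e2 : X.weyl.wordProd (z ++ alternatingWord j i (X.coxeterMatrix i j)) = w := by
      rw [X.weyl.wordProd_append, hv, hb]
    have r1 : X.weyl.IsReduced (z ++ alternatingWord i j (X.coxeterMatrix i j)) := by
      unfold CoxeterSystem.IsReduced
      rw [e1, List.length_append, length_alternatingWord, ← hlv, hz.eq]
    have r2 : X.weyl.IsReduced (z ++ alternatingWord j i (X.coxeterMatrix i j)) := by
      unfold CoxeterSystem.IsReduced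
      rw [e2, List.length_append, length_alternatingWord, ← hlv, hz.eq]
    have hM := X.two_le_coxeterMatrix hij
    obtain ⟨m, hm⟩ : ∃ m, X.coxeterMatrix i j = m + 1 := ⟨X.coxeterMatrix i j - 1, by omega⟩
    have c1 : z ++ alternatingWord i j (X.coxeterMatrix i j) =
        (z ++ alternatingWord j i m).concat j := by
      rw [hm, alternatingWord_succ, List.concat_eq_append, List.concat_eq_append, List.append_assoc]
    have c2 : z ++ alternatingWord j i (X.coxeterMatrix i j) =
        (z ++ alternatingWord i j m).concat i := by
      rw [hm, alternatingWord_succ, List.concat_eq_append, List.concat_eq_append, List.append_assoc]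
    have t1 : Relation.ReflTransGen X.BraidStep (u.concat i)
        (z ++ alternatingWord j i (X.coxeterMatrix i j)) := by
      rw [c2] at r2 e2 ⊢
      exact key _ _ _ hl r2 hn e2.symm
    have t2 : Relation.ReflTransGen X.BraidStep
        (z ++ alternatingWord i j (X.coxeterMatrix i j)) (u'.concat j) := by
      have hle : (z ++ alternatingWord i j (X.coxeterMatrix i j)).length = n := by
        rw [← hn, ← hl.eq, ← r1.eq, e1]
      rw [c1] at r1 e1 hle ⊢
      exact key _ _ _ r1 hl' hle (e1.trans h)
    exact (t1.tail hstep').trans t2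

/-! ### The longest element -/

theorem act_eq_sum (w : X.coxeterMatrix.Group) (v : X.Node → ℤ) :
    X.act w v = ∑ j, v j • X.act w (X.root j) := by
  have : v = ∑ j, v j • X.root j := by
    funext k
    simp [Finset.sum_apply, root, Pi.single_apply]
  conv_lhs => rw [this]
  rw [map_sum]
  exact Finset.sum_congr rfl fun j _ => map_smul _ _ _

/-- An element with all simple reflections as descents is the longest one, with
`ℓ(w g) = ℓ(w) - ℓ(g)`: it maps all positive roots to negative ones. -/
theorem length_mul_add_of_forall_descent {w : X.coxeterMatrix.Group}
    (hw : ∀ i, X.weyl.IsRightDescent w i) (g : X.coxeterMatrix.Group) :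
    X.weyl.length (w * g) + X.weyl.length g = X.weyl.length w := by
  obtain ⟨u, hu, rfl⟩ := X.weyl.exists_isReduced g
  induction u using List.reverseRecOn with
  | nil => simp
  | append_singleton u i ih =>
    rw [← List.concat_eq_append] at *
    have hu' := X.isReduced_of_concat hu
    have h1 : X.weyl.IsRightDescent (w * X.weyl.wordProd u) i := by
      rw [isRightDescent_iff_act_nonpos, act_mul_apply, act_eq_sum]
      have h0 : 0 ≤ X.act (X.weyl.wordProd u) (X.root i) := by
        refine X.act_root_nonneg _ i fun hd => ?_
        have h2 := hu.eq
        rw [X.weyl.wordProd_concat, List.length_concat] at h2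
        unfold CoxeterSystem.IsRightDescent at hd
        have := hu'.eq
        omega
      exact Finset.sum_nonpos fun j _ =>
        smul_nonpos_of_nonneg_of_nonpos (h0 j) (X.act_root_nonpos w j (hw j))
    have h2 := X.weyl.isRightDescent_iff.1 h1
    have h3 := ih hu'
    rw [hu'.eq] at h3
    rw [hu.eq, List.length_concat, X.weyl.wordProd_concat, ← mul_assoc]
    omega

theorem eq_of_forall_descent {w w' : X.coxeterMatrix.Group}
    (hw : ∀ i, X.weyl.IsRightDescent w i) (hw' : ∀ i, X.weyl.IsRightDescent w' i) : w = w' := by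
  have h1 := X.length_mul_add_of_forall_descent hw (w⁻¹ * w')
  have h2 := X.length_mul_add_of_forall_descent hw' (w'⁻¹ * w)
  rw [mul_inv_cancel_left] at h1 h2
  have h3 : X.weyl.length (w⁻¹ * w') = 0 := by omega
  rw [X.weyl.length_eq_zero_iff] at h3
  exact inv_mul_eq_one.1 h3

variable {X}

theorem IsLongestWord.isRightDescent {l : List X.Node} (hl : X.IsLongestWord l) (i : X.Node) :
    X.weyl.IsRightDescent (X.weyl.wordProd l) i := by
  have h1 := hl.2 (X.weyl.wordProd l * X.weyl.simple i)
  have h2 := X.weyl.length_mul_simple (X.weyl.wordProd l) i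
  have h3 := hl.1.eq
  unfold CoxeterSystem.IsRightDescent
  omega

theorem IsLongestWord.wordProd_eq {l l' : List X.Node} (hl : X.IsLongestWord l)
    (hl' : X.IsLongestWord l') : X.weyl.wordProd l = X.weyl.wordProd l' :=
  X.eq_of_forall_descent hl.isRightDescent hl'.isRightDescent

theorem IsLongestWord.of_wordProd_eq {l l' : List X.Node} (hl : X.IsLongestWord l)
    (h : X.weyl.wordProd l' = X.weyl.wordProd l) (hlen : l'.length ≤ l.length) :
    X.IsLongestWord l' := by
  have h1 := hl.1.eq
  have h2 := X.weyl.length_wordProd_le l'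
  rw [h, h1] at h2
  have h3 : l'.length = l.length := le_antisymm hlen h2
  exact ⟨by unfold CoxeterSystem.IsReduced; rw [h, h1, h3], fun g => by rw [h3]; exact hl.2 g⟩

theorem IsLongestWord.of_forall_descent {l l' : List X.Node} (hl : X.IsLongestWord l)
    (hr : X.weyl.IsReduced l') (h : ∀ i, X.weyl.IsRightDescent (X.weyl.wordProd l') i) :
    X.IsLongestWord l' := by
  have he := X.eq_of_forall_descent h hl.isRightDescent
  refine hl.of_wordProd_eq he ?_
  rw [← hr.eq, ← hl.1.eq, he]

theorem IsLongestWord.length_mul_add {l : List X.Node} (hl : X.IsLongestWord l)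
    (g : X.coxeterMatrix.Group) :
    X.weyl.length (X.weyl.wordProd l * g) + X.weyl.length g = l.length := by
  rw [X.length_mul_add_of_forall_descent hl.isRightDescent, hl.1.eq]

theorem IsLongestWord.reverse {l : List X.Node} (hl : X.IsLongestWord l) :
    X.IsLongestWord l.reverse :=
  ⟨hl.1.reverse, fun g => by rw [List.length_reverse]; exact hl.2 g⟩

theorem IsLongestWord.inv_eq {l : List X.Node} (hl : X.IsLongestWord l) :
    (X.weyl.wordProd l)⁻¹ = X.weyl.wordProd l := by
  rw [← X.weyl.wordProd_reverse]
  exact hl.reverse.wordProd_eq hl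

theorem IsLongestWord.mul_self {l : List X.Node} (hl : X.IsLongestWord l) :
    X.weyl.wordProd l * X.weyl.wordProd l = 1 := by
  nth_rw 1 [← hl.inv_eq]
  exact inv_mul_cancel _

theorem IsLongestWord.exists_conj_simple {l : List X.Node} (hl : X.IsLongestWord l) (i : X.Node) :
    ∃ j, X.weyl.wordProd l * X.weyl.simple i = X.weyl.simple j * X.weyl.wordProd l := by
  have h1 := hl.length_mul_add (X.weyl.simple i)
  have h2 := hl.length_mul_add (X.weyl.simple i * (X.weyl.wordProd l)⁻¹)
  have h3 : X.weyl.length (X.weyl.simple i * (X.weyl.wordProd l)⁻¹) =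
      X.weyl.length (X.weyl.wordProd l * X.weyl.simple i) := by
    rw [← X.weyl.length_inv, mul_inv_rev, inv_inv, X.weyl.inv_simple]
  rw [X.weyl.length_simple] at h1
  have h4 : X.weyl.length (X.weyl.wordProd l * (X.weyl.simple i * (X.weyl.wordProd l)⁻¹)) = 1 := by
    omega
  obtain ⟨j, hj⟩ := X.weyl.length_eq_one_iff.1 h4
  exact ⟨j, by rw [← hj, ← mul_assoc, inv_mul_cancel_right]⟩

theorem IsLongestWord.exists_isDynkinInvolution {l : List X.Node} (hl : X.IsLongestWord l) :
    ∃ η, X.IsDynkinInvolution l η := by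
  choose η hη using hl.exists_conj_simple
  have hinv : Function.Involutive η := by
    intro i
    have h1 := hη (η i)
    have h2 := congrArg (X.weyl.wordProd l * ·) (hη i)
    simp only [← mul_assoc] at h2
    rw [hl.mul_self, one_mul, h1, mul_assoc, hl.mul_self, mul_one] at h2
    exact (X.simple_injective h2).symm
  exact ⟨hinv.toPerm, hη⟩

theorem IsDynkinInvolution.apply_apply {l : List X.Node} {η : Equiv.Perm X.Node}
    (h : X.IsDynkinInvolution l η) (hl : X.IsLongestWord l) (i : X.Node) : η (η i) = i := by
  have h1 := h (η i)
  have h2 := congrArg (X.weyl.wordProd l * ·) (h i)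
  simp only [← mul_assoc] at h2
  rw [hl.mul_self, one_mul, h1, mul_assoc, hl.mul_self, mul_one] at h2
  exact (X.simple_injective h2).symm

theorem IsDynkinInvolution.act_root {l : List X.Node} {η : Equiv.Perm X.Node}
    (h : X.IsDynkinInvolution l η) (hl : X.IsLongestWord l) (i : X.Node) :
    X.act (X.weyl.wordProd l) (X.root i) = - X.root (η i) := by
  refine (X.act_root_of_conj (h i)).resolve_left fun h1 => ?_
  have h2 := X.act_root_nonpos _ i (hl.isRightDescent i)
  rw [h1] at h2
  exact X.root_ne_nonpos _ h2

theorem IsDynkinInvolution.mult_apply {l : List X.Node} {η : Equiv.Perm X.Node}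
    (h : X.IsDynkinInvolution l η) (hl : X.IsLongestWord l) (i : X.Node) :
    X.mult (η i) = X.mult i :=
  (X.mult_eq_of_act_root (Or.inr (h.act_root hl i))).symm

variable (X) in
/-- The negative `-(α i, α j)` of the Gram matrix of the simple roots. -/
noncomputable def gram (i j : X.Node) : ℚ := - (X.mult i * X.cartan i j)

theorem gram_comm (i j : X.Node) : X.gram i j = X.gram j i := by
  rw [gram, gram, mult_mul_cartan]

theorem gram_self (i : X.Node) : X.gram i i = - (2 * X.mult i) := by
  rw [gram, cartan_self]; push_cast; ring

theorem gram_eq (i j : X.Node) : X.gram i j = - X.form (X.root i) (X.root j) := by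
  rw [gram, form_root_root]

theorem form_neg_neg (v w : X.Node → ℤ) : X.form (-v) (-w) = X.form v w := by
  simp [form]

theorem form_neg_right (v w : X.Node → ℤ) : X.form v (-w) = - X.form v w := by
  simp [form]

theorem form_neg_left (v w : X.Node → ℤ) : X.form (-v) w = - X.form v w := by
  simp [form]

theorem gram_nonneg {i j : X.Node} (h : i ≠ j) : 0 ≤ X.gram i j := by
  have h0 := X.mult_pos i
  have h1 : X.cartan i j ≤ 0 := by
    rcases X.cartan_cases h with h | h | h | h | h | h <;> rw [h.1] <;> norm_num
  have h2 : (X.cartan i j : ℚ) ≤ 0 := by exact_mod_cast h1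
  unfold gram
  nlinarith

/-- Weyl group elements that map two simple roots to simple roots up to sign preserve the
inner product. -/
theorem gram_eq_of_conj {w : X.coxeterMatrix.Group} {i j i' j' : X.Node} (hij : i ≠ j)
    (hij' : i' ≠ j') (hi : w * X.weyl.simple i = X.weyl.simple i' * w)
    (hj : w * X.weyl.simple j = X.weyl.simple j' * w) : X.gram i' j' = X.gram i j := by
  have h := X.form_act w (X.root i) (X.root j)
  have h1 := gram_nonneg hij
  have h2 := gram_nonneg hij'
  rw [gram_eq] at *
  rw [gram_eq] at *
  rcases X.act_root_of_conj hi with h3 | h3 <;> rcases X.act_root_of_conj hj with h4 | h4 <;>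
    rw [h3, h4] at h <;> (try simp only [form_neg_left, form_neg_right] at h) <;> linarith

theorem mult_eq_of_conj {w : X.coxeterMatrix.Group} {i j : X.Node}
    (h : w * X.weyl.simple i = X.weyl.simple j * w) : X.mult i = X.mult j :=
  X.mult_eq_of_act_root (X.act_root_of_conj h)

theorem IsDynkinInvolution.gram_apply {l : List X.Node} {η : Equiv.Perm X.Node}
    (h : X.IsDynkinInvolution l η) (hl : X.IsLongestWord l) (i j : X.Node) :
    X.gram (η i) (η j) = X.gram i j := by
  rw [gram_eq, gram_eq, ← form_neg_neg, ← h.act_root hl, ← h.act_root hl, form_act]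

theorem IsDynkinInvolution.wordProd_map {l : List X.Node} {η : Equiv.Perm X.Node}
    (h : X.IsDynkinInvolution l η) (u : List X.Node) :
    X.weyl.wordProd (u.map η) =
      X.weyl.wordProd l * X.weyl.wordProd u * (X.weyl.wordProd l)⁻¹ := by
  induction u with
  | nil => simp
  | cons a u ih =>
    rw [List.map_cons, X.weyl.wordProd_cons, X.weyl.wordProd_cons, ih,
      ← mul_assoc (X.weyl.wordProd l), h a]
    simp only [mul_assoc]

theorem IsLongestWord.map {l : List X.Node} {η : Equiv.Perm X.Node} (hl : X.IsLongestWord l)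
    (h : X.IsDynkinInvolution l η) : X.IsLongestWord (l.map η) :=
  hl.of_wordProd_eq (by rw [h.wordProd_map, mul_inv_cancel_right]) (by simp)

theorem act_wordProd_apply_of_notMem {l : List X.Node} {i : X.Node} (h : i ∉ l)
    (v : X.Node → ℤ) : X.act (X.weyl.wordProd l) v i = v i := by
  induction l with
  | nil => simp
  | cons a l ih =>
    rw [List.mem_cons, not_or] at h
    rw [X.weyl.wordProd_cons, act_mul_apply, act_simple, refl_apply, Pi.sub_apply, ih h.2]
    simp [root, h.1]

theorem IsLongestWord.mem {l : List X.Node} (hl : X.IsLongestWord l) (i : X.Node) : i ∈ l := by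
  by_contra h
  have h1 := X.act_root_nonpos _ i (hl.isRightDescent i) i
  rw [act_wordProd_apply_of_notMem h] at h1
  simp [root] at h1

theorem IsLongestWord.count_pos {l : List X.Node} (hl : X.IsLongestWord l) (i : X.Node) :
    0 < l.count i :=
  List.count_pos_iff.2 (hl.mem i)

/-! ### The numbers game -/

/-- The functional `f ∘ s_i`, where `f` is given by its values on the simple roots. -/
noncomputable def play (f : X.Node → ℤ) (i : X.Node) : X.Node → ℤ :=
  fun j => f j - X.cartan i j * f i

/-- Playing the letters of a word one after the other meets positive numbers only. -/
def IsPositivePlay : (X.Node → ℤ) → List X.Node → Prop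
  | _, [] => True
  | f, i :: l => 0 < f i ∧ IsPositivePlay (play f i) l

/-- A legal sequence of the numbers game that starts with positive and ends with negative numbers
is a reduced word of an element all of whose simple reflections are descents. -/
theorem isReduced_of_isPositivePlay {f₀ : X.Node → ℤ} (h0 : ∀ i, 0 < f₀ i) {l : List X.Node}
    (hl : IsPositivePlay f₀ l) (hneg : ∀ i, l.foldl play f₀ i < 0) :
    X.weyl.IsReduced l ∧ ∀ i, X.weyl.IsRightDescent (X.weyl.wordProd l) i := by
  -- `f` is `f₀ ∘ p` for the letters `p` played so far; `f₀` is positive exactly on positive roots,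
  -- so that a positive number `f i = f₀ (p α_i)` means that `p s_i` is longer than `p`
  let ev : (X.Node → ℤ) → (X.Node → ℤ) → ℤ := fun f v => ∑ j, f j * v j
  have ev_root : ∀ f i, ev f (X.root i) = f i := fun f i => by simp [ev, root, Pi.single_apply]
  have ev_play : ∀ f i v, ev (play f i) v = ev f (X.refl i v) := by
    intro f i v
    have : ∑ j, f j * (X.coroot i v * X.root i j) = f i * X.coroot i v := by
      simp [root, Pi.single_apply]
    simp only [ev, play, refl_apply, Pi.sub_apply, Pi.smul_apply, smul_eq_mul, mul_sub, sub_mul,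
      Finset.sum_sub_distrib, this]
    rw [coroot_apply, Finset.mul_sum]
    congr 1
    exact Finset.sum_congr rfl fun j _ => by ring
  have key : ∀ (l p : List X.Node) (f : X.Node → ℤ), X.weyl.IsReduced p →
      (∀ v, ev f v = ev f₀ (X.act (X.weyl.wordProd p) v)) → IsPositivePlay f l →
      X.weyl.IsReduced (p ++ l) ∧
        ∀ v, ev (l.foldl play f) v = ev f₀ (X.act (X.weyl.wordProd (p ++ l)) v) := by
    intro l
    induction l with
    | nil => intro p f hp hf _; simpa using ⟨hp, hf⟩
    | cons i l ih =>
      intro p f hp hf hpl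
      have hd : ¬ X.weyl.IsRightDescent (X.weyl.wordProd p) i := by
        intro hd
        have h1 := X.act_root_nonpos _ i hd
        have h2 := hf (X.root i)
        rw [ev_root] at h2
        have h3 : ev f₀ (X.act (X.weyl.wordProd p) (X.root i)) ≤ 0 :=
          Finset.sum_nonpos fun j _ => mul_nonpos_of_nonneg_of_nonpos (h0 j).le (h1 j)
        have := hpl.1
        omega
      have := ih (p ++ [i]) (play f i) ?_ ?_ hpl.2
      · simpa using this
      · have h1 := X.weyl.not_isRightDescent_iff.1 hd
        unfold CoxeterSystem.IsReduced
        rw [X.weyl.wordProd_append, X.weyl.wordProd_singleton, h1, hp.eq]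
        simp
      · intro v
        rw [ev_play, hf, X.weyl.wordProd_append, X.weyl.wordProd_singleton, act_mul_apply,
          act_simple]
  obtain ⟨h1, h2⟩ := key l [] f₀ (by simp [CoxeterSystem.IsReduced]) (by simp) hl
  rw [List.nil_append] at h1 h2
  refine ⟨h1, fun i => ?_⟩
  by_contra hd
  have h3 := X.act_root_nonneg _ i hd
  have h4 := h2 (X.root i)
  rw [ev_root] at h4
  have h5 : 0 ≤ ev f₀ (X.act (X.weyl.wordProd l) (X.root i)) :=
    Finset.sum_nonneg fun j _ => mul_nonneg (h0 j).le (h3 j)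
  have := hneg i
  omega

end LieType

/-! ### Skew forms and their mutation -/

namespace WQuiver

variable {V : Type}

/-- The skew form `f ∧ g`. -/
def wedge (f g : V → ℚ) (u v : V) : ℚ := f u * g v - f v * g u

open Classical in
/-- The indicator function of a vertex. -/
noncomputable def ind (k v : V) : ℚ := if v = k then 1 else 0

theorem ind_self (k : V) : ind k k = 1 := by simp [ind]

theorem ind_ne {k v : V} (h : v ≠ k) : ind k v = 0 := by simp [ind, h]

theorem ind_nonneg (k v : V) : 0 ≤ ind k v := by
  unfold ind; split_ifs <;> norm_num

theorem ind_mul_ind {k l : V} (h : k ≠ l) (v : V) : ind k v * ind l v = 0 := by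
  by_cases hv : v = k
  · rw [hv, ind_ne h, mul_zero]
  · rw [ind_ne hv, zero_mul]

open Classical in
/-- The weights after a mutation at a vertex `k` with multiplier `d`. -/
noncomputable def mutForm (d : ℚ) (k : V) (w : V → V → ℚ) (u v : V) : ℚ :=
  if u = k ∨ v = k then - w u v
  else w u v + (w u k * |w k v| + |w u k| * w k v) / (2 * d)

theorem mutate_w (Q : WQuiver V) (k : V) : (Q.mutate k).w = mutForm (Q.d k) k Q.w := rfl

/-- If the arrows at `k` are `k → v` of weight `P v` and `v → k` of weight `N v`, then the mutation
at `k` reverses them and adds `N ∧ P / d`. -/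
theorem mutForm_eq {d : ℚ} {k : V} {w : V → V → ℚ} (hd : 0 < d) (P N : V → ℚ) (R : V → V → ℚ)
    (hw : ∀ u v, w u v = wedge (ind k) (fun x => P x - N x) u v + R u v)
    (hP : ∀ v, 0 ≤ P v) (hN : ∀ v, 0 ≤ N v) (hPN : ∀ v, P v * N v = 0) (hPk : P k = 0)
    (hNk : N k = 0) (hR : ∀ v, R k v = 0) (hR' : ∀ v, R v k = 0) (u v : V) :
    mutForm d k w u v =
      - wedge (ind k) (fun x => P x - N x) u v + R u v + wedge N P u v / d := by
  have h1 : ∀ v, v ≠ k → w k v = P v - N v := fun v hv => by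
    rw [hw, hR]; simp [wedge, ind_self, ind_ne hv]
  have h2 : ∀ v, v ≠ k → w v k = N v - P v := fun v hv => by
    rw [hw, hR']; simp [wedge, ind_self, ind_ne hv]
  have habs : ∀ v, |P v - N v| = P v + N v := fun v => by
    rcases mul_eq_zero.1 (hPN v) with h | h
    · rw [h, zero_sub, zero_add, abs_neg, abs_of_nonneg (hN v)]
    · rw [h, sub_zero, add_zero, abs_of_nonneg (hP v)]
  unfold mutForm
  by_cases hu : u = k
  · subst hu
    rw [if_pos (Or.inl rfl), hw, hR]
    simp [wedge, hPk, hNk]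
  by_cases hv : v = k
  · subst hv
    rw [if_pos (Or.inr rfl), hw, hR']
    simp [wedge, hPk, hNk]
  · rw [if_neg (by tauto), h1 v hv, h2 u hu, habs, abs_sub_comm, habs, hw]
    simp only [wedge, ind_ne hu, ind_ne hv]
    field_simp
    ring

theorem mutForm_mutForm {d : ℚ} {k : V} (w : V → V → ℚ) :
    mutForm d k (mutForm d k w) = w := by
  funext u v
  unfold mutForm
  by_cases h : u = k ∨ v = k
  · simp [h]
  · have hu : u ≠ k := fun h' => h (Or.inl h')
    have hv : v ≠ k := fun h' => h (Or.inr h')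
    simp only [hu, hv, or_self, if_false, or_true, true_or, if_true, abs_neg]
    ring

theorem mutate_mutate (Q : WQuiver V) (k : V) : (Q.mutate k).mutate k = Q := by
  refine WQuiver.ext rfl rfl rfl ?_
  exact mutForm_mutForm _

end WQuiver

namespace LieType

open WQuiver

variable {X : LieType}

/-! ### The form of a decorated word -/

/-- The indicator function of the vertices `f_i^{c i}`. -/
def state (c : X.Node → ℤ) : QLabel X.Node → ℚ
  | .f i k => if c i = k then 1 else 0
  | .e _ => 0

/-- The indicator function of the vertex `e_a^0`, or `0` if there is no label `a`. -/
def eInd (o : Option X.Node) : QLabel X.Node → ℚ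
  | .f _ _ => 0
  | .e a => if o = some a then 1 else 0

/-- The counters `c` after one more letter `i`. -/
def bump (c : X.Node → ℤ) (i j : X.Node) : ℤ := if j = i then c j + 1 else c j

/-- A letter of a word, with the label `a` if it carries the vertex `e_a^0`. -/
abbrev Letter (X : LieType) : Type := X.Node × Option X.Node

/-- The contribution of one letter `i` to the weights of a quiver, where `f_j^{c j}` is the current
vertex of the row `j`: with `L = f_i^{c i}`, `R = f_i^{c i + 1}` there is an arrow `L → R`, there
are half arrows `R → f_j^{c j} → L`, and arrows `R → e → L` if the letter has a label. -/
noncomputable def letterForm (c : X.Node → ℤ) (p : X.Letter) (u v : QLabel X.Node) : ℚ :=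
  X.gram u.node v.node / 2 *
      (state (bump c p.1) u * state c v - state c u * state (bump c p.1) v) +
    X.mult p.1 * wedge (eInd p.2) (fun x => state c x - state (bump c p.1) x) u v

/-- The sum of the contributions of all letters. -/
noncomputable def wordForm : (X.Node → ℤ) → List X.Letter → QLabel X.Node → QLabel X.Node → ℚ
  | _, [], _, _ => 0
  | c, p :: T, u, v => letterForm c p u v + wordForm (bump c p.1) T u v

/-- The sum of the indicators of the labels. -/
def eSum : List X.Letter → QLabel X.Node → ℚ
  | [], _ => 0
  | p :: T, v => eInd p.2 v + eSum T v

/-- Half arrows between the labels, from the earlier to the later one. -/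
noncomputable def labelForm : List X.Letter → QLabel X.Node → QLabel X.Node → ℚ
  | [], _, _ => 0
  | p :: T, u, v => X.gram u.node v.node / 2 * wedge (eInd p.2) (eSum T) u v + labelForm T u v

/-- The number of letters `i`. -/
def letterCount (D : List X.Letter) (i : X.Node) : ℤ := ((D.map Prod.fst).count i : ℤ)

theorem letterCount_nonneg (D : List X.Letter) (i : X.Node) : 0 ≤ letterCount D i :=
  Int.natCast_nonneg _

theorem letterCount_cons (p : X.Letter) (D : List X.Letter) (i : X.Node) :
    letterCount (p :: D) i = letterCount D i + if i = p.1 then 1 else 0 := by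
  simp only [letterCount, List.map_cons, List.count_cons]
  by_cases h : i = p.1
  · simp [h]
  · have h' : ¬ p.1 = i := fun h' => h h'.symm
    simp [h, h']

theorem letterCount_append (D D' : List X.Letter) (i : X.Node) :
    letterCount (D ++ D') i = letterCount D i + letterCount D' i := by
  simp [letterCount]

theorem bump_add_letterCount (c : X.Node → ℤ) (p : X.Letter) (D : List X.Letter) :
    bump c p.1 + letterCount D = c + letterCount (p :: D) := by
  funext i
  simp only [Pi.add_apply, letterCount_cons, bump]
  split_ifs <;> ring

theorem wordForm_append (c : X.Node → ℤ) (D D' : List X.Letter) (u v : QLabel X.Node) :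
    wordForm c (D ++ D') u v = wordForm c D u v + wordForm (c + letterCount D) D' u v := by
  induction D generalizing c with
  | nil =>
    have : c + letterCount ([] : List X.Letter) = c := by funext i; simp [letterCount]
    simp [wordForm, this]
  | cons p D ih =>
    rw [List.cons_append, wordForm, wordForm, ih, bump_add_letterCount]
    ring

theorem eSum_append (D D' : List X.Letter) (v : QLabel X.Node) :
    eSum (D ++ D') v = eSum D v + eSum D' v := by
  induction D with
  | nil => simp [eSum]
  | cons p D ih => rw [List.cons_append, eSum, eSum, ih]; ring

/-- Half arrows between two factors of a word go from all labels of the first to all of the second.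
-/
theorem labelForm_append (D D' : List X.Letter) (u v : QLabel X.Node) :
    labelForm (D ++ D') u v = labelForm D u v + labelForm D' u v +
      X.gram u.node v.node / 2 * wedge (eSum D) (eSum D') u v := by
  induction D with
  | nil => simp [labelForm, eSum, wedge]
  | cons p D ih =>
    rw [List.cons_append, labelForm, labelForm, ih]
    simp only [wedge, eSum_append, eSum]
    ring

theorem eSum_f (D : List X.Letter) (i : X.Node) (k : ℤ) : eSum D (.f i k) = 0 := by
  induction D with
  | nil => rfl
  | cons p D ih => rw [eSum, ih]; simp [eInd]

theorem labelForm_f_left (D : List X.Letter) (i : X.Node) (k : ℤ) (v : QLabel X.Node) :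
    labelForm D (.f i k) v = 0 := by
  induction D with
  | nil => rfl
  | cons p D ih => rw [labelForm, ih]; simp [wedge, eSum_f, eInd]

theorem letterForm_skew (c : X.Node → ℤ) (p : X.Letter) (u v : QLabel X.Node) :
    letterForm c p u v = - letterForm c p v u := by
  simp only [letterForm, wedge, gram_comm u.node v.node]; ring

theorem wordForm_skew (c : X.Node → ℤ) (D : List X.Letter) (u v : QLabel X.Node) :
    wordForm c D u v = - wordForm c D v u := by
  induction D generalizing c with
  | nil => simp [wordForm]
  | cons p D ih => rw [wordForm, wordForm, ih, letterForm_skew]; ring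

theorem labelForm_skew (D : List X.Letter) (u v : QLabel X.Node) :
    labelForm D u v = - labelForm D v u := by
  induction D with
  | nil => simp [labelForm]
  | cons p D ih => rw [labelForm, labelForm, ih, gram_comm u.node v.node]; simp only [wedge]; ring

theorem labelForm_f_right (D : List X.Letter) (i : X.Node) (k : ℤ) (v : QLabel X.Node) :
    labelForm D v (.f i k) = 0 := by
  rw [labelForm_skew, labelForm_f_left, neg_zero]

/-- The row `i` of the weights of a word lives on the vertices that are current at some time. -/
theorem wordForm_eq_zero (c : X.Node → ℤ) (D : List X.Letter) (i : X.Node) (t : ℤ)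
    (h : t < c i ∨ c i + letterCount D i < t) (v : QLabel X.Node) :
    wordForm c D (.f i t) v = 0 := by
  induction D generalizing c with
  | nil => rfl
  | cons p D ih =>
    have hD := letterCount_nonneg D i
    rw [letterCount_cons] at h
    have h1 : c i ≠ t := by split_ifs at h <;> omega
    have h2 : bump c p.1 i ≠ t := by unfold bump; split_ifs at h ⊢ <;> omega
    rw [wordForm, ih]
    · simp [letterForm, state, eInd, wedge, h1, h2]
    · unfold bump; split_ifs at h ⊢ <;> omega

/-- The half arrows between a letter `i` and the rows different from `i` and `j`. -/
noncomputable def sideVec (i j : X.Node) (c : X.Node → ℤ) : QLabel X.Node → ℚ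
  | .f x t => if x = i ∨ x = j then 0 else X.gram i x / 2 * (if c x = t then 1 else 0)
  | .e _ => 0

theorem sideVec_congr {i j : X.Node} {c c' : X.Node → ℤ} (h : ∀ x, x ≠ i → x ≠ j → c x = c' x) :
    sideVec i j c = sideVec i j c' := by
  funext v
  rcases v with ⟨x, t⟩ | a
  · simp only [sideVec]
    by_cases hi : x = i
    · simp [hi]
    by_cases hj : x = j
    · simp [hj]
    rw [h x hi hj]
  · rfl

/-- The contribution of a letter in terms of the two ends of its arrow and of a second row. -/
theorem letterForm_eq {c : X.Node → ℤ} {i j : X.Node} (hij : i ≠ j) (o : Option X.Node)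
    {s t : ℤ} (hs : c i = s) (ht : c j = t) (u v : QLabel X.Node) :
    letterForm c (i, o) u v =
      wedge (fun x => ind (.f i (s + 1)) x - ind (.f i s) x)
        (fun x => - X.mult i * ind (.f i s) x + X.gram i j / 2 * ind (.f j t) x +
          sideVec i j c x) u v +
      X.mult i * wedge (eInd o) (fun x => ind (.f i s) x - ind (.f i (s + 1)) x) u v := by
  subst hs ht
  have h1 : ∀ x, state (bump c i) x - state c x = ind (.f i (c i + 1)) x - ind (.f i (c i)) x := by
    rintro (⟨x, t⟩ | a)
    · by_cases hx : x = i
      · subst hx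
        simp [state, bump, ind, eq_comm]
      · simp [state, bump, ind, hx]
    · simp [state, ind]
  have h2 : ∀ x, X.gram i x.node / 2 * state c x = - X.mult i * ind (.f i (c i)) x +
      X.gram i j / 2 * ind (.f j (c j)) x + sideVec i j c x := by
    rintro (⟨x, t⟩ | a)
    · by_cases hx : x = i
      · subst hx
        simp only [QLabel.node, gram_self, state, ind, sideVec, QLabel.f.injEq, true_and,
          true_or, if_true, hij, false_and, if_false, eq_comm (a := t)]
        split_ifs <;> ring
      · by_cases hy : x = j
        · subst hy
          simp [QLabel.node, state, ind, sideVec, hx, eq_comm (a := t)]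
        · simp [QLabel.node, state, ind, sideVec, hx, hy]
    · simp [state, ind, sideVec]
  have h3 : ∀ x y, X.gram x.node y.node / 2 * ((state (bump c i) x - state c x) * state c y) =
      (ind (.f i (c i + 1)) x - ind (.f i (c i)) x) * (- X.mult i * ind (.f i (c i)) y +
      X.gram i j / 2 * ind (.f j (c j)) y + sideVec i j c y) := by
    intro x y
    rw [← h2, h1]
    rcases x with ⟨x, t⟩ | a
    · by_cases hx : x = i
      · subst hx
        simp only [QLabel.node]; ring
      · simp [ind, hx]
    · simp [ind]
  have h4 : ∀ x, state c x - state (bump c i) x = ind (.f i (c i)) x - ind (.f i (c i + 1)) x :=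
    fun x => by linarith [h1 x]
  have h5 := h3 u v
  have h6 := h3 v u
  rw [gram_comm] at h6
  simp only [letterForm, wedge, h4]
  linear_combination h5 - h6

/-! ### Changes of two, three and four letters, on the level of weights -/

/-- The weights of the quiver of a decorated word. -/
noncomputable def triForm (T : List X.Letter) (u v : QLabel X.Node) : ℚ :=
  wordForm 0 T u v + labelForm T u v

/-- The part of `triForm (T₁ ++ T ++ T₂)` that comes from `T₁` and `T₂`, where `c` are the counters
at the beginning of `T₂` and `S = eSum T`. -/
noncomputable def restForm (T₁ T₂ : List X.Letter) (c : X.Node → ℤ) (S : QLabel X.Node → ℚ)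
    (u v : QLabel X.Node) : ℚ :=
  wordForm 0 T₁ u v + wordForm c T₂ u v + (labelForm T₁ u v + labelForm T₂ u v +
    X.gram u.node v.node / 2 * (wedge (eSum T₁) S u v + wedge (eSum T₁) (eSum T₂) u v +
      wedge S (eSum T₂) u v))

/-- A block in the middle of a word contributes to the weights through its own form, its number of
letters and its set of labels only. -/
theorem triForm_block (T₁ T T₂ : List X.Letter) (u v : QLabel X.Node) :
    triForm (T₁ ++ T ++ T₂) u v = wordForm (letterCount T₁) T u v + labelForm T u v +
      restForm T₁ T₂ (letterCount T₁ + letterCount T) (eSum T) u v := by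
  have h0 : (0 : X.Node → ℤ) + letterCount T₁ = letterCount T₁ := zero_add _
  have h1 : (0 : X.Node → ℤ) + letterCount (T₁ ++ T) = letterCount T₁ + letterCount T := by
    funext i; simp [letterCount_append]
  simp only [triForm, wordForm_append, labelForm_append, restForm, h0, h1, wedge, eSum_append]
  ring

/-- A vertex that is current only inside of the block has no arrows coming from outside. -/
theorem restForm_eq_zero (T₁ T₂ : List X.Letter) {c : X.Node → ℤ} {S : QLabel X.Node → ℚ}
    (hS : ∀ i k, S (.f i k) = 0) {i : X.Node} {k : ℤ} (h1 : letterCount T₁ i < k) (h2 : k < c i)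
    (v : QLabel X.Node) : restForm T₁ T₂ c S (.f i k) v = 0 := by
  unfold restForm
  rw [wordForm_eq_zero _ _ _ _ (Or.inr (by simpa using h1)),
    wordForm_eq_zero _ _ _ _ (Or.inl h2), labelForm_f_left, labelForm_f_left]
  simp [wedge, eSum_f, hS]

theorem restForm_skew (T₁ T₂ : List X.Letter) (c : X.Node → ℤ) (S : QLabel X.Node → ℚ)
    (u v : QLabel X.Node) : restForm T₁ T₂ c S u v = - restForm T₁ T₂ c S v u := by
  unfold restForm
  rw [wordForm_skew 0, wordForm_skew c, labelForm_skew T₁, labelForm_skew T₂, gram_comm u.node]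
  simp only [wedge]
  ring

/-- `u` and `u'` play the same role for the form of `T` with the counters `c` and `c'`. -/
def Corresponds (c c' : X.Node → ℤ) (T : List X.Letter) (u u' : QLabel X.Node) : Prop :=
  u.node = u'.node ∧ (∀ o, eInd o u = eInd o u') ∧
    ∀ s : X.Node → ℤ, (∀ i, 0 ≤ s i ∧ s i ≤ letterCount T i) →
      state (c + s) u = state (c' + s) u'

theorem wordForm_congr {c c' : X.Node → ℤ} {T : List X.Letter} {u u' v v' : QLabel X.Node}
    (hu : Corresponds c c' T u u') (hv : Corresponds c c' T v v') :
    wordForm c T u v = wordForm c' T u' v' := by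
  induction T generalizing c c' with
  | nil => rfl
  | cons p T ih =>
    have hb : ∀ c : X.Node → ℤ, bump c p.1 = c + bump 0 p.1 := by
      intro c; funext i; simp only [bump, Pi.add_apply, Pi.zero_apply]; split_ifs <;> simp
    have ht : ∀ w w', Corresponds c c' (p :: T) w w' →
        Corresponds (bump c p.1) (bump c' p.1) T w w' := by
      rintro w w' ⟨h1, h2, h3⟩
      refine ⟨h1, h2, fun s hs => ?_⟩
      rw [hb c, hb c', add_assoc, add_assoc]
      refine h3 _ fun i => ?_
      have := hs i
      rw [letterCount_cons]
      simp only [bump, Pi.add_apply, Pi.zero_apply]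
      split_ifs <;> omega
    have h0 : ∀ w w', Corresponds c c' (p :: T) w w' → state c w = state c' w' := by
      rintro w w' ⟨h1, h2, h3⟩
      have := h3 0 fun i => ⟨le_rfl, letterCount_nonneg _ _⟩
      simpa using this
    have h1 : ∀ w w', Corresponds c c' (p :: T) w w' →
        state (bump c p.1) w = state (bump c' p.1) w' := by
      rintro w w' ⟨h1, h2, h3⟩
      rw [hb c, hb c']
      refine h3 _ fun i => ?_
      have := letterCount_nonneg T i
      rw [letterCount_cons]
      simp only [bump, Pi.zero_apply]
      split_ifs <;> omega
    rw [wordForm, wordForm, ih (ht _ _ hu) (ht _ _ hv)]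
    simp only [letterForm, wedge, h0 _ _ hu, h0 _ _ hv, h1 _ _ hu, h1 _ _ hv, hu.2.1, hv.2.1,
      hu.1, hv.1]

theorem eSum_congr {T : List X.Letter} {u u' : QLabel X.Node} (h : ∀ o, eInd o u = eInd o u') :
    eSum T u = eSum T u' := by
  induction T with
  | nil => rfl
  | cons p T ih => rw [eSum, eSum, ih, h]

theorem labelForm_congr {T : List X.Letter} {u u' v v' : QLabel X.Node}
    (hu : u.node = u'.node ∧ ∀ o, eInd o u = eInd o u')
    (hv : v.node = v'.node ∧ ∀ o, eInd o v = eInd o v') :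
    labelForm T u v = labelForm T u' v' := by
  induction T with
  | nil => rfl
  | cons p T ih =>
    simp only [labelForm, ih, wedge, eSum_congr hu.2, eSum_congr hv.2, hu.2, hv.2, hu.1, hv.1]

theorem restForm_congr {T₁ T₂ : List X.Letter} {c c' : X.Node → ℤ} {S : QLabel X.Node → ℚ}
    {u u' v v' : QLabel X.Node} (hu : Corresponds 0 0 T₁ u u') (hv : Corresponds 0 0 T₁ v v')
    (hu₂ : Corresponds c c' T₂ u u') (hv₂ : Corresponds c c' T₂ v v') (hSu : S u = S u')
    (hSv : S v = S v') : restForm T₁ T₂ c S u v = restForm T₁ T₂ c' S u' v' := by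
  unfold restForm
  rw [wordForm_congr hu hv, wordForm_congr hu₂ hv₂, labelForm_congr ⟨hu.1, hu.2.1⟩ ⟨hv.1, hv.2.1⟩,
    labelForm_congr (T := T₂) ⟨hu.1, hu.2.1⟩ ⟨hv.1, hv.2.1⟩]
  simp only [wedge, eSum_congr hu.2.1, eSum_congr hv.2.1, hSu, hSv, hu.1, hv.1]

theorem ind_symm {V V' : Type} (σ : V ≃ V') (x : V) (u : V') :
    ind x (σ.symm u) = ind (σ x) u := by
  by_cases h : σ.symm u = x
  · rw [← h, ind_self, σ.apply_symm_apply, ind_self]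
  · rw [ind_ne h, ind_ne fun h' => h (by rw [h', σ.symm_apply_apply])]

/-- The labels `a`, `b` are distinct, as far as they exist, and the corresponding simple roots have
the inner product of `α_i` and `α_j`. This is what is needed about the labels at the ends of a braid
block. -/
structure LabelPair (i j : X.Node) (a b : Option X.Node) : Prop where
  gram : ∀ u v, X.gram u.node v.node * (eInd a u * eInd b v) = X.gram i j * (eInd a u * eInd b v)
  disjoint : ∀ v, eInd a v * eInd b v = 0

theorem eInd_nonneg (o : Option X.Node) (v : QLabel X.Node) : 0 ≤ eInd o v := by
  rcases v with ⟨i, k⟩ | a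
  · exact le_rfl
  · simp only [eInd]; split_ifs <;> norm_num

theorem eInd_f (o : Option X.Node) (i : X.Node) (k : ℤ) : eInd o (.f i k) = 0 := rfl

theorem eInd_none (v : QLabel X.Node) : eInd none v = 0 := by
  rcases v with ⟨i, k⟩ | a <;> simp [eInd]

theorem ind_f_mul_eInd (o : Option X.Node) (i : X.Node) (k : ℤ) (v : QLabel X.Node) :
    ind (.f i k) v * eInd o v = 0 := by
  rcases v with ⟨i, k⟩ | a
  · simp [eInd]
  · simp [ind]

theorem sideVec_f_left (i j : X.Node) (c : X.Node → ℤ) (t : ℤ) :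
    sideVec i j c (.f i t) = 0 := by simp [sideVec]

theorem sideVec_f_right (i j : X.Node) (c : X.Node → ℤ) (t : ℤ) :
    sideVec i j c (.f j t) = 0 := by simp [sideVec]

theorem ind_f_of_ne {i : X.Node} {s t : ℤ} (h : t ≠ s) :
    ind (QLabel.f i s) (.f i t) = 0 := ind_ne (by simpa using h)

theorem ind_f_of_node_ne {i j : X.Node} (s t : ℤ) (h : i ≠ j) :
    ind (QLabel.f i s) (.f j t) = 0 := ind_ne (by simpa using fun h' => (h h'.symm).elim)

/-- The quiver before a move `i j i → j i j`, near the vertex that is mutated. -/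
theorem triForm_iji {T₁ T₂ : List X.Letter} {i j : X.Node} (hij : i ≠ j)
    (h1 : X.cartan i j = -1) (h2 : X.cartan j i = -1) {a b : Option X.Node}
    (hab : LabelPair i j a b) (u v : QLabel X.Node) :
    triForm (T₁ ++ [(i, a), (j, none), (i, b)] ++ T₂) u v =
      wedge (ind (.f i (letterCount T₁ i + 1))) (fun x =>
        X.mult i * (ind (.f i (letterCount T₁ i + 1 + 1)) x + ind (.f j (letterCount T₁ j)) x +
          eInd a x) -
        X.mult i * (ind (.f i (letterCount T₁ i)) x + ind (.f j (letterCount T₁ j + 1)) x +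
          eInd b x)) u v +
      (restForm T₁ T₂ (bump (bump (bump (letterCount T₁) i) j) i) (fun x => eInd a x + eInd b x) u v
        - X.mult i / 2 * wedge (ind (.f i (letterCount T₁ i))) (ind (.f j (letterCount T₁ j))) u v
        + X.mult i * wedge (eInd a) (ind (.f i (letterCount T₁ i))) u v
        + X.mult i * wedge (ind (.f j (letterCount T₁ j))) (ind (.f j (letterCount T₁ j + 1))) u v
        + X.mult i / 2 * wedge (ind (.f i (letterCount T₁ i + 1 + 1)))
            (ind (.f j (letterCount T₁ j + 1))) u v
        - X.mult i * wedge (eInd b) (ind (.f i (letterCount T₁ i + 1 + 1))) u v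
        + wedge (fun x => ind (.f i (letterCount T₁ i + 1 + 1)) x - ind (.f i (letterCount T₁ i)) x)
            (sideVec i j (letterCount T₁)) u v
        + wedge (fun x => ind (.f j (letterCount T₁ j + 1)) x - ind (.f j (letterCount T₁ j)) x)
            (sideVec j i (letterCount T₁)) u v
        + X.mult i / 2 * wedge (eInd a) (eInd b) u v) := by
  have hji := hij.symm
  have hm : X.mult j = X.mult i := by
    have := X.mult_mul_cartan i j
    rw [h1, h2] at this
    push_cast at this
    linarith
  have hg : X.gram i j = X.mult i := by rw [gram, h1]; push_cast; ring
  have hg' : X.gram j i = X.mult i := by rw [gram_comm, hg]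
  have hc : letterCount T₁ + letterCount [(i, a), (j, none), (i, b)] =
      bump (bump (bump (letterCount T₁) i) j) i := by
    rw [← bump_add_letterCount, ← bump_add_letterCount, ← bump_add_letterCount]
    funext x; simp [letterCount]
  have hS : eSum [(i, a), (j, none), (i, b)] = fun x => eInd a x + eInd b x := by
    funext x; simp [eSum, eInd_none]
  rw [triForm_block, hc, hS]
  generalize letterCount T₁ = c
  have s2 : sideVec j i (bump c i) = sideVec j i c :=
    sideVec_congr fun x hx hy => by simp [bump, hy]
  have s3 : sideVec i j (bump (bump c i) j) = sideVec i j c :=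
    sideVec_congr fun x hx hy => by simp [bump, hx, hy]
  have l1 := letterForm_eq (c := c) hij a (s := c i) (t := c j) rfl rfl u v
  have l2 := letterForm_eq (c := bump c i) hji none (s := c j) (t := c i + 1)
    (by simp [bump, hji]) (by simp [bump]) u v
  have l3 := letterForm_eq (c := bump (bump c i) j) hij b (s := c i + 1) (t := c j + 1)
    (by simp [bump, hij]) (by simp [bump, hji]) u v
  have e1 := hab.gram u v
  have e2 := hab.gram v u
  rw [gram_comm] at e2
  simp only [wordForm, l1, l2, l3, s2, s3, labelForm, eSum, hm, hg, hg', wedge, eInd_none] at *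
  linear_combination (1 / 2) * e1 - (1 / 2) * e2

/-- Before the block the renaming of a braid move changes nothing. -/
theorem corresponds_braidRename_left {T : List X.Letter} {i j : X.Node} (hij : i ≠ j) {k m : ℤ}
    (hk : k = letterCount T i + 1) (hm : m = letterCount T j + 1) {u : QLabel X.Node}
    (hu : u ≠ .f j m) :
    Corresponds 0 0 T ((QLabel.braidRename i j hij k m).symm u) u := by
  rcases u with ⟨a, t⟩ | a
  · by_cases hi : a = i
    · subst hi
      by_cases h : k ≤ t
      · refine ⟨?_, ?_, fun s hs => ?_⟩
        · simp [QLabel.braidRename, h, QLabel.node]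
        · intro o; simp [QLabel.braidRename, h, eInd]
        · have := hs a
          have h1 : s a ≠ t := by omega
          have h2 : s a ≠ t + 1 := by omega
          simp [QLabel.braidRename, h, state, h1, h2]
      · refine ⟨?_, ?_, fun s hs => ?_⟩ <;> simp [QLabel.braidRename, h]
    by_cases hj : a = j
    · subst hj
      have hne : t ≠ m := fun h => hu (by rw [h])
      by_cases h : m < t
      · refine ⟨?_, ?_, fun s hs => ?_⟩
        · simp [QLabel.braidRename, h, hi, hne, QLabel.node]
        · intro o; simp [QLabel.braidRename, h, hi, hne, eInd]
        · have := hs a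
          have h1 : s a ≠ t := by omega
          have h2 : s a ≠ t - 1 := by omega
          simp [QLabel.braidRename, h, hi, hne, state, h1, h2]
      · refine ⟨?_, ?_, fun s hs => ?_⟩ <;> simp [QLabel.braidRename, h, hi, hne]
    · refine ⟨?_, ?_, fun s hs => ?_⟩ <;> simp [QLabel.braidRename, hi, hj]
  · refine ⟨?_, ?_, fun s hs => ?_⟩ <;> simp [QLabel.braidRename]

/-- After the block the renaming of a braid move accounts for the changed number of letters. -/
theorem corresponds_braidRename_right {T : List X.Letter} {i j : X.Node} (hij : i ≠ j) {k m : ℤ}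
    {c : X.Node → ℤ} (hk : k = c i + 1) (hm : m = c j + 1) {u : QLabel X.Node}
    (hu : u ≠ .f j m) :
    Corresponds (bump (bump (bump c i) j) i) (bump (bump (bump c j) i) j) T
      ((QLabel.braidRename i j hij k m).symm u) u := by
  have hji := hij.symm
  rcases u with ⟨a, t⟩ | a
  · by_cases hi : a = i
    · subst hi
      by_cases h : k ≤ t
      · refine ⟨?_, ?_, fun s hs => ?_⟩
        · simp [QLabel.braidRename, h, QLabel.node]
        · intro o; simp [QLabel.braidRename, h, eInd]
        · have h1 : c a + 1 + 1 + s a = t + 1 ↔ c a + 1 + s a = t := by omega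
          simp [QLabel.braidRename, h, state, bump, hij, h1]
      · refine ⟨?_, ?_, fun s hs => ?_⟩
        · simp [QLabel.braidRename, h, QLabel.node]
        · intro o; simp [QLabel.braidRename, h, eInd]
        · have := hs a
          have h1 : c a + 1 + 1 + s a ≠ t := by omega
          have h2 : c a + 1 + s a ≠ t := by omega
          simp [QLabel.braidRename, h, state, bump, hij, h1, h2]
    by_cases hj : a = j
    · subst hj
      have hne : t ≠ m := fun h => hu (by rw [h])
      by_cases h : m < t
      · refine ⟨?_, ?_, fun s hs => ?_⟩
        · simp [QLabel.braidRename, h, hi, hne, QLabel.node]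
        · intro o; simp [QLabel.braidRename, h, hi, hne, eInd]
        · have h1 : c a + 1 + s a = t - 1 ↔ c a + 1 + 1 + s a = t := by omega
          simp [QLabel.braidRename, h, hi, hne, state, bump, h1]
      · refine ⟨?_, ?_, fun s hs => ?_⟩
        · simp [QLabel.braidRename, h, hi, hne, QLabel.node]
        · intro o; simp [QLabel.braidRename, h, hi, hne, eInd]
        · have := hs a
          have h1 : c a + 1 + 1 + s a ≠ t := by omega
          have h2 : c a + 1 + s a ≠ t := by omega
          simp [QLabel.braidRename, h, hi, hne, state, bump, h1, h2]
    · refine ⟨?_, ?_, fun s hs => ?_⟩ <;>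
        simp [QLabel.braidRename, hi, hj, state, bump]
  · refine ⟨?_, ?_, fun s hs => ?_⟩ <;> simp [QLabel.braidRename, state]

/-- The move `i j i → j i j` on the level of weights. -/
theorem mutForm_triForm_iji {T₁ T₂ : List X.Letter} {i j : X.Node} (hij : i ≠ j)
    (h1 : X.cartan i j = -1) (h2 : X.cartan j i = -1) {a b : Option X.Node}
    (hab : LabelPair i j a b) {k m : ℤ} (hk : k = letterCount T₁ i + 1)
    (hm : m = letterCount T₁ j + 1) (u v : QLabel X.Node) :
    mutForm (X.mult i) (.f i k) (triForm (T₁ ++ [(i, a), (j, none), (i, b)] ++ T₂))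
        ((QLabel.braidRename i j hij k m).symm u) ((QLabel.braidRename i j hij k m).symm v) =
      triForm (T₁ ++ [(j, b), (i, none), (j, a)] ++ T₂) u v := by
  have hd := X.mult_pos i
  have hji := hij.symm
  have hmm : X.mult j = X.mult i := by
    have := X.mult_mul_cartan i j
    rw [h1, h2] at this
    push_cast at this
    linarith
  have hg : X.gram i j = X.mult i := by rw [gram, h1]; push_cast; ring
  have hg' : X.gram j i = X.mult i := by rw [gram_comm, hg]
  subst hk
  rw [mutForm_eq hd _ _ _ (triForm_iji hij h1 h2 hab)]
  rotate_left
  · intro v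
    have := ind_nonneg (.f i (letterCount T₁ i + 1 + 1)) v
    have := ind_nonneg (.f j (letterCount T₁ j)) v
    have := eInd_nonneg a v
    positivity
  · intro v
    have := ind_nonneg (.f i (letterCount T₁ i)) v
    have := ind_nonneg (.f j (letterCount T₁ j + 1)) v
    have := eInd_nonneg b v
    positivity
  · intro v
    have i1 := ind_mul_ind (k := QLabel.f i (letterCount T₁ i + 1 + 1))
      (l := .f i (letterCount T₁ i)) (by simp; omega) v
    have i2 := ind_mul_ind (k := QLabel.f i (letterCount T₁ i + 1 + 1))
      (l := .f j (letterCount T₁ j + 1)) (by simp [hij]) v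
    have i3 := ind_mul_ind (k := QLabel.f j (letterCount T₁ j))
      (l := .f i (letterCount T₁ i)) (by simp [hji]) v
    have i4 := ind_mul_ind (k := QLabel.f j (letterCount T₁ j))
      (l := .f j (letterCount T₁ j + 1)) (by simp) v
    have i5 := ind_f_mul_eInd b i (letterCount T₁ i + 1 + 1) v
    have i6 := ind_f_mul_eInd b j (letterCount T₁ j) v
    have i7 := ind_f_mul_eInd a i (letterCount T₁ i) v
    have i8 := ind_f_mul_eInd a j (letterCount T₁ j + 1) v
    linear_combination (X.mult i) ^ 2 * (i1 + i2 + i3 + i4 + i5 + i6 + i7 + i8 + hab.disjoint v)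
  · simp [ind, eInd, hij]
  · simp [ind, eInd, hij]
  · intro v
    rw [restForm_eq_zero _ _ (fun _ _ => by simp [eInd]) (by simp) (by simp [bump, hij])]
    simp [wedge, ind, eInd, sideVec, hij]
  · intro v
    rw [restForm_skew,
      restForm_eq_zero _ _ (fun _ _ => by simp [eInd]) (by simp) (by simp [bump, hij])]
    simp [wedge, ind, eInd, sideVec, hij]
  have hc : letterCount T₁ + letterCount [(j, b), (i, none), (j, a)] =
      bump (bump (bump (letterCount T₁) j) i) j := by
    rw [← bump_add_letterCount, ← bump_add_letterCount, ← bump_add_letterCount]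
    funext x; simp [letterCount]
  have hS : eSum [(j, b), (i, none), (j, a)] = fun x => eInd a x + eInd b x := by
    funext x; simp [eSum, eInd_none, add_comm]
  have hrest : restForm T₁ T₂ (bump (bump (bump (letterCount T₁) i) j) i)
        (fun x => eInd a x + eInd b x)
        ((QLabel.braidRename i j hij (letterCount T₁ i + 1) m).symm u)
        ((QLabel.braidRename i j hij (letterCount T₁ i + 1) m).symm v) =
      restForm T₁ T₂ (bump (bump (bump (letterCount T₁) j) i) j)
        (fun x => eInd a x + eInd b x) u v := by
    have hK : (QLabel.braidRename i j hij (letterCount T₁ i + 1) m).symm (.f j m) =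
        .f i (letterCount T₁ i + 1) := by simp [QLabel.braidRename, hji]
    by_cases hu : u = .f j m
    · rw [hu, hK, restForm_eq_zero, restForm_eq_zero] <;>
        first | (intro _ _; simp [eInd]) | (simp [bump, hij, hji, hm])
    by_cases hv : v = .f j m
    · rw [hv, hK, restForm_skew, restForm_eq_zero, restForm_skew _ _ _ _ u, restForm_eq_zero] <;>
        first | (intro _ _; simp [eInd]) | (simp [bump, hij, hji, hm])
    have c1 := corresponds_braidRename_left (T := T₁) hij rfl hm hu
    have c2 := corresponds_braidRename_left (T := T₁) hij rfl hm hv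
    have c3 := corresponds_braidRename_right (T := T₂) (c := letterCount T₁) hij rfl hm hu
    have c4 := corresponds_braidRename_right (T := T₂) (c := letterCount T₁) hij rfl hm hv
    exact restForm_congr c1 c2 c3 c4 (by simp only [c1.2.1]) (by simp only [c2.2.1])
  rw [triForm_block, hc, hS, hrest]
  generalize letterCount T₁ = c at *
  subst hm
  set σ := QLabel.braidRename i j hij (c i + 1) (c j + 1) with hσ
  have a1 : σ (.f i (c i)) = .f i (c i) := by simp [hσ, QLabel.braidRename]
  have a2 : σ (.f i (c i + 1)) = .f j (c j + 1) := by simp [hσ, QLabel.braidRename]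
  have a3 : σ (.f i (c i + 1 + 1)) = .f i (c i + 1) := by simp [hσ, QLabel.braidRename]
  have a4 : σ (.f j (c j)) = .f j (c j) := by simp [hσ, QLabel.braidRename, hji]
  have a5 : σ (.f j (c j + 1)) = .f j (c j + 1 + 1) := by simp [hσ, QLabel.braidRename, hji]
  have e0 : ∀ o x, eInd o (σ.symm x) = eInd o x := by
    rintro o (⟨x, t⟩ | x)
    · simp only [hσ, QLabel.braidRename, Equiv.coe_fn_symm_mk]
      split_ifs <;> simp [eInd]
    · simp [hσ, QLabel.braidRename]
  have n0 : ∀ x, sideVec i j c (σ.symm x) = sideVec i j c x := by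
    rintro (⟨x, t⟩ | x)
    · simp only [hσ, QLabel.braidRename, Equiv.coe_fn_symm_mk]
      split_ifs with h1 h2 h3 <;> simp_all [sideVec]
    · simp [hσ, QLabel.braidRename]
  have n1 : ∀ x, sideVec j i c (σ.symm x) = sideVec j i c x := by
    rintro (⟨x, t⟩ | x)
    · simp only [hσ, QLabel.braidRename, Equiv.coe_fn_symm_mk]
      split_ifs with h1 h2 h3 <;> simp_all [sideVec]
    · simp [hσ, QLabel.braidRename]
  have s2 : sideVec i j (bump c j) = sideVec i j c :=
    sideVec_congr fun x hx hy => by simp [bump, hy]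
  have s3 : sideVec j i (bump (bump c j) i) = sideVec j i c :=
    sideVec_congr fun x hx hy => by simp [bump, hx, hy]
  have l1 := letterForm_eq (c := c) hji b (s := c j) (t := c i) rfl rfl u v
  have l2 := letterForm_eq (c := bump c j) hij none (s := c i) (t := c j + 1)
    (by simp [bump, hij]) (by simp [bump]) u v
  have l3 := letterForm_eq (c := bump (bump c j) i) hji a (s := c j + 1) (t := c i + 1)
    (by simp [bump, hji]) (by simp [bump, hij]) u v
  have e1 := hab.gram u v
  have e2 := hab.gram v u
  rw [gram_comm] at e2
  simp only [wordForm, l1, l2, l3, s2, s3, labelForm, eSum, hmm, hg, hg', wedge, eInd_none,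
    ind_symm,
    a1, a2, a3, a4, a5, e0, n0, n1] at *
  field_simp
  linear_combination e1 - e2

/-- The move `i j i j → j i j i` with `i` long and `j` short, on the level of weights. -/
theorem mutForm_triForm_ijij {T₁ T₂ : List X.Letter} {i j : X.Node} (hij : i ≠ j)
    (h1 : X.cartan i j = -1) (h2 : X.cartan j i = -2) {a b : Option X.Node}
    (hab : LabelPair i j a b) {k m : ℤ} (hk : k = letterCount T₁ i + 1)
    (hm : m = letterCount T₁ j + 1) :
    mutForm (X.mult j) (.f j m) (mutForm (X.mult i) (.f i k) (mutForm (X.mult j) (.f j m)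
      (triForm (T₁ ++ [(i, a), (j, none), (i, none), (j, b)] ++ T₂)))) =
      triForm (T₁ ++ [(j, b), (i, none), (j, none), (i, a)] ++ T₂) := by
  have hji := hij.symm
  subst hk hm
  obtain ⟨d, hd⟩ : ∃ d, d = X.mult j := ⟨_, rfl⟩
  have hdpos : 0 < d := hd ▸ X.mult_pos j
  have hmi : X.mult i = 2 * d := by
    have := X.mult_mul_cartan i j
    rw [h1, h2, ← hd] at this
    push_cast at this
    linarith
  have hg : X.gram i j = 2 * d := by rw [gram, h1, hmi]; push_cast; ring
  have hg' : X.gram j i = 2 * d := by rw [gram_comm, hg]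
  have hc : letterCount T₁ + letterCount [(i, a), (j, none), (i, none), (j, b)] =
      bump (bump (bump (bump (letterCount T₁) i) j) i) j := by
    rw [← bump_add_letterCount, ← bump_add_letterCount, ← bump_add_letterCount,
      ← bump_add_letterCount]
    funext x; simp [letterCount]
  have hc' : letterCount T₁ + letterCount [(j, b), (i, none), (j, none), (i, a)] =
      bump (bump (bump (bump (letterCount T₁) i) j) i) j := by
    rw [← hc]
    funext x
    simp only [Pi.add_apply, letterCount_cons]
    split_ifs <;> ring
  have hS : eSum [(i, a), (j, none), (i, none), (j, b)] = fun x => eInd a x + eInd b x := by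
    funext x; simp [eSum, eInd_none]
  have hS' : eSum [(j, b), (i, none), (j, none), (i, a)] = fun x => eInd a x + eInd b x := by
    funext x; simp [eSum, eInd_none, add_comm]
  set c := letterCount T₁ with hcdef
  set A : QLabel X.Node → ℚ := ind (.f i (c i)) with hA
  set K : QLabel X.Node → ℚ := ind (.f i (c i + 1)) with hK
  set B : QLabel X.Node → ℚ := ind (.f i (c i + 1 + 1)) with hB
  set C : QLabel X.Node → ℚ := ind (.f j (c j)) with hC
  set M : QLabel X.Node → ℚ := ind (.f j (c j + 1)) with hM
  set E : QLabel X.Node → ℚ := ind (.f j (c j + 1 + 1)) with hE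
  set R₀ := restForm T₁ T₂ (bump (bump (bump (bump c i) j) i) j)
    (fun x => eInd a x + eInd b x) with hR₀
  have r1 : ∀ v, R₀ (.f i (c i + 1)) v = 0 := fun v =>
    restForm_eq_zero _ _ (fun _ _ => by simp [eInd]) (by simp [hcdef])
      (by simp [bump, hij]) v
  have r2 : ∀ v, R₀ (.f j (c j + 1)) v = 0 := fun v =>
    restForm_eq_zero _ _ (fun _ _ => by simp [eInd]) (by simp [hcdef])
      (by simp [bump, hji]) v
  have r1' : ∀ v, R₀ v (.f i (c i + 1)) = 0 := fun v => by
    rw [hR₀, restForm_skew, ← hR₀, r1, neg_zero]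
  have r2' : ∀ v, R₀ v (.f j (c j + 1)) = 0 := fun v => by
    rw [hR₀, restForm_skew, ← hR₀, r2, neg_zero]
  have s2 : sideVec j i (bump c i) = sideVec j i c :=
    sideVec_congr fun x hx hy => by simp [bump, hy]
  have s3 : sideVec i j (bump (bump c i) j) = sideVec i j c :=
    sideVec_congr fun x hx hy => by simp [bump, hx, hy]
  have s4 : sideVec j i (bump (bump (bump c i) j) i) = sideVec j i c :=
    sideVec_congr fun x hx hy => by simp [bump, hx, hy]
  have t2 : sideVec i j (bump c j) = sideVec i j c :=
    sideVec_congr fun x hx hy => by simp [bump, hy]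
  have t3 : sideVec j i (bump (bump c j) i) = sideVec j i c :=
    sideVec_congr fun x hx hy => by simp [bump, hx, hy]
  have t4 : sideVec i j (bump (bump (bump c j) i) j) = sideVec i j c :=
    sideVec_congr fun x hx hy => by simp [bump, hx, hy]
  set U := sideVec i j c with hU
  set V := sideVec j i c with hV
  have pA := ind_nonneg (QLabel.f i (c i))
  have pK := ind_nonneg (QLabel.f i (c i + 1))
  have pB := ind_nonneg (QLabel.f i (c i + 1 + 1))
  have pC := ind_nonneg (QLabel.f j (c j))
  have pM := ind_nonneg (QLabel.f j (c j + 1))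
  have pE := ind_nonneg (QLabel.f j (c j + 1 + 1))
  rw [← hA] at pA
  rw [← hK] at pK
  rw [← hB] at pB
  rw [← hC] at pC
  rw [← hM] at pM
  rw [← hE] at pE
  have pa := eInd_nonneg a
  have pb := eInd_nonneg b
  -- values at the two vertices that are mutated
  have kA : A (.f i (c i + 1)) = 0 := ind_f_of_ne (by omega)
  have kB : B (.f i (c i + 1)) = 0 := ind_f_of_ne (by omega)
  have kC : C (.f i (c i + 1)) = 0 := ind_f_of_node_ne _ _ hji
  have kM : M (.f i (c i + 1)) = 0 := ind_f_of_node_ne _ _ hji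
  have kE : E (.f i (c i + 1)) = 0 := ind_f_of_node_ne _ _ hji
  have mA : A (.f j (c j + 1)) = 0 := ind_f_of_node_ne _ _ hij
  have mK : K (.f j (c j + 1)) = 0 := ind_f_of_node_ne _ _ hij
  have mB : B (.f j (c j + 1)) = 0 := ind_f_of_node_ne _ _ hij
  have mC : C (.f j (c j + 1)) = 0 := ind_f_of_ne (by omega)
  have mE : E (.f j (c j + 1)) = 0 := ind_f_of_ne (by omega)
  have kU : U (.f i (c i + 1)) = 0 := sideVec_f_left _ _ _ _
  have kV : V (.f i (c i + 1)) = 0 := sideVec_f_right _ _ _ _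
  have mU : U (.f j (c j + 1)) = 0 := sideVec_f_right _ _ _ _
  have mV : V (.f j (c j + 1)) = 0 := sideVec_f_left _ _ _ _
  -- disjointness of the neighbours
  have KA : ∀ v, K v * A v = 0 := ind_mul_ind (by simp)
  have KB : ∀ v, K v * B v = 0 := ind_mul_ind (by simp)
  have KC : ∀ v, K v * C v = 0 := ind_mul_ind (by simp [hij])
  have KE : ∀ v, K v * E v = 0 := ind_mul_ind (by simp [hij])
  have MA : ∀ v, M v * A v = 0 := ind_mul_ind (by simp [hji])
  have MB : ∀ v, M v * B v = 0 := ind_mul_ind (by simp [hji])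
  have CA : ∀ v, C v * A v = 0 := ind_mul_ind (by simp [hji])
  have CB : ∀ v, C v * B v = 0 := ind_mul_ind (by simp [hji])
  have EA : ∀ v, E v * A v = 0 := ind_mul_ind (by simp [hji])
  have EB : ∀ v, E v * B v = 0 := ind_mul_ind (by simp [hji])
  have EC : ∀ v, E v * C v = 0 := ind_mul_ind (by simp; omega)
  have Ka : ∀ v, K v * eInd a v = 0 := ind_f_mul_eInd _ _ _
  have Kb : ∀ v, K v * eInd b v = 0 := ind_f_mul_eInd _ _ _
  have Mb : ∀ v, M v * eInd b v = 0 := ind_f_mul_eInd _ _ _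
  have Eb : ∀ v, E v * eInd b v = 0 := ind_f_mul_eInd _ _ _
  have Ca : ∀ v, C v * eInd a v = 0 := ind_f_mul_eInd _ _ _
  have Cb : ∀ v, C v * eInd b v = 0 := ind_f_mul_eInd _ _ _
  have Aa : ∀ v, A v * eInd a v = 0 := ind_f_mul_eInd _ _ _
  have Ba : ∀ v, B v * eInd a v = 0 := ind_f_mul_eInd _ _ _
  have ab := hab.disjoint
  have hstart : ∀ u v, triForm (T₁ ++ [(i, a), (j, none), (i, none), (j, b)] ++ T₂) u v =
      wedge M (fun x => (2 * d * K x + d * E x) - (d * C x + 2 * d * B x + d * eInd b x)) u v +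
      (R₀ u v + wedge (fun x => K x - A x) (fun x => -(2 * d) * A x + d * C x + U x) u v +
        2 * d * wedge (eInd a) (fun x => A x - K x) u v +
        wedge C (fun x => - d * K x - V x) u v +
        wedge (fun x => B x - K x) (fun x => -(2 * d) * K x + U x) u v +
        wedge E (fun x => d * B x + V x) u v - d * wedge (eInd b) E u v +
        d * wedge (eInd a) (eInd b) u v) := by
    intro u v
    rw [triForm_block, ← hcdef, hc, hS]
    have l1 := letterForm_eq (c := c) hij a (s := c i) (t := c j) rfl rfl u v
    have l2 := letterForm_eq (c := bump c i) hji none (s := c j) (t := c i + 1)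
      (by simp [bump, hji]) (by simp [bump]) u v
    have l3 := letterForm_eq (c := bump (bump c i) j) hij none (s := c i + 1) (t := c j + 1)
      (by simp [bump, hij]) (by simp [bump, hji]) u v
    have l4 := letterForm_eq (c := bump (bump (bump c i) j) i) hji b (s := c j + 1)
      (t := c i + 1 + 1) (by simp [bump, hji]) (by simp [bump, hij]) u v
    rw [s2] at l2
    rw [s3] at l3
    rw [s4] at l4
    rw [← hA, ← hK, ← hC, ← hU] at l1
    rw [← hC, ← hM, ← hK] at l2
    rw [← hK, ← hB, ← hM] at l3
    rw [← hM, ← hE, ← hB] at l4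
    have e1 := hab.gram u v
    have e2 := hab.gram v u
    rw [gram_comm] at e2
    simp only [wordForm, l1, l2, l3, l4, labelForm, eSum, hmi, ← hd, hg, hg', wedge, eInd_none,
      ← hR₀] at e1 e2 ⊢
    linear_combination (1 / 2) * e1 - (1 / 2) * e2
  have step1 : mutForm d (.f j (c j + 1))
      (triForm (T₁ ++ [(i, a), (j, none), (i, none), (j, b)] ++ T₂)) = fun u v =>
      wedge K (fun x => (2 * d * M x + 2 * d * eInd a x) -
        (2 * d * A x + 2 * d * B x + 2 * d * eInd b x)) u v +
      (R₀ u v - wedge M (fun x => d * E x - (d * C x + 2 * d * B x + d * eInd b x)) u v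
        - wedge A (fun x => d * C x + U x) u v + 2 * d * wedge (eInd a) A u v
        - wedge C V u v + wedge B U u v + wedge E (fun x => d * B x + V x) u v
        - d * wedge (eInd b) E u v + d * wedge (eInd a) (eInd b) u v
        + wedge (fun x => C x + 2 * B x + eInd b x) (fun x => d * E x) u v) := by
    funext u v
    rw [mutForm_eq hdpos _ _ _ hstart]
    · simp only [wedge]
      field_simp
      ring
    · intro v; have := pK v; have := pE v; positivity
    · intro v; have := pC v; have := pB v; have := pb v; positivity
    · intro v
      linear_combination 2 * d ^ 2 * KC v + 4 * d ^ 2 * KB v + 2 * d ^ 2 * Kb v + d ^ 2 * EC v +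
        2 * d ^ 2 * EB v + d ^ 2 * Eb v
    · rw [mK, mE]; ring
    · rw [mC, mB, eInd_f]; ring
    · intro v
      simp only [wedge, r2, mA, mK, mB, mC, mE, mU, mV, eInd_f]
      ring
    · intro v
      simp only [wedge, r2', mA, mK, mB, mC, mE, mU, mV, eInd_f]
      ring
  have step2 : mutForm (2 * d) (.f i (c i + 1)) (fun u v =>
      wedge K (fun x => (2 * d * M x + 2 * d * eInd a x) -
        (2 * d * A x + 2 * d * B x + 2 * d * eInd b x)) u v +
      (R₀ u v - wedge M (fun x => d * E x - (d * C x + 2 * d * B x + d * eInd b x)) u v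
        - wedge A (fun x => d * C x + U x) u v + 2 * d * wedge (eInd a) A u v
        - wedge C V u v + wedge B U u v + wedge E (fun x => d * B x + V x) u v
        - d * wedge (eInd b) E u v + d * wedge (eInd a) (eInd b) u v
        + wedge (fun x => C x + 2 * B x + eInd b x) (fun x => d * E x) u v)) = fun u v =>
      wedge M (fun x => (2 * d * K x + d * C x) - (d * E x + 2 * d * A x + d * eInd b x)) u v +
      (R₀ u v - wedge K (fun x => 2 * d * eInd a x -
        (2 * d * A x + 2 * d * B x + 2 * d * eInd b x)) u v
        - wedge A (fun x => d * C x + U x) u v + 2 * d * wedge (eInd a) A u v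
        - wedge C V u v + wedge B U u v + wedge E (fun x => d * B x + V x) u v
        - d * wedge (eInd b) E u v + d * wedge (eInd a) (eInd b) u v
        + wedge (fun x => C x + 2 * B x + eInd b x) (fun x => d * E x) u v
        + 2 * d * wedge (fun x => A x + B x + eInd b x) (eInd a) u v) := by
    funext u v
    rw [mutForm_eq (by positivity) _ _ _ (fun u v => rfl)]
    · simp only [wedge]
      field_simp
      ring
    · intro v; have := pM v; have := pa v; positivity
    · intro v; have := pA v; have := pB v; have := pb v; positivity
    · intro v
      linear_combination 4 * d ^ 2 * (MA v + MB v + Mb v + Aa v + Ba v + ab v)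
    · rw [kM, eInd_f]; ring
    · rw [kA, kB, eInd_f]; ring
    · intro v
      simp only [wedge, r1, kA, kM, kB, kC, kE, kU, kV, eInd_f]
      ring
    · intro v
      simp only [wedge, r1', kA, kM, kB, kC, kE, kU, kV, eInd_f]
      ring
  rw [← hd, hmi, step1, step2]
  funext u v
  rw [mutForm_eq hdpos _ _ _ (fun u v => rfl)]
  · rw [triForm_block, ← hcdef, hc', hS']
    have l1 := letterForm_eq (c := c) hji b (s := c j) (t := c i) rfl rfl u v
    have l2 := letterForm_eq (c := bump c j) hij none (s := c i) (t := c j + 1)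
      (by simp [bump, hij]) (by simp [bump]) u v
    have l3 := letterForm_eq (c := bump (bump c j) i) hji none (s := c j + 1) (t := c i + 1)
      (by simp [bump, hji]) (by simp [bump, hij]) u v
    have l4 := letterForm_eq (c := bump (bump (bump c j) i) j) hij a (s := c i + 1)
      (t := c j + 1 + 1) (by simp [bump, hij]) (by simp [bump, hji]) u v
    rw [t2] at l2
    rw [t3] at l3
    rw [t4] at l4
    rw [← hA, ← hC, ← hM, ← hV] at l1
    rw [← hA, ← hM, ← hK] at l2
    rw [← hK, ← hE, ← hM] at l3
    rw [← hK, ← hE, ← hB] at l4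
    have e1 := hab.gram u v
    have e2 := hab.gram v u
    rw [gram_comm] at e2
    simp only [wordForm, l1, l2, l3, l4, labelForm, eSum, hmi, ← hd, hg, hg', wedge, eInd_none,
      ← hR₀] at e1 e2 ⊢
    field_simp
    linear_combination e1 - e2
  · intro v; have := pK v; have := pC v; positivity
  · intro v; have := pE v; have := pA v; have := pb v; positivity
  · intro v
    linear_combination d ^ 2 * (2 * KE v + 4 * KA v + 2 * Kb v + EC v + 2 * CA v + Cb v)
  · rw [mK, mC]; ring
  · rw [mE, mA, eInd_f]; ring
  · intro v
    simp only [wedge, r2, mA, mK, mB, mC, mE, mU, mV, eInd_f]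
    ring
  · intro v
    simp only [wedge, r2', mA, mK, mB, mC, mE, mU, mV, eInd_f]
    ring

/-! ### Labels of the letters of a word -/

open Classical in
/-- The node `a` if `g = s_a`, and `none` if `g` is not a simple reflection. -/
noncomputable def label (g : X.coxeterMatrix.Group) : Option X.Node :=
  if h : ∃ a, g = X.weyl.simple a then some h.choose else none

theorem label_eq_some {g : X.coxeterMatrix.Group} {a : X.Node} :
    label g = some a ↔ g = X.weyl.simple a := by
  unfold label
  split_ifs with h
  · rw [Option.some_inj]
    constructor
    · rintro rfl; exact h.choose_spec
    · intro h'
      exact X.simple_injective (h.choose_spec.symm.trans h')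
  · simp only [false_iff]
    exact fun h' => h ⟨a, h'⟩

theorem label_eq_none {g : X.coxeterMatrix.Group} :
    label g = none ↔ ∀ a, g ≠ X.weyl.simple a := by
  rw [Option.eq_none_iff_forall_ne_some]
  exact forall_congr' fun a => not_congr label_eq_some

/-- The letters of `l` with the labels of the reflections `(v g)⁻¹ s_i (v g)`, where `v` is the
product of the letters after the letter `i`. -/
noncomputable def decoAt (g : X.coxeterMatrix.Group) : List X.Node → List X.Letter
  | [] => []
  | i :: l => (i, label ((X.weyl.wordProd l * g)⁻¹ * X.weyl.simple i * (X.weyl.wordProd l * g))) ::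
      decoAt g l

/-- The letters of a word, labelled by the simple reflections in its right inversion sequence. -/
noncomputable def deco (l : List X.Node) : List X.Letter := decoAt 1 l

theorem decoAt_append (g : X.coxeterMatrix.Group) (l₁ l₂ : List X.Node) :
    decoAt g (l₁ ++ l₂) = decoAt (X.weyl.wordProd l₂ * g) l₁ ++ decoAt g l₂ := by
  induction l₁ with
  | nil => rfl
  | cons i l ih => simp [decoAt, ih, X.weyl.wordProd_append, mul_assoc]

theorem map_fst_decoAt (g : X.coxeterMatrix.Group) (l : List X.Node) :
    (decoAt g l).map Prod.fst = l := by
  induction l with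
  | nil => rfl
  | cons i l ih => simp [decoAt, ih]

theorem letterCount_decoAt (g : X.coxeterMatrix.Group) (l : List X.Node) (i : X.Node) :
    letterCount (decoAt g l) i = l.count i := by
  rw [letterCount, map_fst_decoAt]

theorem letterCount_deco (l : List X.Node) (i : X.Node) : letterCount (deco l) i = l.count i :=
  letterCount_decoAt 1 l i

theorem deco_block (l₁ b l₂ : List X.Node) :
    deco (l₁ ++ b ++ l₂) = decoAt (X.weyl.wordProd b * X.weyl.wordProd l₂) l₁ ++
      decoAt (X.weyl.wordProd l₂) b ++ deco l₂ := by
  simp [deco, decoAt_append, X.weyl.wordProd_append]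

/-- If `u ++ l` is reduced and `u` has at least two letters, then conjugation by `l` does not map
`u` to a simple reflection `s_a`: the element `u l = l s_a` would have length at most `ℓ(l) + 1`. -/
theorem label_conj_eq_none {u l : List X.Node} (hu : 2 ≤ u.length) (h : X.weyl.IsReduced (u ++ l)) :
    label ((X.weyl.wordProd l)⁻¹ * X.weyl.wordProd u * X.weyl.wordProd l) = none := by
  rw [label_eq_none]
  intro a ha
  have h1 : X.weyl.wordProd u * X.weyl.wordProd l = X.weyl.wordProd l * X.weyl.simple a := by
    rw [← ha]; group
  have h2 := X.weyl.length_mul_le (X.weyl.wordProd l) (X.weyl.simple a)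
  rw [← h1, ← X.weyl.wordProd_append, h.eq, X.weyl.length_simple, List.length_append] at h2
  have h3 := X.weyl.length_wordProd_le l
  omega

/-- The labels of the ends of a braid block are distinct, and the inner product of the corresponding
simple roots is that of `α_i` and `α_j`. -/
theorem labelPair_conj (g : X.coxeterMatrix.Group) {i j : X.Node} (hij : i ≠ j) :
    LabelPair i j (label (g⁻¹ * X.weyl.simple i * g)) (label (g⁻¹ * X.weyl.simple j * g)) := by
  have hne : ∀ a, label (g⁻¹ * X.weyl.simple i * g) = some a →
      label (g⁻¹ * X.weyl.simple j * g) ≠ some a := by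
    intro a h1 h2
    rw [label_eq_some] at h1 h2
    exact hij (X.simple_injective (mul_left_cancel (mul_right_cancel (h1.trans h2.symm))))
  constructor
  · rintro (⟨x, s⟩ | a) (⟨y, t⟩ | b)
    · simp [eInd]
    · simp [eInd]
    · simp [eInd]
    · by_cases h1 : label (g⁻¹ * X.weyl.simple i * g) = some a
      · by_cases h2 : label (g⁻¹ * X.weyl.simple j * g) = some b
        · have hab : a ≠ b := fun h => hne b (h ▸ h1) h2
          rw [label_eq_some] at h1 h2
          have h3 : g * X.weyl.simple a = X.weyl.simple i * g := by rw [← h1]; group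
          have h4 : g * X.weyl.simple b = X.weyl.simple j * g := by rw [← h2]; group
          simp only [QLabel.node]
          rw [gram_eq_of_conj hab hij h3 h4]
        · simp [eInd, h2]
      · simp [eInd, h1]
  · rintro (⟨x, s⟩ | a)
    · simp [eInd]
    · by_cases h1 : label (g⁻¹ * X.weyl.simple i * g) = some a
      · simp [eInd, hne a h1]
      · simp [eInd, h1]

theorem LabelPair.symm {i j : X.Node} {a b : Option X.Node} (h : LabelPair i j a b) :
    LabelPair i j b a :=
  ⟨fun u v => by rw [gram_comm, mul_comm (eInd b u), h.gram v u], fun v => by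
    rw [mul_comm, h.disjoint]⟩

/-! ### The explicit quiver of a word -/

/-- The vertices `f_i^0, ..., f_i^{n_i}, e_i^0`. -/
def triVerts (l : List X.Node) : Set (QLabel X.Node) :=
  {v | (∃ i, v = .e i) ∨ ∃ i k, 0 ≤ k ∧ k ≤ (l.count i : ℤ) ∧ v = .f i k}

/-- The vertices `f_i^0, f_i^{n_i}, e_i^0`. -/
def triFrozen (l : List X.Node) : Set (QLabel X.Node) :=
  {v | ∃ i, v = .e i ∨ v = .f i 0 ∨ v = .f i (l.count i)}

theorem f_mem_triVerts {l : List X.Node} {i : X.Node} {k : ℤ} :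
    .f i k ∈ triVerts l ↔ 0 ≤ k ∧ k ≤ (l.count i : ℤ) := by
  constructor
  · rintro (⟨a, h⟩ | ⟨a, t, h1, h2, h⟩)
    · cases h
    · cases h; exact ⟨h1, h2⟩
  · rintro ⟨h1, h2⟩
    exact Or.inr ⟨i, k, h1, h2, rfl⟩

theorem e_mem_triVerts {l : List X.Node} {i : X.Node} : .e i ∈ triVerts l := Or.inl ⟨i, rfl⟩

theorem f_mem_triFrozen {l : List X.Node} {i : X.Node} {k : ℤ} :
    .f i k ∈ triFrozen l ↔ k = 0 ∨ k = (l.count i : ℤ) := by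
  constructor
  · rintro ⟨a, h | h | h⟩ <;> cases h <;> simp
  · rintro (rfl | rfl)
    · exact ⟨i, Or.inr (Or.inl rfl)⟩
    · exact ⟨i, Or.inr (Or.inr rfl)⟩

theorem e_mem_triFrozen {l : List X.Node} {i : X.Node} : .e i ∈ triFrozen l := ⟨i, Or.inl rfl⟩

theorem triForm_skew (T : List X.Letter) (u v : QLabel X.Node) :
    triForm T u v = - triForm T v u := by
  rw [triForm, triForm, wordForm_skew, labelForm_skew]; ring

theorem mem_of_triForm_ne_zero {l : List X.Node} {u v : QLabel X.Node}
    (h : triForm (deco l) u v ≠ 0) : u ∈ triVerts l := by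
  rcases u with ⟨i, k⟩ | i
  · rw [f_mem_triVerts]
    by_contra hc
    refine h ?_
    rw [triForm, labelForm_f_left, wordForm_eq_zero _ _ _ _ ?_, add_zero]
    rw [letterCount_deco]
    simp only [Pi.zero_apply]
    omega
  · exact e_mem_triVerts

open Classical in
/-- The quiver of the labelled word `l`. -/
noncomputable def triQuiver (l : List X.Node) : WQuiver (QLabel X.Node) where
  verts := triVerts l
  frozen := triFrozen l
  d v := if v ∈ triVerts l then X.mult v.node else 0
  w := triForm (deco l)
  finite_verts := by
    refine Set.Finite.subset ((Set.finite_iUnion fun i : X.Node =>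
      (Set.finite_Icc (0 : ℤ) (l.count i)).image (QLabel.f i)).union
        (Set.finite_range QLabel.e)) ?_
    rintro (⟨i, k⟩ | i) h
    · exact Or.inl (Set.mem_iUnion.2 ⟨i, k, f_mem_triVerts.1 h, rfl⟩)
    · exact Or.inr ⟨i, rfl⟩
  frozen_subset := by
    rintro (⟨i, k⟩ | i) h
    · rw [f_mem_triFrozen] at h
      rw [f_mem_triVerts]
      omega
    · exact e_mem_triVerts
  d_pos v hv := by simp [hv, X.mult_pos]
  d_off v hv := by simp [hv]
  skew := triForm_skew _
  support u v h := ⟨mem_of_triForm_ne_zero h,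
    mem_of_triForm_ne_zero (u := v) (v := u) (by rw [triForm_skew]; simpa using h)⟩

theorem triQuiver_d_f {l : List X.Node} {i : X.Node} {k : ℤ} (h0 : 0 ≤ k)
    (h1 : k ≤ (l.count i : ℤ)) : (triQuiver l).d (.f i k) = X.mult i := by
  simp [triQuiver, f_mem_triVerts, h0, h1, QLabel.node]

/-- Words with the same letters have quivers with the same vertices. -/
theorem triQuiver_ext {l l' : List X.Node} (h : ∀ i, l.count i = l'.count i)
    {Q : WQuiver (QLabel X.Node)} (hv : Q.verts = (triQuiver l).verts)
    (hf : Q.frozen = (triQuiver l).frozen) (hd : Q.d = (triQuiver l).d)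
    (hw : Q.w = triForm (deco l')) : Q = triQuiver l' := by
  have hV : triVerts l = triVerts l' := by simp only [triVerts, h]
  have hF : triFrozen l = triFrozen l' := by simp only [triFrozen, h]
  refine WQuiver.ext (hv.trans hV) (hf.trans hF) (hd.trans ?_) hw
  funext v
  have hx : v ∈ triVerts l ↔ v ∈ triVerts l' := by rw [hV]
  by_cases h : v ∈ triVerts l
  · exact (if_pos h).trans (if_pos (hx.1 h)).symm
  · exact (if_neg h).trans (if_neg fun h' => h (hx.2 h')).symm

theorem wordProd_alternating (i j : X.Node) :
    X.weyl.wordProd (CoxeterSystem.alternatingWord i j (X.coxeterMatrix i j)) =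
      X.weyl.wordProd (CoxeterSystem.alternatingWord j i (X.coxeterMatrix i j)) := by
  have := X.weyl.wordProd_braidWord_eq i j
  unfold CoxeterSystem.braidWord at this
  rwa [X.coxeterMatrix.symmetric j i] at this

theorem ne_of_cartan {i j : X.Node} (h : X.cartan i j ≠ 2) : i ≠ j := by
  rintro rfl; exact h (X.cartan_self i)

theorem simple_comm {i j : X.Node} (h : X.cartan i j = 0) :
    X.weyl.simple i * X.weyl.simple j = X.weyl.simple j * X.weyl.simple i := by
  have := wordProd_alternating i j
  rw [coxeterMatrix_apply X (ne_of_cartan (by rw [h]; norm_num)), h] at this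
  simpa [braidOrder, CoxeterSystem.alternatingWord, X.weyl.wordProd_cons] using this

theorem simple_braid {i j : X.Node} (h₁ : X.cartan i j = -1) (h₂ : X.cartan j i = -1) :
    X.weyl.simple i * X.weyl.simple j * X.weyl.simple i =
      X.weyl.simple j * X.weyl.simple i * X.weyl.simple j := by
  have := wordProd_alternating i j
  rw [coxeterMatrix_apply X (ne_of_cartan (by rw [h₁]; norm_num)), h₁, h₂] at this
  simpa [braidOrder, CoxeterSystem.alternatingWord, X.weyl.wordProd_cons, mul_assoc] using this.symm

theorem simple_braid₄ {i j : X.Node} (h₁ : X.cartan i j = -1) (h₂ : X.cartan j i = -2) :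
    X.weyl.simple i * X.weyl.simple j * X.weyl.simple i * X.weyl.simple j =
      X.weyl.simple j * X.weyl.simple i * X.weyl.simple j * X.weyl.simple i := by
  have := wordProd_alternating i j
  rw [coxeterMatrix_apply X (ne_of_cartan (by rw [h₁]; norm_num)), h₁, h₂] at this
  simpa [braidOrder, CoxeterSystem.alternatingWord, X.weyl.wordProd_cons, mul_assoc] using this

/-! ### Changes of words -/

/-- Two letters that commute can be exchanged together with their labels. -/
theorem triForm_swap (T₁ T₂ : List X.Letter) {i j : X.Node} (h : X.cartan i j = 0)
    {a b : Option X.Node} (hab : LabelPair i j a b) :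
    triForm (T₁ ++ [(i, a), (j, b)] ++ T₂) = triForm (T₁ ++ [(j, b), (i, a)] ++ T₂) := by
  have hij : i ≠ j := ne_of_cartan (by rw [h]; norm_num)
  have hg : X.gram i j = 0 := by rw [gram, h]; simp
  have hg' : X.gram j i = 0 := by rw [gram_comm, hg]
  funext u v
  have hc : letterCount [(i, a), (j, b)] = letterCount [(j, b), (i, a)] := by
    funext x; simp only [letterCount_cons]; ring
  have hS : eSum [(i, a), (j, b)] = eSum [(j, b), (i, a)] := by
    funext x; simp [eSum, add_comm]
  rw [triForm_block, triForm_block, hc, hS]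
  set c := letterCount T₁
  have s2 : sideVec j i (bump c i) = sideVec j i c :=
    sideVec_congr fun x hx hy => by simp [bump, hy]
  have t2 : sideVec i j (bump c j) = sideVec i j c :=
    sideVec_congr fun x hx hy => by simp [bump, hy]
  have l1 := letterForm_eq (c := c) hij a (s := c i) (t := c j) rfl rfl u v
  have l2 := letterForm_eq (c := bump c i) hij.symm b (s := c j) (t := c i + 1)
    (by simp [bump, hij.symm]) (by simp [bump]) u v
  have l3 := letterForm_eq (c := c) hij.symm b (s := c j) (t := c i) rfl rfl u v
  have l4 := letterForm_eq (c := bump c j) hij a (s := c i) (t := c j + 1)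
    (by simp [bump, hij]) (by simp [bump]) u v
  have e1 := hab.gram u v
  have e2 := hab.gram v u
  rw [gram_comm] at e2
  simp only [wordForm, l1, l2, l3, l4, s2, t2, labelForm, eSum, hg, hg', wedge] at e1 e2 ⊢
  linear_combination e1 - e2

/-- The quiver of a word after a move that commutes two letters. -/
theorem triQuiver_swap {l₁ l₂ : List X.Node} {i j : X.Node} (h : X.cartan i j = 0) :
    triQuiver (l₁ ++ [i, j] ++ l₂) = triQuiver (l₁ ++ [j, i] ++ l₂) := by
  have hij : i ≠ j := ne_of_cartan (by rw [h]; norm_num)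
  refine triQuiver_ext (fun a => ?_) rfl rfl rfl ?_
  · simp only [List.count_append, List.count_cons]; omega
  change triForm _ = _
  have hcomm := simple_comm h
  rw [deco_block, deco_block]
  set g := X.weyl.wordProd l₂
  have hb : X.weyl.wordProd [i, j] = X.weyl.wordProd [j, i] := by
    simpa [X.weyl.wordProd_cons] using hcomm
  have e1 : decoAt g [i, j] = [(i, label (g⁻¹ * X.weyl.simple i * g)),
      (j, label (g⁻¹ * X.weyl.simple j * g))] := by
    have : X.weyl.simple j * (X.weyl.simple i * (X.weyl.simple j * g)) = X.weyl.simple i * g := by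
      rw [← mul_assoc (X.weyl.simple i), hcomm, mul_assoc, X.weyl.simple_mul_simple_cancel_left]
    simp [decoAt, mul_assoc, this]
  have e2 : decoAt g [j, i] = [(j, label (g⁻¹ * X.weyl.simple j * g)),
      (i, label (g⁻¹ * X.weyl.simple i * g))] := by
    have : X.weyl.simple i * (X.weyl.simple j * (X.weyl.simple i * g)) = X.weyl.simple j * g := by
      rw [← mul_assoc (X.weyl.simple j), ← hcomm, mul_assoc, X.weyl.simple_mul_simple_cancel_left]
    simp [decoAt, mul_assoc, this]
  rw [e1, e2, hb]
  exact triForm_swap _ _ h (labelPair_conj g hij)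

theorem mem_braidRename {l₁ l₂ : List X.Node} {i j : X.Node} (hij : i ≠ j) {k m : ℤ}
    (hk : k = l₁.count i + 1) (hm : m = l₁.count j + 1) (v : QLabel X.Node) :
    ((QLabel.braidRename i j hij k m).symm v ∈ triVerts (l₁ ++ [i, j, i] ++ l₂) ↔
      v ∈ triVerts (l₁ ++ [j, i, j] ++ l₂)) ∧
    ((QLabel.braidRename i j hij k m).symm v ∈ triFrozen (l₁ ++ [i, j, i] ++ l₂) ↔
      v ∈ triFrozen (l₁ ++ [j, i, j] ++ l₂)) := by
  have hji := hij.symm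
  have ci : ((l₁ ++ [i, j, i] ++ l₂).count i : ℤ) = l₁.count i + l₂.count i + 2 := by
    simp [List.count_append, hji]; ring
  have cj : ((l₁ ++ [i, j, i] ++ l₂).count j : ℤ) = l₁.count j + l₂.count j + 1 := by
    simp [List.count_append, hij]; ring
  have ci' : ((l₁ ++ [j, i, j] ++ l₂).count i : ℤ) = l₁.count i + l₂.count i + 1 := by
    simp [List.count_append, hji]; ring
  have cj' : ((l₁ ++ [j, i, j] ++ l₂).count j : ℤ) = l₁.count j + l₂.count j + 2 := by
    simp [List.count_append, hij]; ring
  have cx : ∀ x, x ≠ i → x ≠ j →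
        (l₁ ++ [i, j, i] ++ l₂).count x = (l₁ ++ [j, i, j] ++ l₂).count x := by
    intro x hi hj
    simp [List.count_append, hi.symm, hj.symm]
  rcases v with ⟨a, t⟩ | a
  · by_cases hi : a = i
    · subst hi
      by_cases h : k ≤ t
      · simp only [QLabel.braidRename, Equiv.coe_fn_symm_mk, if_true, h, f_mem_triVerts,
          f_mem_triFrozen, ci, ci']
        omega
      · simp only [QLabel.braidRename, Equiv.coe_fn_symm_mk, if_true, if_false, h, f_mem_triVerts,
          f_mem_triFrozen, ci, ci']
        omega
    by_cases hj : a = j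
    · subst hj
      by_cases h : t = m
      · simp only [QLabel.braidRename, Equiv.coe_fn_symm_mk, if_true, if_false, h, hi,
          f_mem_triVerts, f_mem_triFrozen, ci, cj']
        omega
      by_cases h' : m < t
      · simp only [QLabel.braidRename, Equiv.coe_fn_symm_mk, if_true, if_false, h, h', hi,
          f_mem_triVerts, f_mem_triFrozen, cj, cj']
        omega
      · simp only [QLabel.braidRename, Equiv.coe_fn_symm_mk, if_true, if_false, h, h', hi,
          f_mem_triVerts, f_mem_triFrozen, cj, cj']
        omega
    · simp only [QLabel.braidRename, Equiv.coe_fn_symm_mk, if_false, hi, hj, f_mem_triVerts,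
        f_mem_triFrozen, cx a hi hj, and_self]
  · simp [QLabel.braidRename, e_mem_triVerts, e_mem_triFrozen]

theorem mult_eq_of_cartan {i j : X.Node} (h₁ : X.cartan i j = -1) (h₂ : X.cartan j i = -1) :
    X.mult i = X.mult j := by
  have := X.mult_mul_cartan i j
  rw [h₁, h₂] at this
  push_cast at this
  linarith

/-- The explicit quivers of two words that differ by a move `i j i → j i j`. The middle letter has
no label, and the labels of the two ends are interchanged. -/
theorem triQuiver_iji {l₁ l₂ : List X.Node} {i j : X.Node} (hij : i ≠ j)
    (h₁ : X.cartan i j = -1) (h₂ : X.cartan j i = -1) {k m : ℤ} (hk : k = l₁.count i + 1)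
    (hm : m = l₁.count j + 1) (hl : X.weyl.IsReduced (l₁ ++ [i, j, i] ++ l₂)) :
    ((triQuiver (l₁ ++ [i, j, i] ++ l₂)).mutate (.f i k)).relabel
      (QLabel.braidRename i j hij k m) = triQuiver (l₁ ++ [j, i, j] ++ l₂) := by
  have hmem := mem_braidRename (l₂ := l₂) hij hk hm
  have hbr := simple_braid h₁ h₂
  have hji := hij.symm
  refine WQuiver.ext (Set.ext fun v => (hmem v).1) (Set.ext fun v => (hmem v).2) ?_ ?_
  · funext v
    have hn : X.mult ((QLabel.braidRename i j hij k m).symm v).node = X.mult v.node := by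
      rcases v with ⟨a, t⟩ | a
      · simp only [QLabel.braidRename, Equiv.coe_fn_symm_mk]
        split_ifs with a1 a2 a3 a4 a5 <;> simp [QLabel.node, *, mult_eq_of_cartan h₁ h₂]
      · rfl
    classical
    have hx := (hmem v).1
    change (if (QLabel.braidRename i j hij k m).symm v ∈ triVerts (l₁ ++ [i, j, i] ++ l₂) then
      X.mult ((QLabel.braidRename i j hij k m).symm v).node else 0) =
        (if v ∈ triVerts (l₁ ++ [j, i, j] ++ l₂) then X.mult v.node else 0)
    rw [hn]
    by_cases h : v ∈ triVerts (l₁ ++ [j, i, j] ++ l₂)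
    · rw [if_pos h, if_pos (hx.2 h)]
    · rw [if_neg h, if_neg fun h' => h (hx.1 h')]
  funext u v
  have hd : (triQuiver (l₁ ++ [i, j, i] ++ l₂)).d (.f i k) = X.mult i := by
    have ci : ((l₁ ++ [i, j, i] ++ l₂).count i : ℤ) = l₁.count i + l₂.count i + 2 := by
      simp [List.count_append, hji]; ring
    refine triQuiver_d_f (by omega) (by rw [ci]; omega)
  change mutForm ((triQuiver (l₁ ++ [i, j, i] ++ l₂)).d (.f i k)) (.f i k)
    (triForm (deco (l₁ ++ [i, j, i] ++ l₂))) _ _ = triForm (deco (l₁ ++ [j, i, j] ++ l₂)) u v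
  have hred : X.weyl.IsReduced ([i, j, i] ++ l₂) := by
    have := hl.drop l₁.length
    simpa using this
  have hred' : X.weyl.IsReduced ([j, i, j] ++ l₂) := by
    have h1 := hred.eq
    unfold CoxeterSystem.IsReduced
    rw [X.weyl.wordProd_append] at h1 ⊢
    have : X.weyl.wordProd [j, i, j] = X.weyl.wordProd [i, j, i] := by
      simpa [X.weyl.wordProd_cons, mul_assoc] using hbr.symm
    rw [this, h1]; simp
  have n1 := label_conj_eq_none (by simp) hred
  have n2 := label_conj_eq_none (by simp) hred'
  rw [hd, deco_block, deco_block]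
  set g := X.weyl.wordProd l₂
  have hb : X.weyl.wordProd [i, j, i] = X.weyl.wordProd [j, i, j] := by
    simpa [X.weyl.wordProd_cons, mul_assoc] using hbr
  have c1 : X.weyl.simple i * X.weyl.simple j * X.weyl.simple i * X.weyl.simple j *
      X.weyl.simple i = X.weyl.simple j := by
    rw [hbr, X.weyl.simple_mul_simple_cancel_right, X.weyl.simple_mul_simple_cancel_right]
  have c2 : X.weyl.simple j * X.weyl.simple i * X.weyl.simple j * X.weyl.simple i *
      X.weyl.simple j = X.weyl.simple i := by
    rw [← hbr, X.weyl.simple_mul_simple_cancel_right, X.weyl.simple_mul_simple_cancel_right]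
  have e1 : decoAt g [i, j, i] = [(i, label (g⁻¹ * X.weyl.simple j * g)), (j, none),
      (i, label (g⁻¹ * X.weyl.simple i * g))] := by
    rw [← n1, ← c1]
    simp [decoAt, X.weyl.wordProd_cons, mul_assoc]
  have e2 : decoAt g [j, i, j] = [(j, label (g⁻¹ * X.weyl.simple i * g)), (i, none),
      (j, label (g⁻¹ * X.weyl.simple j * g))] := by
    rw [← n2, ← c2]
    simp [decoAt, X.weyl.wordProd_cons, mul_assoc]
  rw [e1, e2, hb]
  exact mutForm_triForm_iji hij h₁ h₂ (labelPair_conj g hij).symm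
    (by rw [letterCount_decoAt, hk]) (by rw [letterCount_decoAt, hm]) u v

/-- The explicit quivers of two words that differ by a move `i j i j → j i j i`. The two middle
letters have no labels, and the labels of the two ends are interchanged. -/
theorem triQuiver_ijij {l₁ l₂ : List X.Node} {i j : X.Node}
    (h₁ : X.cartan i j = -1) (h₂ : X.cartan j i = -2) {k m : ℤ} (hk : k = l₁.count i + 1)
    (hm : m = l₁.count j + 1) (hl : X.weyl.IsReduced (l₁ ++ [i, j, i, j] ++ l₂)) :
    (((triQuiver (l₁ ++ [i, j, i, j] ++ l₂)).mutate (.f j m)).mutate (.f i k)).mutate (.f j m) =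
      triQuiver (l₁ ++ [j, i, j, i] ++ l₂) := by
  have hij : i ≠ j := ne_of_cartan (by rw [h₁]; norm_num)
  have hji := hij.symm
  have hbr := simple_braid₄ h₁ h₂
  refine triQuiver_ext (l := l₁ ++ [i, j, i, j] ++ l₂) (fun a => ?_) rfl rfl rfl ?_
  · simp only [List.count_append, List.count_cons]; omega
  have hd : (triQuiver (l₁ ++ [i, j, i, j] ++ l₂)).d (.f i k) = X.mult i := by
    have ci : ((l₁ ++ [i, j, i, j] ++ l₂).count i : ℤ) = l₁.count i + l₂.count i + 2 := by
      simp [List.count_append, hji]; ring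
    refine triQuiver_d_f (by omega) (by rw [ci]; omega)
  have hd' : (triQuiver (l₁ ++ [i, j, i, j] ++ l₂)).d (.f j m) = X.mult j := by
    have ci : ((l₁ ++ [i, j, i, j] ++ l₂).count j : ℤ) = l₁.count j + l₂.count j + 2 := by
      simp [List.count_append, hij]; ring
    refine triQuiver_d_f (by omega) (by rw [ci]; omega)
  change mutForm ((triQuiver (l₁ ++ [i, j, i, j] ++ l₂)).d (.f j m)) (.f j m)
    (mutForm ((triQuiver (l₁ ++ [i, j, i, j] ++ l₂)).d (.f i k)) (.f i k)
      (mutForm ((triQuiver (l₁ ++ [i, j, i, j] ++ l₂)).d (.f j m)) (.f j m)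
        (triForm (deco (l₁ ++ [i, j, i, j] ++ l₂))))) = _
  have hred : X.weyl.IsReduced ([i, j, i, j] ++ l₂) := by
    have := hl.drop l₁.length
    simpa using this
  have hb : X.weyl.wordProd [i, j, i, j] = X.weyl.wordProd [j, i, j, i] := by
    simpa [X.weyl.wordProd_cons, mul_assoc] using hbr
  have hred' : X.weyl.IsReduced ([j, i, j, i] ++ l₂) := by
    have h1 := hred.eq
    unfold CoxeterSystem.IsReduced
    rw [X.weyl.wordProd_append] at h1 ⊢
    rw [← hb, h1]; simp
  have n1 := label_conj_eq_none (u := [j, i, j]) (by simp) (hred.drop 1)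
  have n2 := label_conj_eq_none (u := [i, j, i]) (by simp) (hred'.drop 1)
  rw [hd, hd', deco_block, deco_block]
  set g := X.weyl.wordProd l₂
  have c1 : X.weyl.simple j * X.weyl.simple i * X.weyl.simple j * X.weyl.simple i *
      X.weyl.simple j * X.weyl.simple i * X.weyl.simple j = X.weyl.simple i := by
    rw [← hbr]
    simp [X.weyl.simple_mul_simple_cancel_right]
  have c2 : X.weyl.simple i * X.weyl.simple j * X.weyl.simple i * X.weyl.simple j *
      X.weyl.simple i * X.weyl.simple j * X.weyl.simple i = X.weyl.simple j := by
    rw [hbr]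
    simp [X.weyl.simple_mul_simple_cancel_right]
  have c3 : X.weyl.simple j * X.weyl.simple i * X.weyl.simple j * X.weyl.simple i *
      X.weyl.simple j = X.weyl.simple i * X.weyl.simple j * X.weyl.simple i := by
    rw [← hbr, X.weyl.simple_mul_simple_cancel_right]
  have c4 : X.weyl.simple i * X.weyl.simple j * X.weyl.simple i * X.weyl.simple j *
      X.weyl.simple i = X.weyl.simple j * X.weyl.simple i * X.weyl.simple j := by
    rw [hbr, X.weyl.simple_mul_simple_cancel_right]
  have e1 : decoAt g [i, j, i, j] = [(i, label (g⁻¹ * X.weyl.simple i * g)), (j, none), (i, none),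
      (j, label (g⁻¹ * X.weyl.simple j * g))] := by
    have n1' := n1
    have n2' := n2
    simp only [X.weyl.wordProd_cons, X.weyl.wordProd_nil, mul_one, ← mul_assoc] at n1' n2'
    have n3 := n2'
    simp only [mul_assoc] at n3 c3
    conv_rhs => rw [← c1]
    simp only [decoAt, X.weyl.wordProd_cons, X.weyl.wordProd_nil, mul_one, one_mul, mul_inv_rev,
      X.weyl.inv_simple, mul_assoc] at n1' ⊢
    rw [n1']
    have : X.weyl.simple j * (X.weyl.simple i * (X.weyl.simple j * (X.weyl.simple i *
      (X.weyl.simple j * g)))) = X.weyl.simple i * (X.weyl.simple j * (X.weyl.simple i * g)) := by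
      have := congrArg (· * g) c3
      simpa only [mul_assoc] using this
    rw [this, n3]
  have e2 : decoAt g [j, i, j, i] = [(j, label (g⁻¹ * X.weyl.simple j * g)), (i, none), (j, none),
      (i, label (g⁻¹ * X.weyl.simple i * g))] := by
    have n1' := n1
    have n2' := n2
    simp only [X.weyl.wordProd_cons, X.weyl.wordProd_nil, mul_one, ← mul_assoc] at n1' n2'
    have n3 := n1'
    simp only [mul_assoc] at n3 c4
    conv_rhs => rw [← c2]
    simp only [decoAt, X.weyl.wordProd_cons, X.weyl.wordProd_nil, mul_one, one_mul, mul_inv_rev,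
      X.weyl.inv_simple, mul_assoc] at n2' ⊢
    rw [n2']
    have : X.weyl.simple i * (X.weyl.simple j * (X.weyl.simple i * (X.weyl.simple j *
      (X.weyl.simple i * g)))) = X.weyl.simple j * (X.weyl.simple i * (X.weyl.simple j * g)) := by
      have := congrArg (· * g) c4
      simpa only [mul_assoc] using this
    rw [this, n3]
  rw [e1, e2, hb]
  exact mutForm_triForm_ijij hij h₁ h₂ (labelPair_conj g hij)
    (by rw [letterCount_decoAt, hk]) (by rw [letterCount_decoAt, hm])

end LieType

/-! ### Quivers given by finitely many integral arrows -/

namespace WQuiver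

variable {V : Type}

/-- The total weight of the arrows from `a` to `b`, minus that of the arrows from `b` to `a`. -/
def arrowSum {n : ℕ} : List (Fin n × Fin n × ℤ) → Fin n → Fin n → ℤ
  | [], _, _ => 0
  | (u, v, c) :: L, a, b =>
    arrowSum L a b + (if a = u ∧ b = v then c else if a = v ∧ b = u then -c else 0)

/-- The weights `w` live on the vertices `φ a`, and six times them are given by `M`. -/
structure Represents {n : ℕ} (φ : Fin n → V) (w : V → V → ℚ) (M : Fin n → Fin n → ℤ) : Prop where
  eq : ∀ a b, 6 * w (φ a) (φ b) = M a b
  support : ∀ u v, w u v ≠ 0 → u ∈ Set.range φ ∧ v ∈ Set.range φ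

/-- Mutation in terms of integers: for `M = 6 w` the rule reads
`M' - M = (M |M| + |M| M) / (12 d)`. -/
theorem Represents.mutForm {n : ℕ} {φ : Fin n → V} {w : V → V → ℚ} {M M' : Fin n → Fin n → ℤ}
    (h : Represents φ w M) (hφ : Function.Injective φ) {d : ℚ} (hd : 0 < d) {m : ℤ}
    (hm : 12 * d = m) (k : Fin n)
    (hM : ∀ a b, if a = k ∨ b = k then M' a b = - M a b else
      m * (M' a b - M a b) = M a k * |M k b| + |M a k| * M k b) :
    Represents φ (mutForm d (φ k) w) M' := by
  constructor
  · intro a b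
    have h1 := hM a b
    unfold WQuiver.mutForm
    simp only [hφ.eq_iff]
    split_ifs with hc
    · rw [if_pos hc] at h1
      rw [h1]
      push_cast
      rw [← h.eq]
      ring
    · rw [if_neg hc] at h1
      have h2 : (m : ℚ) * (M' a b - M a b) = M a k * |(M k b : ℚ)| + |(M a k : ℚ)| * M k b := by
        exact_mod_cast h1
      rw [← h.eq a b, ← h.eq a k, ← h.eq k b, ← hm, abs_mul, abs_mul,
        abs_of_pos (by norm_num : (0 : ℚ) < 6)]
        at h2
      field_simp
      linarith
  · intro u v hne
    unfold WQuiver.mutForm at hne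
    split_ifs at hne with hc
    · exact h.support u v (neg_ne_zero.1 hne)
    · by_cases h0 : w u v = 0
      · have h1 : w u (φ k) ≠ 0 := fun hz => hne (by simp [h0, hz])
        have h2 : w (φ k) v ≠ 0 := fun hz => hne (by simp [h0, hz])
        exact ⟨(h.support _ _ h1).1, (h.support _ _ h2).2⟩
      · exact h.support u v h0

theorem Represents.unique {n : ℕ} {φ : Fin n → V} {w w' : V → V → ℚ} {M : Fin n → Fin n → ℤ}
    (h : Represents φ w M) (h' : Represents φ w' M) : w = w' := by
  funext u v
  by_cases hu : u ∈ Set.range φ ∧ v ∈ Set.range φ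
  · obtain ⟨⟨a, rfl⟩, b, rfl⟩ := hu
    have := (h.eq a b).trans (h'.eq a b).symm
    linarith
  · rw [not_imp_comm.1 (h.support u v) hu, not_imp_comm.1 (h'.support u v) hu]

end WQuiver

namespace LieType

open WQuiver

/-! ### The moves in type G₂ -/

/-- The ten vertices of the quivers in type `G2`. -/
def vertexG2 : Fin 10 → QLabel G2.Node :=
  let i : G2.Node := (0 : Fin 2)
  let j : G2.Node := (1 : Fin 2)
  ![.f i 0, .f i 1, .f i 2, .f i 3, .f j 0, .f j 1, .f j 2, .f j 3, .e i, .e j]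

/-- The number of a vertex. -/
def indexG2 : QLabel G2.Node → Fin 10
  | .f i k => Fin.ofNat 10 (4 * i.val + k.toNat)
  | .e i => Fin.ofNat 10 (8 + i.val)

theorem vertexG2_injective : Function.Injective vertexG2 := by
  refine Function.LeftInverse.injective (g := indexG2) ?_
  intro a
  fin_cases a <;> rfl

/-- `6 * gram i j / 2` as an integer. -/
def gramG2 (i j : G2.Node) : ℤ :=
  if i.val = 0 then if j.val = 0 then -6 else 3 else if j.val = 0 then 3 else -2

/-- `state` as an integer. -/
def stateInt {X : LieType} (c : X.Node → ℤ) : QLabel X.Node → ℤ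
  | .f i k => if c i = k then 1 else 0
  | .e _ => 0

theorem state_eq_intCast {X : LieType} (c : X.Node → ℤ) (v : QLabel X.Node) :
    state c v = stateInt c v := by
  rcases v with ⟨i, k⟩ | a <;> simp [state, stateInt]

/-- `eInd` as an integer. -/
def eIndInt {X : LieType} (o : Option X.Node) : QLabel X.Node → ℤ
  | .f _ _ => 0
  | .e a => if o = some a then 1 else 0

theorem eInd_eq_intCast {X : LieType} (o : Option X.Node) (v : QLabel X.Node) :
    eInd o v = eIndInt o v := by
  rcases v with ⟨i, k⟩ | a <;> simp [eInd, eIndInt]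

/-- `6 * letterForm` as an integer. -/
def letterFormG2 (c : G2.Node → ℤ) (p : G2.Letter) (u v : QLabel G2.Node) : ℤ :=
  gramG2 u.node v.node *
      (stateInt (bump c p.1) u * stateInt c v - stateInt c u * stateInt (bump c p.1) v) +
    (if p.1.val = 0 then 6 else 2) *
      (eIndInt p.2 u * (stateInt c v - stateInt (bump c p.1) v) -
        eIndInt p.2 v * (stateInt c u - stateInt (bump c p.1) u))

/-- `6 * wordForm` as an integer. -/
def wordFormG2 : (G2.Node → ℤ) → List G2.Letter → QLabel G2.Node → QLabel G2.Node → ℤ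
  | _, [], _, _ => 0
  | c, p :: T, u, v =>
    letterFormG2 c p u v + wordFormG2 (bump c p.1) T u v

/-- `6 * labelForm` as an integer, for a list of labels. -/
def labelFormG2 : List (Option G2.Node) → QLabel G2.Node → QLabel G2.Node → ℤ
  | [], _, _ => 0
  | o :: T, u, v =>
    gramG2 u.node v.node * (eIndInt o u * (T.map fun o => eIndInt o v).sum -
      eIndInt o v * (T.map fun o => eIndInt o u).sum) + labelFormG2 T u v

theorem gramG2_eq (i j : G2.Node) : 6 * (G2.gram i j / 2) = gramG2 i j := by
  rcases i with ⟨i, hi⟩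
  rcases j with ⟨j, hj⟩
  simp only [rank] at hi hj
  interval_cases i <;> interval_cases j <;>
    norm_num [gram, mult, cartan, gramG2, Adj, Fin.ext_iff]

theorem wordForm_G2 (c : G2.Node → ℤ) (T : List G2.Letter) (u v : QLabel G2.Node) :
    6 * wordForm c T u v = wordFormG2 c T u v := by
  induction T generalizing c with
  | nil => simp [wordForm, wordFormG2]
  | cons p T ih =>
    have hg := gramG2_eq
    have hm : ∀ i : G2.Node, 6 * G2.mult i = ((if i.val = 0 then 6 else 2 : ℤ) : ℚ) := by
      intro i
      simp only [mult]
      split_ifs <;> norm_num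
    rw [wordForm, wordFormG2, mul_add, Int.cast_add]
    refine congrArg₂ _ ?_ (ih _)
    rw [letterForm, letterFormG2, mul_add, ← mul_assoc, ← mul_assoc, hg, hm]
    simp only [wedge, state_eq_intCast, eInd_eq_intCast]
    push_cast
    ring

theorem labelForm_G2 (T : List G2.Letter) (u v : QLabel G2.Node) :
    6 * labelForm T u v = labelFormG2 (T.map Prod.snd) u v := by
  have hs : ∀ (T : List G2.Letter) (x : QLabel G2.Node), eSum T x =
      (((T.map Prod.snd).map fun o => eIndInt o x).sum : ℤ) := by
    intro T x
    induction T with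
    | nil => rfl
    | cons p T ih => rw [eSum, ih, eInd_eq_intCast]; push_cast; rfl
  induction T with
  | nil => simp [labelForm, labelFormG2]
  | cons p T ih =>
    rw [labelForm, List.map_cons, labelFormG2, mul_add, Int.cast_add, ih, ← mul_assoc, gramG2_eq]
    simp only [wedge, hs, eInd_eq_intCast]
    push_cast
    ring

/-- A labelled word of type `G2` in which every node occurs three times is determined by the
integral weights at the ten vertices. -/
theorem represents_triForm {l : List G2.Node} (hl : ∀ i, l.count i = 3) {T : List G2.Letter}
    (hT : deco l = T) {M : Fin 10 → Fin 10 → ℤ}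
    (hM : ∀ a b, wordFormG2 0 T (vertexG2 a) (vertexG2 b) +
      labelFormG2 (T.map Prod.snd) (vertexG2 a) (vertexG2 b) = M a b) :
    Represents vertexG2 (triForm (deco l)) M := by
  subst hT
  constructor
  · intro a b
    rw [triForm, mul_add, wordForm_G2, labelForm_G2, ← hM, Int.cast_add]
  · have key : ∀ u, u ∈ triVerts l → u ∈ Set.range vertexG2 := by
      rintro (⟨⟨i, hi⟩, k⟩ | ⟨i, hi⟩) h
      · rw [f_mem_triVerts, hl] at h
        obtain ⟨h1, h2⟩ := h
        push_cast at h2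
        simp only [rank] at hi
        interval_cases i <;> interval_cases k
        exacts [⟨0, rfl⟩, ⟨1, rfl⟩, ⟨2, rfl⟩, ⟨3, rfl⟩, ⟨4, rfl⟩, ⟨5, rfl⟩, ⟨6, rfl⟩, ⟨7, rfl⟩]
      · simp only [rank] at hi
        interval_cases i
        exacts [⟨8, rfl⟩, ⟨9, rfl⟩]
    intro u v h
    exact ⟨key u (mem_of_triForm_ne_zero h),
      key v (mem_of_triForm_ne_zero (u := v) (v := u) (by rw [triForm_skew]; simpa using h))⟩

/-- The arrows of the quivers that occur in the sequence of eleven mutations between the words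
`1 0 1 0 1 0` and `0 1 0 1 0 1`, with six times their weights. -/
def arrowsG2 : Fin 12 → List (Fin 10 × Fin 10 × ℤ) :=
  ![[(0, 1, 6), (0, 4, 3), (1, 2, 6), (1, 5, 6), (2, 3, 6), (2, 6, 6), (3, 7, 3), (3, 8, 6),
      (4, 5, 2), (5, 0, 6), (5, 6, 2), (5, 9, 2), (6, 1, 6), (6, 7, 2), (7, 2, 6), (8, 2, 6),
      (9, 4, 2), (9, 8, 3)],
    [(0, 1, 6), (0, 4, 3), (1, 3, 6), (1, 5, 6), (2, 1, 6), (2, 7, 6), (2, 8, 6), (3, 2, 6),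
      (4, 5, 2), (5, 0, 6), (5, 6, 2), (5, 9, 2), (6, 2, 6), (7, 3, 3), (7, 6, 4), (8, 6, 6),
      (9, 4, 2), (9, 8, 3)],
    [(0, 3, 6), (0, 4, 3), (1, 0, 6), (1, 2, 6), (2, 5, 6), (2, 7, 6), (2, 8, 6), (3, 1, 6),
      (4, 5, 2), (5, 1, 6), (5, 6, 2), (5, 9, 2), (6, 2, 6), (7, 3, 3), (7, 6, 4), (8, 6, 6),
      (9, 4, 2), (9, 8, 3)],
    [(0, 3, 6), (0, 4, 3), (1, 0, 6), (1, 2, 6), (2, 6, 6), (3, 1, 6), (4, 5, 2), (5, 1, 6),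
      (5, 9, 2), (6, 5, 2), (6, 7, 4), (6, 8, 6), (7, 2, 6), (7, 3, 3), (8, 2, 12), (9, 4, 2),
      (9, 8, 3)],
    [(0, 3, 6), (0, 4, 3), (1, 0, 6), (1, 6, 6), (2, 1, 6), (2, 7, 6), (2, 8, 12), (3, 1, 6),
      (4, 5, 2), (5, 1, 6), (5, 9, 2), (6, 2, 6), (6, 5, 2), (7, 3, 3), (7, 6, 2), (8, 6, 6),
      (9, 4, 2), (9, 8, 3)],
    [(0, 3, 6), (0, 4, 3), (1, 0, 6), (1, 2, 12), (2, 6, 6), (3, 1, 6), (4, 5, 2), (5, 6, 2),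
      (5, 9, 2), (6, 1, 6), (6, 7, 2), (6, 8, 6), (7, 3, 3), (7, 5, 2), (8, 2, 6), (8, 5, 6),
      (9, 4, 2), (9, 8, 3)],
    [(0, 3, 6), (0, 4, 3), (1, 0, 6), (1, 2, 12), (2, 6, 6), (3, 1, 6), (4, 6, 2), (5, 4, 2),
      (5, 7, 2), (5, 8, 6), (6, 1, 6), (6, 5, 2), (7, 3, 3), (7, 9, 2), (8, 2, 6), (8, 9, 3),
      (9, 5, 2)],
    [(0, 3, 6), (0, 4, 3), (1, 0, 6), (1, 6, 6), (2, 1, 6), (2, 5, 6), (3, 1, 6), (4, 1, 6),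
      (5, 6, 2), (5, 7, 2), (5, 8, 6), (6, 2, 6), (6, 4, 2), (7, 3, 3), (7, 9, 2), (8, 2, 6),
      (8, 9, 3), (9, 5, 2)],
    [(0, 3, 6), (0, 4, 3), (1, 0, 6), (1, 2, 6), (2, 6, 6), (2, 8, 6), (3, 1, 6), (4, 1, 6),
      (5, 2, 6), (5, 7, 2), (6, 4, 2), (6, 5, 4), (7, 3, 3), (7, 9, 2), (8, 1, 6), (8, 9, 3),
      (9, 5, 2)],
    [(0, 1, 6), (1, 3, 6), (1, 4, 6), (1, 8, 6), (2, 1, 6), (2, 6, 6), (3, 2, 6), (4, 0, 3),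
      (4, 2, 6), (5, 2, 6), (5, 7, 2), (6, 4, 2), (6, 5, 4), (7, 3, 3), (7, 9, 2), (8, 0, 6),
      (8, 9, 3), (9, 5, 2)],
    [(0, 1, 6), (1, 3, 6), (1, 4, 6), (1, 8, 6), (2, 1, 6), (2, 5, 6), (3, 2, 6), (4, 0, 3),
      (4, 6, 2), (5, 6, 4), (5, 7, 2), (6, 2, 6), (7, 3, 3), (7, 9, 2), (8, 0, 6), (8, 9, 3),
      (9, 5, 2)],
    [(0, 1, 6), (1, 2, 6), (1, 4, 6), (1, 8, 6), (2, 3, 6), (2, 6, 6), (3, 5, 6), (4, 0, 3),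
      (4, 6, 2), (5, 2, 6), (5, 7, 2), (6, 1, 6), (6, 5, 2), (7, 3, 3), (7, 9, 2), (8, 0, 6),
      (8, 9, 3), (9, 5, 2)]]

/-- The vertices at which the mutations take place. -/
def sequenceG2 : Fin 11 → Fin 10 := ![2, 1, 6, 2, 6, 5, 6, 2, 1, 6, 2]

theorem arrowsG2_step (t : Fin 11) : ∀ a b,
    let k := sequenceG2 t
    let M := arrowSum (arrowsG2 t.castSucc)
    let M' := arrowSum (arrowsG2 t.succ)
    if a = k ∨ b = k then M' a b = - M a b else
      (if k.val < 4 then 12 else 4) * (M' a b - M a b) = M a k * |M k b| + |M a k| * M k b := by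
  fin_cases t <;> decide

theorem arrowsG2_first : ∀ a b,
    let i : G2.Node := (0 : Fin 2)
    let j : G2.Node := (1 : Fin 2)
    let T : List G2.Letter :=
      [(j, some j), (i, none), (j, none), (i, none), (j, none), (i, some i)]
    wordFormG2 0 T (vertexG2 a) (vertexG2 b) +
      labelFormG2 (T.map Prod.snd) (vertexG2 a) (vertexG2 b) = arrowSum (arrowsG2 0) a b := by
  decide

theorem arrowsG2_last : ∀ a b,
    let i : G2.Node := (0 : Fin 2)
    let j : G2.Node := (1 : Fin 2)
    let T : List G2.Letter :=
      [(i, some i), (j, none), (i, none), (j, none), (i, none), (j, some j)]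
    wordFormG2 0 T (vertexG2 a) (vertexG2 b) +
      labelFormG2 (T.map Prod.snd) (vertexG2 a) (vertexG2 b) =
        arrowSum (arrowsG2 11) (Equiv.swap 5 6 a) (Equiv.swap 5 6 b) := by
  decide

variable {X : LieType}

theorem simple_braid₆ {i j : X.Node} (h₁ : X.cartan i j = -1) (h₂ : X.cartan j i = -3) :
    X.weyl.wordProd [i, j, i, j, i, j] = X.weyl.wordProd [j, i, j, i, j, i] := by
  have := wordProd_alternating i j
  rw [coxeterMatrix_apply X (ne_of_cartan (by rw [h₁]; norm_num)), h₁, h₂] at this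
  simpa [braidOrder, CoxeterSystem.alternatingWord] using this

/-- In a dihedral group of order twelve only the first and the last letter of the longest words
carry labels. -/
theorem deco_ijijij {i j : X.Node} (h : X.weyl.wordProd [i, j, i, j, i, j] =
    X.weyl.wordProd [j, i, j, i, j, i]) (hred : X.weyl.IsReduced [i, j, i, j, i, j]) :
    deco [i, j, i, j, i, j] =
      [(i, some i), (j, none), (i, none), (j, none), (i, none), (j, some j)] := by
  have hred' : X.weyl.IsReduced [j, i, j, i, j, i] := by
    have h1 := hred.eq
    unfold CoxeterSystem.IsReduced
    rw [← h, h1]; rfl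
  have key : ∀ {u l : List X.Node}, X.weyl.IsReduced (u ++ l) → 2 ≤ u.length →
      label (X.weyl.wordProd u) = none := by
    intro u l hu h2
    have := label_conj_eq_none (u := u) (l := []) h2 (by simpa using hu.take u.length)
    simpa using this
  have n1 : label (X.weyl.wordProd [j, i, j]) = none := key (l := [i, j, i]) hred' (by simp)
  have n2 : label (X.weyl.wordProd [j, i, j, i, j]) = none := key (l := [i]) hred' (by simp)
  have n3 : label (X.weyl.wordProd [i, j, i, j, i]) = none := key (l := [j]) hred (by simp)
  have n4 : label (X.weyl.wordProd [i, j, i]) = none := key (l := [j, i, j]) hred (by simp)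
  have ci : ∀ g, X.weyl.simple i * (X.weyl.simple i * g) = g :=
    fun g => X.weyl.simple_mul_simple_cancel_left i
  have cj : ∀ g, X.weyl.simple j * (X.weyl.simple j * g) = g :=
    fun g => X.weyl.simple_mul_simple_cancel_left j
  have n5 : ∀ a : X.Node, label (X.weyl.simple a) = some a := fun a => label_eq_some.2 rfl
  simp only [X.weyl.wordProd_cons, X.weyl.wordProd_nil, mul_one] at h n1 n2 n3 n4
  have h' : ∀ g, X.weyl.simple j * (X.weyl.simple i * (X.weyl.simple j * (X.weyl.simple i *
      (X.weyl.simple j * (X.weyl.simple i * g))))) = X.weyl.simple i * (X.weyl.simple j *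
      (X.weyl.simple i * (X.weyl.simple j * (X.weyl.simple i * (X.weyl.simple j * g))))) := by
    intro g
    have := congrArg (· * g) h.symm
    simpa only [mul_assoc] using this
  simp only [deco, decoAt, X.weyl.wordProd_cons, X.weyl.wordProd_nil, mul_one, one_mul, mul_inv_rev,
    X.weyl.inv_simple, inv_one, mul_assoc, h', ci, cj, n1, n2, n3, n4, n5,
    X.weyl.simple_mul_simple_self]

theorem eq_G2_of_cartan {i j : X.Node} (h : X.cartan j i = -3) : X = G2 := by
  unfold cartan at h
  split_ifs at h
  cases X <;> simp only at h <;> (try split_ifs at h) <;> first | rfl | omega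

theorem represents_mutateG2 {Q : WQuiver (QLabel G2.Node)} (t : Fin 11) {k : QLabel G2.Node}
    (hk : vertexG2 (sequenceG2 t) = k)
    (h : Represents vertexG2 Q.w (arrowSum (arrowsG2 t.castSucc)))
    (hd : ∀ a, Q.d (vertexG2 a) = G2.mult (vertexG2 a).node) :
    Represents vertexG2 (Q.mutate k).w (arrowSum (arrowsG2 t.succ)) := by
  subst hk
  refine h.mutForm vertexG2_injective ?_ ?_ _ (arrowsG2_step t)
  · rw [hd]; exact G2.mult_pos _
  · have hn : ∀ t, (vertexG2 (sequenceG2 t)).node.val = 0 ↔ (sequenceG2 t).val < 4 := by decide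
    rw [hd]
    simp only [mult, hn]
    split_ifs <;> norm_num

/-- The eleven mutations of the triply laced move transform the explicit quivers into each
other. -/
theorem triQuiver_jijiji {i j : X.Node} (h₁ : X.cartan i j = -1) (h₂ : X.cartan j i = -3)
    (hl : X.weyl.IsReduced [j, i, j, i, j, i]) :
    ([QLabel.f i 2, .f i 1, .f j 2, .f i 2, .f j 2, .f j 1, .f j 2, .f i 2, .f i 1, .f j 2,
      .f i 2].foldl WQuiver.mutate (triQuiver [j, i, j, i, j, i])).relabel (QLabel.swapOneTwo j) =
        triQuiver [i, j, i, j, i, j] := by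
  classical
  obtain rfl := eq_G2_of_cartan h₂
  have hij : i ≠ j := ne_of_cartan (by rw [h₁]; norm_num)
  obtain ⟨rfl, rfl⟩ : i = (0 : Fin 2) ∧ j = (1 : Fin 2) := by
    rcases i with ⟨i, hi⟩
    rcases j with ⟨j, hj⟩
    simp only [rank] at hi hj
    interval_cases i <;> interval_cases j
    · exact (hij rfl).elim
    · exact ⟨rfl, rfl⟩
    · norm_num [cartan, Adj, Fin.ext_iff] at h₁
    · exact (hij rfl).elim
  have hb := simple_braid₆ h₁ h₂
  have hl' := hl
  rw [CoxeterSystem.IsReduced, ← hb] at hl'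
  have d1 := deco_ijijij hb.symm hl
  have d2 := deco_ijijij hb hl'
  have c1 : ∀ a : G2.Node,
      List.count a [(1 : Fin 2), (0 : Fin 2), (1 : Fin 2), (0 : Fin 2), (1 : Fin 2),
        (0 : Fin 2)] = 3 := by
    decide
  have c2 : ∀ a : G2.Node,
      List.count a [(0 : Fin 2), (1 : Fin 2), (0 : Fin 2), (1 : Fin 2), (0 : Fin 2),
        (1 : Fin 2)] = 3 := by
    decide
  set i : G2.Node := (0 : Fin 2)
  set j : G2.Node := (1 : Fin 2)
  have hmem : ∀ v : QLabel G2.Node,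
      ((QLabel.swapOneTwo j).symm v ∈ triVerts [j, i, j, i, j, i] ↔
        v ∈ triVerts [i, j, i, j, i, j]) ∧
      ((QLabel.swapOneTwo j).symm v ∈ triFrozen [j, i, j, i, j, i] ↔
        v ∈ triFrozen [i, j, i, j, i, j]) ∧ ((QLabel.swapOneTwo j).symm v).node = v.node := by
    intro v
    by_cases hv1 : v = .f j 1
    · subst hv1
      simp [QLabel.swapOneTwo, f_mem_triVerts, f_mem_triFrozen, c1, c2, QLabel.node]
    by_cases hv2 : v = .f j 2
    · subst hv2
      simp [QLabel.swapOneTwo, f_mem_triVerts, f_mem_triFrozen, c1, c2, QLabel.node]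
    rw [QLabel.swapOneTwo, Equiv.symm_swap, Equiv.swap_apply_of_ne_of_ne hv1 hv2]
    rcases v with ⟨a, k⟩ | a
    · simp [f_mem_triVerts, f_mem_triFrozen, c1, c2]
    · simp [e_mem_triVerts, e_mem_triFrozen]
  refine WQuiver.ext (Set.ext fun v => (hmem v).1) (Set.ext fun v => (hmem v).2.1) ?_ ?_
  · funext v
    obtain ⟨hx, -, hn⟩ := hmem v
    change (if (QLabel.swapOneTwo j).symm v ∈ triVerts [j, i, j, i, j, i] then
      G2.mult ((QLabel.swapOneTwo j).symm v).node else 0) =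
        (if v ∈ triVerts [i, j, i, j, i, j] then G2.mult v.node else 0)
    rw [hn]
    by_cases h : v ∈ triVerts [i, j, i, j, i, j]
    · rw [if_pos h, if_pos (hx.2 h)]
    · rw [if_neg h, if_neg fun h' => h (hx.1 h')]
  · have hd : ∀ a, (triQuiver [j, i, j, i, j, i]).d (vertexG2 a) = G2.mult (vertexG2 a).node := by
      intro a
      have hf : ∀ (x : G2.Node) (k : ℤ), 0 ≤ k → k ≤ 3 → .f x k ∈ triVerts [j, i, j, i, j, i] :=
        fun x k h0 h1 => f_mem_triVerts.2 ⟨h0, by rw [c1]; exact h1⟩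
      refine if_pos ?_
      fin_cases a
      iterate 8 exact hf _ _ (by decide) (by decide)
      all_goals exact e_mem_triVerts
    have r0 : Represents vertexG2 (triQuiver [j, i, j, i, j, i]).w (arrowSum (arrowsG2 0)) :=
      represents_triForm c1 d1 arrowsG2_first
    have r1 := represents_mutateG2 0 (k := .f i 2) rfl r0 hd
    have r2 := represents_mutateG2 1 (k := .f i 1) rfl r1 hd
    have r3 := represents_mutateG2 2 (k := .f j 2) rfl r2 hd
    have r4 := represents_mutateG2 3 (k := .f i 2) rfl r3 hd
    have r5 := represents_mutateG2 4 (k := .f j 2) rfl r4 hd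
    have r6 := represents_mutateG2 5 (k := .f j 1) rfl r5 hd
    have r7 := represents_mutateG2 6 (k := .f j 2) rfl r6 hd
    have r8 := represents_mutateG2 7 (k := .f i 2) rfl r7 hd
    have r9 := represents_mutateG2 8 (k := .f i 1) rfl r8 hd
    have r10 := represents_mutateG2 9 (k := .f j 2) rfl r9 hd
    have r : Represents vertexG2 _ (arrowSum (arrowsG2 11)) :=
      represents_mutateG2 10 (k := .f i 2) rfl r10 hd
    have hQ : ∀ Q : WQuiver (QLabel G2.Node), Represents vertexG2 Q.w (arrowSum (arrowsG2 11)) →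
        (Q.relabel (QLabel.swapOneTwo j)).w = triForm (deco [i, j, i, j, i, j]) := by
      intro Q r
      have hsw : ∀ a, (QLabel.swapOneTwo j).symm (vertexG2 a) = vertexG2 (Equiv.swap 5 6 a) := by
        intro a
        have h5 : vertexG2 5 = .f j 1 := rfl
        have h6 : vertexG2 6 = .f j 2 := rfl
        rw [QLabel.swapOneTwo, Equiv.symm_swap, ← h5, ← h6]
        exact (vertexG2_injective.map_swap _ _ _).symm
      have hsw' : ∀ v, (QLabel.swapOneTwo j).symm v ∈ Set.range vertexG2 →
          v ∈ Set.range vertexG2 := by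
        rintro v ⟨a, ha⟩
        refine ⟨Equiv.swap 5 6 a, ?_⟩
        rw [← hsw, ha, QLabel.swapOneTwo, Equiv.symm_swap, Equiv.swap_apply_self]
      refine Represents.unique (φ := vertexG2) ⟨fun a b => ?_, fun u v h => ?_⟩
        (represents_triForm c2 d2 arrowsG2_last)
      · rw [← r.eq]
        change 6 * Q.w ((QLabel.swapOneTwo j).symm (vertexG2 a))
          ((QLabel.swapOneTwo j).symm (vertexG2 b)) = _
        rw [hsw, hsw]
      · have := r.support _ _ h
        exact ⟨hsw' u this.1, hsw' v this.2⟩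
    exact hQ _ r

/-! ### Sequences of moves between words of the longest element -/

theorem wordProd_block {b b' : List X.Node} (h : X.weyl.wordProd b = X.weyl.wordProd b')
    (l₁ l₂ : List X.Node) :
    X.weyl.wordProd (l₁ ++ b ++ l₂) = X.weyl.wordProd (l₁ ++ b' ++ l₂) := by
  simp only [X.weyl.wordProd_append, h]

theorem wordProd_iji {i j : X.Node} (h₁ : X.cartan i j = -1) (h₂ : X.cartan j i = -1) :
    X.weyl.wordProd [i, j, i] = X.weyl.wordProd [j, i, j] := by
  simpa [X.weyl.wordProd_cons, mul_assoc] using simple_braid h₁ h₂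

theorem wordProd_ijij {i j : X.Node} (h₁ : X.cartan i j = -1) (h₂ : X.cartan j i = -2) :
    X.weyl.wordProd [i, j, i, j] = X.weyl.wordProd [j, i, j, i] := by
  simpa [X.weyl.wordProd_cons, mul_assoc] using simple_braid₄ h₁ h₂

theorem wordProd_ij {i j : X.Node} (h : X.cartan i j = 0) :
    X.weyl.wordProd [i, j] = X.weyl.wordProd [j, i] := by
  simpa [X.weyl.wordProd_cons] using simple_comm h

theorem WordMove.wordProd_eq {p p' : List X.Node × WQuiver (QLabel X.Node)}
    (h : X.WordMove p p') : X.weyl.wordProd p.1 = X.weyl.wordProd p'.1 := by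
  cases h with
  | swap l₁ l₂ i j Q hij => exact wordProd_block (wordProd_ij hij) _ _
  | simplyLaced l₁ l₂ i j Q hij h₁ h₂ k m hk hm => exact wordProd_block (wordProd_iji h₁ h₂) _ _
  | doublyLaced l₁ l₂ i j Q h₁ h₂ k m hk hm => exact wordProd_block (wordProd_ijij h₁ h₂) _ _
  | doublyLacedInv l₁ l₂ i j Q h₁ h₂ k m hk hm =>
    exact wordProd_block (wordProd_ijij h₁ h₂).symm _ _
  | triplyLaced i j Q h₁ h₂ => exact (simple_braid₆ h₁ h₂).symm
  | triplyLacedInv i j Q h₁ h₂ => exact simple_braid₆ h₁ h₂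

theorem WordMove.length_eq {p p' : List X.Node × WQuiver (QLabel X.Node)}
    (h : X.WordMove p p') : p.1.length = p'.1.length := by
  cases h <;> simp

theorem WordMove.isLongestWord {p p' : List X.Node × WQuiver (QLabel X.Node)}
    (h : X.WordMove p p') (hl : X.IsLongestWord p.1) : X.IsLongestWord p'.1 :=
  hl.of_wordProd_eq h.wordProd_eq.symm h.length_eq.ge

theorem triQuiver_jiji {l₁ l₂ : List X.Node} {i j : X.Node}
    (h₁ : X.cartan i j = -1) (h₂ : X.cartan j i = -2) {k m : ℤ} (hk : k = l₁.count i + 1)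
    (hm : m = l₁.count j + 1) (hl : X.weyl.IsReduced (l₁ ++ [j, i, j, i] ++ l₂)) :
    (((triQuiver (l₁ ++ [j, i, j, i] ++ l₂)).mutate (.f j m)).mutate (.f i k)).mutate (.f j m) =
      triQuiver (l₁ ++ [i, j, i, j] ++ l₂) := by
  have hl' : X.weyl.IsReduced (l₁ ++ [i, j, i, j] ++ l₂) := by
    have h := hl.eq
    unfold CoxeterSystem.IsReduced
    rw [wordProd_block (wordProd_ijij h₁ h₂), h]
    simp
  rw [← triQuiver_ijij h₁ h₂ hk hm hl']
  simp only [mutate_mutate]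

theorem relabel_relabel_swapOneTwo (Q : WQuiver (QLabel X.Node)) (j : X.Node) :
    (Q.relabel (QLabel.swapOneTwo j)).relabel (QLabel.swapOneTwo j) = Q := by
  classical
  have h : ∀ v, (QLabel.swapOneTwo j).symm ((QLabel.swapOneTwo j).symm v) = v := fun v => by
    rw [QLabel.swapOneTwo, Equiv.symm_swap, Equiv.swap_apply_self]
  refine WQuiver.ext (Set.ext fun v => ?_) (Set.ext fun v => ?_) (funext fun v => ?_)
    (funext fun u => funext fun v => ?_)
  · exact iff_of_eq (congrArg (· ∈ Q.verts) (h v))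
  · exact iff_of_eq (congrArg (· ∈ Q.frozen) (h v))
  · exact congrArg Q.d (h v)
  · exact congrArg₂ Q.w (h u) (h v)

theorem triQuiver_ijijij {i j : X.Node} (h₁ : X.cartan i j = -1) (h₂ : X.cartan j i = -3)
    (hl : X.weyl.IsReduced [i, j, i, j, i, j]) :
    [QLabel.f i 2, .f j 2, .f i 1, .f i 2, .f j 2, .f j 1, .f j 2, .f i 2, .f j 2, .f i 1,
      .f i 2].foldl WQuiver.mutate ((triQuiver [i, j, i, j, i, j]).relabel (QLabel.swapOneTwo j)) =
        triQuiver [j, i, j, i, j, i] := by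
  rw [CoxeterSystem.IsReduced, simple_braid₆ h₁ h₂] at hl
  rw [← triQuiver_jijiji h₁ h₂ hl, relabel_relabel_swapOneTwo]
  simp only [List.foldl_cons, List.foldl_nil, mutate_mutate]

/-- The explicit quivers are compatible with the changes of words. -/
theorem WordMove.eq_triQuiver {p p' : List X.Node × WQuiver (QLabel X.Node)}
    (h : X.WordMove p p') (hl : X.weyl.IsReduced p.1) (hp : p.2 = triQuiver p.1) :
    p'.2 = triQuiver p'.1 := by
  cases h with
  | swap l₁ l₂ i j Q hij => exact hp.trans (triQuiver_swap hij)
  | simplyLaced l₁ l₂ i j Q hij h₁ h₂ k m hk hm =>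
    dsimp only at hp hl ⊢
    subst hp
    exact triQuiver_iji hij h₁ h₂ hk hm hl
  | doublyLaced l₁ l₂ i j Q h₁ h₂ k m hk hm =>
    dsimp only at hp hl ⊢
    subst hp
    exact triQuiver_ijij h₁ h₂ hk hm hl
  | doublyLacedInv l₁ l₂ i j Q h₁ h₂ k m hk hm =>
    dsimp only at hp hl ⊢
    subst hp
    exact triQuiver_jiji h₁ h₂ hk hm hl
  | triplyLaced i j Q h₁ h₂ =>
    dsimp only at hp hl ⊢
    subst hp
    exact triQuiver_jijiji h₁ h₂ hl
  | triplyLacedInv i j Q h₁ h₂ =>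
    dsimp only at hp hl ⊢
    subst hp
    exact triQuiver_ijijij h₁ h₂ hl

theorem WordMoves.isLongestWord {p p' : List X.Node × WQuiver (QLabel X.Node)}
    (h : X.WordMoves p p') (hl : X.IsLongestWord p.1) : X.IsLongestWord p'.1 := by
  induction h with
  | refl => exact hl
  | tail _ h ih => exact h.isLongestWord ih

theorem WordMoves.eq_triQuiver {p p' : List X.Node × WQuiver (QLabel X.Node)}
    (h : X.WordMoves p p') (hl : X.IsLongestWord p.1) (hp : p.2 = triQuiver p.1) :
    p'.2 = triQuiver p'.1 := by
  induction h with
  | refl => exact hp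
  | tail h' h ih => exact h.eq_triQuiver (WordMoves.isLongestWord h' hl).1 ih

/-- In type `G2` a braid move changes the whole word. -/
theorem eq_nil_of_isLongestWord {l₁ l₂ : List X.Node} {i j : X.Node} (h₁ : X.cartan i j = -1)
    (h₂ : X.cartan j i = -3) {b : List X.Node}
    (hb : b = [i, j, i, j, i, j] ∨ b = [j, i, j, i, j, i])
    (hl : X.IsLongestWord (l₁ ++ b ++ l₂)) : l₁ = [] ∧ l₂ = [] := by
  have hred : X.weyl.IsReduced b := by
    have := (hl.1.drop l₁.length).take b.length
    simpa using this
  have e1 : X.weyl.wordProd [i, j, i, j, i, j] = X.weyl.wordProd b := by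
    rcases hb with rfl | rfl
    · rfl
    · exact simple_braid₆ h₁ h₂
  have e2 : X.weyl.wordProd [j, i, j, i, j, i] = X.weyl.wordProd b := by
    rw [← simple_braid₆ h₁ h₂, e1]
  have hlen : b.length = 6 := by rcases hb with rfl | rfl <;> rfl
  have r1 : X.weyl.IsReduced (List.concat [i, j, i, j, i] j) := by
    have h := hred.eq
    unfold CoxeterSystem.IsReduced
    rw [show List.concat [i, j, i, j, i] j = [i, j, i, j, i, j] from rfl, e1, h, hlen]
    rfl
  have r2 : X.weyl.IsReduced (List.concat [j, i, j, i, j] i) := by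
    have h := hred.eq
    unfold CoxeterSystem.IsReduced
    rw [show List.concat [j, i, j, i, j] i = [j, i, j, i, j, i] from rfl, e2, h, hlen]
    rfl
  have d1 := X.isRightDescent_of_concat r1
  have d2 := X.isRightDescent_of_concat r2
  rw [show List.concat [i, j, i, j, i] j = [i, j, i, j, i, j] from rfl, e1] at d1
  rw [show List.concat [j, i, j, i, j] i = [j, i, j, i, j, i] from rfl, e2] at d2
  have hij : i ≠ j := ne_of_cartan (by rw [h₁]; norm_num)
  obtain rfl := eq_G2_of_cartan h₂
  have hall : ∀ a : G2.Node, a = i ∨ a = j := by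
    intro a
    have h1 := i.isLt
    have h2 := j.isLt
    have h3 := a.isLt
    simp only [rank] at h1 h2 h3
    have h4 : i.val ≠ j.val := fun h => hij (Fin.ext h)
    have h5 : a.val = i.val ∨ a.val = j.val := by omega
    exact h5.imp Fin.ext Fin.ext
  have hlong := hl.of_forall_descent hred fun a => by
    rcases hall a with rfl | rfl
    · exact d2
    · exact d1
  have h3 := hl.1.eq
  have h4 := hlong.2 (G2.weyl.wordProd (l₁ ++ b ++ l₂))
  rw [h3] at h4
  simp only [List.length_append] at h4
  exact ⟨List.eq_nil_of_length_eq_zero (by omega), List.eq_nil_of_length_eq_zero (by omega)⟩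

/-- Every braid relation between words of `w₀` is one of the changes of words, in one of the two
directions. -/
theorem BraidStep.exists_wordMove {l l' : List X.Node} (h : X.BraidStep l l')
    (hl : X.IsLongestWord l) (Q : WQuiver (QLabel X.Node)) : ∃ Q', X.WordMove (l, Q) (l', Q') := by
  obtain ⟨l₁, l₂, i, j, hij, rfl, rfl⟩ := h
  have hM := coxeterMatrix_apply X hij
  have hji := hij.symm
  rcases X.cartan_cases hij with ⟨h1, h2⟩ | ⟨h1, h2⟩ | ⟨h1, h2⟩ | ⟨h1, h2⟩ | ⟨h1, h2⟩ | ⟨h1, h2⟩ <;>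
    rw [h1, h2] at hM <;> norm_num [braidOrder] at hM <;> rw [hM] at hl ⊢ <;>
    simp only [CoxeterSystem.alternatingWord, List.concat_eq_append, List.nil_append,
      List.cons_append] at hl ⊢
  · exact ⟨_, .swap l₁ l₂ i j Q h1⟩
  · exact ⟨_, .simplyLaced l₁ l₂ j i Q hji h2 h1 _ _ rfl rfl⟩
  · exact ⟨_, .doublyLaced l₁ l₂ i j Q h1 h2 _ _ rfl rfl⟩
  · exact ⟨_, .doublyLacedInv l₁ l₂ j i Q h2 h1 _ _ rfl rfl⟩
  · obtain ⟨rfl, rfl⟩ := eq_nil_of_isLongestWord h1 h2 (Or.inl rfl) hl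
    simp only [List.nil_append, List.append_nil]
    exact ⟨_, .triplyLacedInv i j Q h1 h2⟩
  · obtain ⟨rfl, rfl⟩ := eq_nil_of_isLongestWord h2 h1 (Or.inr rfl) hl
    simp only [List.nil_append, List.append_nil]
    exact ⟨_, .triplyLaced j i Q h2 h1⟩

theorem exists_wordMoves {l l' : List X.Node} (hl : X.IsLongestWord l) (hl' : X.IsLongestWord l')
    (Q : WQuiver (QLabel X.Node)) : ∃ Q', X.WordMoves (l, Q) (l', Q') := by
  have h := X.reflTransGen_braidStep hl.1 hl'.1 (hl.wordProd_eq hl')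
  clear hl'
  induction h with
  | refl => exact ⟨Q, .refl⟩
  | tail h' h ih =>
    obtain ⟨Q₁, h₁⟩ := ih
    obtain ⟨Q₂, h₂⟩ := h.exists_wordMove (WordMoves.isLongestWord h₁ hl) Q₁
    exact ⟨Q₂, h₁.tail h₂⟩

theorem wordMoves_triQuiver {l l' : List X.Node} (hl : X.IsLongestWord l)
    (hl' : X.IsLongestWord l') : X.WordMoves (l, triQuiver l) (l', triQuiver l') := by
  obtain ⟨Q, h⟩ := exists_wordMoves hl hl' (triQuiver l)
  have hQ : Q = triQuiver l' := WordMoves.eq_triQuiver h hl rfl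
  rwa [hQ] at h

/-! ### The cluster variables in terms of the states of a word -/

/-- The indicator of the current vertices `f_i^c` before the letter at position `t`. -/
noncomputable def stateAt (l : List X.Node) (t : ℕ) : QLabel X.Node → ℚ :=
  state fun i => ((l.take t).count i : ℤ)

theorem count_take_succ (l : List X.Node) (t : Fin l.length) (i : X.Node) :
    (l.take (t + 1)).count i = (l.take t).count i + if l.get t = i then 1 else 0 := by
  rw [List.take_succ_eq_append_getElem t.isLt, List.count_append, List.count_singleton]
  simp

theorem count_take_lt {l : List X.Node} {t : Fin l.length} {i : X.Node} (h : l.get t = i) :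
    (l.take t).count i < l.count i := by
  have h1 := count_take_succ l t i
  rw [if_pos h] at h1
  have h2 := (List.take_sublist (t + 1 : ℕ) l).count_le i
  omega

/-- The momentum part of the monomial of a vertex in the upper half of the quiver. -/
noncomputable def momentum (l : List X.Node) (u : QLabel X.Node) (t : Fin l.length) : ℚ :=
  -2 * (stateAt l (t + 1) u - stateAt l t u)

open Classical in
/-- The position part of the monomial of a vertex in the upper half of the quiver. -/
noncomputable def position (l : List X.Node) : QLabel X.Node → Fin l.length → ℚ
  | .f i k, t => X.cartan (l.get t) i * (stateAt l t (.f i k) + stateAt l (t + 1) (.f i k)) / 2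
  | .e a, t => if (X.weyl.rightInvSeq l)[(t : ℕ)]? = some (X.weyl.simple a) then -2 else 0

theorem fMono_fst (l : List X.Node) (i : X.Node) (k : ℕ) (s : ℚ) (t : Fin l.length) :
    (X.fMono l i k s).1 t = s * ((if (l.take t).count i < k then (X.cartan (l.get t) i : ℚ) else 0)
      - (if l.get t = i ∧ (l.take t).count i + 1 = k then 1 else 0)) := by
  simp only [fMono]
  by_cases h : X.IsOcc l i k t
  · rw [if_pos h, if_pos (show l.get t = i ∧ (l.take t).count i + 1 = k from h)]
  · rw [if_neg h, if_neg (show ¬ (l.get t = i ∧ (l.take t).count i + 1 = k) from h)]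

theorem fMono_snd (l : List X.Node) (i : X.Node) (k : ℕ) (s : ℚ) (t : Fin l.length) :
    (X.fMono l i k s).2 t = if l.get t = i ∧ (l.take t).count i + 1 = k then 2 else 0 := by
  simp only [fMono]
  by_cases h : X.IsOcc l i k t
  · rw [if_pos h, if_pos (show l.get t = i ∧ (l.take t).count i + 1 = k from h)]
  · rw [if_neg h, if_neg (show ¬ (l.get t = i ∧ (l.take t).count i + 1 = k) from h)]

theorem position_f (l : List X.Node) (i : X.Node) (k : ℕ) (t : Fin l.length) :
    position l (.f i k) t = (if (l.take t).count i = k then (X.cartan (l.get t) i : ℚ) else 0) +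
      (if l.get t = i ∧ (l.take t).count i + 1 = k then 1 else 0) -
      (if l.get t = i ∧ (l.take t).count i = k then 1 else 0) := by
  have hs := count_take_succ l t i
  simp only [position, stateAt, state, hs]
  by_cases hg : l.get t = i
  · rw [hg, X.cartan_self]
    simp only [if_true, true_and, Nat.cast_inj]
    split_ifs <;> first | omega | norm_num
  · simp only [hg, if_false, false_and, add_zero, Nat.cast_inj]
    split_ifs <;> ring

theorem momentum_f (l : List X.Node) (i : X.Node) (k : ℕ) (t : Fin l.length) :
    momentum l (.f i k) t = (if l.get t = i ∧ (l.take t).count i = k then 2 else 0) -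
      (if l.get t = i ∧ (l.take t).count i + 1 = k then 2 else 0) := by
  have hs := count_take_succ l t i
  simp only [momentum, stateAt, state, hs]
  by_cases hg : l.get t = i
  · simp only [hg, if_true, true_and, Nat.cast_inj]
    split_ifs <;> first | omega | norm_num
  · simp only [hg, if_false, false_and, add_zero, Nat.cast_inj]
    ring

/-- There are no letters `i` beyond the last one. -/
theorem fMono_succ_count (l : List X.Node) (i : X.Node) (k : ℕ) (hk : k = l.count i) (s : ℚ) :
    X.fMono l i (k + 1) s = s • X.kInvMono l i := by
  have hc : ∀ t : Fin l.length, (l.take t).count i ≤ l.count i :=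
    fun t => (List.take_sublist _ l).count_le i
  refine Prod.ext (funext fun t => ?_) (funext fun t => ?_)
  · have hlt := count_take_lt (l := l) (t := t) (i := i)
    specialize hc t
    rw [fMono_fst, if_pos (by omega), if_neg (by rintro ⟨h1, h2⟩; have := hlt h1; omega)]
    simp [kInvMono]
  · have hlt := count_take_lt (l := l) (t := t) (i := i)
    rw [fMono_snd, if_neg (by rintro ⟨h1, h2⟩; have := hlt h1; omega)]
    simp [kInvMono]

/-- The exponent of `X_{f_i^k}` with `k > 0` is the ratio of two consecutive monomials `F_i^{k,+}`,
`F_i^{k+1,+}`, or of `F_i^{n_i,+}` and `K_i⁻¹`. -/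
theorem clusterMono_pos {l : List X.Node} {i : X.Node} {k : ℕ} (h0 : 0 < k) :
    X.clusterMono l (.f i k) = (position l (.f i k), momentum l (.f i k)) := by
  have h : X.clusterMono l (.f i k) = X.fMono l i (k + 1) 1 - X.fMono l i k 1 := by
    simp only [clusterMono, Nat.cast_inj, Nat.cast_pos, Int.toNat_natCast]
    split_ifs with h
    · rw [fMono_succ_count l i k h, h, one_smul]
    · rfl
  rw [h]
  refine Prod.ext (funext fun t => ?_) (funext fun t => ?_)
  · rw [Prod.fst_sub, Pi.sub_apply, fMono_fst, fMono_fst]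
    dsimp only
    rw [position_f]
    simp only [Nat.add_right_cancel_iff]
    split_ifs <;> first | omega | ring
  · rw [Prod.snd_sub, Pi.sub_apply, fMono_snd, fMono_snd]
    dsimp only
    rw [momentum_f]
    simp only [Nat.add_right_cancel_iff]

/-- At `k = 0` the momenta cancel, and the positions are doubled. -/
theorem clusterMono_zero {l : List X.Node} {i : X.Node} (h : 0 < l.count i) :
    X.clusterMono l (.f i 0) = (fun t => 2 * position l (.f i (0 : ℕ)) t, 0) := by
  have h : X.clusterMono l (.f i 0) = X.fMono l i 1 1 - X.fMono l i 1 (-1) := by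
    have h' : ¬ (0 : ℤ) = l.count i := by omega
    simp only [clusterMono, h', if_false, lt_irrefl, if_true]
  rw [h]
  refine Prod.ext (funext fun t => ?_) (funext fun t => ?_)
  · rw [Prod.fst_sub, Pi.sub_apply, fMono_fst, fMono_fst]
    dsimp only
    rw [position_f]
    simp only [Nat.lt_one_iff, Nat.succ_ne_zero, and_false, if_false, Nat.add_eq_right]
    ring
  · rw [Prod.snd_sub, Pi.sub_apply, fMono_snd, fMono_snd, sub_self]
    rfl

/-- For negative indices the momenta have the opposite sign; at the lowest vertex there is no
preceding term, which makes the difference by `K_i⁻¹`. -/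
theorem clusterMono_neg {l : List X.Node} {i : X.Node} {k : ℕ} (h0 : 0 < k) :
    X.clusterMono l (.f i (-k)) =
      (fun t => position l (.f i k) t - if k = l.count i then (X.cartan (l.get t) i : ℚ) else 0,
        fun t => - momentum l (.f i k) t) := by
  have e1 : ¬ (-k : ℤ) = l.count i := by omega
  have e2 : ¬ (0 : ℤ) < -k := by omega
  have e3 : ¬ (-k : ℤ) = 0 := by omega
  have h' : X.clusterMono l (.f i (-k)) = X.fMono l i k (-1) - X.fMono l i (k + 1) (-1) -
      if k = l.count i then X.kInvMono l i else 0 := by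
    by_cases h : k = l.count i
    · have e4 : (-k : ℤ) = - l.count i := by omega
      rw [if_pos h, fMono_succ_count l i k h]
      simp only [clusterMono, e1, e2, e3, if_false]
      rw [if_pos e4, ← h]
      simp
    · have e4 : ¬ (-k : ℤ) = - l.count i := by omega
      simp only [clusterMono, e1, e2, e3, e4, if_false, neg_neg, Int.toNat_natCast, h, sub_zero]
  have hK : (if k = l.count i then X.kInvMono l i else 0) =
      (fun t => if k = l.count i then (X.cartan (l.get t) i : ℚ) else 0, 0) := by
    split_ifs <;> rfl
  rw [h', hK]
  refine Prod.ext (funext fun t => ?_) (funext fun t => ?_)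
  · rw [Prod.fst_sub, Prod.fst_sub, Pi.sub_apply, Pi.sub_apply, fMono_fst, fMono_fst]
    dsimp only
    rw [position_f]
    simp only [Nat.add_right_cancel_iff, sub_left_inj]
    split_ifs <;> first | omega | ring
  · rw [Prod.snd_sub, Prod.snd_sub, Pi.sub_apply, Pi.sub_apply, fMono_snd, fMono_snd]
    dsimp only
    rw [momentum_f]
    simp only [Nat.add_right_cancel_iff, Pi.zero_apply]
    ring

theorem clusterMono_e (l : List X.Node) (a : X.Node) :
    X.clusterMono l (.e a) = (position l (.e a), 0) := by
  refine Prod.ext (funext fun t => ?_) rfl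
  simp only [clusterMono, position]

/-! ### The 𝒟-quiver as an amalgamation -/

theorem wordForm_decoAt (g : X.coxeterMatrix.Group) (l : List X.Node) (c : X.Node → ℤ)
    (u v : QLabel X.Node) :
    wordForm c (decoAt g l) u v = ∑ t : Fin l.length,
      letterForm (fun i => c i + (l.take t).count i)
        (l.get t, label ((X.weyl.wordProd (l.drop (t + 1)) * g)⁻¹ * X.weyl.simple (l.get t) *
          (X.weyl.wordProd (l.drop (t + 1)) * g))) u v := by
  induction l generalizing c with
  | nil => rfl
  | cons a l ih =>
    rw [decoAt, wordForm, ih]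
    simp only [List.length_cons]
    rw [Fin.sum_univ_succ]
    refine congrArg₂ _ (by simp) (Finset.sum_congr rfl fun t _ => ?_)
    have : (fun i => bump c a i + ((l.take t).count i : ℤ)) =
        fun i => c i + (((a :: l).take t.succ).count i : ℤ) := by
      funext i
      simp only [bump, Fin.val_succ, List.take_succ_cons, List.count_cons, beq_iff_eq]
      by_cases h : i = a
      · simp [h]; ring
      · have h' : ¬ a = i := fun h' => h h'.symm
        simp [h, h']
    rw [this]
    simp

theorem state_bump_count (l : List X.Node) (t : Fin l.length) :
    state (bump (fun i => ((l.take t).count i : ℤ)) (l.get t)) = stateAt l (t + 1) := by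
  unfold stateAt
  congr 1
  funext i
  rw [count_take_succ]
  unfold bump
  by_cases h : i = l.get t
  · rw [if_pos h, if_pos h.symm, Nat.cast_add, Nat.cast_one]
  · rw [if_neg h, if_neg fun h' => h h'.symm, add_zero]

theorem rightInvSeq_getElem? (l : List X.Node) (t : Fin l.length) :
    (X.weyl.rightInvSeq l)[(t : ℕ)]? = some ((X.weyl.wordProd (l.drop (t + 1)))⁻¹ *
      X.weyl.simple (l.get t) * X.weyl.wordProd (l.drop (t + 1))) := by
  rw [List.getElem?_eq_getElem (by simp), X.weyl.getElem_rightInvSeq l t t.isLt]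
  simp

/-- The weights of the explicit quiver as a sum over the positions of the letters. -/
theorem wordForm_deco (l : List X.Node) (u v : QLabel X.Node) :
    wordForm 0 (deco l) u v = ∑ t : Fin l.length,
      (X.gram u.node v.node / 2 *
        (stateAt l (t + 1) u * stateAt l t v - stateAt l t u * stateAt l (t + 1) v) +
      X.mult (l.get t) * wedge (eInd (((X.weyl.rightInvSeq l)[(t : ℕ)]?).bind label))
        (fun x => stateAt l t x - stateAt l (t + 1) x) u v) := by
  rw [deco, wordForm_decoAt]
  refine Finset.sum_congr rfl fun t _ => ?_
  rw [rightInvSeq_getElem?]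
  simp only [Pi.zero_apply, zero_add, letterForm, state_bump_count, mul_one, Option.bind_some]
  rfl

/-- The pairing of the momenta of `u` with the positions of `v`. -/
noncomputable def monoPair (l : List X.Node) (u v : QLabel X.Node) : ℚ :=
  (∑ t : Fin l.length, X.mult (l.get t) * (momentum l u t * position l v t)) / 4

theorem stateAt_succ_of_ne {l : List X.Node} {t : Fin l.length} {i : X.Node} (h : l.get t ≠ i)
    (k : ℤ) : stateAt l (t + 1) (.f i k) = stateAt l t (.f i k) := by
  simp only [stateAt, state, count_take_succ, if_neg h, add_zero]

theorem mult_mul_momentum_mul_cartan (l : List X.Node) (i j : X.Node) (k : ℤ) (t : Fin l.length) :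
    X.mult (l.get t) * (momentum l (.f i k) t * X.cartan (l.get t) j) =
      2 * X.gram i j * (stateAt l (t + 1) (.f i k) - stateAt l t (.f i k)) := by
  by_cases h : l.get t = i
  · rw [h, gram, momentum]
    ring
  · rw [momentum, stateAt_succ_of_ne h]
    ring

theorem mult_mul_momentum_mul_position (l : List X.Node) (i j : X.Node) (k m : ℤ)
    (t : Fin l.length) :
    X.mult (l.get t) * (momentum l (.f i k) t * position l (.f j m) t) =
      X.gram i j * (stateAt l (t + 1) (.f i k) - stateAt l t (.f i k)) *
        (stateAt l t (.f j m) + stateAt l (t + 1) (.f j m)) := by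
  have h := mult_mul_momentum_mul_cartan l i j k t
  rw [position]
  linear_combination h * (stateAt l t (.f j m) + stateAt l (t + 1) (.f j m)) / 2

/-- The weights between two rows are the antisymmetrized pairing of momenta and positions. -/
theorem triForm_f_f (l : List X.Node) (i j : X.Node) (k m : ℤ) :
    triForm (deco l) (.f i k) (.f j m) =
      monoPair l (.f i k) (.f j m) - monoPair l (.f j m) (.f i k) := by
  rw [triForm, labelForm_f_left, add_zero, wordForm_deco, monoPair, monoPair, ← sub_div,
    ← Finset.sum_sub_distrib, Finset.sum_div]
  refine Finset.sum_congr rfl fun t _ => ?_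
  rw [mult_mul_momentum_mul_position, mult_mul_momentum_mul_position, X.gram_comm j i]
  simp only [wedge, eInd_f, QLabel.node]
  ring

theorem sum_telescope (l : List X.Node) (F : ℕ → ℚ) :
    ∑ t : Fin l.length, (F (t + 1) - F t) = F l.length - F 0 := by
  rw [Fin.sum_univ_eq_sum_range fun t => F (t + 1) - F t, Finset.sum_range_sub]

/-- The product rule for the states of a word. -/
theorem monoPair_add_monoPair (l : List X.Node) (i j : X.Node) (k m : ℤ) :
    monoPair l (.f i k) (.f j m) + monoPair l (.f j m) (.f i k) =
      X.gram i j / 2 * (stateAt l l.length (.f i k) * stateAt l l.length (.f j m) -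
        stateAt l 0 (.f i k) * stateAt l 0 (.f j m)) := by
  rw [← sum_telescope l fun t => stateAt l t (.f i k) * stateAt l t (.f j m), monoPair, monoPair,
    ← add_div, ← Finset.sum_add_distrib, Finset.sum_div, Finset.mul_sum]
  refine Finset.sum_congr rfl fun t _ => ?_
  rw [mult_mul_momentum_mul_position, mult_mul_momentum_mul_position, X.gram_comm j i]
  ring

theorem sum_momentum_mul_cartan (l : List X.Node) (i j : X.Node) (k : ℤ) :
    (∑ t : Fin l.length, X.mult (l.get t) * (momentum l (.f i k) t * X.cartan (l.get t) j)) / 4 =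
      X.gram i j / 2 * (stateAt l l.length (.f i k) - stateAt l 0 (.f i k)) := by
  rw [← sum_telescope l fun t => stateAt l t (.f i k), Finset.sum_div, Finset.mul_sum]
  refine Finset.sum_congr rfl fun t _ => ?_
  rw [mult_mul_momentum_mul_cartan]
  ring

theorem triForm_f_e (l : List X.Node) (i a : X.Node) (k : ℤ) :
    triForm (deco l) (.f i k) (.e a) = monoPair l (.f i k) (.e a) := by
  rw [triForm, labelForm_f_left, add_zero, wordForm_deco, monoPair, Finset.sum_div]
  refine Finset.sum_congr rfl fun t _ => ?_
  have h : eInd (((X.weyl.rightInvSeq l)[(t : ℕ)]?).bind label) (.e a) =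
      -position l (.e a) t / 2 := by
    have hb : ((X.weyl.rightInvSeq l)[(t : ℕ)]?).bind label = some a ↔
        (X.weyl.rightInvSeq l)[(t : ℕ)]? = some (X.weyl.simple a) := by
      rw [rightInvSeq_getElem?, Option.bind_some, label_eq_some, Option.some_inj]
    by_cases hc : (X.weyl.rightInvSeq l)[(t : ℕ)]? = some (X.weyl.simple a)
    · simp only [eInd, position]
      rw [if_pos (hb.2 hc), if_pos hc]
      norm_num
    · simp only [eInd, position]
      rw [if_neg fun h' => hc (hb.1 h'), if_neg hc]
      norm_num
  have h0 : ∀ s, stateAt l s (.e a) = 0 := fun s => rfl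
  simp only [wedge, eInd_f, h, h0, momentum]
  ring

theorem stateAt_length (l : List X.Node) (i : X.Node) (k : ℕ) :
    stateAt l l.length (.f i k) = if k = l.count i then 1 else 0 := by
  simp only [stateAt, state, List.take_length, Nat.cast_inj, eq_comm]

theorem stateAt_zero (l : List X.Node) (i : X.Node) (k : ℕ) :
    stateAt l 0 (.f i k) = if k = 0 then 1 else 0 := by
  simp [stateAt, state, eq_comm]

theorem commutator_eq (l : List X.Node) (A B : X.Mono l) :
    X.commutator l A B = (∑ t : Fin l.length, X.mult (l.get t) * (A.2 t * B.1 t)) / 4 -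
      (∑ t : Fin l.length, X.mult (l.get t) * (B.2 t * A.1 t)) / 4 := by
  rw [commutator, ← sub_div, ← Finset.sum_sub_distrib]
  congr 1
  refine Finset.sum_congr rfl fun t _ => ?_
  ring

/-- The vertex `f_i^{|k|}` in the upper half of the quiver. -/
def upper : QLabel X.Node → QLabel X.Node
  | .f i k => .f i k.natAbs
  | .e a => .e a

/-- The sign of the momenta of a vertex. -/
def momentumSign : QLabel X.Node → ℚ
  | .f _ k => k.sign
  | .e _ => 0

/-- The positions of a vertex on the symmetry axis are twice as large as in the upper half. -/
def positionFactor : QLabel X.Node → ℚ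
  | .f _ k => if k = 0 then 2 else 1
  | .e _ => 1

/-- The monomial of a lowest vertex does not contain the term `K_i⁻¹`. -/
def lowest (l : List X.Node) : QLabel X.Node → ℚ
  | .f i k => if k = -(l.count i : ℤ) then 1 else 0
  | .e _ => 0

theorem clusterMono_eq {l : List X.Node} (hl : ∀ i, 0 < l.count i) (u : QLabel X.Node) :
    X.clusterMono l u =
      (fun t => positionFactor u * position l (upper u) t -
        lowest l u * X.cartan (l.get t) u.node,
      fun t => momentumSign u * momentum l (upper u) t) := by
  rcases u with ⟨i, k⟩ | a
  · have hn := hl i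
    rcases lt_trichotomy k 0 with h | h | h
    · obtain ⟨n, rfl⟩ : ∃ n : ℕ, k = -n := ⟨k.natAbs, by omega⟩
      have hn0 : 0 < n := by omega
      rw [clusterMono_neg hn0]
      have h1 : (-(n : ℤ)).sign = -1 := Int.sign_eq_neg_one_of_neg h
      simp only [positionFactor, lowest, momentumSign, upper, h1, QLabel.node, Int.natAbs_neg,
        Int.natAbs_natCast, h.ne, if_false, neg_inj, Nat.cast_inj]
      refine Prod.ext (funext fun t => ?_) (funext fun t => ?_)
      · dsimp only
        split_ifs <;> ring
      · push_cast; ring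
    · subst h
      rw [clusterMono_zero hn]
      have h1 : ¬ (0 : ℤ) = -(l.count i : ℤ) := by omega
      refine Prod.ext (funext fun t => ?_) (funext fun t => ?_)
      · simp [positionFactor, lowest, upper, h1]
      · simp [momentumSign]
    · obtain ⟨n, rfl⟩ : ∃ n : ℕ, k = n := ⟨k.natAbs, by omega⟩
      rw [clusterMono_pos (by omega)]
      have h1 : (n : ℤ).sign = 1 := Int.sign_eq_one_of_pos h
      have h2 : ¬ (n : ℤ) = -(l.count i : ℤ) := by omega
      refine Prod.ext (funext fun t => ?_) (funext fun t => ?_)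
      · have h3 : n ≠ 0 := by omega
        simp [positionFactor, lowest, upper, h2, h3]
      · simp [momentumSign, h1, upper]
  · rw [clusterMono_e]
    refine Prod.ext (funext fun t => ?_) (funext fun t => ?_)
    · simp [positionFactor, lowest, upper]
    · simp [momentumSign]

theorem commutator_clusterMono {l : List X.Node} (hl : ∀ i, 0 < l.count i) (u v : QLabel X.Node) :
    X.commutator l (X.clusterMono l u) (X.clusterMono l v) =
      momentumSign u * positionFactor v * monoPair l (upper u) (upper v) -
      momentumSign v * positionFactor u * monoPair l (upper v) (upper u) -
      momentumSign u * lowest l v * ((∑ t : Fin l.length, X.mult (l.get t) *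
        (momentum l (upper u) t * X.cartan (l.get t) v.node)) / 4) +
      momentumSign v * lowest l u * ((∑ t : Fin l.length, X.mult (l.get t) *
        (momentum l (upper v) t * X.cartan (l.get t) u.node)) / 4) := by
  rw [commutator_eq, clusterMono_eq hl, clusterMono_eq hl, monoPair, monoPair]
  simp only [Finset.sum_div, Finset.mul_sum, ← Finset.sum_sub_distrib, ← Finset.sum_add_distrib]
  refine Finset.sum_congr rfl fun t _ => ?_
  ring

theorem triForm_f_f_of_neg {l : List X.Node} {i : X.Node} {k : ℤ} (h : k < 0)
    (v : QLabel X.Node) : triForm (deco l) (.f i k) v = 0 := by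
  rw [triForm, labelForm_f_left, wordForm_eq_zero _ _ _ _ (Or.inl h), add_zero]

theorem commutator_f_f {l : List X.Node} (hl : ∀ i, 0 < l.count i) (i j : X.Node) (k m : ℤ)
    (hk : -(l.count i : ℤ) ≤ k ∧ k ≤ l.count i) (hm : -(l.count j : ℤ) ≤ m ∧ m ≤ l.count j) :
    X.commutator l (X.clusterMono l (.f i k)) (X.clusterMono l (.f j m)) =
      triForm (deco l) (.f i k) (.f j m) - triForm (deco l) (.f i (-k)) (.f j (-m)) := by
  have hi := hl i
  have hj := hl j
  have h1 := triForm_f_f l i j k.natAbs m.natAbs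
  have h2 := monoPair_add_monoPair l i j k.natAbs m.natAbs
  have h3 := sum_momentum_mul_cartan l i j k.natAbs
  have h4 := sum_momentum_mul_cartan l j i m.natAbs
  have hL : ∀ (i : X.Node) (k : ℤ), k < 0 → lowest l (.f i k) =
      if k.natAbs = l.count i then 1 else 0 := by
    intro i k hk
    simp only [lowest]
    congr 1
    exact propext (by omega)
  have hL' : ∀ (i : X.Node) (k : ℤ), 0 ≤ k → lowest l (.f i k) = 0 := by
    intro i k hk
    have := hl i
    exact if_neg (by omega)
  have hS : ∀ (i : X.Node) (k : ℤ) (v : QLabel X.Node), k < 0 → triForm (deco l) (.f i k) v = 0 :=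
    fun i k v h => triForm_f_f_of_neg h v
  have hS' : ∀ (i : X.Node) (k : ℤ) (v : QLabel X.Node), k < 0 →
      triForm (deco l) v (.f i k) = 0 := fun i k v h => by
    rw [triForm_skew, triForm_f_f_of_neg h, neg_zero]
  rw [commutator_clusterMono hl]
  simp only [upper, QLabel.node]
  rw [h3, h4]
  rw [stateAt_length, stateAt_zero, stateAt_length, stateAt_zero] at h2 ⊢
  rw [X.gram_comm j i]
  have hn : ∀ k : ℤ, k < 0 → -k = (k.natAbs : ℤ) ∧ 0 ≤ k.natAbs ∧ k.natAbs ≠ 0 := by omega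
  have hp : ∀ k : ℤ, 0 < k → k = (k.natAbs : ℤ) ∧ -k < 0 ∧ k.natAbs ≠ 0 ∧ k ≠ 0 := by omega
  have sn : ∀ (i : X.Node) (k : ℤ), k < 0 → momentumSign (QLabel.f i k) = -1 := fun i k h => by
    simp [momentumSign, Int.sign_eq_neg_one_of_neg h]
  have sp : ∀ (i : X.Node) (k : ℤ), 0 < k → momentumSign (QLabel.f i k) = 1 := fun i k h => by
    simp [momentumSign, Int.sign_eq_one_of_pos h]
  have sz : ∀ i : X.Node, momentumSign (QLabel.f i 0) = 0 := fun i => by simp [momentumSign]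
  have fz : ∀ i : X.Node, positionFactor (QLabel.f i 0) = 2 := fun i => by simp [positionFactor]
  have fn : ∀ (i : X.Node) (k : ℤ), k ≠ 0 → positionFactor (QLabel.f i k) = 1 := fun i k h => by
    simp [positionFactor, h]
  rcases lt_trichotomy k 0 with hk0 | rfl | hk0 <;> rcases lt_trichotomy m 0 with hm0 | rfl | hm0
  · rw [hS i k _ hk0, (hn k hk0).1, (hn m hm0).1, sn i k hk0, sn j m hm0, fn i k hk0.ne,
      fn j m hm0.ne, hL i k hk0, hL j m hm0, h1, if_neg (hn k hk0).2.2, if_neg (hn m hm0).2.2]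
    ring
  · rw [hS i k _ hk0, (hn k hk0).1, sn i k hk0, sz, fn i k hk0.ne, fz, hL' j 0 le_rfl]
    rw [if_neg (hn k hk0).2.2] at h2
    simp only [Int.natAbs_zero, neg_zero, Nat.cast_zero, hj.ne, if_false, if_true] at h1 h2 ⊢
    linear_combination h1 - h2
  · rw [hS i k _ hk0, hS' j (-m) _ (hp m hm0).2.1, sn i k hk0, sp j m hm0, fn i k hk0.ne,
      fn j m (hp m hm0).2.2.2, hL' j m hm0.le, hL i k hk0, if_neg (hn k hk0).2.2,
      if_neg (hp m hm0).2.2.1]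
    rw [if_neg (hn k hk0).2.2, if_neg (hp m hm0).2.2.1] at h2
    linear_combination -h2
  · rw [hS' j m _ hm0, (hn m hm0).1, sn j m hm0, sz, fn j m hm0.ne, fz, hL' i 0 le_rfl]
    rw [if_neg (hn m hm0).2.2] at h2
    simp only [Int.natAbs_zero, neg_zero, Nat.cast_zero, hi.ne, if_false, if_true] at h1 h2 ⊢
    linear_combination h1 + h2
  · rw [sz, sz]
    simp
  · rw [hS' j (-m) _ (hp m hm0).2.1, sz, sp j m hm0, fz, hL' i 0 le_rfl]
    rw [if_neg (hp m hm0).2.2.1] at h2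
    rw [← (hp m hm0).1] at h1 h2 ⊢
    simp only [Int.natAbs_zero, Nat.cast_zero, hi.ne, if_false, if_true] at h1 h2 ⊢
    linear_combination -h1 - h2
  · rw [hS i (-k) _ (hp k hk0).2.1, hS' j m _ hm0, sp i k hk0, sn j m hm0, fn j m hm0.ne,
      fn i k (hp k hk0).2.2.2, hL' i k hk0.le, hL j m hm0, if_neg (hp k hk0).2.2.1,
      if_neg (hn m hm0).2.2]
    rw [if_neg (hp k hk0).2.2.1, if_neg (hn m hm0).2.2] at h2
    linear_combination h2
  · rw [hS i (-k) _ (hp k hk0).2.1, sz, sp i k hk0, fz, hL' j 0 le_rfl]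
    rw [if_neg (hp k hk0).2.2.1] at h2
    rw [← (hp k hk0).1] at h1 h2 ⊢
    simp only [Int.natAbs_zero, Nat.cast_zero, hj.ne, if_false, if_true] at h1 h2 ⊢
    linear_combination -h1 + h2
  · rw [hS i (-k) _ (hp k hk0).2.1, sp i k hk0, sp j m hm0, fn j m (hp m hm0).2.2.2,
      fn i k (hp k hk0).2.2.2, hL' i k hk0.le, hL' j m hm0.le]
    rw [← (hp k hk0).1, ← (hp m hm0).1] at h1 ⊢
    linear_combination -h1

theorem commutator_f_e {l : List X.Node} (hl : ∀ i, 0 < l.count i) (i a : X.Node) (k : ℤ) :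
    X.commutator l (X.clusterMono l (.f i k)) (X.clusterMono l (.e a)) =
      triForm (deco l) (.f i k) (.e a) - triForm (deco l) (.f i (-k)) (.e a) := by
  rw [commutator_clusterMono hl]
  simp only [upper, momentumSign, positionFactor, lowest]
  rcases lt_trichotomy k 0 with h | rfl | h
  · rw [triForm_f_f_of_neg h, triForm_f_e, Int.sign_eq_neg_one_of_neg h,
      show (k.natAbs : ℤ) = -k by omega]
    push_cast
    ring
  · simp
  · rw [triForm_f_f_of_neg (k := -k) (by omega), triForm_f_e, Int.sign_eq_one_of_pos h,
      show (k.natAbs : ℤ) = k by omega]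
    push_cast
    ring

theorem commutator_skew (l : List X.Node) (A B : X.Mono l) :
    X.commutator l A B = - X.commutator l B A := by
  rw [commutator_eq, commutator_eq]; ring

/-- The commutators of the cluster variables, as the weights of the explicit quiver glued to its
mirror image. -/
theorem commutator_clusterMono_eq {l : List X.Node} (hl : ∀ i, 0 < l.count i) {u v : QLabel X.Node}
    (hu : u ∈ X.doubleVerts l) (hv : v ∈ X.doubleVerts l) :
    X.commutator l (X.clusterMono l u) (X.clusterMono l v) =
      - triForm (deco l) (QLabel.mirror.symm u) (QLabel.mirror.symm v) + triForm (deco l) u v := by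
  rcases u with ⟨i, k⟩ | a <;> rcases v with ⟨j, m⟩ | b
  · rw [commutator_f_f hl i j k m hu hv]
    simp only [QLabel.mirror, Equiv.coe_fn_symm_mk]
    ring
  · rw [commutator_f_e hl]
    simp only [QLabel.mirror, Equiv.coe_fn_symm_mk]
    ring
  · rw [commutator_skew, commutator_f_e hl, triForm_skew _ (.f j m),
      triForm_skew _ (.f j (-m))]
    simp only [QLabel.mirror, Equiv.coe_fn_symm_mk]
    ring
  · rw [commutator_clusterMono hl]
    simp [momentumSign, QLabel.mirror]

theorem mirror_symm_mem {l : List X.Node} (i : X.Node) (k : ℤ) :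
    QLabel.mirror.symm (.f i k) ∈ triVerts l ↔ 0 ≤ -k ∧ -k ≤ (l.count i : ℤ) :=
  f_mem_triVerts

theorem mirror_symm_mem_frozen {l : List X.Node} (i : X.Node) (k : ℤ) :
    QLabel.mirror.symm (.f i k) ∈ triFrozen l ↔ -k = 0 ∨ -k = (l.count i : ℤ) :=
  f_mem_triFrozen

/-- Two copies of the explicit quiver are glued to the `𝒟_𝔤`-quiver. -/
theorem isAmalgamation_triQuiver {l : List X.Node} (hl : ∀ i, 0 < l.count i) :
    IsAmalgamation (X.mirrorQuiver (triQuiver l)) (triQuiver l) (X.doubleQuiver l) := by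
  have hfd : ∀ i k, QLabel.f i k ∈ X.doubleVerts l ↔ -(l.count i : ℤ) ≤ k ∧ k ≤ l.count i :=
    fun i k => Iff.rfl
  have hff : ∀ i k, QLabel.f i k ∈ X.doubleFrozen l ↔ k = -(l.count i : ℤ) ∨ k = l.count i :=
    fun i k => Iff.rfl
  have hv1 : ∀ v, v ∈ (X.mirrorQuiver (triQuiver l)).verts ↔ QLabel.mirror.symm v ∈ triVerts l :=
    fun v => Iff.rfl
  have hf1 : ∀ v, v ∈ (X.mirrorQuiver (triQuiver l)).frozen ↔
    QLabel.mirror.symm v ∈ triFrozen l := fun v => Iff.rfl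
  have hv2 : ∀ v, v ∈ (triQuiver l).verts ↔ v ∈ triVerts l := fun v => Iff.rfl
  have hf2 : ∀ v, v ∈ (triQuiver l).frozen ↔ v ∈ triFrozen l := fun v => Iff.rfl
  have hv : ∀ v, v ∈ (X.doubleQuiver l).verts ↔ v ∈ X.doubleVerts l := fun v => Iff.rfl
  have hf : ∀ v, v ∈ (X.doubleQuiver l).frozen ↔ v ∈ X.doubleFrozen l := fun v => Iff.rfl
  have hme : ∀ a : X.Node, QLabel.mirror.symm (.e a) ∈ triVerts l := fun a => e_mem_triVerts
  have hme' : ∀ a : X.Node, QLabel.mirror.symm (.e a) ∈ triFrozen l := fun a => e_mem_triFrozen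
  have hsub1 : ∀ v, QLabel.mirror.symm v ∈ triVerts l → v ∈ X.doubleVerts l := by
    rintro (⟨i, k⟩ | a) h
    · rw [mirror_symm_mem] at h
      rw [hfd]
      omega
    · trivial
  have hsub2 : ∀ v, v ∈ triVerts l → v ∈ X.doubleVerts l := by
    rintro (⟨i, k⟩ | a) h
    · rw [f_mem_triVerts] at h
      rw [hfd]
      omega
    · trivial
  constructor
  · rintro (⟨i, k⟩ | a) ⟨h1, h2⟩
    · rw [hv1, mirror_symm_mem] at h1
      rw [hv2, f_mem_triVerts] at h2
      rw [hf1, mirror_symm_mem_frozen]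
      omega
    · exact hme' a
  · rintro (⟨i, k⟩ | a) ⟨h1, h2⟩
    · rw [hv1, mirror_symm_mem] at h1
      rw [hv2, f_mem_triVerts] at h2
      rw [hf2, f_mem_triFrozen]
      omega
    · exact e_mem_triFrozen
  · ext v
    rw [Set.mem_union, hv, hv1, hv2]
    rcases v with ⟨i, k⟩ | a
    · rw [mirror_symm_mem, f_mem_triVerts, hfd]
      omega
    · exact iff_of_true trivial (Or.inr e_mem_triVerts)
  · ext v
    rw [Set.mem_sdiff, Set.mem_union, Set.mem_inter_iff, hf, hf1, hf2, hv1, hv2]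
    rcases v with ⟨i, k⟩ | a
    · rw [mirror_symm_mem, mirror_symm_mem_frozen, f_mem_triVerts, f_mem_triFrozen, hff]
      have := hl i
      omega
    · exact iff_of_false id fun h => h.2 ⟨hme a, e_mem_triVerts⟩
  · intro v h
    have hn : (QLabel.mirror.symm v).node = v.node := by rcases v with ⟨i, k⟩ | a <;> rfl
    refine (if_pos (hsub1 v h)).trans (Eq.symm ?_)
    rw [← hn]
    exact if_pos h
  · intro v h
    exact (if_pos (hsub2 v h)).trans (if_pos h).symm
  · intro u v
    classical
    change (if u ∈ X.doubleVerts l ∧ v ∈ X.doubleVerts l then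
      X.commutator l (X.clusterMono l u) (X.clusterMono l v) else 0) =
        - triForm (deco l) (QLabel.mirror.symm u) (QLabel.mirror.symm v) + triForm (deco l) u v
    split_ifs with h
    · exact commutator_clusterMono_eq hl h.1 h.2
    · have h1 : triForm (deco l) u v = 0 := by
        by_contra hc
        have := (triQuiver l).support u v hc
        exact h ⟨hsub2 _ this.1, hsub2 _ this.2⟩
      have h2 : triForm (deco l) (QLabel.mirror.symm u) (QLabel.mirror.symm v) = 0 := by
        by_contra hc
        have := (triQuiver l).support _ _ hc
        exact h ⟨hsub1 _ this.1, hsub1 _ this.2⟩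
      rw [h1, h2]
      ring

/-! ### Reversal of a word and the Dynkin involution -/

theorem IsDynkinInvolution.label_conj {l : List X.Node} {η : Equiv.Perm X.Node}
    (h : X.IsDynkinInvolution l η) (g : X.coxeterMatrix.Group) :
    label (X.weyl.wordProd l * g * (X.weyl.wordProd l)⁻¹) = (label g).map η := by
  ext b
  rw [label_eq_some, Option.map_eq_some_iff]
  constructor
  · intro hb
    refine ⟨η.symm b, ?_, η.apply_symm_apply b⟩
    have h1 := h (η.symm b)
    rw [η.apply_symm_apply, ← hb] at h1
    rw [label_eq_some]
    have h2 : X.weyl.wordProd l * X.weyl.simple (η.symm b) = X.weyl.wordProd l * g := by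
      rw [h1]; group
    exact (mul_left_cancel h2).symm
  · rintro ⟨a, ha, rfl⟩
    rw [label_eq_some] at ha
    rw [ha, h a]
    group

/-- Right inversions of the reversed word are left inversions of the word, which `w₀` conjugates to
right inversions. -/
theorem decoAt_reverse {w : List X.Node} {η : Equiv.Perm X.Node} (hη : X.IsDynkinInvolution w η)
    (l : List X.Node) (g h : X.coxeterMatrix.Group)
    (hw : X.weyl.wordProd w = g⁻¹ * X.weyl.wordProd l * h) :
    decoAt g l.reverse = ((decoAt h l).map (Prod.map id (Option.map η))).reverse := by
  induction l generalizing g with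
  | nil => rfl
  | cons i l ih =>
    rw [List.reverse_cons, decoAt_append]
    have h1 : X.weyl.wordProd w = (X.weyl.wordProd [i] * g)⁻¹ * X.weyl.wordProd l * h := by
      rw [hw, X.weyl.wordProd_cons, X.weyl.wordProd_singleton, mul_inv_rev, X.weyl.inv_simple]
      group
    rw [ih _ h1]
    simp only [decoAt, List.map_cons, List.reverse_cons]
    congr 1
    have h2 : g⁻¹ * X.weyl.simple i * g = X.weyl.wordProd w * ((X.weyl.wordProd l * h)⁻¹ *
        X.weyl.simple i * (X.weyl.wordProd l * h)) * (X.weyl.wordProd w)⁻¹ := by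
      rw [h1, X.weyl.wordProd_singleton]
      have := X.weyl.simple_mul_simple_self i
      simp only [mul_inv_rev, X.weyl.inv_simple, inv_inv, mul_assoc, mul_inv_cancel_left]
      simp only [X.weyl.simple_mul_simple_cancel_left]
    simp only [X.weyl.wordProd_nil, one_mul, Prod.map_apply, id_eq, h2, hη.label_conj]

theorem deco_reverse {l : List X.Node} {η : Equiv.Perm X.Node} (h : X.IsDynkinInvolution l η) :
    deco l.reverse = ((deco l).map (Prod.map id (Option.map η))).reverse :=
  decoAt_reverse h l 1 1 (by simp)

theorem deco_map {w : List X.Node} {η : Equiv.Perm X.Node} (h : X.IsDynkinInvolution w η)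
    (l : List X.Node) : deco (l.map η) = (deco l).map (Prod.map η (Option.map η)) := by
  unfold deco
  induction l with
  | nil => rfl
  | cons i l ih =>
    rw [List.map_cons, decoAt, decoAt, List.map_cons, ih, Prod.map_apply, ← h.label_conj]
    congr 3
    rw [h.wordProd_map, mul_one, mul_one]
    have := h i
    rw [← mul_inv_eq_iff_eq_mul] at this
    rw [← this]
    group

/-- The vertices `u'` and `u` correspond to each other when a labelled word is read backwards, with
the labels permuted by `η`. -/
def FlipCorresponds (η : Equiv.Perm X.Node) (c c' : X.Node → ℤ) (T : List X.Letter)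
    (u u' : QLabel X.Node) : Prop :=
  (∀ o : Option X.Node, eInd (o.map η) u' = eInd o u) ∧
    ∀ s : X.Node → ℤ, (∀ i, 0 ≤ s i ∧ s i ≤ letterCount T i) →
      state (c + letterCount T - s) u' = state (c' + s) u

theorem wordForm_reverse {η : Equiv.Perm X.Node} {c c' : X.Node → ℤ} {T : List X.Letter}
    {u u' v v' : QLabel X.Node} (hu : FlipCorresponds η c c' T u u')
    (hv : FlipCorresponds η c c' T v v')
    (hg : ∀ s s', X.gram u'.node v'.node * (state s u * state s' v) =
      X.gram u.node v.node * (state s u * state s' v)) :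
    wordForm c (T.map (Prod.map id (Option.map η))).reverse u' v' = - wordForm c' T u v := by
  induction T generalizing c' with
  | nil => simp [wordForm]
  | cons p T ih =>
    have hcount : letterCount (T.map (Prod.map id (Option.map η))).reverse = letterCount T := by
      funext i
      simp [letterCount, Function.comp_def]
    have hb : ∀ c : X.Node → ℤ, bump c p.1 = c + bump 0 p.1 := by
      intro c; funext i; simp only [bump, Pi.add_apply, Pi.zero_apply]; split_ifs <;> ring
    have hcons : letterCount (p :: T) = letterCount T + bump 0 p.1 := by
      funext i; rw [letterCount_cons]; simp [bump]
    have hnn := letterCount_nonneg T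
    have hstep : ∀ {u u'}, FlipCorresponds η c c' (p :: T) u u' →
        FlipCorresponds η c (bump c' p.1) T u u' ∧
        state (c + letterCount T) u' = state (bump c' p.1) u ∧
        state (bump (c + letterCount T) p.1) u' = state c' u := by
      rintro u u' ⟨h1, h2⟩
      have hb0 : ∀ i, 0 ≤ bump (0 : X.Node → ℤ) p.1 i := fun i => by
        simp only [bump, Pi.zero_apply]; split_ifs <;> norm_num
      refine ⟨⟨h1, fun s hs => ?_⟩, ?_, ?_⟩
      · have := h2 (s + bump 0 p.1) fun i => by
          have := hs i
          have := hb0 i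
          rw [hcons]
          simp only [Pi.add_apply]
          omega
        rw [hcons] at this
        rw [hb, add_assoc, add_comm (bump 0 p.1), ← this]
        congr 1
        abel
      · have := h2 (bump 0 p.1) fun i => by
          have := hb0 i
          have := hnn i
          rw [hcons]
          simp only [Pi.add_apply]
          omega
        rw [hcons] at this
        rw [hb c', ← this]
        congr 1
        abel
      · have := h2 0 fun i => by
          have := hb0 i
          have := hnn i
          rw [hcons]
          simp only [Pi.add_apply, Pi.zero_apply]
          omega
        rw [hcons, sub_zero, add_zero] at this
        rw [hb, ← this]
        congr 1
        abel
    obtain ⟨u1, u2, u3⟩ := hstep hu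
    obtain ⟨v1, v2, v3⟩ := hstep hv
    rw [List.map_cons, List.reverse_cons, wordForm_append, ih u1 v1, hcount, wordForm, wordForm,
      wordForm]
    simp only [letterForm, Prod.map_fst, Prod.map_snd, id_eq, wedge, u2, u3, v2, v3, hu.1, hv.1]
    have g1 := hg (bump c' p.1) c'
    have g2 := hg c' (bump c' p.1)
    linear_combination (g2 - g1) / 2

theorem eSum_map {η : Equiv.Perm X.Node} {u u' : QLabel X.Node} {f : X.Node → X.Node}
    (h : ∀ o : Option X.Node, eInd (o.map η) u' = eInd o u) (T : List X.Letter) :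
    eSum (T.map (Prod.map f (Option.map η))) u' = eSum T u := by
  induction T with
  | nil => rfl
  | cons p T ih => rw [List.map_cons, eSum, eSum, ih, Prod.map_snd, h]

theorem eSum_reverse (T : List X.Letter) (u : QLabel X.Node) : eSum T.reverse u = eSum T u := by
  induction T with
  | nil => rfl
  | cons p T ih => rw [List.reverse_cons, eSum_append, ih]; simp only [eSum]; ring

theorem labelForm_map {η : Equiv.Perm X.Node} {u u' v v' : QLabel X.Node} {f : X.Node → X.Node}
    (hu : ∀ o : Option X.Node, eInd (o.map η) u' = eInd o u)
    (hv : ∀ o : Option X.Node, eInd (o.map η) v' = eInd o v)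
    (hg : X.gram u'.node v'.node = X.gram u.node v.node) (T : List X.Letter) :
    labelForm (T.map (Prod.map f (Option.map η))) u' v' = labelForm T u v := by
  induction T with
  | nil => rfl
  | cons p T ih =>
    rw [List.map_cons, labelForm, labelForm, ih, hg]
    simp only [wedge, Prod.map_snd, hu, hv, eSum_map hu, eSum_map hv]

theorem labelForm_reverse (T : List X.Letter) (u v : QLabel X.Node) :
    labelForm T.reverse u v = - labelForm T u v := by
  induction T with
  | nil => simp [labelForm]
  | cons p T ih =>
    rw [List.reverse_cons, labelForm_append, ih]
    simp only [labelForm, wedge, eSum, eSum_reverse]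
    ring

theorem eInd_map (η : Equiv.Perm X.Node) (o : Option X.Node) (a : X.Node) :
    eInd (o.map η) (.e (η a)) = eInd o (.e a) := by
  have : o.map η = some (η a) ↔ o = some a := by
    rw [← Option.map_some, (Option.map_injective η.injective).eq_iff]
  simp only [eInd, this]

/-- Reading the word backwards changes the sign of each contribution and the order of the labels. -/
theorem triForm_reverse {l : List X.Node} {η : Equiv.Perm X.Node} (hl : X.IsLongestWord l)
    (h : X.IsDynkinInvolution l η) (u v : QLabel X.Node) :
    triForm (deco l.reverse) ((QLabel.shift (fun i => l.count i) η).symm u)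
      ((QLabel.shift (fun i => l.count i) η).symm v) =
        - triForm (deco l) (QLabel.mirror.symm u) (QLabel.mirror.symm v) := by
  have hη : ∀ a, η.symm a = η a := fun a => by
    rw [Equiv.symm_apply_eq, h.apply_apply hl]
  have hf : ∀ u, FlipCorresponds η 0 0 (deco l) (QLabel.mirror.symm u)
      ((QLabel.shift (fun i => l.count i) η).symm u) := by
    rintro (⟨i, k⟩ | a)
    · refine ⟨fun o => rfl, fun s hs => ?_⟩
      simp only [QLabel.mirror, QLabel.shift, Equiv.coe_fn_symm_mk, state, Pi.sub_apply,
        Pi.add_apply, Pi.zero_apply, letterCount_deco, zero_add]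
      congr 1
      exact propext (by omega)
    · refine ⟨fun o => ?_, fun s hs => rfl⟩
      simp only [QLabel.mirror, QLabel.shift, Equiv.coe_fn_symm_mk, hη, eInd_map]
  rw [deco_reverse h, triForm, triForm, wordForm_reverse (hf u) (hf v), labelForm_reverse]
  · rcases u with ⟨i, k⟩ | a
    · simp only [QLabel.mirror, QLabel.shift, Equiv.coe_fn_symm_mk, labelForm_f_left]
      ring
    rcases v with ⟨i, k⟩ | b
    · simp only [QLabel.mirror, QLabel.shift, Equiv.coe_fn_symm_mk, labelForm_f_right]
      ring
    rw [labelForm_map (hf _).1 (hf _).1]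
    · ring
    · simp only [QLabel.mirror, QLabel.shift, Equiv.coe_fn_symm_mk, hη, QLabel.node,
        h.gram_apply hl]
  · rcases u with ⟨i, k⟩ | a <;> rcases v with ⟨j, m⟩ | b <;>
      simp [QLabel.mirror, QLabel.shift, state, QLabel.node]

theorem _root_.WQuiver.ext_of_mem {V : Type} {Q Q' : WQuiver V}
    (hv : ∀ v, v ∈ Q.verts ↔ v ∈ Q'.verts)
    (hf : ∀ v, v ∈ Q.frozen ↔ v ∈ Q'.frozen) (hd : ∀ v, Q.d v = Q'.d v)
    (hw : ∀ u v, Q.w u v = Q'.w u v) : Q = Q' :=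
  WQuiver.ext (Set.ext hv) (Set.ext hf) (funext hd) (funext fun u => funext fun v => hw u v)

theorem triQuiver_d_congr {l l' : List X.Node} {u v : QLabel X.Node}
    (h : u ∈ triVerts l ↔ v ∈ triVerts l') (hn : X.mult u.node = X.mult v.node) :
    (triQuiver l).d u = (triQuiver l').d v := by
  by_cases hu : u ∈ triVerts l
  · exact (if_pos hu).trans (hn.trans (if_pos (h.1 hu)).symm)
  · exact (if_neg hu).trans (if_neg fun hv => hu (h.2 hv)).symm

/-- The explicit quivers of a word and of its reverse are mirror images of each other. -/
theorem triQuiver_reverse {l : List X.Node} {η : Equiv.Perm X.Node} (hl : X.IsLongestWord l)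
    (h : X.IsDynkinInvolution l η) :
    (triQuiver l.reverse).relabel (QLabel.shift (fun i => l.count i) η) =
      X.mirrorQuiver (triQuiver l) := by
  have hv : ∀ v, (QLabel.shift (fun i => l.count i) η).symm v ∈ triVerts l.reverse ↔
      QLabel.mirror.symm v ∈ triVerts l := by
    rintro (⟨i, k⟩ | a)
    · simp only [QLabel.mirror, QLabel.shift, Equiv.coe_fn_symm_mk, f_mem_triVerts,
        List.count_reverse]
      omega
    · exact iff_of_true e_mem_triVerts e_mem_triVerts
  refine WQuiver.ext_of_mem hv ?_ (fun v => ?_) ?_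
  · rintro (⟨i, k⟩ | a)
    · change QLabel.f _ _ ∈ triFrozen _ ↔ QLabel.f _ _ ∈ triFrozen _
      rw [f_mem_triFrozen, f_mem_triFrozen, List.count_reverse]
      dsimp only
      omega
    · exact iff_of_true e_mem_triFrozen e_mem_triFrozen
  · refine triQuiver_d_congr (hv v) ?_
    rcases v with ⟨i, k⟩ | a
    · rfl
    · have := h.mult_apply hl (η.symm a)
      rw [η.apply_symm_apply] at this
      exact this.symm
  · exact triForm_reverse hl h

theorem state_permute (η : Equiv.Perm X.Node) (c : X.Node → ℤ) (u : QLabel X.Node) :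
    state c (QLabel.permute η u) = state (fun i => c (η i)) u := by
  rcases u with ⟨i, k⟩ | a <;> rfl

theorem node_permute (η : Equiv.Perm X.Node) (u : QLabel X.Node) :
    (QLabel.permute η u).node = η u.node := by
  rcases u with ⟨i, k⟩ | a <;> rfl

theorem eInd_permute (η : Equiv.Perm X.Node) (o : Option X.Node) (u : QLabel X.Node) :
    eInd (o.map η) (QLabel.permute η u) = eInd o u := by
  rcases u with ⟨i, k⟩ | a
  · rfl
  · exact eInd_map η o a

theorem IsDynkinInvolution.wordForm_map {l : List X.Node} {η : Equiv.Perm X.Node}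
    (h : X.IsDynkinInvolution l η) (hl : X.IsLongestWord l) (c : X.Node → ℤ) (T : List X.Letter)
    (u v : QLabel X.Node) :
    wordForm c (T.map (Prod.map η (Option.map η))) (QLabel.permute η u) (QLabel.permute η v) =
      wordForm (fun i => c (η i)) T u v := by
  induction T generalizing c with
  | nil => rfl
  | cons p T ih =>
    have hb : (fun i => bump c (η p.1) (η i)) = bump (fun i => c (η i)) p.1 := by
      funext i
      simp only [bump, η.injective.eq_iff]
    rw [List.map_cons, wordForm, wordForm, ih]
    simp only [letterForm, Prod.map_fst, Prod.map_snd, node_permute, h.gram_apply hl,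
      h.mult_apply hl,
      wedge, eInd_permute, state_permute, hb]

theorem IsDynkinInvolution.triForm_map {l : List X.Node} {η : Equiv.Perm X.Node}
    (h : X.IsDynkinInvolution l η) (hl : X.IsLongestWord l) (u v : QLabel X.Node) :
    triForm (deco (l.map η)) (QLabel.permute η u) (QLabel.permute η v) =
      triForm (deco l) u v := by
  rw [deco_map h, triForm, triForm, h.wordForm_map hl]
  congr 1
  refine labelForm_map (fun o => eInd_permute η o u) (fun o => eInd_permute η o v) ?_ _
  rw [node_permute, node_permute, h.gram_apply hl]

/-- The Dynkin involution maps the explicit quiver of a word to the one of the image word. -/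
theorem triQuiver_map {l : List X.Node} {η : Equiv.Perm X.Node} (hl : X.IsLongestWord l)
    (h : X.IsDynkinInvolution l η) :
    (triQuiver l).relabel (QLabel.permute η) = triQuiver (l.map η) := by
  have hc : ∀ i, (l.map η).count i = l.count (η.symm i) := fun i => by
    conv_lhs => rw [← η.apply_symm_apply i]
    exact List.count_map_of_injective l η η.injective _
  have hm : ∀ i, X.mult (η.symm i) = X.mult i := fun i => by
    have := h.mult_apply hl (η.symm i)
    rwa [η.apply_symm_apply, eq_comm] at this
  have hv : ∀ v, (QLabel.permute η).symm v ∈ triVerts l ↔ v ∈ triVerts (l.map η) := by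
    rintro (⟨i, k⟩ | a)
    · change QLabel.f _ _ ∈ triVerts _ ↔ _
      rw [f_mem_triVerts, f_mem_triVerts, hc]
    · exact iff_of_true e_mem_triVerts e_mem_triVerts
  refine WQuiver.ext_of_mem hv ?_ (fun v => ?_) ?_
  · rintro (⟨i, k⟩ | a)
    · change QLabel.f _ _ ∈ triFrozen _ ↔ QLabel.f _ _ ∈ triFrozen _
      rw [f_mem_triFrozen, f_mem_triFrozen, hc]
    · exact iff_of_true e_mem_triFrozen e_mem_triFrozen
  · refine triQuiver_d_congr (hv v) ?_
    rcases v with ⟨i, k⟩ | a <;> exact hm _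
  · intro u v
    have := h.triForm_map hl ((QLabel.permute η).symm u) ((QLabel.permute η).symm v)
    rw [Equiv.apply_symm_apply, Equiv.apply_symm_apply] at this
    exact this.symm

/-! ### Existence and uniqueness of basic quivers -/

/-- The explicit quiver is a basic quiver. -/
theorem isBasicQuiver_triQuiver {l : List X.Node} (hl : X.IsLongestWord l) :
    X.IsBasicQuiver l (triQuiver l) where
  verts_eq := rfl
  frozen_eq := rfl
  amalgamation := isAmalgamation_triQuiver hl.count_pos
  symmetric := by
    obtain ⟨η, hη⟩ := hl.exists_isDynkinInvolution
    exact ⟨η, hη, ⟨_, wordMoves_triQuiver hl hl.reverse, triQuiver_reverse hl hη⟩,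
      ⟨_, wordMoves_triQuiver hl (hl.map hη), triQuiver_map hl hη⟩⟩

/-- The vertices `f_i^0` and `e_i^0`, along which a quiver is glued to its mirror image. -/
def IsAxis : QLabel X.Node → Prop
  | .f _ k => k = 0
  | .e _ => True

/-- The weights of `Q` and `T` differ by `δ`, which lives on the vertices of the symmetry axis, and
all other data agree. -/
structure DiffersBy (δ : QLabel X.Node → QLabel X.Node → ℚ) (Q T : WQuiver (QLabel X.Node)) :
    Prop where
  verts_eq : Q.verts = T.verts
  frozen_eq : Q.frozen = T.frozen
  d_eq : Q.d = T.d
  w_eq : ∀ u v, Q.w u v = T.w u v + δ u v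
  axis : ∀ u v, δ u v ≠ 0 → IsAxis u ∧ IsAxis v

theorem DiffersBy.eq_zero {δ : QLabel X.Node → QLabel X.Node → ℚ} {Q T : WQuiver (QLabel X.Node)}
    (h : DiffersBy δ Q T) {u v : QLabel X.Node} (hu : ¬ (IsAxis u ∧ IsAxis v)) : δ u v = 0 := by
  by_contra hc
  exact hu (h.axis u v hc)

/-- Mutation at a vertex off the axis involves no weight between two vertices of the axis. -/
theorem DiffersBy.mutate {δ : QLabel X.Node → QLabel X.Node → ℚ} {Q T : WQuiver (QLabel X.Node)}
    (h : DiffersBy δ Q T) {i : X.Node} {k : ℤ} (hk : k ≠ 0) :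
    DiffersBy δ (Q.mutate (.f i k)) (T.mutate (.f i k)) where
  verts_eq := h.verts_eq
  frozen_eq := h.frozen_eq
  d_eq := h.d_eq
  axis := h.axis
  w_eq u v := by
    rw [mutate_w, mutate_w, h.d_eq]
    have hz : ∀ x, δ x (.f i k) = 0 := fun x =>
      h.eq_zero fun hc : IsAxis x ∧ IsAxis (QLabel.f i k) => hk hc.2
    have hz' : ∀ x, δ (.f i k) x = 0 := fun x =>
      h.eq_zero fun hc : IsAxis (QLabel.f i k) ∧ IsAxis x => hk hc.1
    have h1 : ∀ x, Q.w x (.f i k) = T.w x (.f i k) := fun x => by rw [h.w_eq, hz, add_zero]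
    have h2 : ∀ x, Q.w (.f i k) x = T.w (.f i k) x := fun x => by rw [h.w_eq, hz', add_zero]
    unfold mutForm
    split_ifs with hc
    · rcases hc with rfl | rfl
      · rw [h2, hz', add_zero]
      · rw [h1, hz, add_zero]
    · rw [h1, h2, h.w_eq]
      ring

theorem DiffersBy.relabel {δ : QLabel X.Node → QLabel X.Node → ℚ} {Q T : WQuiver (QLabel X.Node)}
    (h : DiffersBy δ Q T) (σ : QLabel X.Node ≃ QLabel X.Node) (hσ : ∀ u, IsAxis u → σ u = u) :
    DiffersBy δ (Q.relabel σ) (T.relabel σ) where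
  verts_eq := by simp only [WQuiver.relabel, h.verts_eq]
  frozen_eq := by simp only [WQuiver.relabel, h.frozen_eq]
  d_eq := by simp only [WQuiver.relabel, h.d_eq]
  axis := h.axis
  w_eq u v := by
    have hs : ∀ u, IsAxis u → σ.symm u = u := fun u hu => by rw [Equiv.symm_apply_eq, hσ u hu]
    have hs' : ∀ u, IsAxis (σ.symm u) → IsAxis u := fun u hu => by
      rwa [← hσ _ hu, Equiv.apply_symm_apply] at hu
    have : δ (σ.symm u) (σ.symm v) = δ u v := by
      by_cases hc : IsAxis u ∧ IsAxis v
      · rw [hs u hc.1, hs v hc.2]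
      · rw [h.eq_zero hc, h.eq_zero fun hc' => hc ⟨hs' u hc'.1, hs' v hc'.2⟩]
    rw [← this]
    exact h.w_eq _ _

theorem braidRename_axis {i j : X.Node} (hij : i ≠ j) {k m : ℤ} (hk : 0 < k) (hm : 0 < m)
    (u : QLabel X.Node) (hu : IsAxis u) : QLabel.braidRename i j hij k m u = u := by
  rcases u with ⟨a, t⟩ | a
  · obtain rfl : t = 0 := hu
    simp only [QLabel.braidRename, Equiv.coe_fn_mk]
    rw [if_neg hk.ne, if_neg hk.not_gt, if_neg hm.not_ge]
    split_ifs with h1 h2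
    · rw [h1]
    · rw [h2]
    · rfl
  · rfl

theorem swapOneTwo_axis (j : X.Node) (u : QLabel X.Node) (hu : IsAxis u) :
    QLabel.swapOneTwo j u = u := by
  classical
  refine Equiv.swap_apply_of_ne_of_ne ?_ ?_ <;> rintro rfl <;> simp [IsAxis] at hu

/-- The difference on the symmetry axis is not affected by changes of words. -/
theorem DiffersBy.wordMove {δ : QLabel X.Node → QLabel X.Node → ℚ} {Q T : WQuiver (QLabel X.Node)}
    {l : List X.Node} {p : List X.Node × WQuiver (QLabel X.Node)} (h : DiffersBy δ Q T)
    (hm : X.WordMove (l, Q) p) : ∃ T', X.WordMove (l, T) (p.1, T') ∧ DiffersBy δ p.2 T' := by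
  cases hm with
  | swap l₁ l₂ i j Q hij => exact ⟨_, .swap l₁ l₂ i j T hij, h⟩
  | simplyLaced l₁ l₂ i j Q hij h₁ h₂ k m hk hm =>
    exact ⟨_, .simplyLaced l₁ l₂ i j T hij h₁ h₂ k m hk hm,
      (h.mutate (by omega)).relabel _ (braidRename_axis hij (by omega) (by omega))⟩
  | doublyLaced l₁ l₂ i j Q h₁ h₂ k m hk hm =>
    exact ⟨_, .doublyLaced l₁ l₂ i j T h₁ h₂ k m hk hm,
      ((h.mutate (by omega)).mutate (by omega)).mutate (by omega)⟩
  | doublyLacedInv l₁ l₂ i j Q h₁ h₂ k m hk hm =>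
    exact ⟨_, .doublyLacedInv l₁ l₂ i j T h₁ h₂ k m hk hm,
      ((h.mutate (by omega)).mutate (by omega)).mutate (by omega)⟩
  | triplyLaced i j Q h₁ h₂ =>
    refine ⟨_, .triplyLaced i j T h₁ h₂, DiffersBy.relabel ?_ _ (swapOneTwo_axis j)⟩
    simp only [List.foldl_cons, List.foldl_nil]
    iterate 11 refine DiffersBy.mutate ?_ (by norm_num)
    exact h
  | triplyLacedInv i j Q h₁ h₂ =>
    refine ⟨_, .triplyLacedInv i j T h₁ h₂, ?_⟩
    simp only [List.foldl_cons, List.foldl_nil]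
    iterate 11 refine DiffersBy.mutate ?_ (by norm_num)
    exact h.relabel _ (swapOneTwo_axis j)

theorem DiffersBy.wordMoves {δ : QLabel X.Node → QLabel X.Node → ℚ}
    {p p' : List X.Node × WQuiver (QLabel X.Node)} {T : WQuiver (QLabel X.Node)}
    (h : DiffersBy δ p.2 T) (hm : X.WordMoves p p') :
    ∃ T', X.WordMoves (p.1, T) (p'.1, T') ∧ DiffersBy δ p'.2 T' := by
  induction hm with
  | refl => exact ⟨T, .refl, h⟩
  | tail _ h' ih =>
    obtain ⟨T₁, h₁, h₂⟩ := ih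
    obtain ⟨T₂, h₃, h₄⟩ := h₂.wordMove h'
    exact ⟨T₂, h₁.tail h₃, h₄⟩

/-- The condition that two copies are glued to the `𝒟_𝔤`-quiver determines a quiver up to the
weights on the symmetry axis. -/
theorem IsBasicQuiver.differsBy {l : List X.Node} {Q T : WQuiver (QLabel X.Node)}
    (hQ : X.IsBasicQuiver l Q) (hT : X.IsBasicQuiver l T) :
    DiffersBy (fun u v => Q.w u v - T.w u v) Q T where
  verts_eq := hQ.verts_eq.trans hT.verts_eq.symm
  frozen_eq := hQ.frozen_eq.trans hT.frozen_eq.symm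
  d_eq := by
    have hv := hQ.verts_eq.trans hT.verts_eq.symm
    funext v
    by_cases h : v ∈ Q.verts
    · rw [← hQ.amalgamation.d_right v h, hT.amalgamation.d_right v (hv ▸ h)]
    · rw [Q.d_off v h, T.d_off v (hv ▸ h)]
  w_eq u v := by ring
  axis := by
    have key : ∀ u v, ¬ IsAxis u → Q.w u v = T.w u v := by
      rintro (⟨i, k⟩ | a) v hu
      · have hk : k ≠ 0 := hu
        have hoff : ∀ {R : WQuiver (QLabel X.Node)}, X.IsBasicQuiver l R → ∀ (t : ℤ) v, t < 0 →
            R.w (.f i t) v = 0 := by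
          intro R hR t v ht
          by_contra hc
          have := (R.support _ _ hc).1
          rw [hR.verts_eq] at this
          have := f_mem_triVerts.1 this
          omega
        rcases hk.lt_or_gt with h | h
        · rw [hoff hQ k v h, hoff hT k v h]
        · have h1 := hQ.amalgamation.w_eq (.f i k) v
          have h2 := hT.amalgamation.w_eq (.f i k) v
          have h3 : ∀ {R : WQuiver (QLabel X.Node)}, X.IsBasicQuiver l R →
              (X.mirrorQuiver R).w (.f i k) v = 0 := fun {R} hR =>
            neg_eq_zero.2 (hoff hR (-k) _ (by omega))
          rw [h3 hQ, zero_add] at h1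
          rw [h3 hT, zero_add] at h2
          rw [← h1, h2]
      · exact (hu trivial).elim
    intro u v h
    by_contra hc
    rw [not_and_or] at hc
    rcases hc with hc | hc
    · exact h (sub_eq_zero.2 (key u v hc))
    · rw [Q.skew, T.skew, key v u hc, sub_self] at h
      exact h rfl

/-- The two symmetry conditions determine the weights on the symmetry axis. -/
theorem IsBasicQuiver.eq_triQuiver {l : List X.Node} (hl : X.IsLongestWord l)
    {Q : WQuiver (QLabel X.Node)} (hQ : X.IsBasicQuiver l Q) : Q = triQuiver l := by
  have hd := hQ.differsBy (isBasicQuiver_triQuiver hl)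
  generalize hδ : (fun u v => Q.w u v - (triQuiver l).w u v) = δ at hd
  suffices h0 : ∀ u v, δ u v = 0 by
    refine WQuiver.ext hd.verts_eq hd.frozen_eq hd.d_eq (funext fun u => funext fun v => ?_)
    rw [hd.w_eq, h0, add_zero]
  obtain ⟨η, hη, ⟨Q₁, hm₁, he₁⟩, ⟨Q₂, hm₂, he₂⟩⟩ := hQ.symmetric
  obtain ⟨T₁, ht₁, hd₁⟩ := DiffersBy.wordMoves hd hm₁
  obtain ⟨T₂, ht₂, hd₂⟩ := DiffersBy.wordMoves hd hm₂
  have hT₁ : T₁ = triQuiver l.reverse := WordMoves.eq_triQuiver ht₁ hl rfl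
  have hT₂ : T₂ = triQuiver (l.map η) := WordMoves.eq_triQuiver ht₂ hl rfl
  subst hT₁ hT₂
  -- the condition on the reversed word, which also holds for the explicit quiver
  have h1 : ∀ u v, δ ((QLabel.shift (fun i => l.count i) η).symm u)
      ((QLabel.shift (fun i => l.count i) η).symm v) =
        - δ (QLabel.mirror.symm u) (QLabel.mirror.symm v) := by
    intro u v
    have e1 : Q₁.w _ _ = - Q.w _ _ := congrFun (congrFun (congrArg WQuiver.w he₁) u) v
    have e2 : triForm _ _ _ = - triForm _ _ _ :=
      congrFun (congrFun (congrArg WQuiver.w (triQuiver_reverse hl hη)) u) v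
    rw [hd₁.w_eq, hd.w_eq] at e1
    change triForm _ _ _ + _ = - (triForm _ _ _ + _) at e1
    linarith
  -- the condition on the image of the word under the Dynkin involution
  have h2 : ∀ u v, δ ((QLabel.permute η).symm u) ((QLabel.permute η).symm v) = δ u v := by
    intro u v
    have e1 : Q.w _ _ = Q₂.w _ _ := congrFun (congrFun (congrArg WQuiver.w he₂) u) v
    have e2 : triForm _ _ _ = triForm _ _ _ :=
      congrFun (congrFun (congrArg WQuiver.w (triQuiver_map hl hη)) u) v
    rw [hd₂.w_eq, hd.w_eq] at e1
    change triForm _ _ _ + _ = triForm _ _ _ + _ at e1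
    linarith
  -- the other end of the row of `f_i^0` is not on the axis, as `n_i` is positive
  have hf : ∀ i v, δ (.f i 0) v = 0 := by
    intro i v
    have := h1 (.f i 0) (QLabel.mirror v)
    rw [Equiv.symm_apply_apply] at this
    have hz : δ ((QLabel.shift (fun i => l.count i) η).symm (.f i 0))
        ((QLabel.shift (fun i => l.count i) η).symm (QLabel.mirror v)) = 0 := by
      refine hd.eq_zero fun hc => ?_
      have h3 : (0 : ℤ) + l.count i = 0 := hc.1
      have := hl.count_pos i
      omega
    rw [hz] at this
    exact neg_eq_zero.1 this.symm
  have hskew : ∀ u v, δ u v = - δ v u := by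
    intro u v
    rw [← hδ]
    dsimp only
    rw [Q.skew, (triQuiver l).skew]
    ring
  rintro (⟨i, k⟩ | a) v
  · by_cases hk : k = 0
    · rw [hk, hf]
    · exact hd.eq_zero fun hc => hk hc.1
  rcases v with ⟨i, k⟩ | b
  · rw [hskew, neg_eq_zero]
    by_cases hk : k = 0
    · rw [hk, hf]
    · exact hd.eq_zero fun hc => hk hc.1
  -- both symmetries permute the vertices `e_a^0` in the same way, with opposite signs
  have h3 : δ (.e (η.symm a)) (.e (η.symm b)) = - δ (.e a) (.e b) := h1 (.e a) (.e b)
  have h4 : δ (.e (η.symm a)) (.e (η.symm b)) = δ (.e a) (.e b) := h2 (.e a) (.e b)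
  linarith

end LieType

/-! ### Mutation equivalence along changes of words -/

namespace WQuiver

variable {V V' : Type}

/-- Mutations transform `Q` into a quiver that becomes `Q'` after a renaming of the vertices. -/
def MutationRelabel (Q Q' : WQuiver V) : Prop :=
  ∃ (P : WQuiver V) (σ : V ≃ V), Relation.ReflTransGen MutationStep Q P ∧ P.relabel σ = Q'

/-- Mutations commute with renamings. -/
theorem relabel_mutate (Q : WQuiver V) (σ : V ≃ V') (k : V) :
    (Q.mutate k).relabel σ = (Q.relabel σ).mutate (σ k) := by
  refine WQuiver.ext rfl rfl rfl (funext fun u => funext fun v => ?_)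
  change mutForm (Q.d k) k Q.w (σ.symm u) (σ.symm v) = mutForm (Q.d (σ.symm (σ k))) (σ k)
    (fun u v => Q.w (σ.symm u) (σ.symm v)) u v
  have h : (σ.symm u = k ∨ σ.symm v = k) ↔ (u = σ k ∨ v = σ k) := by
    rw [Equiv.symm_apply_eq, Equiv.symm_apply_eq]
  unfold mutForm
  by_cases h' : u = σ k ∨ v = σ k
  · rw [if_pos h', if_pos (h.2 h')]
  · rw [if_neg h', if_neg fun hc => h' (h.1 hc)]
    simp only [Equiv.symm_apply_apply]

theorem MutationStep.exists_relabel {P Q' : WQuiver V} {σ : V ≃ V}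
    (h : MutationStep (P.relabel σ) Q') : ∃ P', MutationStep P P' ∧ P'.relabel σ = Q' := by
  obtain ⟨k, hk, hk', rfl⟩ := h
  refine ⟨P.mutate (σ.symm k), ⟨σ.symm k, hk, hk', rfl⟩, ?_⟩
  rw [relabel_mutate, σ.apply_symm_apply]

theorem MutationRelabel.trans {Q Q' Q'' : WQuiver V} (h : MutationRelabel Q Q')
    (h' : MutationRelabel Q' Q'') : MutationRelabel Q Q'' := by
  obtain ⟨P, σ, h1, rfl⟩ := h
  obtain ⟨P', σ', h2, rfl⟩ := h'
  have key : ∃ P₁, Relation.ReflTransGen MutationStep P P₁ ∧ P₁.relabel σ = P' := by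
    clear h1
    induction h2 with
    | refl => exact ⟨P, .refl, rfl⟩
    | tail _ h ih =>
      obtain ⟨P₁, h3, rfl⟩ := ih
      obtain ⟨P₂, h4, h5⟩ := h.exists_relabel
      exact ⟨P₂, h3.tail h4, h5⟩
  obtain ⟨P₁, h3, rfl⟩ := key
  exact ⟨P₁, σ.trans σ', h1.trans h3, rfl⟩

theorem mutationRelabel_relabel (Q : WQuiver V) (σ : V ≃ V) : MutationRelabel Q (Q.relabel σ) :=
  ⟨Q, σ, .refl, rfl⟩

theorem verts_foldl_mutate (Q : WQuiver V) (L : List V) :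
    (L.foldl WQuiver.mutate Q).verts = Q.verts ∧ (L.foldl WQuiver.mutate Q).frozen = Q.frozen := by
  induction L generalizing Q with
  | nil => exact ⟨rfl, rfl⟩
  | cons k L ih => exact ih (Q.mutate k)

theorem mutationRelabel_foldl {Q : WQuiver V} {L : List V} (h : ∀ k ∈ L, k ∈ Q.verts)
    (h' : ∀ k ∈ L, k ∉ Q.frozen) : MutationRelabel Q (L.foldl WQuiver.mutate Q) := by
  refine ⟨_, Equiv.refl V, ?_, rfl⟩
  induction L generalizing Q with
  | nil => exact .refl
  | cons k L ih =>
    exact .head ⟨k, h k (by simp), h' k (by simp), rfl⟩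
      (ih (Q := Q.mutate k) (fun k hk => h k (by simp [hk])) fun k hk => h' k (by simp [hk]))

/-- All renamings can be moved to the end of the sequence of mutations. -/
theorem MutationRelabel.mutationEquivalent {Q Q' : WQuiver V} {Q'' : WQuiver V'}
    (h : MutationRelabel Q Q') (h' : Q'.Isomorphic Q'') : Q.MutationEquivalent Q'' := by
  obtain ⟨P, σ, h1, rfl⟩ := h
  obtain ⟨τ, h2, h3, h4⟩ := h'
  refine ⟨P, h1, ?_⟩
  let e : P.verts ≃ (P.relabel σ).verts :=
    σ.subtypeEquiv fun v => iff_of_eq (congrArg (· ∈ P.verts) (σ.symm_apply_apply v).symm)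
  have he : ∀ v : P.verts, σ.symm (e v : V) = v := fun v => σ.symm_apply_apply _
  refine ⟨e.trans τ, fun v => ?_, fun v => ?_, fun u v => ?_⟩
  · rw [Equiv.trans_apply, ← h2]
    exact iff_of_eq (congrArg (· ∈ P.frozen) (he v).symm)
  · rw [Equiv.trans_apply, h3]
    exact congrArg P.d (he v)
  · rw [Equiv.trans_apply, Equiv.trans_apply, h4]
    exact congrArg₂ P.w (he u) (he v)

end WQuiver

namespace LieType

open WQuiver

variable {X : LieType}

theorem WordMove.mutationRelabel {p p' : List X.Node × WQuiver (QLabel X.Node)}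
    (h : X.WordMove p p') (hl : X.IsLongestWord p.1) (hp : p.2 = triQuiver p.1) :
    MutationRelabel p.2 p'.2 := by
  have hmem : ∀ {l : List X.Node} {i : X.Node} {k : ℤ}, 0 < k → k < (l.count i : ℤ) →
      .f i k ∈ (triQuiver l).verts ∧ .f i k ∉ (triQuiver l).frozen := fun h1 h2 =>
    ⟨f_mem_triVerts.2 ⟨h1.le, h2.le⟩, fun hc => by have := f_mem_triFrozen.1 hc; omega⟩
  have hp' := h.eq_triQuiver hl.1 hp
  cases h with
  | swap l₁ l₂ i j Q hij => exact ⟨Q, Equiv.refl _, .refl, rfl⟩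
  | simplyLaced l₁ l₂ i j Q hij h₁ h₂ k m hk hm =>
    dsimp only at hp ⊢
    subst hp
    have hji := hij.symm
    have ci : ((l₁ ++ [i, j, i] ++ l₂).count i : ℤ) = l₁.count i + l₂.count i + 2 := by
      simp [List.count_append, hji]; ring
    have := hmem (l := l₁ ++ [i, j, i] ++ l₂) (i := i) (k := k) (by omega) (by omega)
    exact (mutationRelabel_foldl (L := [QLabel.f i k]) (by simpa using this.1)
      (by simpa using this.2)).trans (mutationRelabel_relabel _ _)
  | doublyLaced l₁ l₂ i j Q h₁ h₂ k m hk hm =>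
    dsimp only at hp ⊢
    subst hp
    have hij : i ≠ j := ne_of_cartan (by rw [h₁]; norm_num)
    have hji := hij.symm
    have ci : ((l₁ ++ [i, j, i, j] ++ l₂).count i : ℤ) = l₁.count i + l₂.count i + 2 := by
      simp [List.count_append, hji]; ring
    have cj : ((l₁ ++ [i, j, i, j] ++ l₂).count j : ℤ) = l₁.count j + l₂.count j + 2 := by
      simp [List.count_append, hij]; ring
    have hi := hmem (l := l₁ ++ [i, j, i, j] ++ l₂) (i := i) (k := k) (by omega) (by omega)
    have hj := hmem (l := l₁ ++ [i, j, i, j] ++ l₂) (i := j) (k := m) (by omega) (by omega)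
    exact mutationRelabel_foldl (L := [QLabel.f j m, QLabel.f i k, QLabel.f j m])
      (List.forall_mem_cons.2 ⟨hj.1, List.forall_mem_cons.2 ⟨hi.1, by simpa using hj.1⟩⟩)
      (List.forall_mem_cons.2 ⟨hj.2, List.forall_mem_cons.2 ⟨hi.2, by simpa using hj.2⟩⟩)
  | doublyLacedInv l₁ l₂ i j Q h₁ h₂ k m hk hm =>
    dsimp only at hp ⊢
    subst hp
    have hij : i ≠ j := ne_of_cartan (by rw [h₁]; norm_num)
    have hji := hij.symm
    have ci : ((l₁ ++ [j, i, j, i] ++ l₂).count i : ℤ) = l₁.count i + l₂.count i + 2 := by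
      simp [List.count_append, hji]; ring
    have cj : ((l₁ ++ [j, i, j, i] ++ l₂).count j : ℤ) = l₁.count j + l₂.count j + 2 := by
      simp [List.count_append, hij]; ring
    have hi := hmem (l := l₁ ++ [j, i, j, i] ++ l₂) (i := i) (k := k) (by omega) (by omega)
    have hj := hmem (l := l₁ ++ [j, i, j, i] ++ l₂) (i := j) (k := m) (by omega) (by omega)
    exact mutationRelabel_foldl (L := [QLabel.f j m, QLabel.f i k, QLabel.f j m])
      (List.forall_mem_cons.2 ⟨hj.1, List.forall_mem_cons.2 ⟨hi.1, by simpa using hj.1⟩⟩)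
      (List.forall_mem_cons.2 ⟨hj.2, List.forall_mem_cons.2 ⟨hi.2, by simpa using hj.2⟩⟩)
  | triplyLaced i j Q h₁ h₂ =>
    dsimp only at hp ⊢
    subst hp
    have hij : i ≠ j := ne_of_cartan (by rw [h₁]; norm_num)
    have hji := hij.symm
    have ci : [j, i, j, i, j, i].count i = 3 := by simp [hij, hji]
    have cj : [j, i, j, i, j, i].count j = 3 := by simp [hij, hji]
    have hi1 := hmem (l := [j, i, j, i, j, i]) (i := i) (k := 1) (by omega) (by omega)
    have hi2 := hmem (l := [j, i, j, i, j, i]) (i := i) (k := 2) (by omega) (by omega)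
    have hj1 := hmem (l := [j, i, j, i, j, i]) (i := j) (k := 1) (by omega) (by omega)
    have hj2 := hmem (l := [j, i, j, i, j, i]) (i := j) (k := 2) (by omega) (by omega)
    exact (mutationRelabel_foldl (by simp [hi1, hi2, hj1, hj2])
      (by simp [hi1, hi2, hj1, hj2])).trans (mutationRelabel_relabel _ _)
  | triplyLacedInv i j Q h₁ h₂ =>
    dsimp only at hp hp' ⊢
    have hij : i ≠ j := ne_of_cartan (by rw [h₁]; norm_num)
    have hji := hij.symm
    have ci : [j, i, j, i, j, i].count i = 3 := by simp [hij, hji]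
    have cj : [j, i, j, i, j, i].count j = 3 := by simp [hij, hji]
    have hi1 := hmem (l := [j, i, j, i, j, i]) (i := i) (k := 1) (by omega) (by omega)
    have hi2 := hmem (l := [j, i, j, i, j, i]) (i := i) (k := 2) (by omega) (by omega)
    have hj1 := hmem (l := [j, i, j, i, j, i]) (i := j) (k := 1) (by omega) (by omega)
    have hj2 := hmem (l := [j, i, j, i, j, i]) (i := j) (k := 2) (by omega) (by omega)
    rw [← hp', (verts_foldl_mutate _ _).1, (verts_foldl_mutate _ _).2] at hi1 hi2 hj1 hj2
    exact (mutationRelabel_relabel _ _).trans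
      (mutationRelabel_foldl (by simp [hi1, hi2, hj1, hj2]) (by simp [hi1, hi2, hj1, hj2]))

/-- The explicit quivers of all reduced words of the longest element are mutation equivalent. -/
theorem mutationRelabel_triQuiver {l l' : List X.Node} (hl : X.IsLongestWord l)
    (hl' : X.IsLongestWord l') : MutationRelabel (triQuiver l) (triQuiver l') := by
  have h := wordMoves_triQuiver hl hl'
  have key : ∀ p, X.WordMoves (l, triQuiver l) p → MutationRelabel (triQuiver l) p.2 := by
    intro p h
    induction h with
    | refl => exact ⟨_, Equiv.refl _, .refl, rfl⟩
    | tail h' h ih =>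
      exact ih.trans (h.mutationRelabel (WordMoves.isLongestWord h' hl)
        (WordMoves.eq_triQuiver h' hl rfl))
  exact key _ h

/-! ### Staircase words -/

variable (X) in
/-- The nodes `i` with `b ≤ i < s`, in decreasing order. -/
def descend (b s : ℕ) : List X.Node :=
  (List.finRange X.rank).reverse.filter fun i => b ≤ i.val ∧ i.val < s

variable (X) in
/-- The word `(n-1, ..., b 0, n-1, ..., b 1, ..., n-1, ..., b (m-1))`, with `n` the rank. -/
def staircase (b : ℕ → ℕ) : ℕ → List X.Node
  | 0 => []
  | m + 1 => staircase b m ++ descend X (b m) X.rank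

theorem mem_descend {b s : ℕ} {i : X.Node} : i ∈ descend X b s ↔ b ≤ i.val ∧ i.val < s := by
  simp [descend]

theorem pairwise_descend (b s : ℕ) : (descend X b s).Pairwise (· > ·) :=
  ((List.pairwise_reverse).2 (List.pairwise_lt_finRange X.rank)).filter _

theorem nodup_descend (b s : ℕ) : (descend X b s).Nodup := (pairwise_descend b s).nodup

theorem filter_descend_eq {b s : ℕ} (P : X.Node → Bool) {l : List X.Node}
    (hl : l.Pairwise (· > ·)) (h : ∀ a, a ∈ l ↔ (b ≤ a.val ∧ a.val < s) ∧ P a) :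
    (descend X b s).filter P = l :=
  ((pairwise_descend b s).filter P).eq_of_mem_iff hl fun a => by
    rw [List.mem_filter, mem_descend, h]

theorem descend_eq {b s : ℕ} {l : List X.Node} (hl : l.Pairwise (· > ·))
    (h : ∀ a, a ∈ l ↔ b ≤ a.val ∧ a.val < s) : descend X b s = l :=
  (pairwise_descend b s).eq_of_mem_iff hl fun a => by rw [mem_descend, h]

theorem descend_self (b : ℕ) : descend X b b = [] :=
  descend_eq List.Pairwise.nil fun a => by simp

theorem descend_succ {b s : ℕ} (h : b ≤ s) (hs : s < X.rank) :
    descend X b (s + 1) = ⟨s, hs⟩ :: descend X b s := by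
  refine descend_eq (List.pairwise_cons.2 ⟨fun a ha => (mem_descend.1 ha).2,
    pairwise_descend b s⟩) fun a => ?_
  rw [List.mem_cons, mem_descend, Fin.ext_iff]
  dsimp only
  omega

theorem descend_append {b m s : ℕ} (h : b ≤ m) (h' : m ≤ s) :
    descend X b s = descend X m s ++ descend X b m := by
  refine descend_eq (List.pairwise_append.2 ⟨pairwise_descend m s, pairwise_descend b m,
    fun a ha a' ha' => ?_⟩) fun a => ?_
  · exact Fin.lt_def.2 (lt_of_lt_of_le (mem_descend.1 ha').2 (mem_descend.1 ha).1)
  · rw [List.mem_append, mem_descend, mem_descend]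
    omega

theorem length_descend {s : ℕ} (hs : s ≤ X.rank) : (descend X 0 s).length = s := by
  induction s with
  | zero => rw [descend_self, List.length_nil]
  | succ s ih => rw [descend_succ (Nat.zero_le s) hs, List.length_cons, ih (by omega)]

theorem count_descend (b : ℕ) (i : X.Node) :
    (descend X b X.rank).count i = if b ≤ i.val then 1 else 0 := by
  split_ifs with h
  · exact List.count_eq_one_of_mem (nodup_descend _ _) (mem_descend.2 ⟨h, i.isLt⟩)
  · exact List.count_eq_zero.2 fun h' => h (mem_descend.1 h').1

theorem count_staircase {b : ℕ → ℕ} {i : X.Node} {m : ℕ} (h : ∀ r < m, b r ≤ i.val) :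
    (staircase X b m).count i = m := by
  induction m with
  | zero => rfl
  | succ m ih =>
    rw [staircase, List.count_append, ih fun r hr => h r (by omega), count_descend,
      if_pos (h m (by omega))]

theorem length_staircase (m : ℕ) : (staircase X (fun _ => 0) m).length = m * X.rank := by
  induction m with
  | zero => simp [staircase]
  | succ m ih => rw [staircase, List.length_append, ih, length_descend le_rfl]; ring

theorem staircase_prefix (b : ℕ → ℕ) {k m : ℕ} (h : k ≤ m) :
    staircase X b k <+: staircase X b m := by
  induction m, h using Nat.le_induction with
  | base => exact List.prefix_rfl
  | succ m h ih => exact ih.trans (List.prefix_append _ _)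

/-- The word up to the `k`-th letter `n - 1`. -/
theorem exists_staircase_eq {b : ℕ → ℕ} {k m : ℕ} (h : k < m) {i : X.Node}
    (hi : i.val + 1 = X.rank) (hb : b k ≤ i.val) :
    ∃ v, staircase X b m = staircase X b k ++ i :: v := by
  obtain ⟨t, ht⟩ := staircase_prefix (X := X) b (Nat.succ_le_of_lt h)
  refine ⟨descend X (b k) i.val ++ t, ?_⟩
  have hd : descend X (b k) X.rank = i :: descend X (b k) i.val :=
    (congrArg (descend X (b k)) hi.symm).trans (descend_succ hb i.isLt)
  rw [← ht, Nat.succ_eq_add_one, staircase, hd]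
  simp

/-! ### The rows of the quiver of a staircase word -/

/-- The weights between two rows depend only on the letters of these rows. -/
theorem wordForm_filter {c c' : X.Node → ℤ} {T : List X.Letter} {P : X.Node → Bool} {i j : X.Node}
    (hi : P i) (hj : P j) (hci : c i = c' i) (hcj : c j = c' j) (k p : ℤ) :
    wordForm c T (.f i k) (.f j p) =
      wordForm c' (((T.map Prod.fst).filter P).map (·, none)) (.f i k) (.f j p) := by
  induction T generalizing c c' with
  | nil => rfl
  | cons x T ih =>
    rw [List.map_cons, List.filter_cons]
    split_ifs with hx
    · rw [List.map_cons, wordForm, wordForm,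
        ih (c := bump c x.1) (c' := bump c' x.1) (by simp [bump, hci]) (by simp [bump, hcj])]
      congr 1
      simp only [letterForm, wedge, eInd_f, state, bump, hci, hcj]
      ring_nf
    · have h1 : i ≠ x.1 := fun h => hx (h ▸ hi)
      have h2 : j ≠ x.1 := fun h => hx (h ▸ hj)
      rw [wordForm, ih (c := bump c x.1) (c' := c') (by simp [bump, hci, h1])
        (by simp [bump, hcj, h2])]
      simp [letterForm, wedge, eInd, state, bump, h1, h2]

theorem triForm_deco_f_f (l : List X.Node) {P : X.Node → Bool} {i j : X.Node} (hi : P i) (hj : P j)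
    (k p : ℤ) : triForm (deco l) (.f i k) (.f j p) =
      wordForm 0 ((l.filter P).map (·, none)) (.f i k) (.f j p) := by
  rw [triForm, labelForm_f_left, add_zero, wordForm_filter hi hj rfl rfl, deco, map_fst_decoAt]

theorem letterCount_filter_map (l : List X.Node) {P : X.Node → Bool} {i : X.Node} (hi : P i) :
    letterCount (X := X) ((l.filter P).map (·, none)) i = l.count i := by
  rw [letterCount, List.map_map]
  have : (Prod.fst ∘ fun x : X.Node => (x, (none : Option X.Node))) = id := rfl
  rw [this, List.map_id, List.count_filter hi]

theorem ite_lt_succ (p m : ℕ) (Q : Prop) [Decidable Q] :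
    (if p < m + 1 ∧ Q then (1 : ℚ) else 0) =
      (if p < m ∧ Q then 1 else 0) + (if p = m ∧ Q then 1 else 0) := by
  by_cases hQ : Q
  · rcases lt_trichotomy p m with h | h | h
    · simp [hQ, h, h.ne, h.trans (Nat.lt_succ_self m)]
    · simp [hQ, h]
    · simp [hQ, h.not_gt, h.ne', show ¬ p < m + 1 by omega]
  · simp [hQ]

theorem ite_eq_mul {P Q R : Prop} [Decidable P] [Decidable Q] [Decidable R] (h : P ↔ Q ∧ R) :
    (if P then (1 : ℚ) else 0) = (if Q then 1 else 0) * (if R then 1 else 0) := by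
  by_cases hQ : Q <;> by_cases hR : R <;> simp [h, hQ, hR]

/-- The row `i` of the quiver of a staircase word is a path. -/
theorem triForm_staircase_self {b : ℕ → ℕ} (hb : Monotone b) (m : ℕ) (i : X.Node) (k p : ℕ) :
    triForm (deco (staircase X b m)) (.f i k) (.f i p) =
      X.mult i * ((if k < m ∧ b k ≤ i.val ∧ p = k + 1 then 1 else 0) -
        (if p < m ∧ b p ≤ i.val ∧ k = p + 1 then 1 else 0)) := by
  rw [triForm_deco_f_f (P := fun a => a = i) _ (by simp) (by simp)]
  induction m with
  | zero => simp [staircase, wordForm]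
  | succ m ih =>
    have hf : (descend X (b m) X.rank).filter (fun a => a = i) =
        if b m ≤ i.val then [i] else [] := by
      split_ifs with h
      · exact filter_descend_eq _ (by simp) fun a => by
          have := a.isLt
          simp only [List.mem_singleton, decide_eq_true_eq]
          constructor
          · rintro rfl; exact ⟨⟨h, this⟩, rfl⟩
          · exact fun h => h.2
      · exact filter_descend_eq _ (by simp) fun a => by
          simp only [List.not_mem_nil, decide_eq_true_eq, false_iff]
          rintro ⟨⟨h1, -⟩, rfl⟩
          exact h h1
    rw [staircase, List.filter_append, List.map_append, wordForm_append, ih, hf, ite_lt_succ,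
      ite_lt_succ]
    have hs : ∀ q : ℕ, ((m : ℤ) + 1 = q) = (m + 1 = q) := fun q =>
      propext (by exact_mod_cast Iff.rfl)
    by_cases h : b m ≤ i.val
    · have hc : (letterCount (X := X) (((staircase X b m).filter fun a => a = i).map (·, none)) i) =
          m := by
        rw [letterCount_filter_map _ (by simp), count_staircase fun r hr => (hb hr.le).trans h]
      rw [if_pos h]
      simp only [List.map_cons, List.map_nil, wordForm, letterForm, wedge, eInd_f, bump, state,
        QLabel.node, gram_self, hc, if_true, zero_add, hs, Nat.cast_inj]
      rw [ite_eq_mul (P := k = m ∧ b k ≤ i.val ∧ p = k + 1) (Q := m = k) (R := m + 1 = p) (by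
          constructor
          · rintro ⟨rfl, -, rfl⟩; exact ⟨rfl, rfl⟩
          · rintro ⟨rfl, rfl⟩; exact ⟨rfl, h, rfl⟩),
        ite_eq_mul (P := p = m ∧ b p ≤ i.val ∧ k = p + 1) (Q := m = p) (R := m + 1 = k) (by
          constructor
          · rintro ⟨rfl, -, rfl⟩; exact ⟨rfl, rfl⟩
          · rintro ⟨rfl, rfl⟩; exact ⟨rfl, h, rfl⟩)]
      ring
    · rw [if_neg h]
      have h1 : ∀ q r : ℕ, ¬ (q = m ∧ b q ≤ i.val ∧ r = q + 1) := by
        rintro q r ⟨rfl, h', -⟩; exact h h'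
      rw [if_neg (h1 k p), if_neg (h1 p k)]
      simp [wordForm]

/-- The weights between two neighbouring rows. In each block the letter `i` comes before the
letter `j`, which is missing only if it is not needed any more. -/
theorem triForm_staircase_pair {b : ℕ → ℕ} (hb : Monotone b) (m : ℕ) {i j : X.Node} (hij : j < i)
    (h : ∀ r, b r ≤ i.val → ∀ s < r, b s ≤ j.val) (k p : ℕ) :
    triForm (deco (staircase X b m)) (.f i k) (.f j p) =
      X.gram i j / 2 * (((if p < m ∧ b p ≤ i.val ∧ k = p + 1 then 1 else 0) -
        (if p < m ∧ b p ≤ i.val ∧ k = p then 1 else 0)) +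
        ((if p < m ∧ b p ≤ j.val ∧ k = p + 1 then 1 else 0) -
        (if p < m + 1 ∧ 0 < p ∧ b (p - 1) ≤ j.val ∧ k = p then 1 else 0))) := by
  rw [triForm_deco_f_f (P := fun a => a = i ∨ a = j) _ (by simp) (by simp)]
  induction m with
  | zero =>
    have : ¬ (p < 0 + 1 ∧ 0 < p ∧ b (p - 1) ≤ j.val ∧ k = p) := by omega
    rw [if_neg this]
    simp [staircase, wordForm]
  | succ m ih =>
    have hf : (descend X (b m) X.rank).filter (fun a => a = i ∨ a = j) =
        (if b m ≤ i.val then [i] else []) ++ (if b m ≤ j.val then [j] else []) := by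
      have := i.isLt
      have := j.isLt
      refine filter_descend_eq _ ?_ fun a => ?_
      · split_ifs <;> simp [hij]
      · simp only [decide_eq_true_eq]
        split_ifs with h1 h2 h2 <;> simp only [List.append_nil, List.nil_append, List.mem_cons,
          List.cons_append, List.not_mem_nil, or_false, false_iff, Fin.ext_iff] <;>
          rw [Fin.lt_def] at hij <;> omega
    rw [staircase, List.filter_append, List.map_append, wordForm_append, ih, hf,
      ite_lt_succ p m (b p ≤ i.val ∧ k = p + 1), ite_lt_succ p m (b p ≤ i.val ∧ k = p),
      ite_lt_succ p m (b p ≤ j.val ∧ k = p + 1), ite_lt_succ p (m + 1)]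
    have hs : ∀ q : ℕ, ((m : ℤ) + 1 = q) = (m + 1 = q) := fun q =>
      propext (by exact_mod_cast Iff.rfl)
    have hne : i ≠ j := hij.ne'
    have e1 : ∀ x : X.Node, b m ≤ x.val → (if p = m ∧ b p ≤ x.val ∧ k = p + 1 then (1 : ℚ) else 0) =
        (if m = p then 1 else 0) * (if m + 1 = k then 1 else 0) := fun x hx => ite_eq_mul (by
      constructor
      · rintro ⟨rfl, -, rfl⟩; exact ⟨rfl, rfl⟩
      · rintro ⟨rfl, rfl⟩; exact ⟨rfl, hx, rfl⟩)
    have e2 : b m ≤ i.val → (if p = m ∧ b p ≤ i.val ∧ k = p then (1 : ℚ) else 0) =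
        (if m = p then 1 else 0) * (if m = k then 1 else 0) := fun hx => ite_eq_mul (by
      constructor
      · rintro ⟨rfl, -, rfl⟩; exact ⟨rfl, rfl⟩
      · rintro ⟨rfl, rfl⟩; exact ⟨rfl, hx, rfl⟩)
    have e3 : b m ≤ j.val →
        (if p = m + 1 ∧ 0 < p ∧ b (p - 1) ≤ j.val ∧ k = p then (1 : ℚ) else 0) =
        (if m + 1 = p then 1 else 0) * (if m + 1 = k then 1 else 0) := fun hx => ite_eq_mul (by
      constructor
      · rintro ⟨rfl, -, -, rfl⟩; exact ⟨rfl, rfl⟩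
      · rintro ⟨rfl, rfl⟩; exact ⟨rfl, m.succ_pos, hx, rfl⟩)
    have z1 : ∀ x : X.Node, ¬ b m ≤ x.val → ¬ (p = m ∧ b p ≤ x.val ∧ k = p + 1) := by
      rintro x hx ⟨rfl, h', -⟩; exact hx h'
    have z2 : ¬ b m ≤ i.val → ¬ (p = m ∧ b p ≤ i.val ∧ k = p) := by
      rintro hx ⟨rfl, h', -⟩; exact hx h'
    have z3 : ¬ b m ≤ j.val → ¬ (p = m + 1 ∧ 0 < p ∧ b (p - 1) ≤ j.val ∧ k = p) := by
      rintro hx ⟨rfl, -, h', -⟩; exact hx h'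
    by_cases hi : b m ≤ i.val
    · have hc : (letterCount (X := X) (((staircase X b m).filter fun a => a = i ∨ a = j).map
          (·, none)) i) = m := by
        rw [letterCount_filter_map _ (by simp), count_staircase fun r hr => (hb hr.le).trans hi]
      have hc' : (letterCount (X := X) (((staircase X b m).filter fun a => a = i ∨ a = j).map
          (·, none)) j) = m := by
        rw [letterCount_filter_map _ (by simp), count_staircase (h m hi)]
      rw [if_pos hi]
      by_cases hj : b m ≤ j.val
      · rw [if_pos hj]
        simp only [List.map_cons, List.map_nil, List.cons_append, List.nil_append, wordForm,
          letterForm, wedge, eInd_f, bump, state, QLabel.node, hc,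
          hc', if_true, zero_add, hs, Nat.cast_inj, if_neg hne, if_neg hne.symm]
        rw [e1 i hi, e2 hi, e1 j hj, e3 hj]
        ring
      · rw [if_neg hj]
        simp only [List.map_cons, List.map_nil, List.append_nil, wordForm,
          letterForm, wedge, eInd_f, bump, state, QLabel.node, hc,
          hc', if_true, zero_add, hs, Nat.cast_inj, if_neg hne.symm]
        rw [e1 i hi, e2 hi, if_neg (z1 j hj), if_neg (z3 hj)]
        ring
    · have hj : ¬ b m ≤ j.val := fun h' => hi (h'.trans (Fin.lt_def.1 hij).le)
      rw [if_neg hi, if_neg hj, if_neg (z1 i hi), if_neg (z2 hi), if_neg (z1 j hj), if_neg (z3 hj)]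
      simp [wordForm]

/-! ### Staircase words of the longest element -/

theorem isPositivePlay_append {f : X.Node → ℤ} {l l' : List X.Node} :
    IsPositivePlay f (l ++ l') ↔ IsPositivePlay f l ∧ IsPositivePlay (l.foldl play f) l' := by
  induction l generalizing f with
  | nil => simp [IsPositivePlay]
  | cons i l ih => simp only [List.cons_append, IsPositivePlay, ih, List.foldl_cons, and_assoc]

/-- The sequence `y` with the entries at `k - 1` and `k` exchanged. -/
def swapAt (y : ℤ → ℤ) (k : ℤ) (t : ℤ) : ℤ :=
  if t = k then y (k - 1) else if t = k - 1 then y k else y t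

/-- The sequence `y` with the entry at `s - 1` moved to the position `b - 1`, and the entries in
between moved up. -/
def cycleAt (y : ℤ → ℤ) (b s : ℤ) (t : ℤ) : ℤ :=
  if t = b - 1 then y (s - 1) else if b ≤ t ∧ t < s then y (t - 1) else y t

/-- If the reflections in the nodes of a chain exchange neighbouring coordinates, then a descending
word of nodes moves one coordinate, which has to be larger than the ones that it passes. -/
theorem play_descend {F : (ℤ → ℤ) → X.Node → ℤ} {b : ℕ}
    (hswap : ∀ (y : ℤ → ℤ) (i : X.Node), b ≤ i.val → play (F y) i = F (swapAt y i.val))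
    (hF : ∀ (y : ℤ → ℤ) (i : X.Node), b ≤ i.val → F y i = y i.val - y (i.val - 1))
    {s : ℕ} (hb : b ≤ s) (hs : s ≤ X.rank) (y : ℤ → ℤ)
    (hy : ∀ t : ℤ, b - 1 ≤ t → t < s - 1 → y t < y (s - 1)) :
    IsPositivePlay (F y) (descend X b s) ∧
      (descend X b s).foldl play (F y) = F (cycleAt y b s) := by
  induction s, hb using Nat.le_induction generalizing y with
  | base =>
    rw [descend_self]
    refine ⟨trivial, congrArg F (funext fun t => ?_)⟩
    unfold cycleAt
    split_ifs with h1 h2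
    · rw [h1]
    · omega
    · rfl
  | succ s hb ih =>
    have hs' : s < X.rank := hs
    rw [descend_succ hb hs', List.foldl_cons, IsPositivePlay, hswap y ⟨s, hs'⟩ hb,
      hF y ⟨s, hs'⟩ hb]
    have h0 : (((s + 1 : ℕ) : ℤ) - 1) = s := by push_cast; ring
    rw [h0] at hy
    have h1 : swapAt y s (s - 1) = y s := by simp [swapAt]
    obtain ⟨h2, h3⟩ := ih hs'.le (swapAt y s) fun t ht ht' => by
      rw [h1, swapAt, if_neg (by omega), if_neg (by omega)]
      exact hy t ht (by omega)
    refine ⟨⟨by have := hy (s - 1) (by omega) (by omega); dsimp only; omega, h2⟩, h3.trans ?_⟩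
    refine congrArg F (funext fun t => ?_)
    unfold cycleAt
    rw [h1, h0]
    unfold swapAt
    push_cast
    split_ifs <;> first | rfl | omega | (congr 1; omega)

/-- A word that is played like a word of `w₀` is one. -/
theorem isLongestWord_of_isPositivePlay {l l' : List X.Node} (hl : X.IsLongestWord l)
    {f : X.Node → ℤ} (h0 : ∀ i, 0 < f i) (hp : IsPositivePlay f l')
    (hneg : ∀ i, l'.foldl play f i < 0) : X.IsLongestWord l' :=
  have h := X.isReduced_of_isPositivePlay h0 hp hneg
  hl.of_forall_descent h.1 h.2

theorem cartan_A {n : ℕ} (i j : (A n).Node) : (A n).cartan i j =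
    if i.val = j.val then 2 else if i.val + 1 = j.val ∨ j.val + 1 = i.val then -1 else 0 := by
  classical
  exact if_congr Fin.ext_iff rfl (if_congr Iff.rfl rfl rfl)

theorem cartan_B {n : ℕ} (i j : (B n).Node) : (B n).cartan i j =
    if i.val = j.val then 2 else if i.val + 1 = j.val ∨ j.val + 1 = i.val then
      (if i.val = 0 then -2 else -1) else 0 := by
  classical
  exact if_congr Fin.ext_iff rfl (if_congr Iff.rfl rfl rfl)

theorem cartan_C {n : ℕ} (i j : (C n).Node) : (C n).cartan i j =
    if i.val = j.val then 2 else if i.val + 1 = j.val ∨ j.val + 1 = i.val then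
      (if j.val = 0 then -2 else -1) else 0 := by
  classical
  exact if_congr Fin.ext_iff rfl (if_congr Iff.rfl rfl rfl)

theorem cartan_D {n : ℕ} (i j : (D n).Node) : (D n).cartan i j =
    if i.val = j.val then 2 else if (1 ≤ i.val ∧ i.val + 1 = j.val) ∨
      (1 ≤ j.val ∧ j.val + 1 = i.val) ∨ (i.val = 0 ∧ j.val = 2) ∨ (i.val = 2 ∧ j.val = 0) then -1
    else 0 := by
  classical
  exact if_congr Fin.ext_iff rfl (if_congr Iff.rfl rfl rfl)

/-- The simple roots of type `A n` are `ε_i - ε_{i-1}` for coordinates `ε_{-1}, ..., ε_{n-1}`. -/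
theorem play_A {n : ℕ} (y : ℤ → ℤ) (i : (A n).Node) :
    play (X := A n) (fun j => y j.val - y (j.val - 1)) i =
      fun j => swapAt y i.val j.val - swapAt y i.val (j.val - 1) := by
  funext j
  simp only [play, cartan_A, swapAt]
  grind

/-- The values of the simple roots of type `B n` (`c = 1`) or `C n` (`c = 2`) at the point `y`: the
root of the node `0` is `c ε_0`, the other ones are `ε_i - ε_{i-1}`. -/
def valueBC (c : ℤ) (y : ℤ → ℤ) (i : X.Node) : ℤ :=
  if i.val = 0 then c * y 0 else y i.val - y (i.val - 1)

/-- The values of the simple roots of type `D n`, with `ε_0 + ε_1` for the node `0`. -/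
def valueD (y : ℤ → ℤ) (i : X.Node) : ℤ :=
  if i.val = 0 then y 0 + y 1 else y i.val - y (i.val - 1)

/-- The Cartan matrix of type `B n` (`c = 1`) or `C n` (`c = 2`). -/
def IsCartanBC (X : LieType) (c : ℤ) : Prop :=
  0 < c ∧ ∀ i j : X.Node, X.cartan i j =
    if i.val = j.val then 2 else if i.val + 1 = j.val ∨ j.val + 1 = i.val then
      (if i.val = 0 then c - 3 else if j.val = 0 then -c else -1) else 0

theorem isCartanBC_B (n : ℕ) : IsCartanBC (B n) 1 := by
  refine ⟨one_pos, fun i j => ?_⟩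
  rw [cartan_B]
  split_ifs <;> rfl

theorem isCartanBC_C (n : ℕ) : IsCartanBC (C n) 2 := by
  refine ⟨two_pos, fun i j => ?_⟩
  rw [cartan_C]
  split_ifs <;> first | rfl | omega

theorem play_valueBC {c : ℤ} (hX : IsCartanBC X c) (y : ℤ → ℤ) (i : X.Node) (hi : 1 ≤ i.val) :
    play (valueBC c y) i = valueBC c (swapAt y i.val) := by
  funext j
  simp only [play, hX.2, swapAt, valueBC]
  grind

theorem play_valueBC_zero {c : ℤ} (hX : IsCartanBC X c) (hc : c = 1 ∨ c = 2) (y : ℤ → ℤ)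
    (i : X.Node) (hi : i.val = 0) :
    play (valueBC c y) i = valueBC c (fun t => if t = 0 then - y 0 else y t) := by
  funext j
  simp only [play, hX.2, valueBC, hi]
  grind

theorem play_valueD {n : ℕ} (y : ℤ → ℤ) (i : (D n).Node) (hi : 1 ≤ i.val) :
    play (valueD y) i = valueD (swapAt y i.val) := by
  funext j
  simp only [play, cartan_D, swapAt, valueD]
  grind

theorem play_valueD_zero {n : ℕ} (y : ℤ → ℤ) (i : (D n).Node) (hi : i.val = 0) :
    play (valueD y) i = valueD fun t =>
      if t = 0 then - y 1 else if t = 1 then - y 0 else y t := by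
  funext j
  simp only [play, cartan_D, valueD, hi]
  grind

/-- The word `s_{n-1} ... s_0` moves the last coordinate to the front and changes its sign. -/
theorem play_block_BC {c : ℤ} (hX : IsCartanBC X c) (hc : c = 1 ∨ c = 2) (hn : 1 ≤ X.rank)
    (y : ℤ → ℤ) (h0 : 0 < y (X.rank - 1))
    (hy : ∀ t : ℤ, 0 ≤ t → t < X.rank - 1 → y t < y (X.rank - 1)) :
    IsPositivePlay (valueBC c y) (descend X 0 X.rank) ∧
      (descend X 0 X.rank).foldl play (valueBC c y) = valueBC c fun t =>
        if t = 0 then - y (X.rank - 1) else if 1 ≤ t ∧ t < X.rank then y (t - 1) else y t := by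
  have h1 := play_descend (X := X) (b := 1) (F := valueBC c) (play_valueBC hX)
    (fun y i hi => if_neg (by omega)) hn le_rfl y (by simpa using hy)
  have h2 : descend X 0 1 = [⟨0, hn⟩] := by
    rw [descend_succ le_rfl hn, descend_self]
  rw [descend_append (m := 1) (Nat.zero_le 1) hn, h2, isPositivePlay_append, List.foldl_append,
    h1.2, List.foldl_cons, List.foldl_nil, play_valueBC_zero hX hc _ _ rfl]
  refine ⟨⟨h1.1, ?_, trivial⟩, congrArg _ (funext fun t => ?_)⟩
  · simpa [valueBC, cycleAt] using mul_pos hX.1 h0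
  · simp [cycleAt]
    grind

theorem isLongestWord_staircase_BC {c : ℤ} (hX : IsCartanBC X c) (hc : c = 1 ∨ c = 2)
    (hn : 1 ≤ X.rank) {l : List X.Node} (hl : X.IsLongestWord l) :
    X.IsLongestWord (staircase X (fun _ => 0) X.rank) := by
  let Y : ℕ → ℤ → ℤ := fun r t => if 0 ≤ t ∧ t < X.rank then
    (if t < r then -(X.rank - r + 1 + t) else t - r + 1) else 0
  have key : ∀ r ≤ X.rank, IsPositivePlay (valueBC (X := X) c (Y 0)) (staircase X (fun _ => 0) r) ∧
      (staircase X (fun _ => 0) r).foldl play (valueBC c (Y 0)) = valueBC c (Y r) := by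
    intro r hr
    induction r with
    | zero => exact ⟨trivial, rfl⟩
    | succ r ih =>
      obtain ⟨h1, h2⟩ := ih (by omega)
      obtain ⟨h3, h4⟩ := play_block_BC hX hc hn (Y r) (by simp only [Y]; split_ifs <;> omega)
        (fun t ht ht' => by simp only [Y]; split_ifs <;> omega)
      rw [staircase, isPositivePlay_append, List.foldl_append, h2]
      refine ⟨⟨h1, h3⟩, h4.trans (congrArg _ (funext fun t => ?_))⟩
      simp only [Y]
      push_cast
      split_ifs <;> omega
  obtain ⟨h1, h2⟩ := key X.rank le_rfl
  refine isLongestWord_of_isPositivePlay hl (fun i => ?_) h1 fun i => ?_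
  · have := i.isLt
    simp only [valueBC, Y]
    have := hX.1
    split_ifs <;> omega
  · have := i.isLt
    rw [h2]
    simp only [valueBC, Y]
    split_ifs <;> omega

/-- The word `s_{n-1} ... s_0` moves the last coordinate to the position `1`, if the coordinate at
`0` vanishes, and changes its sign. -/
theorem play_block_D {n : ℕ} (hn : 2 ≤ n) (y : ℤ → ℤ) (h0 : 0 < y (n - 1)) (hy0 : y 0 = 0)
    (hy : ∀ t : ℤ, 0 ≤ t → t < n - 1 → y t < y (n - 1)) :
    IsPositivePlay (X := D n) (valueD y) (descend (D n) 0 n) ∧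
      (descend (D n) 0 n).foldl play (valueD y) = valueD fun t =>
        if t = 0 then 0 else if t = 1 then - y (n - 1) else if 2 ≤ t ∧ t < n then y (t - 1)
          else y t := by
  have h1 := play_descend (X := D n) (b := 1) (s := n) (F := valueD) play_valueD
    (fun y i hi => if_neg (by omega)) (by omega) le_rfl y (by simpa using hy)
  have hn' : 0 < (D n).rank := by change 0 < n; omega
  have h2 : descend (D n) 0 1 = [⟨0, hn'⟩] := by
    rw [descend_succ le_rfl hn', descend_self]
  rw [descend_append (m := 1) (Nat.zero_le 1) (by omega), h2, isPositivePlay_append,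
    List.foldl_append, h1.2, List.foldl_cons, List.foldl_nil, play_valueD_zero _ _ rfl]
  refine ⟨⟨h1.1, ?_, trivial⟩, congrArg _ (funext fun t => ?_)⟩
  · have h3 : (1 : ℤ) < n := by omega
    simpa [valueD, cycleAt, hy0, h3] using h0
  · simp [cycleAt]
    grind

theorem isLongestWord_staircase_D {n : ℕ} (hn : 2 ≤ n) {l : List (D n).Node}
    (hl : (D n).IsLongestWord l) : (D n).IsLongestWord (staircase (D n) (fun _ => 0) (n - 1)) := by
  let Y : ℕ → ℤ → ℤ := fun r t => if 1 ≤ t ∧ t < n then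
    (if t ≤ r then -(n - 1 - r + t) else t - r) else 0
  have key : ∀ r ≤ n - 1,
      IsPositivePlay (X := D n) (valueD (Y 0)) (staircase (D n) (fun _ => 0) r) ∧
      (staircase (D n) (fun _ => 0) r).foldl play (valueD (Y 0)) = valueD (Y r) := by
    intro r hr
    induction r with
    | zero => exact ⟨trivial, rfl⟩
    | succ r ih =>
      obtain ⟨h1, h2⟩ := ih (by omega)
      obtain ⟨h3, h4⟩ := play_block_D hn (Y r) (by simp only [Y]; split_ifs <;> omega) (by simp [Y])
        (fun t ht ht' => by simp only [Y]; split_ifs <;> omega)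
      rw [staircase, isPositivePlay_append, List.foldl_append, h2]
      refine ⟨⟨h1, h3⟩, h4.trans (congrArg _ (funext fun t => ?_))⟩
      simp only [Y]
      push_cast
      split_ifs <;> omega
  obtain ⟨h1, h2⟩ := key (n - 1) le_rfl
  refine isLongestWord_of_isPositivePlay hl (fun i => ?_) h1 fun i => ?_
  · have : i.val < n := i.isLt
    simp only [valueD, Y]
    split_ifs <;> omega
  · have : i.val < n := i.isLt
    rw [h2]
    simp only [valueD, Y]
    split_ifs <;> omega

theorem isLongestWord_staircase_A {n : ℕ} {l : List (A n).Node}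
    (hl : (A n).IsLongestWord l) : (A n).IsLongestWord (staircase (A n) id n) := by
  let F : (ℤ → ℤ) → (A n).Node → ℤ := fun y j => y j.val - y (j.val - 1)
  let Y : ℕ → ℤ → ℤ := fun r t => if -1 ≤ t ∧ t < n then
    (if t ≤ r - 2 then n - 2 - t else t - r) else 0
  have key : ∀ r ≤ n,
      IsPositivePlay (X := A n) (F (Y 0)) (staircase (A n) id r) ∧
      (staircase (A n) id r).foldl play (F (Y 0)) = F (Y r) := by
    intro r hr
    induction r with
    | zero => exact ⟨trivial, rfl⟩
    | succ r ih =>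
      obtain ⟨h1, h2⟩ := ih (by omega)
      obtain ⟨h3, h4⟩ := play_descend (X := A n) (F := F) (b := r) (s := n)
        (fun y i _ => play_A y i) (fun y i _ => rfl) (by omega) le_rfl (Y r)
        (fun t ht ht' => by simp only [Y]; split_ifs <;> omega)
      rw [staircase, isPositivePlay_append, List.foldl_append, h2]
      refine ⟨⟨h1, h3⟩, h4.trans (congrArg _ (funext fun t => ?_))⟩
      simp only [Y, cycleAt]
      push_cast
      split_ifs <;> omega
  obtain ⟨h1, h2⟩ := key n le_rfl
  refine isLongestWord_of_isPositivePlay hl (fun i => ?_) h1 fun i => ?_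
  · have : i.val < n := i.isLt
    simp only [F, Y]
    split_ifs <;> omega
  · have : i.val < n := i.isLt
    rw [h2]
    simp only [F, Y]
    split_ifs <;> omega

theorem isLongestWord_staircase_G2 {l : List G2.Node} (hl : G2.IsLongestWord l) :
    G2.IsLongestWord (staircase G2 (fun _ => 0) 3) := by
  have hd : descend G2 0 G2.rank = [⟨1, by decide⟩, ⟨0, by decide⟩] := by decide
  have hs : staircase G2 (fun _ => 0) 3 = [⟨1, by decide⟩, ⟨0, by decide⟩, ⟨1, by decide⟩,
      ⟨0, by decide⟩, ⟨1, by decide⟩, ⟨0, by decide⟩] := by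
    simp [staircase, hd]
  have hc : ∀ i j : G2.Node, G2.cartan i j =
      if i.val = j.val then 2 else if i.val = 1 then -3 else -1 := by
    intro i j
    have h : i ≠ j → G2.Adj i j := by revert i j; unfold Adj; decide
    unfold cartan
    by_cases h1 : i = j
    · rw [if_pos h1, if_pos (congrArg _ h1)]
    · rw [if_neg h1, if_pos (h h1), if_neg fun h' => h1 (Fin.ext h')]
  rw [hs]
  refine isLongestWord_of_isPositivePlay hl (f := fun _ => 1) (fun _ => one_pos) ?_ ?_
  · simp [IsPositivePlay, play, hc]
  · intro i
    fin_cases i <;> simp [play, hc]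

/-! ### Weights at the vertices `e_a^0` -/

theorem eSum_nonneg (T : List X.Letter) (v : QLabel X.Node) : 0 ≤ eSum T v := by
  induction T with
  | nil => exact le_rfl
  | cons p T ih => exact add_nonneg (eInd_nonneg _ _) ih

theorem labelForm_eq_zero {T : List X.Letter} {u : QLabel X.Node} (h : eSum T u = 0)
    (v : QLabel X.Node) : labelForm T u v = 0 := by
  induction T with
  | nil => rfl
  | cons p T ih =>
    obtain ⟨h1, h2⟩ := (add_eq_zero_iff_of_nonneg (eInd_nonneg _ _) (eSum_nonneg _ _)).1 h
    simp [labelForm, wedge, h1, h2, ih h2]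

theorem wordForm_e_e (c : X.Node → ℤ) (T : List X.Letter) (a b : X.Node) :
    wordForm c T (.e a) (.e b) = 0 := by
  induction T generalizing c with
  | nil => rfl
  | cons p T ih => simp [wordForm, letterForm, wedge, state, ih]

open Classical in
theorem eSum_deco_e (l : List X.Node) (a : X.Node) :
    eSum (deco l) (.e a) = (X.weyl.rightInvSeq l).count (X.weyl.simple a) := by
  induction l with
  | nil => rfl
  | cons i l ih =>
    rw [deco] at ih
    rw [deco, decoAt, eSum, ih, CoxeterSystem.rightInvSeq, List.count_cons]
    simp only [eInd, label_eq_some, mul_one, beq_iff_eq]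
    split_ifs <;> push_cast <;> ring

/-- The right inversions of a reduced word are distinct, so that a label occurs at most once. -/
theorem eSum_deco_e_le {l : List X.Node} (hl : X.weyl.IsReduced l) (a : X.Node) :
    eSum (deco l) (.e a) ≤ 1 := by
  classical
  rw [eSum_deco_e]
  exact_mod_cast List.nodup_iff_count_le_one.1 hl.nodup_rightInvSeq _

/-- The letter `i` after the prefix `p` of `l` carries the label `a`. -/
def HasLabel (l p : List X.Node) (i a : X.Node) : Prop :=
  ∃ v, l = p ++ i :: v ∧
    (X.weyl.wordProd v)⁻¹ * X.weyl.simple i * X.weyl.wordProd v = X.weyl.simple a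

theorem HasLabel.mult_eq {l p : List X.Node} {i a : X.Node} (h : HasLabel l p i a) :
    X.mult i = X.mult a := by
  obtain ⟨v, -, h⟩ := h
  exact (mult_eq_of_conj (w := X.weyl.wordProd v) (by rw [← h]; group)).symm

/-- Labels are right inversions; in a longest word the Dynkin involution translates them to left
inversions. -/
theorem hasLabel_of_conj {l p v : List X.Node} {η : Equiv.Perm X.Node} (hl : X.IsLongestWord l)
    (hη : X.IsDynkinInvolution l η) {i b : X.Node} (h : l = p ++ i :: v)
    (hb : X.weyl.wordProd p * X.weyl.simple i = X.weyl.simple b * X.weyl.wordProd p) :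
    HasLabel l p i (η b) := by
  refine ⟨v, h, ?_⟩
  have h1 := hη (η b)
  rw [hη.apply_apply hl, h, X.weyl.wordProd_append, X.weyl.wordProd_cons,
    ← mul_assoc (X.weyl.wordProd p),
    hb, mul_assoc, mul_assoc, mul_assoc, X.weyl.simple_mul_simple_cancel_left] at h1
  have h2 : X.weyl.wordProd p * (X.weyl.wordProd v * X.weyl.simple (η b)) =
      X.weyl.wordProd p * (X.weyl.simple i * X.weyl.wordProd v) := by
    rw [← mul_assoc _ (X.weyl.simple i), hb, mul_assoc, ← h1, X.weyl.simple_mul_simple_cancel_left]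
  rw [mul_assoc, ← mul_left_cancel h2, inv_mul_cancel_left]

theorem wordForm_f_e_eq_zero {T : List X.Letter} {a : X.Node} (h : eSum T (.e a) = 0)
    (c : X.Node → ℤ) (j : X.Node) (k : ℤ) : wordForm c T (.f j k) (.e a) = 0 := by
  induction T generalizing c with
  | nil => rfl
  | cons p T ih =>
    obtain ⟨h1, h2⟩ := (add_eq_zero_iff_of_nonneg (eInd_nonneg _ _) (eSum_nonneg _ _)).1 h
    simp [wordForm, letterForm, wedge, h1, ih h2, state, eInd_f]

/-- The labels before and after a letter with the label `a` are different from `a`. -/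
theorem HasLabel.exists_deco_eq {l p : List X.Node} {i a : X.Node} (hl : X.weyl.IsReduced l)
    (h : HasLabel l p i a) : ∃ T v, l = p ++ i :: v ∧ deco l = T ++ [(i, some a)] ++ deco v ∧
      T.map Prod.fst = p ∧ eSum T (.e a) = 0 ∧ eSum (deco v) (.e a) = 0 := by
  obtain ⟨v, hv, ha⟩ := h
  have hD : deco l = decoAt (X.weyl.wordProd [i] * X.weyl.wordProd v) p ++ [(i, some a)] ++
      deco v := by
    have := deco_block p [i] v
    rw [decoAt, decoAt, X.weyl.wordProd_nil, one_mul, ha, label_eq_some.2 rfl] at this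
    rw [← this, hv]
    simp
  refine ⟨_, v, hv, hD, map_fst_decoAt _ _, ?_⟩
  have h1 := eSum_deco_e_le hl a
  rw [hD, eSum_append, eSum_append] at h1
  have h2 : eSum [(i, some a)] (.e a) = 1 := by simp [eSum, eInd]
  have h3 := eSum_nonneg (decoAt (X.weyl.wordProd [i] * X.weyl.wordProd v) p) (.e a)
  have h4 := eSum_nonneg (deco v) (.e a)
  constructor <;> linarith

/-- The vertex `e_a^0` has arrows to and from the two ends of the arrow of the letter that carries
`a`. -/
theorem HasLabel.triForm_f_e {l p : List X.Node} {i a : X.Node} (hl : X.weyl.IsReduced l)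
    (h : HasLabel l p i a) (j : X.Node) (k : ℕ) :
    triForm (deco l) (.f j k) (.e a) = if j = i then X.mult i *
      ((if k = p.count i + 1 then 1 else 0) - (if k = p.count i then 1 else 0)) else 0 := by
  obtain ⟨T, v, -, hD, hT, h1, h2⟩ := h.exists_deco_eq hl
  rw [triForm, labelForm_f_left, add_zero, hD, wordForm_append, wordForm_append,
    wordForm_f_e_eq_zero h1, wordForm_f_e_eq_zero h2]
  have hc : ∀ x, letterCount T x = p.count x := fun x => by rw [letterCount, hT]
  simp only [wordForm, letterForm, state, wedge, bump, eInd, Pi.add_apply, Pi.zero_apply,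
    hc, if_true]
  by_cases hj : j = i
  · subst hj
    have e1 : (((p.count j : ℕ) : ℤ) + 1 = k) = (k = p.count j + 1) :=
      propext ⟨fun h => by omega, fun h => by omega⟩
    have e2 : (((p.count j : ℕ) : ℤ) = k) = (k = p.count j) :=
      propext ⟨fun h => by omega, fun h => by omega⟩
    simp only [if_true, zero_add, e1, e2]
    ring
  · simp [hj]

theorem HasLabel.triForm_e_e {l p p' : List X.Node} {i i' a a' : X.Node} (hl : X.weyl.IsReduced l)
    (h : HasLabel l p i a) (h' : HasLabel l p' i' a') (hp : p.length < p'.length) :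
    triForm (deco l) (.e a) (.e a') = X.gram a a' / 2 := by
  obtain ⟨T, v, hv, hD, hT, h1, h2⟩ := h.exists_deco_eq hl
  obtain ⟨T', v', hv', hD', hT', h1', h2'⟩ := h'.exists_deco_eq hl
  have hlen : T.length < T'.length := by
    rwa [← List.length_map (f := Prod.fst), hT, ← List.length_map (f := Prod.fst) (as := T'), hT']
  obtain ⟨W, rfl⟩ : ∃ W, T' = T ++ [(i, some a)] ++ W := by
    obtain ⟨W, hW⟩ := List.prefix_of_prefix_length_le (l₁ := T ++ [(i, some a)]) (l₂ := T')
      (l₃ := deco l) ⟨_, hD.symm⟩ ⟨_, by rw [hD', List.append_assoc]⟩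
      (by rw [List.length_append]; exact hlen)
    exact ⟨W, hW.symm⟩
  have e : ∀ o (b : X.Node), eSum [(i, some o)] (.e b) = if o = b then 1 else 0 := by
    simp [eSum, eInd]
  have e' : eSum [(i', some a')] (.e a') = 1 := by simp [eSum, eInd]
  rw [eSum_append, eSum_append] at h1'
  have n1 := eSum_nonneg T (.e a')
  have n2 := eSum_nonneg [(i, some a)] (.e a')
  have n3 := eSum_nonneg W (.e a')
  have h3 : deco v = W ++ [(i', some a')] ++ deco v' := by
    rw [hD'] at hD
    simpa using hD.symm
  rw [triForm, wordForm_e_e, zero_add, hD, labelForm_append, labelForm_append,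
    labelForm_eq_zero h1, labelForm_eq_zero h2]
  have h4 : eSum (deco v) (.e a') = 1 := by
    rw [h3, eSum_append, eSum_append, e', h2']
    linarith
  have h5 : eSum T (.e a') = 0 := by linarith
  have h6 : eSum [(i, some a)] (.e a') = 0 := by linarith
  have h7 : labelForm [(i, some a)] (.e a) (.e a') = 0 := by simp [labelForm, eSum, wedge]
  simp only [wedge, eSum_append, h1, h2, h4, h5, h6, h7, e, QLabel.node, if_true]
  ring

end LieType

namespace WQuiver

theorem isomorphic_of_bijOn {V V' : Type} {Q : WQuiver V} {Q' : WQuiver V'} (ψ : V' → V)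
    (hψ : Set.BijOn ψ Q'.verts Q.verts) (hf : ∀ v ∈ Q'.verts, v ∈ Q'.frozen ↔ ψ v ∈ Q.frozen)
    (hd : ∀ v ∈ Q'.verts, Q'.d v = Q.d (ψ v))
    (hw : ∀ u ∈ Q'.verts, ∀ v ∈ Q'.verts, Q'.w u v = Q.w (ψ u) (ψ v)) : Q.Isomorphic Q' := by
  have h : ∀ v : Q.verts, ψ ((hψ.equiv ψ).symm v : V') = v := fun v =>
    congrArg Subtype.val ((hψ.equiv ψ).apply_symm_apply v)
  refine ⟨(hψ.equiv ψ).symm, fun v => ?_, fun v => ?_, fun u v => ?_⟩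
  · rw [hf _ (Subtype.prop _), h]
  · rw [hd _ (Subtype.prop _), h]
  · rw [hw _ (Subtype.prop _) _ (Subtype.prop _), h, h]

end WQuiver

namespace LieType

open WQuiver

variable {X : LieType}

/-! ### The types B, C, D and G₂ -/

theorem x_mem_confVerts (hA : ∀ n, X ≠ A n) {i : X.Node} {k : ℕ} :
    .x i k ∈ X.confVerts ↔ k ≤ X.halfCoxeter := by
  cases X
  · exact absurd rfl (hA _)
  all_goals exact Iff.rfl

theorem y_mem_confVerts (hA : ∀ n, X ≠ A n) {i : X.Node} : .y i ∈ X.confVerts := by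
  cases X
  · exact absurd rfl (hA _)
  all_goals exact trivial

theorem t_notMem_confVerts (hA : ∀ n, X ≠ A n) {a b c : ℕ} : .t a b c ∉ X.confVerts := by
  cases X
  · exact absurd rfl (hA _)
  all_goals exact id

theorem abs_mult_mul_cartan {i j : X.Node} (h : i ≠ j) :
    |X.mult i * X.cartan i j| = X.gram i j := by
  rw [← abs_neg]
  exact abs_of_nonneg (gram_nonneg h)

theorem triForm_e_e_eq_zero {a b : X.Node} (h : X.gram a b = 0) (T : List X.Letter) :
    triForm T (.e a) (.e b) = 0 := by
  rw [triForm, wordForm_e_e, zero_add]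
  induction T with
  | nil => rfl
  | cons p T ih => rw [labelForm, ih]; simp [QLabel.node, h]

theorem wordForm_gram_zero {i j : X.Node} (h : X.gram i j = 0) (c : X.Node → ℤ)
    (T : List X.Letter) (k p : ℤ) : wordForm c T (.f i k) (.f j p) = 0 := by
  induction T generalizing c with
  | nil => rfl
  | cons x T ih => rw [wordForm, ih]; simp [letterForm, QLabel.node, h, wedge, eInd_f]

theorem triForm_f_f_eq_zero {i j : X.Node} (h : X.gram i j = 0) (T : List X.Letter) (k p : ℤ) :
    triForm T (.f i k) (.f j p) = 0 := by
  rw [triForm, labelForm_f_left, add_zero, wordForm_gram_zero h]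

/-- The quiver of a word that consists of `h / 2` blocks `n-1, ..., 0` is the `Conf₃ 𝒜_G` quiver,
with `x_{i,k}` corresponding to `f_i^k`, if the letter number `c_i` in the row `r_i` carries the
label `σ i` that corresponds to `y_i`. -/
theorem isomorphic_confQuiver (hA : ∀ n, X ≠ A n) (hm : 0 < X.halfCoxeter) (i₀ : X.Node)
    {l : List X.Node} (hs : l = staircase X (fun _ => 0) X.halfCoxeter) (hl : X.weyl.IsReduced l)
    {row : X.Node → X.Node} (hrow : ∀ i, (row i).val = X.yRow i) {p : X.Node → List X.Node}
    (hp : ∀ i, (p i).count (row i) + 1 = X.yCol i) {σ : Equiv.Perm X.Node}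
    (hσ : ∀ i, HasLabel l (p i) (row i) (σ i)) (hgram : ∀ i j, X.gram (σ i) (σ j) = X.gram i j)
    (horder : ∀ i j, j < i → X.gram i j ≠ 0 → (p i).length < (p j).length) :
    (triQuiver l).Isomorphic X.confQuiver := by
  have hcount : ∀ i, l.count i = X.halfCoxeter := fun i => by
    rw [hs, count_staircase fun _ _ => Nat.zero_le _]
  have hmult : ∀ i, X.mult (σ i) = X.mult i := fun i => by
    have := hgram i i
    rw [gram_self, gram_self] at this
    linarith
  let ψ : ConfLabel X.Node → QLabel X.Node
    | .x i k => .f i k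
    | .y i => .e (σ i)
    | .t _ _ _ => .e i₀
  have hw : ∀ u ∈ X.confVerts, ∀ v ∈ X.confVerts,
      triForm (deco l) (ψ u) (ψ v) = X.confArrow u v - X.confArrow v u := by
    have key : ∀ u ∈ X.confVerts, ∀ v ∈ X.confVerts,
        triForm (deco l) (ψ u) (ψ v) = X.confArrow u v - X.confArrow v u →
        triForm (deco l) (ψ v) (ψ u) = X.confArrow v u - X.confArrow u v := by
      intro u _ v _ h
      rw [triForm_skew, h]; ring
    have hxx : ∀ (i j : X.Node) (k q : ℕ), j ≤ i → k ≤ X.halfCoxeter → q ≤ X.halfCoxeter →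
        triForm (deco l) (.f i k) (.f j q) =
          X.confArrow (.x i k) (.x j q) - X.confArrow (.x j q) (.x i k) := by
      intro i j k q hij hk hq
      rcases hij.eq_or_lt with rfl | hij
      · rw [hs, triForm_staircase_self (fun _ _ _ => le_rfl)]
        simp only [confArrow, if_true]
        split_ifs <;> first | omega | ring
      · rw [hs, triForm_staircase_pair (fun _ _ _ => le_rfl) _ hij fun _ _ _ _ => Nat.zero_le _]
        simp only [confArrow, if_neg hij.ne, if_neg hij.ne', if_pos hij, if_neg hij.not_gt,
          abs_mult_mul_cartan hij.ne', abs_mult_mul_cartan hij.ne, gram_comm j i]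
        split_ifs <;> first | omega | ring
    have hxy : ∀ (r i : X.Node) (k : ℕ), triForm (deco l) (.f r k) (.e (σ i)) =
        X.confArrow (.x r k) (.y i) - X.confArrow (.y i) (.x r k) := by
      intro r i k
      rw [(hσ i).triForm_f_e hl, (hσ i).mult_eq, hmult]
      have h1 : r.val = X.yRow i ↔ r = row i := by rw [← hrow, Fin.ext_iff]
      simp only [confArrow, h1, ← hp]
      split_ifs <;> first | omega | tauto | ring
    have hyy : ∀ i j : X.Node, j ≤ i → triForm (deco l) (.e (σ i)) (.e (σ j)) =
        X.confArrow (.y i) (.y j) - X.confArrow (.y j) (.y i) := by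
      intro i j hij
      rcases hij.eq_or_lt with rfl | hij
      · have := triForm_skew (deco l) (.e (σ j)) (.e (σ j))
        linarith
      · simp only [confArrow, if_pos hij, if_neg hij.not_gt, abs_mult_mul_cartan hij.ne', sub_zero]
        by_cases h0 : X.gram i j = 0
        · rw [triForm_e_e_eq_zero (by rw [hgram, h0]), h0, zero_div]
        · rw [(hσ i).triForm_e_e hl (hσ j) (horder i j hij h0), hgram]
    rintro (⟨i, k⟩ | i | ⟨a, b, c⟩) hu (⟨j, q⟩ | j | ⟨a', b', c'⟩) hv
    · rcases le_total j i with hij | hij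
      · exact hxx i j k q hij ((x_mem_confVerts hA).1 hu) ((x_mem_confVerts hA).1 hv)
      · exact key _ hv _ hu
          (hxx j i q k hij ((x_mem_confVerts hA).1 hv) ((x_mem_confVerts hA).1 hu))
    · exact hxy i j k
    · exact absurd hv (t_notMem_confVerts hA)
    · exact key _ hv _ hu (hxy j i q)
    · rcases le_total j i with hij | hij
      · exact hyy i j hij
      · exact key _ hv _ hu (hyy j i hij)
    · exact absurd hv (t_notMem_confVerts hA)
    all_goals exact absurd hu (t_notMem_confVerts hA)
  have hf : ∀ {i : X.Node} {k : ℕ}, k ≤ X.halfCoxeter → QLabel.f i (k : ℤ) ∈ triVerts l := by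
    intro i k hk
    rw [f_mem_triVerts, hcount]
    omega
  refine isomorphic_of_bijOn ψ ⟨?_, ?_, ?_⟩ ?_ ?_ ?_
  · rintro (⟨i, k⟩ | i | ⟨a, b, c⟩) hu
    · exact hf ((x_mem_confVerts hA).1 hu)
    · exact e_mem_triVerts
    · exact absurd hu (t_notMem_confVerts hA)
  · rintro (⟨i, k⟩ | i | ⟨a, b, c⟩) hu (⟨j, q⟩ | j | ⟨a', b', c'⟩) hv h
    · simp only [ψ, QLabel.f.injEq, Nat.cast_inj] at h
      rw [h.1, h.2]
    · cases h
    · exact absurd hv (t_notMem_confVerts hA)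
    · cases h
    · simp only [ψ, QLabel.e.injEq, EmbeddingLike.apply_eq_iff_eq] at h
      rw [h]
    · exact absurd hv (t_notMem_confVerts hA)
    all_goals exact absurd hu (t_notMem_confVerts hA)
  · rintro (⟨i, k⟩ | i) hv
    · obtain ⟨h0, h1⟩ := f_mem_triVerts.1 hv
      rw [hcount] at h1
      exact ⟨.x i k.toNat, (x_mem_confVerts hA).2 (by omega), by simp [ψ, h0]⟩
    · exact ⟨.y (σ.symm i), y_mem_confVerts hA, by simp [ψ]⟩
  · rintro (⟨i, k⟩ | i | ⟨a, b, c⟩) hu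
    · refine Iff.trans (b := k = 0 ∨ k = X.halfCoxeter) ⟨fun h => h.2, fun h => ⟨hu, h⟩⟩ ?_
      refine Iff.trans ?_ f_mem_triFrozen.symm
      rw [hcount]
      omega
    · exact ⟨fun _ => e_mem_triFrozen, fun _ => ⟨hu, trivial⟩⟩
    · exact absurd hu (t_notMem_confVerts hA)
  · rintro (⟨i, k⟩ | i | ⟨a, b, c⟩) hu
    · exact (if_pos hu).trans (if_pos (hf ((x_mem_confVerts hA).1 hu))).symm
    · exact (if_pos hu).trans ((hmult i).symm.trans (if_pos e_mem_triVerts).symm)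
    · exact absurd hu (t_notMem_confVerts hA)
  · intro u hu v hv
    exact (if_pos ⟨hu, hv⟩).trans (hw u hu v hv).symm

/-! ### The labels of staircase words -/

theorem wordProd_mul_simple_comm {L : List X.Node} {a : X.Node} (h : ∀ x ∈ L, X.cartan x a = 0) :
    X.weyl.wordProd L * X.weyl.simple a = X.weyl.simple a * X.weyl.wordProd L := by
  induction L with
  | nil => simp
  | cons x L ih =>
    rw [X.weyl.wordProd_cons, mul_assoc, ih fun y hy => h y (by simp [hy]), ← mul_assoc,
      simple_comm (h x (by simp)), mul_assoc]

/-- The nodes from `lo` on form a chain with simple bonds, and those after `lo` are only joined to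
their neighbours in the chain. -/
def IsChainFrom (X : LieType) (lo : ℕ) : Prop :=
  ∀ i i' : X.Node, lo ≤ i'.val → i.val = i'.val + 1 → X.cartan i i' = -1 ∧ X.cartan i' i = -1 ∧
    (∀ x, x < i' → X.cartan x i = 0) ∧ ∀ x, i < x → X.cartan x i' = 0

/-- A descending word `c` with the letters `j + 1` and `j` satisfies `c s_{j+1} c⁻¹ = s_j`. -/
theorem wordProd_descend_mul_simple {lo : ℕ} (hX : IsChainFrom X lo) {b : ℕ} {i i' : X.Node}
    (hlo : lo ≤ i'.val) (hb : b ≤ i'.val) (hi : i.val = i'.val + 1) :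
    X.weyl.wordProd (descend X b X.rank) * X.weyl.simple i =
      X.weyl.simple i' * X.weyl.wordProd (descend X b X.rank) := by
  obtain ⟨h1, h2, h3, h4⟩ := hX i i' hlo hi
  have hd : descend X b X.rank =
      descend X (i.val + 1) X.rank ++ (i :: i' :: descend X b i'.val) := by
    rw [descend_append (b := b) (m := i.val + 1) (by omega) i.isLt,
      descend_succ (by omega) i.isLt]
    congr 2
    have := descend_succ hb i'.isLt
    rw [← hi] at this
    exact this
  have c1 := wordProd_mul_simple_comm (L := descend X (i.val + 1) X.rank) (a := i') fun x hx =>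
    h4 x (Fin.lt_def.2 (mem_descend.1 hx).1)
  have c2 := wordProd_mul_simple_comm (L := descend X b i'.val) (a := i) fun x hx =>
    h3 x (Fin.lt_def.2 (mem_descend.1 hx).2)
  have h5 := simple_braid h1 h2
  rw [hd, X.weyl.wordProd_append, X.weyl.wordProd_cons, X.weyl.wordProd_cons]
  simp only [mul_assoc] at h5 ⊢
  rw [c2, ← mul_assoc (X.weyl.simple i'), ← mul_assoc (X.weyl.simple i), h5,
    ← mul_assoc, ← mul_assoc,
    ← mul_assoc, c1]
  simp only [mul_assoc]

/-- The shift of the nodes of the chain by one step per block. -/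
theorem wordProd_staircase_mul_simple {lo : ℕ} (hX : IsChainFrom X lo) {b : ℕ → ℕ}
    (hb : ∀ r, b r ≤ r) {k : ℕ} {i i' : X.Node} (hlo : lo ≤ i'.val) (hi : i.val = i'.val + k) :
    X.weyl.wordProd (staircase X b k) * X.weyl.simple i =
      X.weyl.simple i' * X.weyl.wordProd (staircase X b k) := by
  induction k generalizing i with
  | zero =>
    obtain rfl : i = i' := Fin.ext hi
    simp [staircase]
  | succ k ih =>
    have hlt := i.isLt
    have h1 := hb k
    have h2 := wordProd_descend_mul_simple hX (b := b k) (i := i)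
      (i' := ⟨i'.val + k, by omega⟩) (by simp only; omega) (by simp only; omega)
      (by simp only; omega)
    rw [staircase, X.weyl.wordProd_append, mul_assoc, h2, ← mul_assoc, ih rfl, mul_assoc]

/-- The label of the `(k+1)`-th letter `n - 1` of a staircase word. -/
theorem hasLabel_staircase {lo : ℕ} (hX : IsChainFrom X lo) {b : ℕ → ℕ} (hb : ∀ r, b r ≤ r)
    {m : ℕ} (hl : X.IsLongestWord (staircase X b m)) {η : Equiv.Perm X.Node}
    (hη : X.IsDynkinInvolution (staircase X b m) η) {k : ℕ} (hk : k < m) {i i' : X.Node}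
    (hlo : lo ≤ i'.val) (hi : i.val = i'.val + k) (hn : i.val + 1 = X.rank) :
    HasLabel (staircase X b m) (staircase X b k) i (η i') := by
  obtain ⟨v, hv⟩ := exists_staircase_eq (X := X) (b := b) hk hn (by have := hb k; omega)
  exact hasLabel_of_conj hl hη hv (wordProd_staircase_mul_simple hX hb hlo hi)

theorem HasLabel.not_length_lt {l p p' : List X.Node} {i i' a : X.Node} (hl : X.weyl.IsReduced l)
    (h : HasLabel l p i a) (h' : HasLabel l p' i' a) : ¬ p.length < p'.length := by
  intro hlt
  have h1 := h.triForm_e_e hl h' hlt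
  have h2 := triForm_skew (deco l) (.e a) (.e a)
  have h3 := X.mult_pos a
  rw [gram_self] at h1
  linarith

theorem hasLabel_last {l p : List X.Node} {i : X.Node} (h : l = p ++ [i]) : HasLabel l p i i :=
  ⟨[], h, by simp⟩

/-- The last but one letter has a label if it commutes with the last one. -/
theorem hasLabel_second_last {l p : List X.Node} {i j : X.Node} (h : l = p ++ [i, j])
    (hij : X.cartan i j = 0) : HasLabel l p i i :=
  ⟨[j], h, by
    rw [X.weyl.wordProd_singleton, mul_assoc, simple_comm hij, X.weyl.inv_simple,
      X.weyl.simple_mul_simple_cancel_left]⟩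

theorem staircase_succ_eq (hn : 0 < X.rank) (m : ℕ) : staircase X (fun _ => 0) (m + 1) =
    (staircase X (fun _ => 0) m ++ descend X 1 X.rank) ++ [⟨0, hn⟩] := by
  rw [staircase, descend_append (m := 1) (Nat.zero_le 1) hn, descend_succ le_rfl hn, descend_self,
    List.append_assoc]

theorem length_staircase_lt (hn : 0 < X.rank) {k m : ℕ} (h : k < m) :
    (staircase X (fun _ => 0) k).length < (staircase X (fun _ => 0) m).length := by
  rw [length_staircase, length_staircase]
  exact Nat.mul_lt_mul_of_pos_right h hn

/-- In types B and C the vertex `y_0` belongs to the last letter, and the other vertices `y_i`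
belong to letters `n - 1`. -/
theorem isomorphic_confQuiver_BC {c : ℤ} (hX : IsCartanBC X c) (hc : c = 1 ∨ c = 2)
    (hA : ∀ n, X ≠ A n) (hn : 2 ≤ X.rank) (hm : X.halfCoxeter = X.rank)
    (hrow : ∀ i, X.yRow i = if i.val = 0 then 0 else X.rank - 1)
    (hcol : ∀ i, X.yCol i = X.rank - i.val) (hmult : ∀ i : X.Node, i.val ≠ 0 →
      X.mult i ≠ X.mult ⟨0, by omega⟩)
    {l : List X.Node} (hl : X.IsLongestWord l) :
    ∃ l', X.IsLongestWord l' ∧ (triQuiver l').Isomorphic X.confQuiver := by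
  have hn0 : 0 < X.rank := by omega
  have hl' := isLongestWord_staircase_BC hX hc hn0 hl
  obtain ⟨η, hη⟩ := hl'.exists_isDynkinInvolution
  let zero : X.Node := ⟨0, hn0⟩
  let top : X.Node := ⟨X.rank - 1, by omega⟩
  -- the Dynkin involution preserves lengths of roots, and there is only one root like `α_0`
  have hη0 : η zero = zero := by
    by_contra h
    exact hmult (η zero) (fun h' => h (Fin.ext h')) (hη.mult_apply hl' zero)
  have hchain : IsChainFrom X 1 := by
    intro i i' h1 h2
    simp only [hX.2, Fin.lt_def]
    refine ⟨?_, ?_, fun x hx => ?_, fun x hx => ?_⟩ <;> split_ifs <;> first | rfl | omega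
  have hlast : staircase X (fun _ => 0) X.rank =
      (staircase X (fun _ => 0) (X.rank - 1) ++ descend X 1 X.rank) ++ [zero] := by
    rw [← staircase_succ_eq hn0, Nat.sub_add_cancel hn0]
  have hval : ∀ {i : X.Node}, i ≠ zero → i.val ≠ 0 := fun h h' => h (Fin.ext h')
  refine ⟨_, hl', isomorphic_confQuiver hA (by omega) zero (by rw [hm]) hl'.1
    (row := fun i => if i = zero then zero else top)
    (p := fun i => if i = zero then
      staircase X (fun _ => 0) (X.rank - 1) ++ descend X 1 X.rank
        else staircase X (fun _ => 0) (X.rank - i.val - 1)) (σ := η) (fun i => ?_) (fun i => ?_)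
    (fun i => ?_) (hη.gram_apply hl') (fun i j hij _ => ?_)⟩
  · rw [hrow]
    by_cases h : i = zero
    · rw [if_pos h, h]; rfl
    · rw [if_neg h, if_neg (hval h)]
  · rw [hcol]
    by_cases h : i = zero
    · simp only [if_pos h]
      rw [List.count_append, count_staircase fun _ _ => Nat.zero_le _, count_descend, h]
      have h0 : zero.val = 0 := rfl
      rw [h0, if_neg (by omega)]
      omega
    · simp only [if_neg h]
      rw [count_staircase fun _ _ => Nat.zero_le _]
      omega
  · by_cases h : i = zero
    · simp only [if_pos h]
      rw [h, hη0]
      exact hasLabel_last hlast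
    · simp only [if_neg h]
      have := hval h
      exact hasLabel_staircase hchain (fun _ => Nat.zero_le _) hl' hη (by omega) (by omega)
        (by simp only [top]; omega) (by simp only [top]; omega)
  · have h1 := Fin.lt_def.1 hij
    have hi : i ≠ zero := fun h => by rw [h] at h1; simp [zero] at h1
    simp only [if_neg hi]
    by_cases hj : j = zero
    · rw [if_pos hj, List.length_append]
      exact (length_staircase_lt hn0 (by omega)).trans_le (Nat.le_add_right _ _)
    · rw [if_neg hj]
      exact length_staircase_lt hn0 (by omega)

theorem isomorphic_confQuiver_B {n : ℕ} (hn : 2 ≤ n) {l : List (B n).Node}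
    (hl : (B n).IsLongestWord l) :
    ∃ l', (B n).IsLongestWord l' ∧ (triQuiver l').Isomorphic (B n).confQuiver :=
  isomorphic_confQuiver_BC (isCartanBC_B n) (.inl rfl) (fun _ h => by cases h) hn rfl
    (fun _ => rfl) (fun _ => rfl) (fun i hi => by
      change (if i.val = 0 then (1 / 2 : ℚ) else 1) ≠ if 0 = 0 then 1 / 2 else 1
      rw [if_neg hi, if_pos rfl]
      norm_num) hl

theorem isomorphic_confQuiver_C {n : ℕ} (hn : 2 ≤ n) {l : List (C n).Node}
    (hl : (C n).IsLongestWord l) :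
    ∃ l', (C n).IsLongestWord l' ∧ (triQuiver l').Isomorphic (C n).confQuiver :=
  isomorphic_confQuiver_BC (isCartanBC_C n) (.inr rfl) (fun _ h => by cases h) hn rfl
    (fun _ => rfl) (fun _ => rfl) (fun i hi => by
      change (if i.val = 0 then (1 : ℚ) else 1 / 2) ≠ if 0 = 0 then 1 else 1 / 2
      rw [if_neg hi, if_pos rfl]
      norm_num) hl

/-- In type D the vertices `y_0` and `y_1` belong to the last two letters, and the other vertices
`y_i` belong to letters `n - 1`. -/
theorem isomorphic_confQuiver_D {n : ℕ} (hn : 3 ≤ n) {l : List (D n).Node}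
    (hl : (D n).IsLongestWord l) :
    ∃ l', (D n).IsLongestWord l' ∧ (triQuiver l').Isomorphic (D n).confQuiver := by
  have hn0 : 0 < (D n).rank := by change 0 < n; omega
  have hl' := isLongestWord_staircase_D (by omega) hl
  obtain ⟨η, hη⟩ := hl'.exists_isDynkinInvolution
  let zero : (D n).Node := ⟨0, hn0⟩
  let one : (D n).Node := ⟨1, by change 1 < n; omega⟩
  let top : (D n).Node := ⟨n - 1, by change n - 1 < n; omega⟩
  have hchain : IsChainFrom (D n) 2 := by
    intro i i' h1 h2
    simp only [cartan_D, Fin.lt_def]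
    refine ⟨?_, ?_, fun x hx => ?_, fun x hx => ?_⟩ <;> split_ifs <;> first | rfl | omega
  obtain ⟨P, hP⟩ : ∃ P, P = staircase (D n) (fun _ => 0) (n - 2) ++ descend (D n) 2 n := ⟨_, rfl⟩
  have hd1 : descend (D n) 1 n = descend (D n) 2 n ++ [one] := by
    rw [descend_append (m := 2) (by omega) (by omega), descend_succ le_rfl (by change 1 < n; omega),
      descend_self]
  have hlast : staircase (D n) (fun _ => 0) (n - 1) = P ++ [one, zero] := by
    have h1 : n - 1 = n - 2 + 1 := by omega
    rw [h1, staircase_succ_eq hn0]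
    change staircase (D n) (fun _ => 0) (n - 2) ++ descend (D n) 1 n ++ [zero] = _
    rw [hd1, hP]
    simp
  have hlast' : staircase (D n) (fun _ => 0) (n - 1) = (P ++ [one]) ++ [zero] := by
    rw [hlast]; simp
  have hcomm : (D n).cartan one zero = 0 := by
    rw [cartan_D]
    simp [one, zero]
  have hlen : ∀ {k}, k < n - 2 → (staircase (D n) (fun _ => 0) k).length < P.length := fun hk => by
    rw [hP, List.length_append]
    exact (length_staircase_lt hn0 hk).trans_le (Nat.le_add_right _ _)
  have hl0 : HasLabel _ (P ++ [one]) zero zero := hasLabel_last hlast'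
  have hl1 : HasLabel _ P one one := hasLabel_second_last hlast hcomm
  have hl2 : ∀ i : (D n).Node, ¬ i.val ≤ 1 →
      HasLabel (staircase (D n) (fun _ => 0) (n - 1)) (staircase (D n) (fun _ => 0) (n - i.val - 1))
        top (η i) := fun i hi => by
    have := i.isLt
    change i.val < n at this
    exact hasLabel_staircase hchain (fun _ => Nat.zero_le _) hl' hη (by omega) (by omega)
      (by simp only [top]; omega) (by simp only [top]; change n - 1 + 1 = n; omega)
  -- different letters have different labels, so that `η` preserves the set of the nodes `0` and `1`
  have hη2 : ∀ i : (D n).Node, ¬ i.val ≤ 1 → ¬ (η i).val ≤ 1 := by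
    intro i hi h
    have h1 := hlen (k := n - i.val - 1) (by omega)
    have h2 := hl2 i hi
    rcases Nat.le_one_iff_eq_zero_or_eq_one.1 h with h | h
    · rw [show η i = zero from Fin.ext h] at h2
      exact h2.not_length_lt hl'.1 hl0 (by rw [List.length_append]; omega)
    · rw [show η i = one from Fin.ext h] at h2
      exact h2.not_length_lt hl'.1 hl1 h1
  have hη1 : ∀ i : (D n).Node, i.val ≤ 1 → (η i).val ≤ 1 := by
    intro i hi
    by_contra h
    have := hη2 _ h
    rw [hη.apply_apply hl'] at this
    exact this hi
  have hlow : ∀ i j x : (D n).Node, i.val ≤ 1 → j.val ≤ 1 → ¬ x.val ≤ 1 →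
      (D n).gram i x = (D n).gram j x := by
    intro i j x hi hj hx
    have : (D n).cartan i x = (D n).cartan j x := by
      rw [cartan_D, cartan_D]
      split_ifs <;> first | rfl | omega
    rw [gram, gram, this]
    rfl
  let s : (D n).Node → (D n).Node := fun i => if i.val ≤ 1 then i else η i
  have hinj : Function.Injective s := by
    intro i j h
    simp only [s] at h
    split_ifs at h with h1 h2 h2
    · exact h
    · rw [h] at h1; exact absurd h1 (hη2 _ h2)
    · rw [← h] at h2; exact absurd h2 (hη2 _ h1)
    · exact η.injective h
  refine ⟨_, hl', isomorphic_confQuiver (fun _ h => by cases h)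
    (by change 0 < n - 1; omega) zero rfl hl'.1 (row := fun i => if i.val ≤ 1 then i else top)
    (p := fun i => if i.val = 0 then P ++ [one] else if i.val = 1 then P else
      staircase (D n) (fun _ => 0) (n - i.val - 1))
    (σ := Equiv.ofBijective s (Finite.injective_iff_bijective.1 hinj)) (fun i => ?_) (fun i => ?_)
    (fun i => ?_) (fun i j => ?_) (fun i j hij h0 => ?_)⟩
  · change _ = if i.val ≤ 1 then i.val else n - 1
    split_ifs <;> rfl
  · change _ = if i.val ≤ 1 then n - 1 else n - i.val
    have : i.val < n := i.isLt
    have c0 : (descend (D n) 2 n).count zero = 0 :=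
      (count_descend (X := D n) 2 zero).trans (if_neg (by simp [zero]))
    have c1 : (descend (D n) 2 n).count one = 0 :=
      (count_descend (X := D n) 2 one).trans (if_neg (by simp [one]))
    by_cases hi0 : i.val = 0
    · rw [if_pos hi0, if_pos (by omega), if_pos (by omega), show i = zero from Fin.ext hi0, hP,
        List.count_append, List.count_append, c0, count_staircase fun _ _ => Nat.zero_le _]
      have : [one].count zero = 0 := by simp [one, zero]
      omega
    by_cases hi1 : i.val = 1
    · rw [if_neg hi0, if_pos hi1, if_pos (by omega), if_pos (by omega),
        show i = one from Fin.ext hi1, hP,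
        List.count_append, c1, count_staircase fun _ _ => Nat.zero_le _]
      omega
    · rw [if_neg hi0, if_neg hi1, if_neg (by omega), if_neg (by omega),
        count_staircase fun _ _ => Nat.zero_le _]
      omega
  · rw [Equiv.ofBijective_apply]
    simp only [s]
    by_cases hi0 : i.val = 0
    · rw [if_pos hi0, if_pos (by omega), if_pos (by omega), show i = zero from Fin.ext hi0]
      exact hl0
    by_cases hi1 : i.val = 1
    · rw [if_neg hi0, if_pos hi1, if_pos (by omega), if_pos (by omega),
        show i = one from Fin.ext hi1]
      exact hl1
    · rw [if_neg hi0, if_neg hi1, if_neg (by omega), if_neg (by omega)]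
      exact hl2 i (by omega)
  · rw [Equiv.ofBijective_apply, Equiv.ofBijective_apply]
    have hg := hη.gram_apply hl' i j
    simp only [s]
    split_ifs with h1 h2 h2
    · rfl
    · rw [← hg, hlow i (η i) _ h1 (hη1 i h1) (hη2 j h2)]
    · rw [← hg, gram_comm, gram_comm (η i), hlow j (η j) _ h2 (hη1 j h2) (hη2 i h1)]
    · exact hg
  · have h1 := Fin.lt_def.1 hij
    have hi1 : i.val ≠ 1 := by
      intro hi1
      refine h0 ?_
      rw [show i = one from Fin.ext hi1,
        show j = zero from Fin.ext (by simp only [zero]; omega), gram,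
        hcomm]
      simp
    have hi : i.val < n := i.isLt
    rw [if_neg (by omega), if_neg hi1]
    split_ifs
    · rw [List.length_append]
      exact (hlen (by omega)).trans_le (Nat.le_add_right _ _)
    · exact hlen (by omega)
    · exact length_staircase_lt hn0 (by omega)

theorem isomorphic_confQuiver_G2 {l : List G2.Node} (hl : G2.IsLongestWord l) :
    ∃ l', G2.IsLongestWord l' ∧ (triQuiver l').Isomorphic G2.confQuiver := by
  have hl' := isLongestWord_staircase_G2 hl
  obtain ⟨η, hη⟩ := hl'.exists_isDynkinInvolution
  let zero : G2.Node := ⟨0, by decide⟩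
  let one : G2.Node := ⟨1, by decide⟩
  have hd : descend G2 0 G2.rank = [one, zero] := by decide
  have hs : staircase G2 (fun _ => 0) 3 = [one, zero, one, zero, one, zero] := by
    simp [staircase, hd]
  have hcases : ∀ i : G2.Node, i = zero ∨ i = one := by decide
  -- the two roots have different lengths
  have hη1 : η one = one := by
    refine (hcases _).resolve_left fun h => ?_
    have := hη.mult_apply hl' one
    rw [h] at this
    simp [mult, zero, one] at this
  have hl1 : HasLabel (staircase G2 (fun _ => 0) 3) [] one one := by
    have := hasLabel_of_conj hl' hη (p := []) (i := one) (b := one) hs (by simp)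
    rwa [hη1] at this
  have hl0 : HasLabel (staircase G2 (fun _ => 0) 3) [one, zero, one, zero, one] zero zero :=
    hasLabel_last hs
  refine ⟨_, hl', isomorphic_confQuiver (fun _ h => by cases h) (by decide) zero rfl hl'.1
    (row := id) (p := fun i => if i.val = 0 then [one, zero, one, zero, one] else [])
    (σ := Equiv.refl _) (fun i => rfl) (fun i => ?_) (fun i => ?_) (fun i j => rfl)
    (fun i j hij _ => ?_)⟩
  · rcases hcases i with rfl | rfl <;> rfl
  · rcases hcases i with rfl | rfl
    · exact hl0
    · exact hl1
  · rcases hcases i with rfl | rfl <;> rcases hcases j with rfl | rfl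
    · exact absurd hij (lt_irrefl _)
    · exact absurd hij (by decide)
    · simp [zero, one]
    · exact absurd hij (lt_irrefl _)

/-! ### Type A -/

theorem t_mem_confVerts {n a b c : ℕ} :
    .t a b c ∈ (A n).confVerts ↔ a + b + c = n + 1 ∧ a ≤ n ∧ b ≤ n ∧ c ≤ n := Iff.rfl

theorem gram_A {n : ℕ} (i j : (A n).Node) : (A n).gram i j =
    if i.val = j.val then -2 else if i.val + 1 = j.val ∨ j.val + 1 = i.val then 1 else 0 := by
  rw [gram, cartan_A]
  change -(1 * _) = _
  split_ifs <;> norm_num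

theorem count_staircase_id (m : ℕ) (i : X.Node) :
    (staircase X id m).count i = min m (i.val + 1) := by
  induction m with
  | zero => simp [staircase]
  | succ m ih =>
    rw [staircase, List.count_append, ih, count_descend]
    simp only [id]
    split_ifs <;> omega

theorem confArrow_t {n a b c a' b' c' : ℕ} : (A n).confArrow (.t a b c) (.t a' b' c') =
    if a' + 1 = a ∧ b' = b + 1 ∧ c' = c then (if c = 0 then 1 / 2 else 1)
    else if a' = a ∧ b' + 1 = b ∧ c' = c + 1 then (if a = 0 then 1 / 2 else 1)
    else if a' = a + 1 ∧ b' = b ∧ c' + 1 = c then (if b = 0 then 1 / 2 else 1)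
    else 0 := rfl

theorem confArrow_t_first {n a b c a' b' c' : ℕ} (h : a' + 1 = a ∧ b' = b + 1 ∧ c' = c) :
    (A n).confArrow (.t a b c) (.t a' b' c') = if c = 0 then 1 / 2 else 1 := by
  rw [confArrow_t, if_pos h]

theorem confArrow_t_second {n a b c a' b' c' : ℕ} (h : a' = a ∧ b' + 1 = b ∧ c' = c + 1) :
    (A n).confArrow (.t a b c) (.t a' b' c') = if a = 0 then 1 / 2 else 1 := by
  rw [confArrow_t, if_neg (by omega), if_pos h]

theorem confArrow_t_third {n a b c a' b' c' : ℕ} (h : a' = a + 1 ∧ b' = b ∧ c' + 1 = c) :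
    (A n).confArrow (.t a b c) (.t a' b' c') = if b = 0 then 1 / 2 else 1 := by
  rw [confArrow_t, if_neg (by omega), if_neg (by omega), if_pos h]

theorem confArrow_t_eq_zero {n a b c a' b' c' : ℕ} (h1 : ¬ (a' + 1 = a ∧ b' = b + 1 ∧ c' = c))
    (h2 : ¬ (a' = a ∧ b' + 1 = b ∧ c' = c + 1)) (h3 : ¬ (a' = a + 1 ∧ b' = b ∧ c' + 1 = c)) :
    (A n).confArrow (.t a b c) (.t a' b' c') = 0 := by
  rw [confArrow_t, if_neg h1, if_neg h2, if_neg h3]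

theorem length_staircase_id_lt {n b b' : ℕ} (h : b < b') (hb' : b' ≤ n) :
    (staircase (A n) id b).length < (staircase (A n) id b').length := by
  have hp := staircase_prefix (X := A n) id h.le
  refine hp.length_le.lt_of_ne fun he => ?_
  have hc := congrArg (List.count (⟨n - 1, by change n - 1 < n; omega⟩ : (A n).Node))
    (hp.eq_of_length he)
  rw [count_staircase_id, count_staircase_id] at hc
  simp only at hc
  omega

section

variable {n a b c a' b' c' : ℕ} {i j : (A n).Node}

/-- The sides of the triangles in the direction of a row. -/
theorem triForm_row_A (hi : i.val + c = n) (h : a + b + c = n + 1) (h' : a' + b' + c = n + 1)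
    (hc : 0 < c) : triForm (deco (staircase (A n) id n)) (.f i b) (.f i b') =
      (A n).confArrow (.t a b c) (.t a' b' c) - (A n).confArrow (.t a' b' c) (.t a b c) := by
  have hlt : i.val < n := i.isLt
  rw [triForm_staircase_self monotone_id]
  change (1 : ℚ) * _ = _
  simp only [id]
  generalize i.val = r at *
  rcases eq_or_ne b' (b + 1) with rfl | h1
  · rw [confArrow_t_first (by omega), confArrow_t_eq_zero (by omega) (by omega) (by omega),
      if_pos (by omega), if_neg (by omega), if_neg (by omega)]
    norm_num
  rcases eq_or_ne b (b' + 1) with rfl | h2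
  · rw [confArrow_t_eq_zero (by omega) (by omega) (by omega), confArrow_t_first (by omega),
      if_neg (by omega), if_pos (by omega), if_neg (by omega)]
    norm_num
  · rw [confArrow_t_eq_zero (by omega) (by omega) (by omega),
      confArrow_t_eq_zero (by omega) (by omega) (by omega), if_neg (by omega), if_neg (by omega)]
    norm_num

/-- The sides of the triangles between neighbouring rows. -/
theorem triForm_pair_A (hi : i.val + c = n) (hj : j.val + (c + 1) = n) (h : a + b + c = n + 1)
    (h' : a' + b' + (c + 1) = n + 1) (hc : 0 < c) :
    triForm (deco (staircase (A n) id n)) (.f i b) (.f j b') =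
      (A n).confArrow (.t a b c) (.t a' b' (c + 1)) -
        (A n).confArrow (.t a' b' (c + 1)) (.t a b c) := by
  rw [triForm_staircase_pair monotone_id _ (by rw [Fin.lt_def]; omega)
    (fun r hr s hs => by simp only [id] at hr ⊢; omega), gram_A, if_neg (by omega),
    if_pos (by omega)]
  simp only [id]
  generalize i.val = r at *
  generalize j.val = s at *
  rcases eq_or_ne b (b' + 1) with rfl | h1
  · rw [confArrow_t_second (by omega), confArrow_t_eq_zero (by omega) (by omega) (by omega),
      if_pos (by omega), if_neg (by omega), if_neg (by omega : ¬ (_ ∧ _ ∧ _ ∧ _))]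
    split_ifs <;> first | omega | norm_num
  rcases eq_or_ne b' b with rfl | h2
  · rw [confArrow_t_eq_zero (by omega) (by omega) (by omega), confArrow_t_third (by omega),
      if_neg (by omega), if_pos (by omega), if_neg (by omega)]
    split_ifs <;> first | omega | norm_num
  · rw [confArrow_t_eq_zero (by omega) (by omega) (by omega),
      confArrow_t_eq_zero (by omega) (by omega) (by omega), if_neg (by omega), if_neg (by omega),
      if_neg (by omega), if_neg (by omega)]
    norm_num

/-- There are no arrows between rows that are not neighbours. -/
theorem triForm_far_A (hi : i.val + c = n) (hj : j.val + c' = n) (hc : c + 1 < c') :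
    triForm (deco (staircase (A n) id n)) (.f i b) (.f j b') =
      (A n).confArrow (.t a b c) (.t a' b' c') - (A n).confArrow (.t a' b' c') (.t a b c) := by
  rw [triForm_f_f_eq_zero (by rw [gram_A, if_neg (by omega), if_neg (by omega)]),
    confArrow_t_eq_zero (by omega) (by omega) (by omega),
    confArrow_t_eq_zero (by omega) (by omega) (by omega), sub_zero]

/-- The arrows between the points of the side `c = 0` and the others, which go to the row `c = 1`
only. -/
theorem triForm_f_e_A {top x : (A n).Node} (htop : top.val + 1 = n)
    (hw : (A n).weyl.IsReduced (staircase (A n) id n))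
    (hx : HasLabel (staircase (A n) id n) (staircase (A n) id (b' - 1)) top x)
    (hi : i.val + c = n) (h : a + b + c = n + 1) (h' : a' + b' = n + 1)
    (hc : 0 < c) (hb' : 1 ≤ b') (ha' : 1 ≤ a') :
    triForm (deco (staircase (A n) id n)) (.f i b) (.e x) =
      (A n).confArrow (.t a b c) (.t a' b' 0) - (A n).confArrow (.t a' b' 0) (.t a b c) := by
  rw [hx.triForm_f_e hw, count_staircase_id]
  change (if _ then (1 : ℚ) * _ else 0) = _
  have e : min (b' - 1) (top.val + 1) = b' - 1 := by omega
  rw [e]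
  by_cases hc1 : c = 1
  · subst hc1
    rw [if_pos (Fin.ext (by omega))]
    rcases eq_or_ne b' b with rfl | h1
    · rw [confArrow_t_third (by omega), confArrow_t_eq_zero (by omega) (by omega) (by omega),
        if_pos (by omega), if_neg (by omega), if_neg (by omega)]
      norm_num
    rcases eq_or_ne b' (b + 1) with rfl | h2
    · rw [confArrow_t_eq_zero (by omega) (by omega) (by omega), confArrow_t_second (by omega),
        if_neg (by omega), if_pos (by omega), if_neg (by omega)]
      norm_num
    · rw [confArrow_t_eq_zero (by omega) (by omega) (by omega),
        confArrow_t_eq_zero (by omega) (by omega) (by omega), if_neg (by omega),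
        if_neg (by omega)]
      norm_num
  · rw [if_neg (fun he => hc1 (by rw [Fin.ext_iff] at he; omega)),
      confArrow_t_eq_zero (by omega) (by omega) (by omega),
      confArrow_t_eq_zero (by omega) (by omega) (by omega), sub_zero]

/-- The arrows along the side `c = 0`. -/
theorem half_gram_A (hi : i.val + b = n) (hj : j.val + b' = n) (h : a + b = n + 1)
    (h' : a' + b' = n + 1) (hb : b < b') : (A n).gram i j / 2 =
      (A n).confArrow (.t a b 0) (.t a' b' 0) - (A n).confArrow (.t a' b' 0) (.t a b 0) := by
  rw [gram_A, if_neg (by omega)]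
  rcases eq_or_ne b' (b + 1) with rfl | h1
  · rw [confArrow_t_first (by omega), confArrow_t_eq_zero (by omega) (by omega) (by omega),
      if_pos (by omega), if_pos rfl, sub_zero]
  · rw [confArrow_t_eq_zero (by omega) (by omega) (by omega),
      confArrow_t_eq_zero (by omega) (by omega) (by omega), if_neg (by omega)]
    norm_num

end

/-- In type A the point `(a, b, c)` of the triangulation is the vertex `f_{n-c}^b` if `c` is
positive, and the points `(n + 1 - b, b, 0)` of the third side belong to the letters `n - 1`. -/
theorem isomorphic_confQuiver_A {n : ℕ} (hn : 1 ≤ n) {l : List (A n).Node}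
    (hl : (A n).IsLongestWord l) :
    ∃ l', (A n).IsLongestWord l' ∧ (triQuiver l').Isomorphic (A n).confQuiver := by
  have hl' := isLongestWord_staircase_A hl
  obtain ⟨η, hη⟩ := hl'.exists_isDynkinInvolution
  obtain ⟨w, hw0⟩ : ∃ w, w = staircase (A n) id n := ⟨_, rfl⟩
  rw [← hw0] at hl' hη
  let top : (A n).Node := ⟨n - 1, by change n - 1 < n; omega⟩
  have hchain : IsChainFrom (A n) 0 := by
    intro i i' _ h2
    simp only [cartan_A, Fin.lt_def]
    refine ⟨?_, ?_, fun x hx => ?_, fun x hx => ?_⟩ <;> split_ifs <;> first | rfl | omega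
  have hcount : ∀ i : (A n).Node, w.count i = i.val + 1 := fun i => by
    have : i.val < n := i.isLt
    rw [hw0, count_staircase_id]
    omega
  -- the node `k`; the bound only matters outside of the triangle
  let node : ℕ → (A n).Node := fun k => ⟨min k (n - 1), by change _ < n; omega⟩
  have hnode : ∀ {k}, k < n → (node k).val = k := fun hk => by simp only [node]; omega
  have hlab : ∀ {b : ℕ}, 1 ≤ b → b ≤ n →
      HasLabel w (staircase (A n) id (b - 1)) top (η (node (n - b))) := by
    intro b h1 h2
    rw [hw0] at hl' hη ⊢
    refine hasLabel_staircase hchain (fun _ => le_rfl) hl' hη (by omega) (Nat.zero_le _) ?_ ?_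
    · rw [hnode (by omega)]
      simp only [top]
      omega
    · simp only [top]
      change n - 1 + 1 = n
      omega
  let ψ : ConfLabel (A n).Node → QLabel (A n).Node
    | .x i k => .f i k
    | .y i => .e i
    | .t _ b c => if c = 0 then .e (η (node (n - b))) else .f (node (n - c)) b
  have hψe : ∀ a b, ψ (.t a b 0) = .e (η (node (n - b))) := fun a b => if_pos rfl
  have hψf : ∀ a b c, 0 < c → ψ (.t a b c) = .f (node (n - c)) b := fun a b c h => if_neg h.ne'
  clear_value ψ node
  have hw : ∀ u ∈ (A n).confVerts, ∀ v ∈ (A n).confVerts,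
      triForm (deco w) (ψ u) (ψ v) = (A n).confArrow u v - (A n).confArrow v u := by
    have key : ∀ u ∈ (A n).confVerts, ∀ v ∈ (A n).confVerts,
        triForm (deco w) (ψ u) (ψ v) = (A n).confArrow u v - (A n).confArrow v u →
        triForm (deco w) (ψ v) (ψ u) = (A n).confArrow v u - (A n).confArrow u v := by
      intro u _ v _ h
      rw [triForm_skew, h]; ring
    have hff : ∀ a b c a' b' c', .t a b c ∈ (A n).confVerts → .t a' b' c' ∈ (A n).confVerts →
        0 < c → c ≤ c' → triForm (deco w) (ψ (.t a b c)) (ψ (.t a' b' c')) =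
          (A n).confArrow (.t a b c) (.t a' b' c') - (A n).confArrow (.t a' b' c') (.t a b c) := by
      intro a b c a' b' c' hu hv hc hcc
      obtain ⟨h1, h2, h3, h4⟩ := t_mem_confVerts.1 hu
      obtain ⟨h1', h2', h3', h4'⟩ := t_mem_confVerts.1 hv
      have e1 := hnode (k := n - c) (by omega)
      have e2 := hnode (k := n - c') (by omega)
      rw [hψf a b c hc, hψf a' b' c' (by omega), hw0]
      rcases hcc.eq_or_lt with rfl | hcc
      · exact triForm_row_A (by omega) h1 h1' hc
      by_cases hc1 : c' = c + 1
      · subst hc1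
        exact triForm_pair_A (by omega) (by omega) h1 h1' hc
      · exact triForm_far_A (by omega) (by omega) (by omega)
    have hfe : ∀ a b c a' b', .t a b c ∈ (A n).confVerts → .t a' b' 0 ∈ (A n).confVerts →
        0 < c → triForm (deco w) (ψ (.t a b c)) (ψ (.t a' b' 0)) =
          (A n).confArrow (.t a b c) (.t a' b' 0) - (A n).confArrow (.t a' b' 0) (.t a b c) := by
      intro a b c a' b' hu hv hc
      obtain ⟨h1, h2, h3, h4⟩ := t_mem_confVerts.1 hu
      obtain ⟨h1', h2', h3', h4'⟩ := t_mem_confVerts.1 hv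
      have e1 := hnode (k := n - c) (by omega)
      have hx := hlab (b := b') (by omega) h3'
      rw [hw0] at hx hl'
      rw [hψf _ _ _ hc, hψe, hw0]
      exact triForm_f_e_A (by simp only [top]; omega) hl'.1 hx (by omega) h1 h1' hc (by omega)
        (by omega)
    have hee : ∀ a b a' b', .t a b 0 ∈ (A n).confVerts → .t a' b' 0 ∈ (A n).confVerts →
        b ≤ b' → triForm (deco w) (ψ (.t a b 0)) (ψ (.t a' b' 0)) =
          (A n).confArrow (.t a b 0) (.t a' b' 0) - (A n).confArrow (.t a' b' 0) (.t a b 0) := by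
      intro a b a' b' hu hv hb
      obtain ⟨h1, h2, h3, h4⟩ := t_mem_confVerts.1 hu
      obtain ⟨h1', h2', h3', h4'⟩ := t_mem_confVerts.1 hv
      rcases hb.eq_or_lt with rfl | hb
      · obtain rfl : a = a' := by omega
        have := triForm_skew (deco w) (ψ (.t a b 0)) (ψ (.t a b 0))
        linarith
      · have e1 := hnode (k := n - b) (by omega)
        have e2 := hnode (k := n - b') (by omega)
        rw [hψe, hψe, (hlab (by omega) h3).triForm_e_e hl'.1 (hlab (by omega) h3')
          (length_staircase_id_lt (by omega) (by omega)), hη.gram_apply hl']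
        exact half_gram_A (by omega) (by omega) h1 h1' hb
    rintro (⟨i, k⟩ | i | ⟨a, b, c⟩) hu (⟨j, q⟩ | j | ⟨a', b', c'⟩) hv <;>
      first | exact hu.elim | exact hv.elim | skip
    rcases Nat.eq_zero_or_pos c with rfl | hc <;> rcases Nat.eq_zero_or_pos c' with rfl | hc'
    · rcases le_total b b' with hb | hb
      · exact hee _ _ _ _ hu hv hb
      · exact key _ hv _ hu (hee _ _ _ _ hv hu hb)
    · exact key _ hv _ hu (hfe _ _ _ _ _ hv hu hc')
    · exact hfe _ _ _ _ _ hu hv hc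
    · rcases le_total c c' with hb | hb
      · exact hff _ _ _ _ _ _ hu hv hc hb
      · exact key _ hv _ hu (hff _ _ _ _ _ _ hv hu hc' hb)
  have hf : ∀ {a b c : ℕ}, .t a b c ∈ (A n).confVerts → 0 < c →
      QLabel.f (node (n - c)) (b : ℤ) ∈ triVerts w := by
    intro a b c hu hc
    obtain ⟨h1, h2, h3, h4⟩ := t_mem_confVerts.1 hu
    rw [f_mem_triVerts, hcount, hnode (by omega)]
    omega
  refine ⟨w, hl', isomorphic_of_bijOn ψ ⟨?_, ?_, ?_⟩ ?_ ?_ ?_⟩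
  · rintro (⟨i, k⟩ | i | ⟨a, b, c⟩) hu <;> first | exact hu.elim | skip
    rcases Nat.eq_zero_or_pos c with rfl | hc
    · rw [hψe]; exact e_mem_triVerts
    · rw [hψf _ _ _ hc]; exact hf hu hc
  · rintro (⟨i, k⟩ | i | ⟨a, b, c⟩) hu (⟨j, q⟩ | j | ⟨a', b', c'⟩) hv h <;>
      first | exact hu.elim | exact hv.elim | skip
    obtain ⟨h1, h2, h3, h4⟩ := t_mem_confVerts.1 hu
    obtain ⟨h1', h2', h3', h4'⟩ := t_mem_confVerts.1 hv
    have hinj : ∀ {k k'}, k < n → k' < n → node k = node k' → k = k' := fun hk hk' h => by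
      rw [← hnode hk, ← hnode hk', h]
    rcases Nat.eq_zero_or_pos c with rfl | hc <;> rcases Nat.eq_zero_or_pos c' with rfl | hc'
    · rw [hψe, hψe, QLabel.e.injEq] at h
      have := hinj (by omega) (by omega) (η.injective h)
      obtain rfl : b = b' := by omega
      obtain rfl : a = a' := by omega
      rfl
    · rw [hψe, hψf _ _ _ hc'] at h; cases h
    · rw [hψe, hψf _ _ _ hc] at h; cases h
    · rw [hψf _ _ _ hc, hψf _ _ _ hc', QLabel.f.injEq, Nat.cast_inj] at h
      have := hinj (by omega) (by omega) h.1
      obtain rfl : c = c' := by omega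
      obtain rfl : b = b' := h.2
      obtain rfl : a = a' := by omega
      rfl
  · rintro (⟨i, k⟩ | i) hv
    · obtain ⟨h0, h1⟩ := f_mem_triVerts.1 hv
      rw [hcount] at h1
      have hi : i.val < n := i.isLt
      refine ⟨.t (i.val + 1 - k.toNat) k.toNat (n - i.val), t_mem_confVerts.2 (by omega), ?_⟩
      have e1 : node (n - (n - i.val)) = i := Fin.ext (by rw [hnode (by omega)]; omega)
      rw [hψf _ _ _ (by omega), e1, Int.toNat_of_nonneg h0]
    · have hi : (η.symm i).val < n := (η.symm i).isLt
      refine ⟨.t ((η.symm i).val + 1) (n - (η.symm i).val) 0, t_mem_confVerts.2 (by omega), ?_⟩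
      have e1 : node (n - (n - (η.symm i).val)) = η.symm i :=
        Fin.ext (by rw [hnode (by omega)]; omega)
      rw [hψe, e1, Equiv.apply_symm_apply]
  · rintro (⟨i, k⟩ | i | ⟨a, b, c⟩) hu <;> first | exact hu.elim | skip
    obtain ⟨h1, h2, h3, h4⟩ := t_mem_confVerts.1 hu
    rcases Nat.eq_zero_or_pos c with rfl | hc
    · rw [hψe]
      exact ⟨fun _ => e_mem_triFrozen, fun _ => ⟨hu, Or.inr (Or.inr rfl)⟩⟩
    · rw [hψf _ _ _ hc]
      refine Iff.trans (b := a = 0 ∨ b = 0 ∨ c = 0) ⟨fun h => h.2, fun h => ⟨hu, h⟩⟩ ?_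
      refine Iff.trans ?_ f_mem_triFrozen.symm
      rw [hcount, hnode (by omega)]
      omega
  · rintro (⟨i, k⟩ | i | ⟨a, b, c⟩) hu <;> first | exact hu.elim | skip
    refine (if_pos hu).trans ?_
    rcases Nat.eq_zero_or_pos c with rfl | hc
    · rw [hψe]; exact (if_pos e_mem_triVerts).symm
    · rw [hψf _ _ _ hc]; exact (if_pos (hf hu hc)).symm
  · intro u hu v hv
    exact (if_pos ⟨hu, hv⟩).trans (hw u hu v hv).symm

theorem exists_isomorphic_confQuiver (hX : X.Admissible) {l : List X.Node}
    (hl : X.IsLongestWord l) :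
    ∃ l', X.IsLongestWord l' ∧ (triQuiver l').Isomorphic X.confQuiver := by
  cases X with
  | A n => exact isomorphic_confQuiver_A hX hl
  | B n => exact isomorphic_confQuiver_B hX hl
  | C n => exact isomorphic_confQuiver_C hX hl
  | D n => exact isomorphic_confQuiver_D hX hl
  | G2 => exact isomorphic_confQuiver_G2 hl

end LieType

theorem mainTheorem6 (X : LieType) (hX : X.Admissible) (l : List X.Node)
    (hl : X.IsLongestWord l) :
    (∃! Q : WQuiver (QLabel X.Node), X.IsBasicQuiver l Q) ∧
      ∀ Q : WQuiver (QLabel X.Node), X.IsBasicQuiver l Q →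
        Q.MutationEquivalent X.confQuiver := by
  refine ⟨⟨LieType.triQuiver l, LieType.isBasicQuiver_triQuiver hl,
    fun Q hQ => hQ.eq_triQuiver hl⟩, fun Q hQ => ?_⟩
  obtain ⟨l', hl', h⟩ := LieType.exists_isomorphic_confQuiver hX hl
  rw [hQ.eq_triQuiver hl]
  exact (LieType.mutationRelabel_triQuiver hl hl').mutationEquivalent h
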